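/- A \emph{knot} is a tame unoriented knot $K\subset\mathbb R^3$, considered up to ambient isotopy; equivalently, a simple closed polygon in $\mathbb R^3$ up to finitely many elementary (triangle) deformations and their inverses. $K$ is \emph{prime} if it is nontrivial and is not the connected sum of two nontrivial knots. The eleven \emph{mosaic tiles} are squares carrying the following curves, whose endpoints (the \emph{connection points}) are midpoints of sides: the blank tile, with no curve; the four tiles with a single arc joining two adjacent sides; the two tiles with a single line segment joining two opposite sides; the two tiles with two disjoint arcs, each joining two adjacent sides; and the two crossings of a horizontal and a vertical segment (with either one passing over the other). An \emph{$n$-mosaic} is an $n\times n$ array of tiles in which every connection point of every tile coincides with a connection point of an adjacent tile. It \emph{represents} $K$ if the curve it draws is a diagram of $K$. Its \emph{tile number} is the number of its non-blank tiles. The \emph{mosaic number} $m(K)$ is the least $n$ such that some $n$-mosaic represents $K$. The \emph{tile number} $t(K)$ is the least tile number of all mosaics (of any size) representing $K$, and the \emph{minimal mosaic tile number} $t_M(K)$ is the least tile number of all $m(K)$-mosaics representing $K$. \textbf{Corollary.} Let $K$ be a prime knot with $m(K)\le 6$ and $t_M(K)\le 27$. Then $t(K)=t_M(K)$. -/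

import Mathlib

namespace KnotMosaic

/-! ### Polygonal knots in three-space -/

/-- Three-dimensional space. Only its real vector space structure is used. -/
abbrev Space := Fin 3 → ℝ

/-- `S` is a simple closed polygon: it is the union of the edges `[p i, p (i+1)]` (indices cyclic),
and the parametrization of this closed polygon by half-open edges is injective, so that distinct
edges meet only where consecutive edges share a vertex. -/
def IsSimpleClosedPolygon (S : Set Space) : Prop :=
  ∃ (n : ℕ) (p : Fin (n + 3) → Space),
    Function.Injective (fun x : Fin (n + 3) × Set.Ico (0 : ℝ) 1 =>
      (AffineMap.lineMap (p x.1) (p (x.1 + 1)) (x.2 : ℝ) : Space)) ∧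
    S = ⋃ i, segment ℝ (p i) (p (i + 1))

/-- A (tame, unoriented) knot, given as a simple closed polygon in three-space. -/
structure Knot where
  carrier : Set Space
  polygonal : IsSimpleClosedPolygon carrier

namespace Knot

/-- Elementary deformation: a triangle `abc` meets `K` exactly in its side `[a, b]`, and `K'` is
obtained from `K` by replacing `[a, b]` by the other two sides. -/
def DeltaMove (K K' : Knot) : Prop :=
  ∃ a b c : Space, AffineIndependent ℝ ![a, b, c] ∧
    K.carrier ∩ convexHull ℝ {a, b, c} = segment ℝ a b ∧
    K'.carrier = (K.carrier \ segment ℝ a b) ∪ (segment ℝ a c ∪ segment ℝ c b)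

/-- Two knots are equivalent (have the same knot type) if they are joined by a finite sequence of
elementary deformations and their inverses. -/
def Equivalent : Knot → Knot → Prop :=
  Relation.EqvGen DeltaMove

/-- A knot is trivial if it is equivalent to the boundary of a triangle. -/
def IsTrivial (K : Knot) : Prop :=
  ∃ T : Knot, Equivalent K T ∧ ∃ a b c : Space, AffineIndependent ℝ ![a, b, c] ∧
    T.carrier = segment ℝ a b ∪ segment ℝ b c ∪ segment ℝ c a

/-- A plane `{f = c}` meets `K` in exactly two points `a, b`, and closing up by the segment `[a, b]`
the arcs of `K` on the two sides of the plane gives the knots `K₁` and `K₂`. -/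
def SplitsInto (K K₁ K₂ : Knot) : Prop :=
  ∃ (f : Space →ₗ[ℝ] ℝ) (c : ℝ) (a b : Space), a ≠ b ∧
    K.carrier ∩ {x | f x = c} = {a, b} ∧
    K₁.carrier = (K.carrier ∩ {x | f x ≤ c}) ∪ segment ℝ a b ∧
    K₂.carrier = (K.carrier ∩ {x | c ≤ f x}) ∪ segment ℝ a b

/-- `K` is a connected sum of `K₁` and `K₂` (for some choice of orientations). -/
def IsConnectedSum (K K₁ K₂ : Knot) : Prop :=
  ∃ L L₁ L₂ : Knot, Equivalent K L ∧ Equivalent K₁ L₁ ∧ Equivalent K₂ L₂ ∧ SplitsInto L L₁ L₂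

/-- A knot is prime if it is nontrivial and is not a connected sum of two nontrivial knots. -/
def IsPrime (K : Knot) : Prop :=
  ¬ K.IsTrivial ∧ ∀ K₁ K₂ : Knot, IsConnectedSum K K₁ K₂ → K₁.IsTrivial ∨ K₂.IsTrivial

end Knot

/-! ### Mosaics -/

/-- The four sides of a tile. -/
inductive Side
  | left | right | top | bottom
  deriving DecidableEq

namespace Side

def opposite : Side → Side
  | left => right
  | right => left
  | top => bottom
  | bottom => top

/-- The midpoint of a side of the tile `[-1, 1] × [-1, 1]`, at height `0`. -/
def midpoint : Side → Space
  | left => ![-1, 0, 0]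
  | right => ![1, 0, 0]
  | top => ![0, 1, 0]
  | bottom => ![0, -1, 0]

/-- `s.Leads i j i' j'`: the tile in row `i'`, column `j'` is the one adjacent to the tile in
row `i`, column `j` along the side `s`. Rows are numbered from top to bottom, columns from left to
right. -/
def Leads {n : ℕ} (s : Side) (i j i' j' : Fin n) : Prop :=
  match s with
  | left => i' = i ∧ (j' : ℕ) + 1 = j
  | right => i' = i ∧ (j' : ℕ) = j + 1
  | top => (i' : ℕ) + 1 = i ∧ j' = j
  | bottom => (i' : ℕ) = i + 1 ∧ j' = j

end Side

/-- The eleven mosaic tiles: the blank tile, the four single arcs, the two line segments, the two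
double arcs, and the two crossings. -/
inductive Tile
  | blank
  | leftBottom
  | rightBottom
  | rightTop
  | leftTop
  | horizontal
  | vertical
  | leftBottomRightTop
  | leftTopRightBottom
  | horizontalOver
  | verticalOver
  deriving DecidableEq

namespace Tile

/-- The sides of a tile whose midpoint is a connection point of the tile. -/
def connections : Tile → Finset Side
  | blank => ∅
  | leftBottom => {Side.left, Side.bottom}
  | rightBottom => {Side.right, Side.bottom}
  | rightTop => {Side.right, Side.top}
  | leftTop => {Side.left, Side.top}
  | horizontal => {Side.left, Side.right}
  | vertical => {Side.top, Side.bottom}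
  | leftBottomRightTop => {Side.left, Side.right, Side.top, Side.bottom}
  | leftTopRightBottom => {Side.left, Side.right, Side.top, Side.bottom}
  | horizontalOver => {Side.left, Side.right, Side.top, Side.bottom}
  | verticalOver => {Side.left, Side.right, Side.top, Side.bottom}

/-- The straight strand on a tile joining the midpoints of two sides. -/
def strand (s s' : Side) : Set Space :=
  segment ℝ s.midpoint s'.midpoint

/-- The overcrossing strand joining the midpoints of two opposite sides: it passes at height `1`
above the centre of the tile. -/
def overStrand (s s' : Side) : Set Space :=
  segment ℝ s.midpoint ![0, 0, 1] ∪ segment ℝ ![0, 0, 1] s'.midpoint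

/-- The curves of a tile, as polygonal curves in space over the square `[-1, 1] × [-1, 1]`: arcs are
drawn as chords at height `0`, and the overcrossing strand of a crossing is raised. -/
def drawing : Tile → Set Space
  | blank => ∅
  | leftBottom => strand Side.left Side.bottom
  | rightBottom => strand Side.right Side.bottom
  | rightTop => strand Side.right Side.top
  | leftTop => strand Side.left Side.top
  | horizontal => strand Side.left Side.right
  | vertical => strand Side.top Side.bottom
  | leftBottomRightTop => strand Side.left Side.bottom ∪ strand Side.right Side.top
  | leftTopRightBottom => strand Side.left Side.top ∪ strand Side.right Side.bottom
  | horizontalOver => overStrand Side.left Side.right ∪ strand Side.top Side.bottom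
  | verticalOver => overStrand Side.top Side.bottom ∪ strand Side.left Side.right

end Tile

/-- An `n`-mosaic: an `n × n` array of tiles (first index: row, from the top; second index: column,
from the left) in which every connection point of a tile touches a connection point of an adjacent
tile. -/
structure Mosaic (n : ℕ) where
  tile : Fin n → Fin n → Tile
  suitablyConnected : ∀ (i j : Fin n), ∀ s ∈ (tile i j).connections,
    ∃ i' j' : Fin n, s.Leads i j i' j' ∧ s.opposite ∈ (tile i' j').connections

namespace Mosaic

variable {n : ℕ}

/-- The curve in space drawn by a mosaic; the tile in row `i` and column `j` is centred at
`(2 j, -2 i, 0)`. -/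
def drawing (M : Mosaic n) : Set Space :=
  ⋃ (i : Fin n) (j : Fin n),
    (fun x : Space => ![2 * ((j : ℕ) : ℝ), -(2 * ((i : ℕ) : ℝ)), 0] + x) '' (M.tile i j).drawing

/-- The mosaic `M` depicts the knot `K`: the curve drawn by `M` is a knot of the same type as `K`. -/
def Represents (M : Mosaic n) (K : Knot) : Prop :=
  ∃ L : Knot, L.carrier = M.drawing ∧ Knot.Equivalent L K

/-- The number of non-blank tiles of a mosaic. -/
def tileNumber (M : Mosaic n) : ℕ :=
  (Finset.univ.filter fun x : Fin n × Fin n => M.tile x.1 x.2 ≠ Tile.blank).card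

end Mosaic

namespace Knot

/-- The mosaic number `m(K)`: the least `n` for which some `n`-mosaic depicts `K` (an infimum in
`ℕ∞`, so it is finite exactly when such an `n` exists, and then it is attained). -/
noncomputable def mosaicNumber (K : Knot) : ℕ∞ :=
  sInf {m : ℕ∞ | ∃ (n : ℕ) (M : Mosaic n), M.Represents K ∧ m = (n : ℕ∞)}

/-- The tile number `t(K)`: the least number of non-blank tiles among all mosaics of `K`. -/
noncomputable def tileNumber (K : Knot) : ℕ∞ :=
  sInf {t : ℕ∞ | ∃ (n : ℕ) (M : Mosaic n), M.Represents K ∧ t = (M.tileNumber : ℕ∞)}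

/-- The minimal mosaic tile number `t_M(K)`: the least number of non-blank tiles among all minimal
mosaics of `K`, that is, those whose size is the mosaic number of `K`. -/
noncomputable def minimalMosaicTileNumber (K : Knot) : ℕ∞ :=
  sInf {t : ℕ∞ | ∃ (n : ℕ) (M : Mosaic n), (n : ℕ∞) = K.mosaicNumber ∧ M.Represents K ∧
    t = (M.tileNumber : ℕ∞)}

end Knot

end KnotMosaic

namespace KnotMosaic

open Set Filter Topology

/-! ### Segments -/

/-! Only `t_M(K) ≤ t(K)` needs an argument. Suppose `t(K) < t_M(K) ≤ 27`, so that some mosaic of `K`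
has at most 26 tiles. Among all finite tile patterns on the integer grid which draw `K`, take one,
`F`, with the fewest tiles and, among those, the fewest occupied rows plus columns
(`Pattern.Minimal`). It is shown that `F` fits into a square of side `m = m(K)`. It is then an
`m`-mosaic with at most `t(K)` tiles, a contradiction.

Counting tiles. A horizontal line between occupied rows is crossed an even, positive number of
times, so each row has at least two tiles. If at least two occupied rows lie on each side of the
line, it is crossed at least four times (`Pattern.Minimal.four_le_cross`): a line crossed only twice
is a plane meeting the prime knot in two points, one of the two parts can then be replaced by a
strand along the line, and this strand takes a single row and no more tiles than the part it
replaces. A row with four crossings above and below has at least five tiles, since four tiles would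
all be vertical segments and the row could be deleted (`Pattern.Rep.collapse`). Hence `r ≥ 4` rows
use at least `2 + 4 + 5 (r - 4) + 4 + 2 = 5 r - 8` tiles (`Pattern.Minimal.five_mul_rows_le`), and
the same holds for columns by rotation. With at most 26 tiles there are at most 6 rows. For `m ≤ 4`
the bound `m²` on the number of tiles is enough. For `m = 5` the four corners of the square can be
emptied (`Pattern.Rep.exists_corner_blank`), which leaves 21 tiles, whereas six rows need 22.

Topology. Equivalence is generated by triangle moves, so isotopy arguments have to be reduced to
these. Nearby simple polygons are equivalent, hence so are polygons joined by a path of simple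
polygons (`equivalent_of_path`), and piecewise affine isotopies preserve the knot type
(`Knot.becomes_of_piecewise`). For a knot cut by a plane in two points, primeness makes one
closed-up part trivial, and it must be deduced that the knot is equivalent to the other closed-up
part (`Knot.becomes_of_trivial_side`). For this each triangle move is realized by a piecewise affine
map of space, affine near all but finitely many points of the knot. Composing such maps and
correcting by an affine one yields a map which carries the trivial part to a triangle and is the
identity near some point `o` of the closing segment. The other part is first shrunk into that
neighbourhood of `o`; the map then turns the knot into a triangle with a tiny copy of this part in
one side, and the rest of the triangle is removed by hand.

A diagram lies in the half-space of nonnegative height, so strands at height zero may be rerouted at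
will within that plane: both the old and the new strand deform to the same path through a point
below it (`Knot.becomes_flat`). -/

theorem mem_segment_iff_lineMap {a b x : Space} :
    x ∈ segment ℝ a b ↔ ∃ s ∈ Icc (0 : ℝ) 1, AffineMap.lineMap a b s = x := by
  rw [segment_eq_image_lineMap]; rfl

theorem segment_eq_union {a b x : Space} (hx : x ∈ segment ℝ a b) :
    segment ℝ a b = segment ℝ a x ∪ segment ℝ x b := by
  obtain ⟨s, hs, rfl⟩ := mem_segment_iff_lineMap.1 hx
  have h0 : segment ℝ a b = AffineMap.lineMap a b '' Icc (0 : ℝ) 1 :=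
    segment_eq_image_lineMap ℝ a b
  have h1 := image_segment ℝ (AffineMap.lineMap a b : ℝ →ᵃ[ℝ] Space) 0 s
  have h2 := image_segment ℝ (AffineMap.lineMap a b : ℝ →ᵃ[ℝ] Space) s 1
  rw [segment_eq_Icc hs.1, AffineMap.lineMap_apply_zero] at h1
  rw [segment_eq_Icc hs.2, AffineMap.lineMap_apply_one] at h2
  rw [h0, ← h1, ← h2, ← image_union, Icc_union_Icc_eq_Icc hs.1 hs.2]

theorem segment_inter_of_mem {a b x : Space} (hx : x ∈ segment ℝ a b) :
    segment ℝ a x ∩ segment ℝ x b ⊆ {x} := by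
  rcases eq_or_ne a b with rfl | hab
  · rw [segment_same] at hx
    rw [mem_singleton_iff] at hx; subst hx; simp
  obtain ⟨s, hs, rfl⟩ := mem_segment_iff_lineMap.1 hx
  have h1 := image_segment ℝ (AffineMap.lineMap a b : ℝ →ᵃ[ℝ] Space) 0 s
  have h2 := image_segment ℝ (AffineMap.lineMap a b : ℝ →ᵃ[ℝ] Space) s 1
  rw [segment_eq_Icc hs.1, AffineMap.lineMap_apply_zero] at h1
  rw [segment_eq_Icc hs.2, AffineMap.lineMap_apply_one] at h2
  rw [← h1, ← h2, ← image_inter (AffineMap.lineMap_injective ℝ hab), Icc_inter_Icc_eq_singleton hs.1 hs.2,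
    image_singleton]

theorem segment_subset_left {a b x : Space} (hx : x ∈ segment ℝ a b) :
    segment ℝ a x ⊆ segment ℝ a b := by
  rw [segment_eq_union hx]; exact subset_union_left

theorem segment_subset_right {a b x : Space} (hx : x ∈ segment ℝ a b) :
    segment ℝ x b ⊆ segment ℝ a b := by
  rw [segment_eq_union hx]; exact subset_union_right

theorem isCompact_segment (a b : Space) : IsCompact (segment ℝ a b) := by
  rw [segment_eq_image_lineMap]
  exact isCompact_Icc.image AffineMap.lineMap_continuous

theorem isPreconnected_segment_diff_left {a b : Space} (hab : a ≠ b) :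
    IsPreconnected (segment ℝ a b \ {a}) := by
  have : segment ℝ a b \ {a} = AffineMap.lineMap a b '' Ioc (0 : ℝ) 1 := by
    ext x; constructor
    · rintro ⟨hx, hxa⟩
      obtain ⟨s, hs, rfl⟩ := mem_segment_iff_lineMap.1 hx
      refine ⟨s, ⟨lt_of_le_of_ne hs.1 ?_, hs.2⟩, rfl⟩
      rintro rfl
      simp at hxa
    · rintro ⟨s, hs, rfl⟩
      refine ⟨mem_segment_iff_lineMap.2 ⟨s, ⟨hs.1.le, hs.2⟩, rfl⟩, ?_⟩
      intro h
      rw [mem_singleton_iff] at h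
      have h' : (AffineMap.lineMap a b s : Space) = AffineMap.lineMap a b (0 : ℝ) := by rw [h]; simp
      exact hs.1.ne' (AffineMap.lineMap_injective ℝ hab h')
  rw [this]
  exact isPreconnected_Ioc.image _ AffineMap.lineMap_continuous.continuousOn

theorem eq_of_mem_segment_of_mem {a v x : Space} (h1 : x ∈ segment ℝ a v) (h2 : v ∈ segment ℝ a x) :
    x = v := by
  have := segment_inter_of_mem h1
  exact (this ⟨h2, right_mem_segment ℝ x v⟩).symm

/-! ### Polygonal arcs -/

/-- `S` is a simple polygonal arc from `a` to `b`, all of whose edges satisfy `P`. -/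
inductive Arc (P : Space → Space → Prop) : Set Space → Space → Space → Prop
  | single {a b : Space} (hab : a ≠ b) (h : P a b) : Arc P (segment ℝ a b) a b
  | cons {a b c : Space} {S : Set Space} (hab : a ≠ b) (h : P a b) (hS : Arc P S b c)
      (hi : segment ℝ a b ∩ S ⊆ {b}) : Arc P (segment ℝ a b ∪ S) a c

namespace Arc

variable {P Q : Space → Space → Prop} {S T : Set Space} {a b c x : Space}

theorem left_mem (h : Arc P S a b) : a ∈ S := by
  cases h with
  | single => exact left_mem_segment ℝ _ _
  | cons => exact Or.inl (left_mem_segment ℝ _ _)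

theorem right_mem (h : Arc P S a b) : b ∈ S := by
  induction h with
  | single => exact right_mem_segment ℝ _ _
  | cons _ _ _ _ ih => exact Or.inr ih

theorem ne (h : Arc P S a b) : a ≠ b := by
  cases h with
  | single hab _ => exact hab
  | cons hab h hS hi =>
    rintro rfl
    exact hab (hi ⟨left_mem_segment ℝ _ _, hS.right_mem⟩)

theorem isCompact (h : Arc P S a b) : IsCompact S := by
  induction h with
  | single => exact isCompact_segment _ _
  | cons _ _ _ _ ih => exact (isCompact_segment _ _).union ih

theorem mono (hPQ : ∀ a b, P a b → Q a b) (h : Arc P S a b) : Arc Q S a b := by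
  induction h with
  | single hab h => exact single hab (hPQ _ _ h)
  | cons hab h _ hi ih => exact cons hab (hPQ _ _ h) ih hi

theorem mono_subset (h : Arc P S a b) : Arc (fun a b => P a b ∧ segment ℝ a b ⊆ S) S a b := by
  induction h with
  | single hab h => exact single hab ⟨h, Subset.rfl⟩
  | cons hab h _ hi ih =>
    exact cons hab ⟨h, subset_union_left⟩
      (ih.mono fun a b h => ⟨h.1, h.2.trans subset_union_right⟩) hi

theorem trans (h : Arc P S a b) (h' : Arc P T b c) (hi : S ∩ T ⊆ {b}) : Arc P (S ∪ T) a c := by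
  induction h with
  | single hab h => exact cons hab h h' hi
  | @cons a v b S hab h hS hi' ih =>
    rw [union_assoc]
    refine cons hab h (ih h' fun y hy => hi ⟨Or.inr hy.1, hy.2⟩) ?_
    rintro y ⟨hy, hy' | hy'⟩
    · exact hi' ⟨hy, hy'⟩
    · have := hi ⟨Or.inl hy, hy'⟩
      rw [mem_singleton_iff] at this
      subst this
      exact hi' ⟨hy, hS.right_mem⟩

theorem symm (hP : ∀ a b, P a b → P b a) (h : Arc P S a b) : Arc P S b a := by
  induction h with
  | single hab h => rw [segment_symm]; exact single hab.symm (hP _ _ h)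
  | cons hab h hS hi ih =>
    rw [union_comm, segment_symm]
    refine ih.trans (single hab.symm (hP _ _ h)) ?_
    rw [inter_comm, segment_symm]; exact hi

/-- This is subdivision: the set `S` stays the same while the condition on the edges is
strengthened. -/
theorem refine (hPQ : ∀ a b, a ≠ b → P a b → Arc Q (segment ℝ a b) a b) (h : Arc P S a b) :
    Arc Q S a b := by
  induction h with
  | single hab h => exact hPQ _ _ hab h
  | cons hab h _ hi ih => exact (hPQ _ _ hab h).trans ih hi

theorem exists_start (h : Arc P S a b) :
    ∃ v S', a ≠ v ∧ S = segment ℝ a v ∪ S' ∧ IsClosed S' ∧ a ∉ S' := by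
  cases h with
  | single hab h => exact ⟨b, ∅, hab, by simp, isClosed_empty, by simp⟩
  | @cons _ v _ S hab h hS hi =>
    exact ⟨v, S, hab, rfl, hS.isCompact.isClosed, fun ha => hab (hi ⟨left_mem_segment ℝ _ _, ha⟩)⟩

/-- The point `x` may be interior to an edge, so the edge condition has to pass to both halves. -/
theorem exists_split (hP : ∀ a b x, x ∈ segment ℝ a b → P a b → P a x ∧ P x b)
    (h : Arc P S a b) (hx : x ∈ S) (hxa : x ≠ a) (hxb : x ≠ b) :
    ∃ S₁ S₂, Arc P S₁ a x ∧ Arc P S₂ x b ∧ S = S₁ ∪ S₂ ∧ S₁ ∩ S₂ ⊆ {x} := by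
  induction h with
  | single hab h =>
    exact ⟨_, _, single hxa.symm (hP _ _ _ hx h).1, single hxb (hP _ _ _ hx h).2,
      segment_eq_union hx, segment_inter_of_mem hx⟩
  | @cons a v b S hab h hS hi ih =>
    rcases eq_or_ne x v with rfl | hxv
    · exact ⟨_, _, single hab h, hS, rfl, hi⟩
    rcases hx with hx | hx
    · refine ⟨_, _, single hxa.symm (hP _ _ _ hx h).1, cons hxv (hP _ _ _ hx h).2 hS ?_, ?_, ?_⟩
      · exact fun y hy => hi ⟨segment_subset_right hx hy.1, hy.2⟩
      · rw [← union_assoc, ← segment_eq_union hx]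
      · rintro y ⟨hy, hy' | hy'⟩
        · exact segment_inter_of_mem hx ⟨hy, hy'⟩
        · have := hi ⟨segment_subset_left hx hy, hy'⟩
          rw [mem_singleton_iff] at this
          subst this
          exact absurd (eq_of_mem_segment_of_mem hx hy) hxv
    · obtain ⟨S₁, S₂, h1, h2, rfl, h12⟩ := ih hx hxv hxb
      refine ⟨_, _, cons hab h h1 fun y hy => hi ⟨hy.1, Or.inl hy.2⟩, h2, by rw [union_assoc], ?_⟩
      rintro y ⟨hy | hy, hy'⟩
      · have := hi ⟨hy, Or.inr hy'⟩
        rw [mem_singleton_iff] at this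
        subst this
        exact absurd (h12 ⟨h1.left_mem, hy'⟩).symm hxv
      · exact h12 ⟨hy, hy'⟩

theorem isPreconnected (h : Arc P S a b) : IsPreconnected S := by
  induction h with
  | single hab h => exact (convex_segment _ _).isPreconnected
  | @cons a v b S hab h hS hi ih =>
    exact (convex_segment _ _).isPreconnected.union v (right_mem_segment ℝ _ _) hS.left_mem ih

theorem isPreconnected_sdiff_left (h : Arc P S a b) : IsPreconnected (S \ {a}) := by
  cases h with
  | single hab h => exact isPreconnected_segment_diff_left hab
  | @cons a v b S hab h hS hi =>
    have haS : a ∉ S := fun ha => hab (hi ⟨left_mem_segment ℝ _ _, ha⟩)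
    rw [union_sdiff_distrib, sdiff_singleton_eq_self haS]
    exact (isPreconnected_segment_diff_left hab).union v
      ⟨right_mem_segment ℝ _ _, fun h => hab h.symm⟩ hS.left_mem hS.isPreconnected

theorem forget (h : Arc P S a b) : Arc (fun _ _ => True) S a b := h.mono fun _ _ _ => trivial

theorem symm' (h : Arc (fun _ _ => True) S a b) : Arc (fun _ _ => True) S b a :=
  h.symm fun _ _ _ => trivial

theorem exists_split' (h : Arc (fun _ _ => True) S a b) (hx : x ∈ S) (hxa : x ≠ a) (hxb : x ≠ b) :
    ∃ S₁ S₂, Arc (fun _ _ => True) S₁ a x ∧ Arc (fun _ _ => True) S₂ x b ∧ S = S₁ ∪ S₂ ∧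
      S₁ ∩ S₂ ⊆ {x} :=
  h.exists_split (fun _ _ _ _ _ => ⟨trivial, trivial⟩) hx hxa hxb

theorem exists_interior (h : Arc P S a b) : ∃ x ∈ S, x ≠ a ∧ x ≠ b := by
  cases h with
  | single hab h =>
    refine ⟨midpoint ℝ a b, midpoint_mem_segment _ _, ?_, ?_⟩
    · rw [Ne, midpoint_eq_left_iff]; exact hab
    · rw [Ne, midpoint_eq_right_iff]; exact hab
  | @cons a v b S hab h hS hi => exact ⟨v, Or.inr hS.left_mem, hab.symm, hS.ne⟩

/-- An interior point `x` cuts the arc into two half-open arcs, each connected and containing `x`.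
-/
theorem isPreconnected_interior (h : Arc P S a b) : IsPreconnected (S \ {a, b}) := by
  obtain ⟨x, hx, hxa, hxb⟩ := h.exists_interior
  obtain ⟨S₁, S₂, h1, h2, rfl, h12⟩ := h.forget.exists_split' hx hxa hxb
  have e : (S₁ ∪ S₂) \ {a, b} = (S₁ \ {a}) ∪ (S₂ \ {b}) := by
    ext y
    simp only [Set.mem_sdiff, mem_union, mem_insert_iff, mem_singleton_iff]
    constructor
    · rintro ⟨hy | hy, hn⟩
      · exact Or.inl ⟨hy, fun h => hn (Or.inl h)⟩
      · exact Or.inr ⟨hy, fun h => hn (Or.inr h)⟩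
    · rintro (⟨hy, hn⟩ | ⟨hy, hn⟩)
      · refine ⟨Or.inl hy, ?_⟩
        rintro (h | rfl)
        · exact hn h
        · exact hxb (h12 ⟨hy, h2.right_mem⟩).symm
      · refine ⟨Or.inr hy, ?_⟩
        rintro (rfl | h)
        · exact hxa (h12 ⟨h1.left_mem, hy⟩).symm
        · exact hn h
  rw [e]
  exact h1.isPreconnected_sdiff_left.union x ⟨h1.right_mem, hxa⟩ ⟨h2.left_mem, hxb⟩
    h2.symm'.isPreconnected_sdiff_left

/-- An end point is the limit of the points of its edge. This extends an inclusion of the interior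
in a closed set to the end points. -/
theorem subset_closure_interior (h : Arc P S a b) : S ⊆ closure (S \ {a, b}) := by
  have key : ∀ {S : Set Space} {a b : Space}, Arc (fun _ _ => True) S a b →
      a ∈ closure (S \ {a, b}) := by
    intro S a b h
    obtain ⟨x, hx, hxa, hxb⟩ := h.exists_interior
    by_contra hcl
    obtain ⟨v, S', hav, rfl, hS', haS'⟩ := h.exists_start
    apply hcl
    rw [mem_closure_iff_frequently]
    have hc : Tendsto (fun s : ℝ => (AffineMap.lineMap a v s : Space)) (𝓝[>] 0) (𝓝 a) := by
      have : Continuous (fun s : ℝ => (AffineMap.lineMap a v s : Space)) :=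
        AffineMap.lineMap_continuous
      have := this.tendsto 0
      simp only [AffineMap.lineMap_apply_zero] at this
      exact this.mono_left nhdsWithin_le_nhds
    refine hc.frequently (Eventually.frequently ?_)
    filter_upwards [Ioo_mem_nhdsGT (zero_lt_one' ℝ),
      hc.eventually (isOpen_ne.mem_nhds (show a ≠ b from h.ne))] with s hs hsb
    refine ⟨Or.inl (mem_segment_iff_lineMap.2 ⟨s, ⟨hs.1.le, hs.2.le⟩, rfl⟩), ?_⟩
    rintro (h | h)
    · have h' : (AffineMap.lineMap a v s : Space) = AffineMap.lineMap a v (0 : ℝ) := by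
        rw [h]; simp
      exact hs.1.ne' (AffineMap.lineMap_injective ℝ hav h')
    · exact hsb h
  intro y hy
  by_cases hya : y = a
  · subst hya; exact key h.forget
  by_cases hyb : y = b
  · subst hyb
    rw [pair_comm]; exact key h.forget.symm'
  exact subset_closure ⟨hy, by simp [hya, hyb]⟩

/-- A connected subset of an arc containing both end points is the whole arc. -/
theorem eq_of_subset (h : Arc P S a b) (hT : IsPreconnected T) (hTS : T ⊆ S) (ha : a ∈ T)
    (hb : b ∈ T) : T = S := by
  refine hTS.antisymm fun x hx => ?_
  by_contra hxT
  have hxa : x ≠ a := fun h => hxT (h ▸ ha)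
  have hxb : x ≠ b := fun h => hxT (h ▸ hb)
  obtain ⟨S₁, S₂, h1, h2, rfl, h12⟩ := h.forget.exists_split' hx hxa hxb
  -- A missing point `x` would separate `T`: the two closed pieces of the arc meet only in `x`.
  obtain ⟨y, hy, hy'⟩ := isPreconnected_closed_iff.1 hT S₁ S₂ h1.isCompact.isClosed
    h2.isCompact.isClosed hTS ⟨a, ha, h1.left_mem⟩ ⟨b, hb, h2.right_mem⟩
  exact hxT (h12 hy' ▸ hy)

/-- An arc contained in a loop made of two arcs with the same end points is one of the two. -/
theorem eq_or_eq_of_subset_union {S₁ S₂ : Set Space} (h1 : Arc P S₁ a b) (h2 : Arc P S₂ a b)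
    (h12 : S₁ ∩ S₂ ⊆ {a, b}) (hT : Arc Q T a b) (hTS : T ⊆ S₁ ∪ S₂) : T = S₁ ∨ T = S₂ := by
  -- The interior of `T` is connected and avoids `S₁ ∩ S₂ ⊆ {a, b}`, so it cannot meet both closed
  -- sets.
  have key : T \ {a, b} ⊆ S₁ ∨ T \ {a, b} ⊆ S₂ := by
    by_contra! hcon
    obtain ⟨h1', h2'⟩ := hcon
    obtain ⟨y, hy, hy1⟩ := not_subset.1 h1'
    obtain ⟨z, hz, hz2⟩ := not_subset.1 h2'
    obtain ⟨w, hw, hw'⟩ := isPreconnected_closed_iff.1 hT.isPreconnected_interior S₁ S₂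
      h1.isCompact.isClosed h2.isCompact.isClosed (sdiff_subset.trans hTS)
      ⟨z, hz, (hTS hz.1).resolve_right hz2⟩ ⟨y, hy, (hTS hy.1).resolve_left hy1⟩
    exact hw.2 (h12 hw')
  rcases key with k | k
  · left
    exact h1.eq_of_subset hT.isPreconnected
      (hT.subset_closure_interior.trans (closure_minimal k h1.isCompact.isClosed)) hT.left_mem
      hT.right_mem
  · right
    exact h2.eq_of_subset hT.isPreconnected
      (hT.subset_closure_interior.trans (closure_minimal k h2.isCompact.isClosed)) hT.left_mem
      hT.right_mem

end Arc

/-! ### Loops -/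

/-- `S` is a simple closed polygon all of whose edges satisfy `P`. -/
def IsLoop (P : Space → Space → Prop) (S : Set Space) : Prop :=
  ∃ a b T, Arc P T a b ∧ P b a ∧ T ∩ segment ℝ b a ⊆ {a, b} ∧ S = T ∪ segment ℝ b a

theorem IsLoop.mono {P Q : Space → Space → Prop} {S : Set Space} (hPQ : ∀ a b, P a b → Q a b)
    (h : IsLoop P S) : IsLoop Q S := by
  obtain ⟨a, b, T, hT, hP, hi, rfl⟩ := h
  exact ⟨a, b, T, hT.mono hPQ, hPQ _ _ hP, hi, rfl⟩

/-- `IsLoop` wants the closing piece to be a single edge. If the second arc has several edges, its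
first edge becomes the closing one and its remainder is prepended to `S₁`. -/
theorem IsLoop.of_arcs {P : Space → Space → Prop} {S₁ S₂ : Set Space} {a b : Space}
    (h1 : Arc P S₁ a b) (h2 : Arc P S₂ b a) (hi : S₁ ∩ S₂ ⊆ {a, b}) : IsLoop P (S₁ ∪ S₂) := by
  generalize hA : a = a' at h2
  cases h2 with
  | single hba h => subst hA; exact ⟨a, b, S₁, h1, h, hi, rfl⟩
  | @cons _ v _ S hbv h hS hi' =>
    subst hA
    have hva := hS.ne
    have hbS : b ∉ S := fun hb => hbv (hi' ⟨left_mem_segment ℝ _ _, hb⟩)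
    -- rotate the base point to `v`
    have e : S₁ ∪ (segment ℝ b v ∪ S) = (S ∪ S₁) ∪ segment ℝ b v := by
      rw [union_comm S S₁, union_assoc, union_comm S]
    rw [e]
    refine ⟨v, b, S ∪ S₁, hS.trans h1 ?_, h, ?_, rfl⟩
    · rintro y ⟨hy, hy1⟩
      rcases hi ⟨hy1, Or.inr hy⟩ with rfl | hyb
      · rfl
      · rw [mem_singleton_iff] at hyb; subst hyb; exact absurd hy hbS
    · rintro y ⟨hy | hy, hy'⟩
      · exact Or.inl (hi' ⟨hy', hy⟩)
      · rcases hi ⟨hy, Or.inl hy'⟩ with rfl | hyb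
        · exact Or.inl (hi' ⟨hy', hS.right_mem⟩)
        · exact Or.inr hyb

theorem IsLoop.refine {P Q : Space → Space → Prop} {S : Set Space} (h : IsLoop P S)
    (hPQ : ∀ a b, a ≠ b → P a b → Arc Q (segment ℝ a b) a b) : IsLoop Q S := by
  obtain ⟨a, b, T, hT, hP, hi, rfl⟩ := h
  exact IsLoop.of_arcs (hT.refine hPQ) (hPQ _ _ hT.ne.symm hP) hi

theorem IsLoop.isPreconnected {P : Space → Space → Prop} {S : Set Space} (h : IsLoop P S) :
    IsPreconnected S := by
  obtain ⟨a, b, T, hT, hP, hi, rfl⟩ := h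
  exact hT.isPreconnected.union a hT.left_mem (right_mem_segment ℝ _ _)
    (convex_segment _ _).isPreconnected

theorem IsLoop.mono_subset {P : Space → Space → Prop} {S : Set Space} (h : IsLoop P S) :
    IsLoop (fun a b => P a b ∧ segment ℝ a b ⊆ S) S := by
  obtain ⟨a, b, T, hT, hP, hi, rfl⟩ := h
  exact ⟨a, b, T, hT.mono_subset.mono fun a b h => ⟨h.1, h.2.trans subset_union_left⟩,
    ⟨hP, subset_union_right⟩, hi, rfl⟩

abbrev Arc' := Arc fun _ _ => True

/-- Any point of a loop can be taken as a base point. -/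
theorem IsLoop.exists_arcs_left {S : Set Space} (h : IsLoop (fun _ _ => True) S) {x : Space}
    (hx : x ∈ S) : ∃ y S₁ S₂, Arc' S₁ x y ∧ Arc' S₂ x y ∧ S = S₁ ∪ S₂ ∧ S₁ ∩ S₂ ⊆ {x, y} := by
  obtain ⟨a, b, T, hT, hP, hi, rfl⟩ := h
  have key : ∀ (S₁ S₂ : Set Space) (a b : Space), Arc' S₁ a b → Arc' S₂ a b → S₁ ∩ S₂ ⊆ {a, b} →
      x ∈ S₁ → ∃ y U V, Arc' U x y ∧ Arc' V x y ∧ S₁ ∪ S₂ = U ∪ V ∧ U ∩ V ⊆ {x, y} := by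
    intro S₁ S₂ a b h1 h2 h12 hx
    by_cases hxa : x = a
    · subst hxa; exact ⟨b, S₁, S₂, h1, h2, rfl, h12⟩
    by_cases hxb : x = b
    · subst hxb; exact ⟨a, S₁, S₂, h1.symm', h2.symm', rfl, by rw [pair_comm]; exact h12⟩
    obtain ⟨U, V, hU, hV, rfl, hUV⟩ := h1.exists_split' hx hxa hxb
    refine ⟨b, V, U ∪ S₂, hV, hU.symm'.trans h2 ?_, ?_, ?_⟩
    · rintro z ⟨hz, hz'⟩
      rcases h12 ⟨Or.inl hz, hz'⟩ with h | h
      · exact h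
      · rw [mem_singleton_iff] at h; subst h
        exact absurd (hUV ⟨hz, hV.right_mem⟩).symm hxb
    · rw [← union_assoc, union_comm V U]
    · rintro z ⟨hz, hz' | hz'⟩
      · exact Or.inl (hUV ⟨hz', hz⟩)
      · rcases h12 ⟨Or.inr hz, hz'⟩ with h | h
        · subst h; exact absurd (hUV ⟨hU.left_mem, hz⟩).symm hxa
        · exact Or.inr h
  rcases hx with hx | hx
  · exact key T (segment ℝ b a) a b hT (Arc.single hT.ne.symm trivial).symm' hi hx
  · rw [union_comm]
    exact key (segment ℝ b a) T a b (Arc.single hT.ne.symm trivial).symm' hT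
      (by rw [inter_comm]; exact hi) hx

theorem IsLoop.exists_arcs {S : Set Space} (h : IsLoop (fun _ _ => True) S) {x y : Space}
    (hx : x ∈ S) (hy : y ∈ S) (hxy : x ≠ y) :
    ∃ S₁ S₂, Arc' S₁ x y ∧ Arc' S₂ x y ∧ S = S₁ ∪ S₂ ∧ S₁ ∩ S₂ ⊆ {x, y} := by
  obtain ⟨z, S₁, S₂, h1, h2, rfl, h12⟩ := h.exists_arcs_left hx
  have key : ∀ (S₁ S₂ : Set Space), Arc' S₁ x z → Arc' S₂ x z → S₁ ∩ S₂ ⊆ {x, z} →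
      y ∈ S₁ → ∃ U V, Arc' U x y ∧ Arc' V x y ∧ S₁ ∪ S₂ = U ∪ V ∧ U ∩ V ⊆ {x, y} := by
    intro S₁ S₂ h1 h2 h12 hy
    by_cases hyz : y = z
    · subst hyz; exact ⟨S₁, S₂, h1, h2, rfl, h12⟩
    obtain ⟨U, V, hU, hV, rfl, hUV⟩ := h1.exists_split' hy hxy.symm hyz
    refine ⟨U, S₂ ∪ V, hU, h2.trans hV.symm' ?_, ?_, ?_⟩
    · rintro w ⟨hw, hw'⟩
      rcases h12 ⟨Or.inr hw', hw⟩ with h | h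
      · subst h; exact absurd (hUV ⟨hU.left_mem, hw'⟩) hxy
      · exact h
    · rw [union_comm S₂, union_assoc]
    · rintro w ⟨hw, hw' | hw'⟩
      · rcases h12 ⟨Or.inl hw, hw'⟩ with h | h
        · exact Or.inl h
        · rw [mem_singleton_iff] at h; subst h
          exact absurd (hUV ⟨hw, hV.right_mem⟩).symm hyz
      · exact Or.inr (hUV ⟨hw, hw'⟩)
  rcases hy with hy | hy
  · exact key _ _ h1 h2 h12 hy
  · rw [union_comm]
    exact key _ _ h2 h1 (by rw [inter_comm]; exact h12) hy

/-- An arc contained in a loop has a complementary arc. -/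
theorem IsLoop.exists_complement {S T : Set Space} (h : IsLoop (fun _ _ => True) S) {a b : Space}
    (hT : Arc' T a b) (hTS : T ⊆ S) : ∃ U, Arc' U a b ∧ S = T ∪ U ∧ T ∩ U ⊆ {a, b} := by
  obtain ⟨S₁, S₂, h1, h2, rfl, h12⟩ := h.exists_arcs (hTS hT.left_mem) (hTS hT.right_mem) hT.ne
  rcases h1.eq_or_eq_of_subset_union h2 h12 hT hTS with rfl | rfl
  · exact ⟨S₂, h2, rfl, h12⟩
  · exact ⟨S₁, h1, union_comm _ _, by rw [inter_comm]; exact h12⟩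

/-- Replacing an arc of a loop by another one. -/
theorem IsLoop.replace {R T T' : Set Space} {a b : Space}
    (h : IsLoop (fun _ _ => True) (R ∪ T)) (hT : Arc' T a b) (hT' : Arc' T' a b)
    (hi : R ∩ T ⊆ {a, b}) (hi' : R ∩ T' ⊆ {a, b}) : IsLoop (fun _ _ => True) (R ∪ T') := by
  obtain ⟨U, hU, hS, hTU⟩ := h.exists_complement hT subset_union_right
  -- `R` and the complementary arc `U` differ only in the points `a, b`, which `T'` contains anyway.
  -- Thus `R` itself never has to be known as an arc.
  have e : R ∪ T' = T' ∪ U := by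
    ext y
    constructor
    · rintro (hy | hy)
      · rcases hS.le (Or.inl hy) with hy' | hy'
        · rcases hi ⟨hy, hy'⟩ with rfl | h
          · exact Or.inl hT'.left_mem
          · rw [mem_singleton_iff] at h; subst h; exact Or.inl hT'.right_mem
        · exact Or.inr hy'
      · exact Or.inl hy
    · rintro (hy | hy)
      · exact Or.inr hy
      · rcases hS.ge (Or.inr hy) with hy' | hy'
        · exact Or.inl hy'
        · rcases hTU ⟨hy', hy⟩ with rfl | h
          · exact Or.inr hT'.left_mem
          · rw [mem_singleton_iff] at h; subst h; exact Or.inr hT'.right_mem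
  rw [e]
  refine IsLoop.of_arcs hT' hU.symm' ?_
  rintro y ⟨hy, hy'⟩
  rcases hS.ge (Or.inr hy') with hy2 | hy2
  · exact hi' ⟨hy2, hy⟩
  · exact hTU ⟨hy2, hy'⟩

end KnotMosaic

/-! ### Vertices of arcs and loops, and elementary deformations of carriers -/

namespace KnotMosaic

open Set Filter Topology

variable {P : Space → Space → Prop}

/-- This passes from the inductive description to a list of vertices. The half-open edges are
disjoint and miss `b`, which is the form of injectivity in `IsSimpleClosedPolygon`. -/
theorem Arc.exists_vertices {S : Set Space} {a b : Space} (h : Arc P S a b) :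
    ∃ (n : ℕ) (q : ℕ → Space), q 0 = a ∧ q (n + 1) = b ∧
      (∀ x, x ∈ S ↔ ∃ i ≤ n, x ∈ segment ℝ (q i) (q (i + 1))) ∧
      (∀ i ≤ n, P (q i) (q (i + 1))) ∧
      (∀ i ≤ n, ∀ j ≤ n, ∀ s ∈ Ico (0 : ℝ) 1, ∀ t ∈ Ico (0 : ℝ) 1,
        (AffineMap.lineMap (q i) (q (i + 1)) s : Space) = AffineMap.lineMap (q j) (q (j + 1)) t →
        i = j ∧ s = t) ∧
      (∀ i ≤ n, ∀ s ∈ Ico (0 : ℝ) 1,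
        (AffineMap.lineMap (q i) (q (i + 1)) s : Space) ≠ b) := by
  have ne1 : ∀ {u v : Space}, u ≠ v → ∀ s ∈ Ico (0 : ℝ) 1,
      (AffineMap.lineMap u v s : Space) ≠ v := by
    intro u v huv s hs he
    have : (AffineMap.lineMap u v s : Space) = AffineMap.lineMap u v (1 : ℝ) := by rw [he]; simp
    exact hs.2.ne (AffineMap.lineMap_injective ℝ huv this)
  induction h with
  | @single a b hab h =>
    refine ⟨0, fun i => if i = 0 then a else b, rfl, rfl, ?_, ?_, ?_, ?_⟩
    · intro x; simp
    · simpa using h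
    · intro i hi j hj s hs t ht
      obtain rfl : i = 0 := by omega
      obtain rfl : j = 0 := by omega
      intro he
      exact ⟨rfl, AffineMap.lineMap_injective ℝ hab (by simpa using he)⟩
    · intro i hi s hs
      obtain rfl : i = 0 := by omega
      simpa using ne1 hab s hs
  | @cons a v b S hab h hS hi ih =>
    obtain ⟨n, q, h0, h1, hm, hP, hinj, hb⟩ := ih
    have hcross : ∀ s ∈ Ico (0 : ℝ) 1, (AffineMap.lineMap a v s : Space) ∉ S := by
      intro s hs hmem
      exact ne1 hab s hs (hi ⟨mem_segment_iff_lineMap.2 ⟨s, ⟨hs.1, hs.2.le⟩, rfl⟩, hmem⟩)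
    have hmemS : ∀ i ≤ n, ∀ s ∈ Ico (0 : ℝ) 1,
        (AffineMap.lineMap (q i) (q (i + 1)) s : Space) ∈ S := fun i hi s hs =>
      (hm _).2 ⟨i, hi, mem_segment_iff_lineMap.2 ⟨s, ⟨hs.1, hs.2.le⟩, rfl⟩⟩
    refine ⟨n + 1, fun i => Nat.casesOn i a q, rfl, h1, ?_, ?_, ?_, ?_⟩
    · intro x
      constructor
      · rintro (hx | hx)
        · exact ⟨0, by omega, by simpa [h0] using hx⟩
        · obtain ⟨i, hi, hx⟩ := (hm x).1 hx
          exact ⟨i + 1, by omega, hx⟩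
      · rintro ⟨i, hi, hx⟩
        cases i with
        | zero => left; simpa [h0] using hx
        | succ i => right; exact (hm x).2 ⟨i, by omega, hx⟩
    · intro i hi
      cases i with
      | zero => simpa [h0] using h
      | succ i => exact hP i (by omega)
    · intro i hi j hj s hs t ht he
      cases i with
      | zero =>
        cases j with
        | zero =>
          refine ⟨rfl, AffineMap.lineMap_injective ℝ hab ?_⟩
          simpa [h0] using he
        | succ j =>
          exfalso
          refine hcross s hs ?_
          have := hmemS j (by omega) t ht
          rw [← show _ = (AffineMap.lineMap (q j) (q (j + 1)) t : Space) from he] at this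
          simpa [h0] using this
      | succ i =>
        cases j with
        | zero =>
          exfalso
          refine hcross t ht ?_
          have := hmemS i (by omega) s hs
          rw [show (AffineMap.lineMap (q i) (q (i + 1)) s : Space) = _ from he] at this
          simpa [h0] using this
        | succ j =>
          obtain ⟨rfl, rfl⟩ := hinj i (by omega) j (by omega) s hs t ht he
          exact ⟨rfl, rfl⟩
    · intro i hi s hs
      cases i with
      | zero =>
        intro he
        refine hcross s hs ?_
        have he' : (AffineMap.lineMap a v s : Space) = b := by simpa [h0] using he
        rw [he']; exact hS.right_mem
      | succ i => exact hb i (by omega) s hs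

theorem fin_val_succ {n : ℕ} (i : Fin (n + 1)) (hi : (i : ℕ) < n) : ((i + 1 : Fin (n + 1)) : ℕ) = i + 1 := by
  rw [Fin.val_add_one, if_neg]
  rintro rfl
  simp at hi

/-- A tuple of points is the tuple of vertices of a simple closed polygon. -/
def Simple {n : ℕ} (p : Fin (n + 3) → Space) : Prop :=
  Function.Injective (fun x : Fin (n + 3) × Set.Ico (0 : ℝ) 1 =>
      (AffineMap.lineMap (p x.1) (p (x.1 + 1)) (x.2 : ℝ) : Space))

/-- The closed polygon with the given vertices. -/
def polygon {n : ℕ} (p : Fin (n + 3) → Space) : Set Space := ⋃ i, segment ℝ (p i) (p (i + 1))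

theorem IsLoop.exists_simple {S : Set Space} (h : IsLoop P S) :
    ∃ (n : ℕ) (p : Fin (n + 3) → Space), Simple p ∧ S = polygon p ∧ ∀ i, P (p i) (p (i + 1)) := by
  obtain ⟨a, b, T, hT, hba, hi, rfl⟩ := h
  obtain ⟨n, q, h0, h1, hm, hP, hinj, hb⟩ := hT.exists_vertices
  -- For `n = 0` the arc would be the segment `[a, b]` itself and the closing edge would retrace it.
  -- So there are at least three vertices.
  obtain ⟨m, rfl⟩ : ∃ m, n = m + 1 := by
    refine Nat.exists_eq_succ_of_ne_zero ?_
    rintro rfl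
    have hab := hT.ne
    have hmid : midpoint ℝ a b ∈ T := (hm _).2 ⟨0, le_rfl, by
      rw [h0, h1]; exact midpoint_mem_segment _ _⟩
    have hmid' : midpoint ℝ a b ∈ segment ℝ b a := by
      rw [segment_symm]; exact midpoint_mem_segment _ _
    rcases hi ⟨hmid, hmid'⟩ with h | h
    · exact hab ((midpoint_eq_left_iff ℝ).1 h)
    · exact hab ((midpoint_eq_right_iff ℝ).1 h)
  have hs : ∀ i : Fin (m + 3), (i : ℕ) ≤ m + 1 → q ((i + 1 : Fin (m + 3)) : ℕ) = q (i + 1) := by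
    intro i hi
    rw [fin_val_succ i (by omega)]
  have hl : ∀ i : Fin (m + 3), ¬ (i : ℕ) ≤ m + 1 → q i = b ∧ q ((i + 1 : Fin (m + 3)) : ℕ) = a := by
    intro i hi
    obtain rfl : i = Fin.last (m + 2) := Fin.ext (by simp; omega)
    refine ⟨h1, ?_⟩
    rw [Fin.val_add_one, if_pos rfl, h0]
  have hcross : ∀ i ≤ m + 1, ∀ s ∈ Ico (0 : ℝ) 1, ∀ t ∈ Ico (0 : ℝ) 1,
      (AffineMap.lineMap (q i) (q (i + 1)) s : Space) ≠ AffineMap.lineMap b a t := by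
    intro i hi' s hs t ht he
    have h2 : (AffineMap.lineMap (q i) (q (i + 1)) s : Space) ∈ T :=
      (hm _).2 ⟨i, hi', mem_segment_iff_lineMap.2 ⟨s, ⟨hs.1, hs.2.le⟩, rfl⟩⟩
    have h3 : (AffineMap.lineMap b a t : Space) ∈ segment ℝ b a :=
      mem_segment_iff_lineMap.2 ⟨t, ⟨ht.1, ht.2.le⟩, rfl⟩
    have h4 := hi ⟨he ▸ h2, h3⟩
    rcases h4 with h | h
    · have : (AffineMap.lineMap b a t : Space) = AffineMap.lineMap b a (1 : ℝ) := by rw [h]; simp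
      exact ht.2.ne (AffineMap.lineMap_injective ℝ hT.ne.symm this)
    · exact hb i hi' s hs (he.trans h)
  refine ⟨m, fun i => q i, ?_, ?_, ?_⟩
  · rintro ⟨i, s, hs'⟩ ⟨j, t, ht'⟩ he
    simp only at he
    by_cases hi' : (i : ℕ) ≤ m + 1 <;> by_cases hj' : (j : ℕ) ≤ m + 1
    · rw [hs i hi', hs j hj'] at he
      obtain ⟨h, rfl⟩ := hinj i hi' j hj' s hs' t ht' he
      rw [Fin.ext h]
    · rw [hs i hi', (hl j hj').1, (hl j hj').2] at he
      exact absurd he (hcross i hi' s hs' t ht')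
    · rw [hs j hj', (hl i hi').1, (hl i hi').2] at he
      exact absurd he.symm (hcross j hj' t ht' s hs')
    · obtain rfl : i = j := Fin.ext (by omega)
      rw [(hl i hi').1, (hl i hi').2] at he
      have := AffineMap.lineMap_injective ℝ hT.ne.symm he
      subst this; rfl
  · ext x
    simp only [polygon, mem_iUnion, mem_union]
    constructor
    · rintro (hx | hx)
      · obtain ⟨i, hi', hx⟩ := (hm x).1 hx
        refine ⟨⟨i, by omega⟩, ?_⟩
        rw [hs ⟨i, by omega⟩ hi']; exact hx
      · refine ⟨Fin.last (m + 2), ?_⟩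
        rw [(hl (Fin.last (m + 2)) (by simp)).1, (hl (Fin.last (m + 2)) (by simp)).2]; exact hx
    · rintro ⟨i, hx⟩
      by_cases hi' : (i : ℕ) ≤ m + 1
      · rw [hs i hi'] at hx
        exact Or.inl ((hm x).2 ⟨i, hi', hx⟩)
      · rw [(hl i hi').1, (hl i hi').2] at hx
        exact Or.inr hx
  · intro i
    by_cases hi' : (i : ℕ) ≤ m + 1
    · simp only; rw [hs i hi']; exact hP i hi'
    · simp only; rw [(hl i hi').1, (hl i hi').2]; exact hba

theorem IsLoop.isSimpleClosedPolygon {S : Set Space} (h : IsLoop P S) :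
    IsSimpleClosedPolygon S := by
  obtain ⟨n, p, hp, hS, -⟩ := h.exists_simple
  exact ⟨n, p, hp, hS⟩

theorem IsSimpleClosedPolygon.isLoop {S : Set Space} (h : IsSimpleClosedPolygon S) :
    IsLoop (fun _ _ => True) S := by
  obtain ⟨n, p, hp, rfl⟩ := h
  -- The vertices are extended periodically to `ℕ`, so that the closing edge runs from `q (n + 2)`
  -- to `q (n + 3) = q 0`.
  set q : ℕ → Space := fun i => p (Fin.ofNat (n + 3) i) with hq
  have hq1 : ∀ i, q (i + 1) = p (Fin.ofNat (n + 3) i + 1) := by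
    intro i
    simp only [hq]
    congr 1
    ext
    simp [Fin.val_add]
  have hinj : ∀ i < n + 3, ∀ j < n + 3, ∀ s ∈ Ico (0 : ℝ) 1, ∀ t ∈ Ico (0 : ℝ) 1,
      (AffineMap.lineMap (q i) (q (i + 1)) s : Space) = AffineMap.lineMap (q j) (q (j + 1)) t →
      i = j ∧ s = t := by
    intro i hi j hj s hs t ht he
    rw [hq1, hq1] at he
    have := @hp ⟨Fin.ofNat (n + 3) i, s, hs⟩ ⟨Fin.ofNat (n + 3) j, t, ht⟩ he
    simp only [Prod.mk.injEq, Subtype.mk.injEq] at this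
    refine ⟨?_, this.2⟩
    have h2 := congrArg Fin.val this.1
    simpa [Nat.mod_eq_of_lt hi, Nat.mod_eq_of_lt hj] using h2
  have hne : ∀ i < n + 3, q i ≠ q (i + 1) := by
    intro i hi he
    have := hinj i hi i hi 0 (by simp) (1 / 2) (by norm_num) (by rw [he]; simp)
    norm_num at this
  have hmem : ∀ i x, x ∈ segment ℝ (q i) (q (i + 1)) → x ≠ q (i + 1) →
      ∃ s ∈ Ico (0 : ℝ) 1, AffineMap.lineMap (q i) (q (i + 1)) s = x := by
    intro i x hx hne
    obtain ⟨s, hs, rfl⟩ := mem_segment_iff_lineMap.1 hx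
    refine ⟨s, ⟨hs.1, lt_of_le_of_ne hs.2 ?_⟩, rfl⟩
    rintro rfl
    simp at hne
  -- two different edges only meet in vertices that follow both or start one of them
  have hmeet : ∀ i < n + 3, ∀ j < n + 3, i ≠ j → ∀ x, x ∈ segment ℝ (q i) (q (i + 1)) →
      x ∈ segment ℝ (q j) (q (j + 1)) → x = q (i + 1) ∨ x = q (j + 1) := by
    intro i hi j hj hij x hx hx'
    by_contra! hcon
    obtain ⟨s, hs, h1⟩ := hmem i x hx hcon.1
    obtain ⟨t, ht, h2⟩ := hmem j x hx' hcon.2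
    exact hij (hinj i hi j hj s hs t ht (h1.trans h2.symm)).1
  have hvert : ∀ i < n + 3, ∀ j < n + 3, q i ∈ segment ℝ (q j) (q (j + 1)) → i = j ∨ q i = q (j + 1) := by
    intro i hi j hj hx
    by_contra! hcon
    obtain ⟨s, hs, h1⟩ := hmem j _ hx hcon.2
    exact hcon.1 (hinj i hi j hj 0 (by simp) s hs (by rw [h1]; simp)).1
  have hqinj : ∀ i < n + 3, ∀ j < n + 3, q i = q j → i = j := by
    intro i hi j hj he
    exact (hinj i hi j hj 0 (by simp) 0 (by simp) (by simpa using he)).1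
  have hwrap : q (n + 3) = q 0 := by simp [hq]
  -- Edges are prepended one by one, as `Arc.cons` requires. The case `k = n + 1` gives the arc made
  -- of all edges but the closing one.
  have hsub : ∀ k ≤ n + 1, ∃ T, Arc' T (q (n + 1 - k)) (q (n + 2)) ∧
      ∀ x, x ∈ T ↔ ∃ i, n + 1 - k ≤ i ∧ i ≤ n + 1 ∧ x ∈ segment ℝ (q i) (q (i + 1)) := by
    intro k
    induction k with
    | zero =>
      intro _
      refine ⟨_, Arc.single (hne (n + 1) (by omega)) trivial, fun x => ⟨fun hx => ⟨n + 1, by omega, le_rfl, hx⟩, ?_⟩⟩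
      rintro ⟨i, h1, h2, hx⟩
      obtain rfl : i = n + 1 := by omega
      exact hx
    | succ k ih =>
      intro hk
      obtain ⟨T, hT, hTm⟩ := ih (by omega)
      obtain ⟨l, hl⟩ : ∃ l, n + 1 - (k + 1) = l := ⟨_, rfl⟩
      have hl1 : n + 1 - k = l + 1 := by omega
      rw [hl1] at hT hTm
      rw [hl]
      refine ⟨segment ℝ (q l) (q (l + 1)) ∪ T, Arc.cons (hne l (by omega)) trivial hT ?_, ?_⟩
      · rintro x ⟨hx, hx'⟩
        obtain ⟨i, hi1, hi2, hx'⟩ := (hTm x).1 hx'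
        rcases hmeet l (by omega) i (by omega) (by omega) x hx hx' with h | h
        · exact h
        · subst h
          by_cases hlast : i + 1 < n + 3
          · rcases hvert (i + 1) hlast l (by omega) hx with h | h
            · omega
            · exact h
          · omega
      · intro x
        simp only [mem_union]
        rw [hTm]
        constructor
        · rintro (hx | ⟨i, h1, h2, hx⟩)
          · exact ⟨l, le_rfl, by omega, hx⟩
          · exact ⟨i, by omega, h2, hx⟩
        · rintro ⟨i, h1, h2, hx⟩
          rcases eq_or_lt_of_le h1 with rfl | h1
          · exact Or.inl hx
          · exact Or.inr ⟨i, by omega, h2, hx⟩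
  obtain ⟨T, hT, hTm⟩ := hsub (n + 1) le_rfl
  rw [Nat.sub_self] at hT hTm
  refine ⟨q 0, q (n + 2), T, hT, trivial, ?_, ?_⟩
  · rintro x ⟨hx, hx'⟩
    obtain ⟨i, -, hi, hx⟩ := (hTm x).1 hx
    rw [← hwrap] at hx'
    rcases hmeet (n + 2) (by omega) i (by omega) (by omega) x hx' hx with h | h
    · left; rw [h, hwrap]
    · subst h
      rcases hvert (i + 1) (by omega) (n + 2) (by omega) hx' with h | h
      · right; rw [h]; rfl
      · left; rw [h, hwrap]
  · ext x
    simp only [mem_iUnion, mem_union]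
    constructor
    · rintro ⟨i, hx⟩
      have e : p i = q i := by simp [hq]
      have e1 : p (i + 1) = q (i + 1) := by rw [hq1]; simp
      rw [e, e1] at hx
      by_cases hi : (i : ℕ) ≤ n + 1
      · exact Or.inl ((hTm x).2 ⟨i, by omega, hi, hx⟩)
      · right
        have : (i : ℕ) = n + 2 := by omega
        rw [this, hwrap] at hx; exact hx
    · rintro (hx | hx)
      · obtain ⟨i, -, hi, hx⟩ := (hTm x).1 hx
        refine ⟨Fin.ofNat (n + 3) i, ?_⟩
        rw [← hq1]; exact hx
      · refine ⟨Fin.ofNat (n + 3) (n + 2), ?_⟩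
        rw [← hq1, hwrap]; exact hx

theorem Knot.isLoop (K : Knot) : IsLoop (fun _ _ => True) K.carrier := K.polygonal.isLoop

theorem Knot.ext' {K K' : Knot} (h : K.carrier = K'.carrier) : K = K' := by
  cases K; cases K'; cases h; rfl

namespace Knot

theorem Equivalent.refl (K : Knot) : Equivalent K K := Relation.EqvGen.refl _
theorem Equivalent.symm {K K' : Knot} (h : Equivalent K K') : Equivalent K' K := Relation.EqvGen.symm _ _ h
theorem Equivalent.trans {K K' K'' : Knot} (h : Equivalent K K') (h' : Equivalent K' K'') :
    Equivalent K K'' := Relation.EqvGen.trans _ _ _ h h'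

end Knot

/-- The set `S'` is the carrier of a knot equivalent to `K`. -/
def Knot.Becomes (K : Knot) (S' : Set Space) : Prop :=
  ∃ K' : Knot, K'.carrier = S' ∧ Knot.Equivalent K K'

theorem Knot.Becomes.trans {K : Knot} {S S' : Set Space} (h : K.Becomes S)
    (h' : ∀ K' : Knot, K'.carrier = S → K'.Becomes S') : K.Becomes S' := by
  obtain ⟨K', hK', he⟩ := h
  obtain ⟨K'', hK'', he'⟩ := h' K' hK'
  exact ⟨K'', hK'', he.trans he'⟩

theorem ne_of_affineIndependent {a b c : Space} (h : AffineIndependent ℝ ![a, b, c]) :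
    a ≠ b ∧ a ≠ c ∧ b ≠ c := by
  have := h.injective
  refine ⟨fun e => ?_, fun e => ?_, fun e => ?_⟩
  · exact absurd (@this 0 1 e) (by decide)
  · exact absurd (@this 0 2 e) (by decide)
  · exact absurd (@this 1 2 e) (by decide)

/-- Two sides of a triangle only meet in their common vertex. -/
theorem segment_inter_of_affineIndependent {a b c : Space} (h : AffineIndependent ℝ ![a, b, c]) :
    segment ℝ a b ∩ segment ℝ b c ⊆ {b} := by
  have h' : AffineIndependent ℝ ![b, a, c] := by
    have := h.comp_embedding (Equiv.swap (0 : Fin 3) 1).toEmbedding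
    convert this using 1
    ext i j; fin_cases i <;> rfl
  have h2 : LinearIndependent ℝ ![a - b, c - b] := by
    have := (affineIndependent_iff_linearIndependent_vsub ℝ _ (0 : Fin 3)).1 h'
    have := this.comp (fun i : Fin 2 => (⟨i.succ, Fin.succ_ne_zero i⟩ : {x : Fin 3 // x ≠ 0})) (by
      intro i j hij; simpa using hij)
    have e : ((fun i : {x : Fin 3 // x ≠ 0} => (![b, a, c] i -ᵥ ![b, a, c] 0 : Space)) ∘
        fun i : Fin 2 => ⟨i.succ, Fin.succ_ne_zero i⟩) = ![a - b, c - b] := by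
      ext i; fin_cases i <;> rfl
    rwa [e] at this
  rw [segment_symm ℝ a b]
  exact (segment_inter_subset_endpoint_of_linearIndependent_sub (𝕜 := ℝ) h2)

theorem segment_subset_convexHull₃ {a b c : Space} :
    segment ℝ a b ⊆ convexHull ℝ {a, b, c} :=
  (convex_convexHull ℝ _).segment_subset (subset_convexHull ℝ _ (by simp))
    (subset_convexHull ℝ _ (by simp))

/-- The working form of a triangle move. The rest `R` of the knot is an arbitrary set which may
overlap the edge in its end points; that the result is again a simple polygon comes from
`IsLoop.replace`. -/
theorem Knot.becomes_add_vertex {K : Knot} {R : Set Space} {a b c : Space}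
    (hK : K.carrier = R ∪ segment ℝ a b) (hi : AffineIndependent ℝ ![a, b, c])
    (hR : R ∩ convexHull ℝ {a, b, c} ⊆ {a, b}) :
    K.Becomes (R ∪ (segment ℝ a c ∪ segment ℝ c b)) := by
  obtain ⟨hab, hac, hbc⟩ := ne_of_affineIndependent hi
  have hi' : AffineIndependent ℝ ![a, c, b] := by
    have := hi.comp_embedding (Equiv.swap (1 : Fin 3) 2).toEmbedding
    convert this using 1
    ext i j; fin_cases i <;> rfl
  have hT' : Arc' (segment ℝ a c ∪ segment ℝ c b) a b :=
    (Arc.single hac trivial).trans (Arc.single hbc.symm trivial)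
      (segment_inter_of_affineIndependent hi')
  have hsub : segment ℝ a c ∪ segment ℝ c b ⊆ convexHull ℝ {a, b, c} := by
    refine union_subset ?_ ?_
    · rw [show ({a, b, c} : Set Space) = {a, c, b} by rw [pair_comm]]
      exact segment_subset_convexHull₃
    · rw [show ({a, b, c} : Set Space) = {c, b, a} by
        rw [insert_comm, pair_comm, insert_comm]]
      exact segment_subset_convexHull₃
  have hab' : R ∩ segment ℝ a b ⊆ {a, b} := fun x hx => hR ⟨hx.1, segment_subset_convexHull₃ hx.2⟩
  have hloop := IsLoop.replace (hK ▸ K.isLoop) (Arc.single hab trivial) hT' hab'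
    (fun x hx => hR ⟨hx.1, hsub hx.2⟩)
  refine ⟨⟨_, hloop.isSimpleClosedPolygon⟩, rfl, Relation.EqvGen.rel _ _ ⟨a, b, c, hi, ?_, ?_⟩⟩
  · rw [hK]
    ext x; constructor
    · rintro ⟨hx | hx, hx'⟩
      · rcases hR ⟨hx, hx'⟩ with rfl | h
        · exact left_mem_segment ℝ _ _
        · rw [mem_singleton_iff] at h; subst h; exact right_mem_segment ℝ _ _
      · exact hx
    · exact fun hx => ⟨Or.inr hx, segment_subset_convexHull₃ hx⟩
  · rw [hK]
    ext x; constructor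
    · rintro (hx | hx)
      · by_cases hx' : x ∈ segment ℝ a b
        · rcases hab' ⟨hx, hx'⟩ with rfl | h
          · exact Or.inr hT'.left_mem
          · rw [mem_singleton_iff] at h; subst h; exact Or.inr hT'.right_mem
        · exact Or.inl ⟨Or.inl hx, hx'⟩
      · exact Or.inr hx
    · rintro (⟨hx | hx, hx'⟩ | hx)
      · exact Or.inl hx
      · exact absurd hx hx'
      · exact Or.inr hx

/-- `IsLoop.replace` yields the shortened polygon, and `Knot.becomes_add_vertex` leads from it back
to `K`. -/
theorem Knot.becomes_remove_vertex {K : Knot} {R : Set Space} {a b c : Space}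
    (hK : K.carrier = R ∪ (segment ℝ a c ∪ segment ℝ c b)) (hi : AffineIndependent ℝ ![a, b, c])
    (hR : R ∩ convexHull ℝ {a, b, c} ⊆ {a, b}) :
    K.Becomes (R ∪ segment ℝ a b) := by
  obtain ⟨hab, hac, hbc⟩ := ne_of_affineIndependent hi
  have hi' : AffineIndependent ℝ ![a, c, b] := by
    have := hi.comp_embedding (Equiv.swap (1 : Fin 3) 2).toEmbedding
    convert this using 1
    ext i j; fin_cases i <;> rfl
  have hT' : Arc' (segment ℝ a c ∪ segment ℝ c b) a b :=
    (Arc.single hac trivial).trans (Arc.single hbc.symm trivial)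
      (segment_inter_of_affineIndependent hi')
  have hsub : segment ℝ a c ∪ segment ℝ c b ⊆ convexHull ℝ {a, b, c} := by
    refine union_subset ?_ ?_
    · rw [show ({a, b, c} : Set Space) = {a, c, b} by rw [pair_comm]]
      exact segment_subset_convexHull₃
    · rw [show ({a, b, c} : Set Space) = {c, b, a} by
        rw [insert_comm, pair_comm, insert_comm]]
      exact segment_subset_convexHull₃
  have hab' : R ∩ segment ℝ a b ⊆ {a, b} := fun x hx => hR ⟨hx.1, segment_subset_convexHull₃ hx.2⟩
  have hloop := IsLoop.replace (hK ▸ K.isLoop) hT' (Arc.single hab trivial)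
    (fun x hx => hR ⟨hx.1, hsub hx.2⟩) hab'
  refine ⟨⟨_, hloop.isSimpleClosedPolygon⟩, rfl, ?_⟩
  obtain ⟨K'', hK'', he⟩ := Knot.becomes_add_vertex (K := ⟨_, hloop.isSimpleClosedPolygon⟩) rfl hi hR
  obtain rfl : K'' = K := Knot.ext' (hK''.trans hK.symm)
  exact he.symm

end KnotMosaic

namespace KnotMosaic

open Set Filter Topology

/-! ### Small deformations of polygons -/

theorem mem_convexHull₃ {a b c x : Space} :
    x ∈ convexHull ℝ {a, b, c} ↔
      ∃ α β γ : ℝ, 0 ≤ α ∧ 0 ≤ β ∧ 0 ≤ γ ∧ α + β + γ = 1 ∧ x = α • a + β • b + γ • c := by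
  constructor
  · rw [convexHull_insert (by simp), convexHull_pair]
    intro h
    obtain ⟨a', ha', y, ⟨β, γ, hβ, hγ, hs, rfl⟩, α, δ, hα, hδ, hs', rfl⟩ := mem_convexJoin.1 h
    rw [mem_singleton_iff] at ha'; subst ha'
    refine ⟨α, δ * β, δ * γ, hα, mul_nonneg hδ hβ, mul_nonneg hδ hγ, ?_, ?_⟩
    · rw [add_assoc, ← mul_add, hs, mul_one, hs']
    · rw [smul_add, smul_smul, smul_smul, add_assoc]
  · rintro ⟨α, β, γ, hα, hβ, hγ, hs, rfl⟩
    have h := (convex_convexHull ℝ ({a, b, c} : Set Space)).sum_mem (t := Finset.univ)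
      (w := ![α, β, γ]) (z := ![a, b, c]) (by intro i _; fin_cases i <;> simpa)
      (by simp [Fin.sum_univ_three, hs])
      (by intro i _; apply subset_convexHull; fin_cases i <;> simp)
    simpa [Fin.sum_univ_three] using h

theorem mem_segment' {a b x : Space} :
    x ∈ segment ℝ a b ↔ ∃ s ∈ Icc (0 : ℝ) 1, x = (1 - s) • a + s • b := by
  rw [mem_segment_iff_lineMap]
  simp only [AffineMap.lineMap_apply_module, eq_comm]

theorem triangle_swap' (a b c : Space) : ({a, b, c} : Set Space) = {a, c, b} := by rw [pair_comm]

/-- Points of the unit cube parametrize the points of a triangle and of a segment. -/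
theorem eventually_disjoint {u v x y : Space} (h : Disjoint (segment ℝ u v) (segment ℝ x y)) :
    ∀ᶠ z : Space × Space × Space × Space × Space in 𝓝 (u, u, v, x, y),
      Disjoint (convexHull ℝ {z.1, z.2.1, z.2.2.1}) (segment ℝ z.2.2.2.1 z.2.2.2.2) := by
  -- At the limit the triangle degenerates to the segment `[u, v]`, its first two vertices being
  -- equal. Disjointness is an inequality over a compact parameter space, hence an open condition.
  have key : ∀ᶠ z : Space × Space × Space × Space × Space in 𝓝 (u, u, v, x, y),
      ∀ r ∈ (Icc (0 : ℝ) 1 ×ˢ (Icc (0 : ℝ) 1 ×ˢ Icc (0 : ℝ) 1)),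
      (1 - r.1) • ((1 - r.2.1) • z.1 + r.2.1 • z.2.1) + r.1 • z.2.2.1 ≠
        (1 - r.2.2) • z.2.2.2.1 + r.2.2 • z.2.2.2.2 := by
    refine (isCompact_Icc.prod (isCompact_Icc.prod isCompact_Icc)).eventually_forall_of_forall_eventually ?_
    rintro r hr
    refine ((Continuous.continuousAt ?_).ne_iff_eventually_ne (Continuous.continuousAt ?_)).1 ?_
    · fun_prop
    · fun_prop
    · simp only
      rw [← add_smul, sub_add_cancel, one_smul]
      intro he
      exact disjoint_left.1 h (mem_segment'.2 ⟨r.1, hr.1, rfl⟩) (mem_segment'.2 ⟨r.2.2, hr.2.2, he⟩)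
  filter_upwards [key] with z hz
  rw [disjoint_left]
  intro p hp hp'
  obtain ⟨α, β, γ, hα, hβ, hγ, hs, rfl⟩ := mem_convexHull₃.1 hp
  obtain ⟨t, ht, he⟩ := mem_segment'.1 hp'
  -- Barycentric coordinates are converted to the cube parameters. The ratio `β / (α + β)` is
  -- undefined only at the third vertex.
  by_cases h0 : α + β = 0
  · obtain rfl : α = 0 := by linarith
    obtain rfl : β = 0 := by linarith
    refine hz (1, 0, t) ⟨by simp, by simp, ht⟩ ?_
    obtain rfl : γ = 1 := by linarith
    simpa using he
  · have h0' : 0 < α + β := lt_of_le_of_ne (by linarith) (Ne.symm h0)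
    refine hz (γ, β / (α + β), t) ⟨⟨hγ, by linarith⟩, ⟨by positivity, ?_⟩, ht⟩ ?_
    · rw [div_le_one h0']; linarith
    · simp only
      rw [← he, smul_add, smul_smul, smul_smul]
      obtain rfl : γ = 1 - α - β := by linarith
      congr 3
      · field_simp; ring
      · field_simp; ring

/-- Consecutive edges share `v`, so disjointness is not available. The substitute is that no convex
combination of `u - v` and `v - w` vanishes, i.e. the path does not fold back at `v`, and this is an
open condition. A common point other than the vertex would give a vanishing combination for the
perturbed points after rescaling. -/
theorem eventually_adjacent {u v w : Space}
    (h : ∀ s ∈ Icc (0 : ℝ) 1, (1 - s) • (u - v) + s • (v - w) ≠ 0) :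
    ∀ᶠ z : Space × Space × Space × Space in 𝓝 (u, u, v, w),
      convexHull ℝ {z.1, z.2.1, z.2.2.1} ∩ segment ℝ z.2.2.1 z.2.2.2 ⊆ {z.2.2.1} := by
  have key : ∀ᶠ z : Space × Space × Space × Space in 𝓝 (u, u, v, w),
      ∀ r ∈ (Icc (0 : ℝ) 1 ×ˢ Icc (0 : ℝ) 1),
      (1 - r.1) • ((1 - r.2) • (z.1 - z.2.2.1) + r.2 • (z.2.1 - z.2.2.1)) +
        r.1 • (z.2.2.1 - z.2.2.2) ≠ 0 := by
    refine (isCompact_Icc.prod isCompact_Icc).eventually_forall_of_forall_eventually ?_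
    rintro r hr
    refine ((Continuous.continuousAt ?_).ne_iff_eventually_ne continuousAt_const).1 ?_
    · fun_prop
    · simp only
      rw [← add_smul, sub_add_cancel, one_smul]
      exact h r.1 hr.1
  filter_upwards [key] with z hz
  rintro p ⟨hp, hp'⟩
  obtain ⟨α, β, γ, hα, hβ, hγ, hs, rfl⟩ := mem_convexHull₃.1 hp
  obtain ⟨t, ht, he⟩ := mem_segment'.1 hp'
  have he' : α • (z.1 - z.2.2.1) + β • (z.2.1 - z.2.2.1) + t • (z.2.2.1 - z.2.2.2) = 0 := by
    have hγ' : γ = 1 - α - β := by linarith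
    rw [hγ'] at he
    calc _ = (α • z.1 + β • z.2.1 + (1 - α - β) • z.2.2.1) -
          ((1 - t) • z.2.2.1 + t • z.2.2.2) := by module
      _ = 0 := sub_eq_zero.2 he
  by_cases h0 : α + β = 0
  · obtain rfl : α = 0 := by linarith
    obtain rfl : β = 0 := by linarith
    obtain rfl : γ = 1 := by linarith
    simp
  · exfalso
    have h0' : 0 < α + β := lt_of_le_of_ne (by linarith) (Ne.symm h0)
    have hM : 0 < α + β + t := by linarith [ht.1]
    refine hz (t / (α + β + t), β / (α + β)) ⟨⟨div_nonneg ht.1 hM.le, ?_⟩, ⟨by positivity, ?_⟩⟩ ?_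
    · rw [div_le_one hM]; linarith
    · rw [div_le_one h0']; linarith
    · have : ((1 : ℝ) / (α + β + t)) • (α • (z.1 - z.2.2.1) + β • (z.2.1 - z.2.2.1) + t • (z.2.2.1 - z.2.2.2)) = 0 := by
        rw [he', smul_zero]
      rw [← this]
      simp only [smul_add, smul_smul]
      congr 3
      · field_simp; ring
      · field_simp; ring
      · field_simp

/-- The condition on a tuple of vertices, in a form which is visibly open. -/
def Good {n : ℕ} (p : Fin (n + 3) → Space) : Prop :=
  (∀ i, ∀ s ∈ Icc (0 : ℝ) 1, (1 - s) • (p i - p (i + 1)) + s • (p (i + 1) - p (i + 1 + 1)) ≠ 0) ∧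
  ∀ i j, i ≠ j → j ≠ i + 1 → i ≠ j + 1 →
    Disjoint (segment ℝ (p i) (p (i + 1))) (segment ℝ (p j) (p (j + 1)))

theorem succ_ne_self {n : ℕ} (i : Fin (n + 3)) : i + 1 ≠ i := by
  intro h
  rw [add_eq_left] at h
  exact absurd h (by simp)

theorem succ_succ_ne_self {n : ℕ} (i : Fin (n + 3)) : i + 1 + 1 ≠ i := by
  intro h
  rw [add_assoc, add_eq_left] at h
  have := congrArg Fin.val h
  simp only [Fin.val_add, Fin.val_one, Fin.val_zero] at this
  rw [Nat.mod_eq_of_lt (by omega)] at this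
  omega

theorem Simple.ne_succ {n : ℕ} {p : Fin (n + 3) → Space} (h : Simple p) (i : Fin (n + 3)) :
    p i ≠ p (i + 1) := by
  intro he
  have := @h ⟨i, 0, by simp⟩ ⟨i, 1 / 2, by norm_num⟩ (by simp [he])
  simp only [Prod.mk.injEq, Subtype.mk.injEq] at this
  norm_num at this

/-- The combination in `Good` is the difference of the points with parameter `s` on the edges `i`
and `i + 1`. If it vanished, these two points would coincide. -/
theorem Simple.good {n : ℕ} {p : Fin (n + 3) → Space} (h : Simple p) : Good p := by
  have hinj : ∀ i j, ∀ s ∈ Ico (0 : ℝ) 1, ∀ t ∈ Ico (0 : ℝ) 1,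
      (1 - s) • p i + s • p (i + 1) = (1 - t) • p j + t • p (j + 1) → i = j := by
    intro i j s hs t ht he
    have := @h ⟨i, s, hs⟩ ⟨j, t, ht⟩ (by simpa [AffineMap.lineMap_apply_module] using he)
    simp only [Prod.mk.injEq] at this
    exact this.1
  refine ⟨fun i s hs he => ?_, fun i j hij hj hi => ?_⟩
  · by_cases hs1 : s = 1
    · subst hs1
      simp only [sub_self, zero_smul, zero_add, one_smul, sub_eq_zero] at he
      exact h.ne_succ _ he
    · have hs' : s ∈ Ico (0 : ℝ) 1 := ⟨hs.1, lt_of_le_of_ne hs.2 hs1⟩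
      refine succ_ne_self i (hinj i (i + 1) s hs' s hs' ?_).symm
      rw [← sub_eq_zero, ← he]; module
  · rw [disjoint_left]
    intro x hx hx'
    obtain ⟨s, hs, rfl⟩ := mem_segment'.1 hx
    obtain ⟨t, ht, he⟩ := mem_segment'.1 hx'
    rcases eq_or_lt_of_le hs.2 with rfl | hs1 <;> rcases eq_or_lt_of_le ht.2 with rfl | ht1
    · have := hinj (i + 1) (j + 1) 0 (by simp) 0 (by simp) (by simpa using he)
      exact hij (add_right_cancel this)
    · exact hj (hinj (i + 1) j 0 (by simp) t ⟨ht.1, ht1⟩ (by simpa using he)).symm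
    · exact hi (hinj i (j + 1) s ⟨hs.1, hs1⟩ 0 (by simp) (by simpa using he))
    · exact hij (hinj i j s ⟨hs.1, hs1⟩ t ⟨ht.1, ht1⟩ he)

/-- A common point of consecutive half-open edges with parameters `s` and `t` gives a vanishing
combination with weights `1 - s` and `t`. Their sum is positive, and dividing by it contradicts
`Good`. -/
theorem Good.simple {n : ℕ} {p : Fin (n + 3) → Space} (h : Good p) : Simple p := by
  have hne : ∀ i, p i ≠ p (i + 1) := fun i he => by
    have := h.1 i 0 (by simp)
    simp [he] at this
  have adj : ∀ i, ∀ s ∈ Ico (0 : ℝ) 1, ∀ t ∈ Ico (0 : ℝ) 1,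
      (1 - s) • p i + s • p (i + 1) ≠ (1 - t) • p (i + 1) + t • p (i + 1 + 1) := by
    intro i s hs t ht he
    have hM : 0 < 1 - s + t := by linarith [hs.2, ht.1]
    refine h.1 i (t / (1 - s + t)) ⟨div_nonneg ht.1 hM.le, ?_⟩ ?_
    · rw [div_le_one hM]; linarith [hs.2]
    · have e : 1 - t / (1 - s + t) = (1 - s + t)⁻¹ * (1 - s) := by field_simp; ring
      have e' : t / (1 - s + t) = (1 - s + t)⁻¹ * t := by field_simp
      rw [e, e', ← smul_smul, ← smul_smul, ← smul_add]
      have : (1 - s) • (p i - p (i + 1)) + t • (p (i + 1) - p (i + 1 + 1)) = 0 := by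
        rw [← sub_eq_zero] at he
        rw [← he]; module
      rw [this, smul_zero]
  rintro ⟨i, s, hs⟩ ⟨j, t, ht⟩ he
  have he' := he
  simp only [AffineMap.lineMap_apply_module] at he
  by_cases hij : i = j
  · subst hij
    have := AffineMap.lineMap_injective ℝ (hne i) he'
    subst this; rfl
  · exfalso
    by_cases hj : j = i + 1
    · subst hj; exact adj i s hs t ht he
    by_cases hi : i = j + 1
    · subst hi; exact adj j t ht s hs he.symm
    exact disjoint_left.1 (h.2 i j hij hj hi) (mem_segment'.2 ⟨s, ⟨hs.1, hs.2.le⟩, rfl⟩)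
      (mem_segment'.2 ⟨t, ⟨ht.1, ht.2.le⟩, he⟩)

theorem Good.eventually {n : ℕ} {p : Fin (n + 3) → Space} (h : Good p) : ∀ᶠ q in 𝓝 p, Good q := by
  have h1 : ∀ᶠ q in 𝓝 p, ∀ i, ∀ s ∈ Icc (0 : ℝ) 1,
      (1 - s) • (q i - q (i + 1)) + s • (q (i + 1) - q (i + 1 + 1)) ≠ 0 := by
    rw [eventually_all]
    intro i
    refine isCompact_Icc.eventually_forall_of_forall_eventually fun s hs => ?_
    refine ((Continuous.continuousAt ?_).ne_iff_eventually_ne continuousAt_const).1 (h.1 i s hs)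
    fun_prop
  have h2 : ∀ᶠ q in 𝓝 p, ∀ i j, i ≠ j → j ≠ i + 1 → i ≠ j + 1 →
      Disjoint (segment ℝ (q i) (q (i + 1))) (segment ℝ (q j) (q (j + 1))) := by
    rw [eventually_all]
    intro i
    rw [eventually_all]
    intro j
    by_cases hij : i ≠ j ∧ j ≠ i + 1 ∧ i ≠ j + 1
    -- The repeated vertex makes the triangle of `eventually_disjoint` the edge itself.
    · have hc : Tendsto (fun q : Fin (n + 3) → Space => (q i, q i, q (i + 1), q j, q (j + 1))) (𝓝 p)
          (𝓝 (p i, p i, p (i + 1), p j, p (j + 1))) := by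
        apply Continuous.tendsto; fun_prop
      filter_upwards [hc.eventually (eventually_disjoint (h.2 i j hij.1 hij.2.1 hij.2.2))] with q hq _ _ _
      refine hq.mono_left ?_
      simp only [mem_singleton_iff, insert_eq_of_mem, mem_insert_iff, true_or, convexHull_pair]
      exact Subset.rfl
    · filter_upwards with q a b c
      exact absurd ⟨a, b, c⟩ hij
  filter_upwards [h1, h2] with q a b using ⟨a, b⟩

/-- Three points lie in a plane: two difference vectors cannot span a space of dimension three. -/
theorem exists_dual_const (x y z : Space) :
    ∃ φ : Space →ₗ[ℝ] ℝ, φ ≠ 0 ∧ φ x = φ y ∧ φ y = φ z := by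
  have hlt : Submodule.span ℝ {x - y, z - y} < ⊤ := by
    rw [lt_top_iff_ne_top]
    intro htop
    classical
    have h1 := finrank_span_finset_le_card (R := ℝ) ({x - y, z - y} : Finset Space)
    rw [show ((({x - y, z - y} : Finset Space)) : Set Space) = {x - y, z - y} by simp, Set.finrank, htop,
      finrank_top] at h1
    have h2 : ({x - y, z - y} : Finset Space).card ≤ 2 := Finset.card_le_two
    simp at h1
    omega
  obtain ⟨φ, h0, hle⟩ := Submodule.exists_le_ker_of_lt_top _ hlt
  have hx := hle (Submodule.subset_span (show x - y ∈ ({x - y, z - y} : Set Space) by simp))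
  have hz := hle (Submodule.subset_span (show z - y ∈ ({x - y, z - y} : Set Space) by simp))
  rw [LinearMap.mem_ker, map_sub, sub_eq_zero] at hx hz
  exact ⟨φ, h0, hx, hz.symm⟩

theorem affineIndependent_of_dual {u v w : Space} (huv : u ≠ v) (φ : Space →ₗ[ℝ] ℝ)
    (h : φ u = φ v) (hw : φ w ≠ φ u) : AffineIndependent ℝ ![u, v, w] := by
  refine affineIndependent_of_ne_of_mem_of_mem_of_notMem (s := affineSpan ℝ {u, v}) huv
    (left_mem_affineSpan_pair ℝ _ _) (right_mem_affineSpan_pair ℝ _ _) ?_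
  intro hmem
  obtain ⟨t, rfl⟩ := (mem_affineSpan_pair_iff_exists_lineMap_eq).1 hmem
  apply hw
  rw [AffineMap.lineMap_apply_module, map_add, map_smul, map_smul, h, ← add_smul, sub_add_cancel,
    one_smul]

/-- Moving one vertex of a polygon off the plane of the two adjacent edges. -/
theorem becomes_move_vertex {K : Knot} {R : Set Space} {r u v w : Space}
    (hK : K.carrier = R ∪ segment ℝ r u ∪ segment ℝ u v)
    (hru : r ≠ u) (huv : u ≠ v) (hi : segment ℝ r u ∩ segment ℝ u v ⊆ {u})
    (φ : Space →ₗ[ℝ] ℝ) (h1 : φ r = φ u) (h2 : φ u = φ v) (hw : φ w ≠ φ u)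
    (hR1 : R ∩ convexHull ℝ {u, w, v} ⊆ {v}) (hR2 : R ∩ convexHull ℝ {u, w, r} ⊆ {r}) :
    K.Becomes (R ∪ segment ℝ r w ∪ segment ℝ w v) := by
  -- Two triangle moves: `[u, v]` takes the detour through `w`, then the vertex `u` between `r` and
  -- `w` is removed. Since `r, u, v` lie in a level plane of `φ` and `w` does not, comparing values
  -- of `φ` shows that the triangles do not hit the other moved edges.
  have a1 := Knot.becomes_add_vertex (R := R ∪ segment ℝ r u) hK
    (affineIndependent_of_dual huv φ h2 hw) (by
      rintro x ⟨hx | hx, hx'⟩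
      · right; rw [triangle_swap'] at hx'; exact hR1 ⟨hx, hx'⟩
      · left
        obtain ⟨α, β, γ, hα, hβ, hγ, hs, rfl⟩ := mem_convexHull₃.1 hx'
        obtain ⟨s, hs', he⟩ := mem_segment'.1 hx
        have h3 := congrArg φ he
        simp only [map_add, map_smul, smul_eq_mul, ← h2, h1] at h3
        have h4 : γ * (φ w - φ u) = 0 := by
          have : α = 1 - β - γ := by linarith
          subst this; linarith
        have h5 : γ = 0 := by
          rcases mul_eq_zero.1 h4 with h | h
          · exact h
          · exact absurd (sub_eq_zero.1 h) hw
        subst h5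
        refine hi ⟨hx, mem_segment'.2 ⟨β, ⟨hβ, by linarith⟩, ?_⟩⟩
        rw [zero_smul, add_zero]
        congr 2; linarith)
  refine a1.trans fun K' hK' => ?_
  have hr_notMem : r ∉ segment ℝ u v := fun h => hru (hi ⟨left_mem_segment ℝ _ _, h⟩)
  have hv_notMem : v ∉ segment ℝ r u := fun h => huv (hi ⟨h, right_mem_segment ℝ _ _⟩).symm
  have hind : AffineIndependent ℝ ![r, w, u] := by
    have := affineIndependent_of_dual (w := w) hru φ h1 (by rw [h1]; exact hw)
    have := this.comp_embedding (Equiv.swap (1 : Fin 3) 2).toEmbedding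
    convert this using 1
    ext i j; fin_cases i <;> rfl
  have a2 := Knot.becomes_remove_vertex (K := K') (R := R ∪ segment ℝ w v) (a := r) (b := w) (c := u)
    (by rw [hK', union_assoc, union_assoc]; congr 1
        rw [← union_assoc, union_comm]) hind (by
      rintro x ⟨hx | hx, hx'⟩
      · left
        refine hR2 ⟨hx, ?_⟩
        rwa [show ({u, w, r} : Set Space) = {r, w, u} by
          ext; simp only [mem_insert_iff, mem_singleton_iff]; tauto]
      · right
        obtain ⟨α, β, γ, hα, hβ, hγ, hs, rfl⟩ := mem_convexHull₃.1 hx'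
        obtain ⟨s, hs', he⟩ := mem_segment'.1 hx
        have h3 := congrArg φ he
        simp only [map_add, map_smul, smul_eq_mul, ← h2, h1] at h3
        have h4 : (β - (1 - s)) * (φ w - φ u) = 0 := by
          have : α = 1 - β - γ := by linarith
          subst this; linarith
        have h5 : β = 1 - s := by
          rcases mul_eq_zero.1 h4 with h | h
          · linarith
          · exact absurd (sub_eq_zero.1 h) hw
        subst h5
        have he2 : α • r + γ • u = s • v := by
          rw [← sub_eq_zero] at he ⊢
          rw [← he]; module
        rcases eq_or_lt_of_le hs'.1 with h0 | h0
        · subst h0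
          obtain rfl : α = 0 := by linarith
          obtain rfl : γ = 0 := by linarith
          simp
        · exfalso
          apply hv_notMem
          refine mem_segment'.2 ⟨γ / s, ⟨by positivity, ?_⟩, ?_⟩
          · rw [div_le_one h0]; linarith
          · have : v = s⁻¹ • (s • v) := by rw [smul_smul, inv_mul_cancel₀ h0.ne', one_smul]
            rw [this, ← he2, smul_add, smul_smul, smul_smul]
            congr 2
            · have : α = s - γ := by linarith
              subst this; field_simp
            · field_simp)
  obtain ⟨K'', hK'', he⟩ := a2
  refine ⟨K'', ?_, he⟩
  rw [hK'', union_assoc, union_assoc, union_comm (segment ℝ w v)]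

/-- Some vector `e` is killed by neither functional. Along `u + η • e` only one value of `η` is
forbidden for each of them. -/
theorem exists_smul_avoid {φ ψ : Space →ₗ[ℝ] ℝ} (hφ : φ ≠ 0) (hψ : ψ ≠ 0) (u : Space) (c d : ℝ)
    {U : Set Space} (hU : U ∈ 𝓝 u) : ∃ r ∈ U, φ r ≠ c ∧ ψ r ≠ d := by
  obtain ⟨e, he1, he2⟩ : ∃ e, φ e ≠ 0 ∧ ψ e ≠ 0 := by
    obtain ⟨e1, h1⟩ := DFunLike.ne_iff.1 hφ
    obtain ⟨e2, h2⟩ := DFunLike.ne_iff.1 hψ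
    simp only [LinearMap.zero_apply] at h1 h2
    by_cases h3 : ψ e1 = 0
    · by_cases h4 : φ e2 = 0
      · exact ⟨e1 + e2, by simpa [h4] using h1, by simpa [h3] using h2⟩
      · exact ⟨e2, h4, h2⟩
    · exact ⟨e1, h1, h3⟩
  have hc : Tendsto (fun η : ℝ => u + η • e) (𝓝[>] 0) (𝓝 u) := by
    have : Continuous (fun η : ℝ => u + η • e) := by fun_prop
    have := this.tendsto 0
    simp only [zero_smul, add_zero] at this
    exact this.mono_left nhdsWithin_le_nhds
  have hne : ∀ x : ℝ, ∀ᶠ η : ℝ in 𝓝[>] 0, η ≠ x := by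
    intro x
    rcases le_or_gt x 0 with hx | hx
    · filter_upwards [self_mem_nhdsWithin] with η hη
      exact (lt_of_le_of_lt hx hη).ne'
    · filter_upwards [Ioo_mem_nhdsGT hx] with η hη using hη.2.ne
  obtain ⟨η, h1, h2, h3⟩ := (hc.eventually hU |>.and
    ((hne ((c - φ u) / φ e)).and (hne ((d - ψ u) / ψ e)))).exists
  refine ⟨_, h1, fun h => h2 ?_, fun h => h3 ?_⟩
  · rw [eq_div_iff he1, ← h]; simp
  · rw [eq_div_iff he2, ← h]; simp

end KnotMosaic

/-! ### Invariance of the knot type along paths of simple polygons -/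

namespace KnotMosaic

open Set Filter Topology

theorem polygon_eq_union {n : ℕ} (p : Fin (n + 3) → Space) (k : Fin (n + 3)) :
    polygon p = (⋃ j : {j : Fin (n + 3) // j ≠ k ∧ j ≠ k + 1}, segment ℝ (p j) (p (j + 1))) ∪
      segment ℝ (p k) (p (k + 1)) ∪ segment ℝ (p (k + 1)) (p (k + 1 + 1)) := by
  ext x
  simp only [polygon, mem_iUnion, mem_union, Subtype.exists, exists_prop]
  constructor
  · rintro ⟨j, hj⟩
    by_cases h1 : j = k
    · subst h1; exact Or.inl (Or.inr hj)
    by_cases h2 : j = k + 1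
    · subst h2; exact Or.inr hj
    exact Or.inl (Or.inl ⟨j, ⟨h1, h2⟩, hj⟩)
  · rintro ((⟨j, -, hj⟩ | h) | h)
    · exact ⟨j, hj⟩
    · exact ⟨_, h⟩
    · exact ⟨_, h⟩

theorem Good.adjacent {n : ℕ} {p : Fin (n + 3) → Space} (h : Good p) (i : Fin (n + 3)) :
    segment ℝ (p i) (p (i + 1)) ∩ segment ℝ (p (i + 1)) (p (i + 1 + 1)) ⊆ {p (i + 1)} := by
  have hs := h.simple
  rintro x ⟨hx, hx'⟩
  obtain ⟨s, hs1, e1⟩ := mem_segment_iff_lineMap.1 hx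
  obtain ⟨t, ht1, e2⟩ := mem_segment_iff_lineMap.1 hx'
  rcases eq_or_lt_of_le hs1.2 with rfl | hs2
  · rw [← e1]; simp
  rcases eq_or_lt_of_le ht1.2 with rfl | ht2
  · exfalso
    have e3 : (AffineMap.lineMap (p i) (p (i + 1)) s : Space) =
        AffineMap.lineMap (p (i + 1 + 1)) (p (i + 1 + 1 + 1)) (0 : ℝ) := by
      rw [e1, ← e2]; simp
    have := @hs ⟨i, s, hs1.1, hs2⟩ ⟨i + 1 + 1, 0, by simp⟩ e3
    simp only [Prod.mk.injEq] at this
    exact succ_succ_ne_self i this.1.symm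
  · exfalso
    have := @hs ⟨i, s, hs1.1, hs2⟩ ⟨i + 1, t, ht1.1, ht2⟩ (e1.trans e2.symm)
    simp only [Prod.mk.injEq] at this
    exact succ_ne_self i this.1.symm

theorem polygon_update {n : ℕ} (p : Fin (n + 3) → Space) (k : Fin (n + 3)) (w : Space) :
    polygon (Function.update p (k + 1) w) =
      (⋃ j : {j : Fin (n + 3) // j ≠ k ∧ j ≠ k + 1}, segment ℝ (p j) (p (j + 1))) ∪
      segment ℝ (p k) w ∪ segment ℝ w (p (k + 1 + 1)) := by
  rw [polygon_eq_union _ k]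
  congr 1
  · congr 1
    · refine iUnion_congr fun j => ?_
      rw [Function.update_of_ne j.2.2, Function.update_of_ne]
      intro h
      exact j.2.1 (add_right_cancel h)
    · rw [Function.update_self, Function.update_of_ne (succ_ne_self k).symm]
  · rw [Function.update_self, Function.update_of_ne (succ_ne_self (k + 1))]

/-- The triangles swept when a vertex of `p` moves a little stay away from the other edges. -/
def Clear {n : ℕ} (p : Fin (n + 3) → Space) (k : Fin (n + 3)) (w : Space) : Prop :=
  (⋃ j : {j : Fin (n + 3) // j ≠ k ∧ j ≠ k + 1}, segment ℝ (p j) (p (j + 1))) ∩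
      convexHull ℝ {p (k + 1), w, p (k + 1 + 1)} ⊆ {p (k + 1 + 1)} ∧
  (⋃ j : {j : Fin (n + 3) // j ≠ k ∧ j ≠ k + 1}, segment ℝ (p j) (p (j + 1))) ∩
      convexHull ℝ {p (k + 1), w, p k} ⊆ {p k}

/-- At the limit the swept triangles are the edges `k` and `k + 1`. The edges next to these two are
handled by `eventually_adjacent`, all others by `eventually_disjoint`. -/
theorem Good.eventually_clear {n : ℕ} {p : Fin (n + 3) → Space} (h : Good p) (k : Fin (n + 3)) :
    ∀ᶠ z : (Fin (n + 3) → Space) × Space in 𝓝 (p, p (k + 1)), Clear z.1 k z.2 := by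
  have h1 : ∀ j, j ≠ k → j ≠ k + 1 → ∀ᶠ z : (Fin (n + 3) → Space) × Space in 𝓝 (p, p (k + 1)),
      segment ℝ (z.1 j) (z.1 (j + 1)) ∩ convexHull ℝ {z.1 (k + 1), z.2, z.1 (k + 1 + 1)} ⊆
        {z.1 (k + 1 + 1)} := by
    intro j hj hj'
    by_cases hj2 : j = k + 1 + 1
    · subst hj2
      have hc : Tendsto (fun z : (Fin (n + 3) → Space) × Space =>
          (z.1 (k + 1), z.2, z.1 (k + 1 + 1), z.1 (k + 1 + 1 + 1))) (𝓝 (p, p (k + 1)))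
          (𝓝 (p (k + 1), p (k + 1), p (k + 1 + 1), p (k + 1 + 1 + 1))) := by
        refine Continuous.tendsto' ?_ _ _ rfl
        fun_prop
      filter_upwards [hc.eventually (eventually_adjacent (h.1 (k + 1)))] with z hz
      rw [inter_comm]; exact hz
    · have hc : Tendsto (fun z : (Fin (n + 3) → Space) × Space =>
          (z.1 (k + 1), z.2, z.1 (k + 1 + 1), z.1 j, z.1 (j + 1))) (𝓝 (p, p (k + 1)))
          (𝓝 (p (k + 1), p (k + 1), p (k + 1 + 1), p j, p (j + 1))) := by
        refine Continuous.tendsto' ?_ _ _ rfl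
        fun_prop
      filter_upwards [hc.eventually (eventually_disjoint (h.2 (k + 1) j hj'.symm hj2
        (fun e => hj (add_right_cancel e).symm)))] with z hz
      rw [hz.symm.inter_eq]; exact empty_subset _
  have h2 : ∀ j, j ≠ k → j ≠ k + 1 → ∀ᶠ z : (Fin (n + 3) → Space) × Space in 𝓝 (p, p (k + 1)),
      segment ℝ (z.1 j) (z.1 (j + 1)) ∩ convexHull ℝ {z.1 (k + 1), z.2, z.1 k} ⊆ {z.1 k} := by
    intro j hj hj'
    by_cases hj2 : k = j + 1
    · subst hj2
      have hc : Tendsto (fun z : (Fin (n + 3) → Space) × Space =>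
          (z.1 (j + 1 + 1), z.2, z.1 (j + 1), z.1 j)) (𝓝 (p, p (j + 1 + 1)))
          (𝓝 (p (j + 1 + 1), p (j + 1 + 1), p (j + 1), p j)) := by
        refine Continuous.tendsto' ?_ _ _ rfl
        fun_prop
      have := eventually_adjacent (u := p (j + 1 + 1)) (v := p (j + 1)) (w := p j) (by
        intro s hs he
        refine h.1 j (1 - s) ⟨by linarith [hs.2], by linarith [hs.1]⟩ ?_
        rw [← neg_eq_zero, ← he]; module)
      filter_upwards [hc.eventually this] with z hz
      rw [inter_comm, segment_symm]; exact hz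
    · have hc : Tendsto (fun z : (Fin (n + 3) → Space) × Space =>
          (z.1 (k + 1), z.2, z.1 k, z.1 j, z.1 (j + 1))) (𝓝 (p, p (k + 1)))
          (𝓝 (p (k + 1), p (k + 1), p k, p j, p (j + 1))) := by
        refine Continuous.tendsto' ?_ _ _ rfl
        fun_prop
      have := h.2 k j hj.symm hj' hj2
      rw [segment_symm] at this
      filter_upwards [hc.eventually (eventually_disjoint this)] with z hz
      rw [hz.symm.inter_eq]; exact empty_subset _
  have h1' := eventually_all.2 fun j : {j : Fin (n + 3) // j ≠ k ∧ j ≠ k + 1} => h1 j j.2.1 j.2.2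
  have h2' := eventually_all.2 fun j : {j : Fin (n + 3) // j ≠ k ∧ j ≠ k + 1} => h2 j j.2.1 j.2.2
  filter_upwards [h1', h2'] with z a b
  exact ⟨by rw [iUnion_inter]; exact iUnion_subset a, by rw [iUnion_inter]; exact iUnion_subset b⟩

theorem Knot.becomes_self (K : Knot) {S : Set Space} (h : K.carrier = S) : K.Becomes S :=
  ⟨K, h, Knot.Equivalent.refl K⟩

theorem becomes_update_of_generic {n : ℕ} {p : Fin (n + 3) → Space} (h : Good p) {k : Fin (n + 3)}
    {w : Space} (hw : Clear p k w) (φ : Space →ₗ[ℝ] ℝ) (h1 : φ (p k) = φ (p (k + 1)))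
    (h2 : φ (p (k + 1)) = φ (p (k + 1 + 1))) (hne : φ w ≠ φ (p (k + 1))) {K : Knot}
    (hK : K.carrier = polygon p) : K.Becomes (polygon (Function.update p (k + 1) w)) := by
  rw [polygon_update]
  exact becomes_move_vertex (hK.trans (polygon_eq_union p k)) (h.simple.ne_succ _)
    (h.simple.ne_succ _) (h.adjacent k) φ h1 h2 hne hw.1 hw.2

/-- The vertices are moved one at a time, each through an auxiliary position off the planes in which
`becomes_move_vertex` does not apply. A uniform neighbourhood of `p` keeps all intermediate polygons
simple and all swept triangles clear. -/
theorem Good.eventually_becomes {n : ℕ} {p : Fin (n + 3) → Space} (h : Good p) :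
    ∀ᶠ q in 𝓝 p, Good q ∧ ∀ K K' : Knot, K.carrier = polygon p → K'.carrier = polygon q →
      Knot.Equivalent K K' := by
  have hcl : ∀ᶠ z : (Fin (n + 3) → Space) × (Fin (n + 3) → Space) in 𝓝 (p, p),
      Good z.1 ∧ ∀ k, Clear z.1 k (z.2 (k + 1)) := by
    refine Eventually.and ?_ (eventually_all.2 fun k => ?_)
    · exact (continuous_fst.tendsto (p, p)).eventually h.eventually
    · have hc : Tendsto (fun z : (Fin (n + 3) → Space) × (Fin (n + 3) → Space) => (z.1, z.2 (k + 1)))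
          (𝓝 (p, p)) (𝓝 (p, p (k + 1))) := by
        refine Continuous.tendsto' ?_ _ _ rfl
        fun_prop
      exact hc.eventually (h.eventually_clear k)
  rw [nhds_prod_eq, Filter.Eventually, Filter.mem_prod_self_iff] at hcl
  obtain ⟨U, hU, hUc'⟩ := hcl
  have hUc : ∀ x ∈ U, ∀ y ∈ U, Good x ∧ ∀ k, Clear x k (y (k + 1)) := fun x hx y hy =>
    hUc' (mk_mem_prod hx hy)
  -- A ball of the supremum distance is a product of balls, so vertices may be changed independently
  -- without leaving `U`.
  obtain ⟨ε, hε, hball⟩ := Metric.mem_nhds_iff.1 hU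
  have hmem : ∀ q : Fin (n + 3) → Space, (∀ i, dist (q i) (p i) < ε) → q ∈ U := fun q hq =>
    hball (by rw [Metric.mem_ball, dist_pi_lt_iff hε]; exact hq)
  have hupd : ∀ q : Fin (n + 3) → Space, (∀ i, dist (q i) (p i) < ε) → ∀ k w, dist w (p k) < ε →
      ∀ i, dist (Function.update q k w i) (p i) < ε := by
    intro q hq k w hw i
    by_cases hik : i = k
    · subst hik; rwa [Function.update_self]
    · rw [Function.update_of_ne hik]; exact hq i
  -- one vertex
  have one : ∀ q : Fin (n + 3) → Space, (∀ i, dist (q i) (p i) < ε) → ∀ k w, dist w (p (k + 1)) < ε →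
      ∀ K : Knot, K.carrier = polygon q → K.Becomes (polygon (Function.update q (k + 1) w)) := by
    intro q hq k w hw K hK
    set q' := Function.update q (k + 1) w with hq'
    have hq'U := hupd q hq (k + 1) w hw
    -- The moved vertex and its neighbours span a plane before and after the move. The point `r`
    -- avoids both planes, so `q` and `q'` both deform to the polygon through `r`.
    obtain ⟨φ, φ0, φ1, φ2⟩ := exists_dual_const (q k) (q (k + 1)) (q (k + 1 + 1))
    obtain ⟨ψ, ψ0, ψ1, ψ2⟩ := exists_dual_const (q' k) (q' (k + 1)) (q' (k + 1 + 1))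
    obtain ⟨r, hr, hr1, hr2⟩ := exists_smul_avoid φ0 ψ0 (p (k + 1)) (φ (q (k + 1))) (ψ (q' (k + 1)))
      (Metric.ball_mem_nhds _ hε)
    rw [Metric.mem_ball] at hr
    have hrU := hupd q hq (k + 1) r hr
    have c1 := (hUc _ (hmem _ hq) _ (hmem _ hrU)).2 k
    have c2 := (hUc _ (hmem _ hq'U) _ (hmem _ hrU)).2 k
    rw [Function.update_self] at c1 c2
    have g1 := (hUc _ (hmem _ hq) _ (hmem _ hq)).1
    have g2 := (hUc _ (hmem _ hq'U) _ (hmem _ hq)).1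
    obtain ⟨K1, hK1, he1⟩ := becomes_update_of_generic g1 c1 φ φ1 φ2 hr1 hK
    obtain ⟨K2, hK2, he2⟩ := becomes_update_of_generic g2 c2 ψ ψ1 ψ2 hr2
      (K := ⟨polygon q', ⟨n, q', g2.simple, rfl⟩⟩) rfl
    have : Function.update q' (k + 1) r = Function.update q (k + 1) r := by
      rw [hq', Function.update_idem]
    rw [this] at hK2
    obtain rfl : K1 = K2 := Knot.ext' (hK1.trans hK2.symm)
    exact ⟨_, rfl, he1.trans he2.symm⟩
  filter_upwards [h.eventually, Metric.ball_mem_nhds p hε] with q hqg hq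
  rw [Metric.mem_ball, dist_pi_lt_iff hε] at hq
  refine ⟨hqg, ?_⟩
  classical
  -- The set `s` consists of the vertices already moved to their new position.
  have all : ∀ s : Finset (Fin (n + 3)), ∀ K : Knot, K.carrier = polygon p →
      K.Becomes (polygon (s.piecewise q p)) := by
    intro s
    induction s using Finset.induction_on with
    | empty => intro K hK; rw [Finset.piecewise_empty]; exact K.becomes_self hK
    | insert k s hk ih =>
      intro K hK
      refine (ih K hK).trans fun K' hK' => ?_
      rw [Finset.piecewise_insert]
      obtain ⟨l, rfl⟩ : ∃ l, k = l + 1 := ⟨k - 1, by simp⟩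
      refine one _ (fun i => ?_) l _ (hq _) K' hK'
      by_cases hi : i ∈ s
      · rw [Finset.piecewise_eq_of_mem _ _ _ hi]; exact hq i
      · rw [Finset.piecewise_eq_of_notMem _ _ _ hi]; simpa using hε
  intro K K' hK hK'
  obtain ⟨K'', hK'', he⟩ := all Finset.univ K hK
  rw [Finset.piecewise_univ] at hK''
  obtain rfl : K'' = K' := Knot.ext' (hK''.trans hK'.symm)
  exact he

/-- Polygons joined by a path of simple polygons are equivalent. -/
theorem equivalent_of_path {n : ℕ} (F : ℝ → Fin (n + 3) → Space) (hF : ContinuousOn F (Icc 0 1))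
    (hs : ∀ t ∈ Icc (0 : ℝ) 1, Simple (F t)) {K K' : Knot} (hK : K.carrier = polygon (F 0))
    (hK' : K'.carrier = polygon (F 1)) : Knot.Equivalent K K' := by
  -- The relation "the polygons at times `x` and `y` are equivalent" is transitive and holds both
  -- ways for nearby times. Connectedness of the interval does the rest.
  have := isPreconnected_Icc.induction₂' (s := Icc (0 : ℝ) 1)
    (fun x y => ∀ K K' : Knot, K.carrier = polygon (F x) → K'.carrier = polygon (F y) →
      Knot.Equivalent K K') (fun x hx => ?_) (fun x y z hx hy hz hxy hyz K K' hK hK' => ?_)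
    (left_mem_Icc.2 zero_le_one) (right_mem_Icc.2 zero_le_one)
  · exact this K K' hK hK'
  · filter_upwards [(hF x hx).eventually (hs x hx).good.eventually_becomes] with y hy
    exact ⟨hy.2, fun K K' hK hK' => (hy.2 K' K hK' hK).symm⟩
  · exact (hxy K ⟨polygon (F y), n, F y, hs y hy, rfl⟩ hK rfl).trans (hyz _ K' rfl hK')

/-- An isotopy of a knot, affine on the edges of a subdivision, gives an equivalent knot. -/
theorem Knot.becomes_of_isotopy (K : Knot) (H : ℝ → Space → Space)
    (hc : ∀ x, ContinuousOn (fun t => H t x) (Icc 0 1)) (h0 : ∀ x ∈ K.carrier, H 0 x = x)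
    (hinj : ∀ t ∈ Icc (0 : ℝ) 1, InjOn (H t) K.carrier)
    (hloop : IsLoop (fun a b => ∀ t ∈ Icc (0 : ℝ) 1, ∀ s ∈ Icc (0 : ℝ) 1,
      H t (AffineMap.lineMap a b s) = AffineMap.lineMap (H t a) (H t b) s) K.carrier) :
    K.Becomes (H 1 '' K.carrier) := by
  obtain ⟨n, p, hp, hS, haff⟩ := hloop.exists_simple
  have himg : ∀ t ∈ Icc (0 : ℝ) 1, H t '' K.carrier = polygon (fun i => H t (p i)) := by
    intro t ht
    rw [hS, polygon, image_iUnion]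
    refine iUnion_congr fun i => ?_
    ext x
    simp only [mem_image, mem_segment_iff_lineMap]
    constructor
    · rintro ⟨_, ⟨s, hs, rfl⟩, rfl⟩
      exact ⟨s, hs, (haff i t ht s hs).symm⟩
    · rintro ⟨s, hs, rfl⟩
      exact ⟨_, ⟨s, hs, rfl⟩, haff i t ht s hs⟩
  have hsimple : ∀ t ∈ Icc (0 : ℝ) 1, Simple (fun i => H t (p i)) := by
    rintro t ht ⟨i, s, hs⟩ ⟨j, r, hr⟩ he
    simp only at he
    rw [← haff i t ht s ⟨hs.1, hs.2.le⟩, ← haff j t ht r ⟨hr.1, hr.2.le⟩] at he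
    have hm : ∀ i, ∀ s ∈ Ico (0 : ℝ) 1, (AffineMap.lineMap (p i) (p (i + 1)) s : Space) ∈ K.carrier := by
      intro i s hs
      rw [hS]
      exact mem_iUnion.2 ⟨i, mem_segment_iff_lineMap.2 ⟨s, ⟨hs.1, hs.2.le⟩, rfl⟩⟩
    exact hp (hinj t ht (hm i s hs) (hm j r hr) he)
  have m0 : (0 : ℝ) ∈ Icc (0 : ℝ) 1 := by simp
  have m1 : (1 : ℝ) ∈ Icc (0 : ℝ) 1 := by simp
  refine ⟨⟨H 1 '' K.carrier, n, fun i => H 1 (p i), hsimple 1 m1, himg 1 m1⟩, rfl, ?_⟩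
  refine equivalent_of_path (fun t i => H t (p i)) (continuousOn_pi.2 fun i => hc (p i)) hsimple ?_
    (himg 1 m1)
  rw [← himg 0 m0]
  ext x; constructor
  · exact fun hx => ⟨x, hx, h0 x hx⟩
  · rintro ⟨y, hy, rfl⟩; rwa [h0 y hy]

end KnotMosaic

namespace KnotMosaic

open Set Filter Topology

/-! ### Affine and piecewise affine maps -/

theorem apply_combo (g : Space →ᵃ[ℝ] ℝ) (a b : Space) (s : ℝ) :
    g ((1 - s) • a + s • b) = (1 - s) * g a + s * g b := by
  rw [← AffineMap.lineMap_apply_module, AffineMap.apply_lineMap, AffineMap.lineMap_apply_module]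
  rfl

theorem apply_lineMap' (g : Space →ᵃ[ℝ] ℝ) (a b : Space) (s : ℝ) :
    g (AffineMap.lineMap a b s) = (1 - s) * g a + s * g b := by
  rw [AffineMap.lineMap_apply_module, apply_combo]

theorem sign_left {g : Space →ᵃ[ℝ] ℝ} {a b x : Space} (hx : x ∈ segment ℝ a b)
    (h : 0 ≤ g a * g b) : 0 ≤ g a * g x ∧ 0 ≤ g x * g b := by
  obtain ⟨s, hs, rfl⟩ := mem_segment'.1 hx
  rw [apply_combo]
  have h1 := mul_nonneg (sub_nonneg.2 hs.2) (mul_self_nonneg (g a))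
  have h2 := mul_nonneg hs.1 h
  have h3 := mul_nonneg (sub_nonneg.2 hs.2) h
  have h4 := mul_nonneg hs.1 (mul_self_nonneg (g b))
  constructor <;> linarith

/-- An edge on which `g` changes sign is cut at the zero of `g`, which lies at the parameter `g a /
(g a - g b)`. -/
theorem arc_sign {P : Space → Space → Prop}
    (hP : ∀ a b x, x ∈ segment ℝ a b → P a b → P a x ∧ P x b) (g : Space →ᵃ[ℝ] ℝ) {a b : Space}
    (hab : a ≠ b) (h : P a b) :
    Arc (fun a b => P a b ∧ 0 ≤ g a * g b) (segment ℝ a b) a b := by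
  by_cases hs : 0 ≤ g a * g b
  · exact Arc.single hab ⟨h, hs⟩
  have hs' : g a * g b < 0 := not_le.1 hs
  have hd : g a - g b ≠ 0 := by
    intro h0
    rw [sub_eq_zero] at h0
    rw [h0] at hs'
    exact absurd (mul_self_nonneg (g b)) (not_le.2 hs')
  set θ := g a / (g a - g b) with hθ
  have hθ0 : θ ∈ Icc (0 : ℝ) 1 := by
    rw [hθ]
    rcases lt_trichotomy (g a) 0 with h0 | h0 | h0
    · have hb : 0 < g b := by by_contra hb; exact hs (mul_nonneg_of_nonpos_of_nonpos h0.le (not_lt.1 hb))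
      refine ⟨div_nonneg_of_nonpos h0.le (by linarith), ?_⟩
      rw [div_le_one_of_neg (by linarith)]; linarith
    · rw [h0] at hs'; simp at hs'
    · have hb : g b < 0 := by by_contra hb; exact hs (mul_nonneg h0.le (not_lt.1 hb))
      refine ⟨div_nonneg h0.le (by linarith), ?_⟩
      rw [div_le_one (by linarith)]; linarith
  set x : Space := (1 - θ) • a + θ • b with hx
  have hxm : x ∈ segment ℝ a b := mem_segment'.2 ⟨θ, hθ0, rfl⟩
  have hgx : g x = 0 := by
    rw [hx, apply_combo, hθ]; field_simp; ring
  have hga : g a ≠ 0 := by intro h0; rw [h0] at hs'; simp at hs'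
  have hgb : g b ≠ 0 := by intro h0; rw [h0] at hs'; simp at hs'
  have hxa : x ≠ a := fun h => hga (h ▸ hgx)
  have hxb : x ≠ b := fun h => hgb (h ▸ hgx)
  rw [segment_eq_union hxm]
  refine Arc.cons hxa.symm ⟨(hP _ _ _ hxm h).1, by simp [hgx]⟩
    (Arc.single hxb ⟨(hP _ _ _ hxm h).2, by simp [hgx]⟩) (segment_inter_of_mem hxm)

/-- A knot has a subdivision on whose edges given affine functions do not change sign. -/
theorem Knot.isLoop_sign (K : Knot) (l : List (Space →ᵃ[ℝ] ℝ)) :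
    IsLoop (fun a b => segment ℝ a b ⊆ K.carrier ∧ ∀ g ∈ l, 0 ≤ g a * g b) K.carrier := by
  induction l with
  | nil => exact K.isLoop.mono_subset.mono fun a b h => ⟨h.2, by simp⟩
  | cons g l ih =>
    refine (ih.refine (fun a b hab h => arc_sign ?_ g hab h)).mono ?_
    · rintro a b x hx ⟨h1, h2⟩
      exact ⟨⟨(segment_subset_left hx).trans h1, fun g hg => (sign_left hx (h2 g hg)).1⟩,
        ⟨(segment_subset_right hx).trans h1, fun g hg => (sign_left hx (h2 g hg)).2⟩⟩
    · rintro a b ⟨⟨h1, h2⟩, h3⟩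
      refine ⟨h1, fun g' hg' => ?_⟩
      rcases List.mem_cons.1 hg' with rfl | h
      · exact h3
      · exact h2 g' h

theorem nonneg_or_nonpos {x y : ℝ} (h : 0 ≤ x * y) : (0 ≤ x ∧ 0 ≤ y) ∨ (x ≤ 0 ∧ y ≤ 0) := by
  rcases mul_nonneg_iff.1 h with h | h
  · exact Or.inl h
  · exact Or.inr h

/-- An isotopy which is affine wherever the given affine functions do not change sign. -/
theorem Knot.becomes_of_piecewise (K : Knot) (H : ℝ → Space → Space) (l : List (Space →ᵃ[ℝ] ℝ))
    (hc : ∀ x, ContinuousOn (fun t => H t x) (Icc 0 1)) (h0 : ∀ x ∈ K.carrier, H 0 x = x)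
    (hinj : ∀ t ∈ Icc (0 : ℝ) 1, InjOn (H t) K.carrier)
    (haff : ∀ a b, segment ℝ a b ⊆ K.carrier → (∀ g ∈ l, 0 ≤ g a * g b) →
      ∀ t ∈ Icc (0 : ℝ) 1, ∀ s ∈ Icc (0 : ℝ) 1,
      H t (AffineMap.lineMap a b s) = AffineMap.lineMap (H t a) (H t b) s) :
    K.Becomes (H 1 '' K.carrier) :=
  K.becomes_of_isotopy H hc h0 hinj ((K.isLoop_sign l).mono fun a b h => haff a b h.1 h.2)

theorem Arc.image {P : Space → Space → Prop} {S : Set Space} {a b : Space} (h : Arc P S a b)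
    (A : Space ≃ᵃ[ℝ] Space) : Arc' (A '' S) (A a) (A b) := by
  have hseg : ∀ a b, A '' segment ℝ a b = segment ℝ (A a) (A b) := fun a b =>
    image_segment ℝ A.toAffineMap a b
  induction h with
  | single hab h => rw [hseg]; exact Arc.single (A.injective.ne hab) trivial
  | cons hab h hS hi ih =>
    rw [image_union, hseg]
    refine Arc.cons (A.injective.ne hab) trivial ih ?_
    rw [← hseg, ← image_inter A.injective]
    exact (image_mono hi).trans (by simp)

theorem IsLoop.image {P : Space → Space → Prop} {S : Set Space} (h : IsLoop P S)
    (A : Space ≃ᵃ[ℝ] Space) : IsLoop (fun _ _ => True) (A '' S) := by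
  obtain ⟨a, b, T, hT, hP, hi, rfl⟩ := h
  have hseg : ∀ a b, A '' segment ℝ a b = segment ℝ (A a) (A b) := fun a b =>
    image_segment ℝ A.toAffineMap a b
  refine ⟨A a, A b, A '' T, hT.image A, trivial, ?_, by rw [image_union, hseg]⟩
  rw [← hseg, ← image_inter A.injective]
  exact (image_mono hi).trans (by rw [image_pair])

/-- Affine maps which preserve all knot types. -/
def GoodAff (A : Space ≃ᵃ[ℝ] Space) : Prop := ∀ K : Knot, K.Becomes (A '' K.carrier)

theorem GoodAff.trans {A B : Space ≃ᵃ[ℝ] Space} (hA : GoodAff A) (hB : GoodAff B) :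
    GoodAff (A.trans B) := by
  intro K
  refine (hA K).trans fun K' hK' => ?_
  have := hB K'
  rwa [hK', image_image] at this

theorem GoodAff.refl : GoodAff (AffineEquiv.refl ℝ Space) := fun K =>
  K.becomes_self (by simp)

theorem GoodAff.symm {A : Space ≃ᵃ[ℝ] Space} (hA : GoodAff A) : GoodAff A.symm := by
  intro K
  obtain ⟨K', hK', he⟩ := hA ⟨_, (K.isLoop.image A.symm).isSimpleClosedPolygon⟩
  refine ⟨⟨_, (K.isLoop.image A.symm).isSimpleClosedPolygon⟩, rfl, ?_⟩
  have : K'.carrier = K.carrier := by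
    rw [hK', image_image]; simp
  obtain rfl : K' = K := Knot.ext' this
  exact he.symm

/-- The straight homotopy from the identity to `A` is affine at every time; when it stays injective
it is an isotopy of every knot. -/
theorem goodAff_of_path {A : Space ≃ᵃ[ℝ] Space}
    (h : ∀ t ∈ Icc (0 : ℝ) 1, Function.Injective fun x => (1 - t) • x + t • A x) : GoodAff A := by
  intro K
  have := K.becomes_of_isotopy (fun t x => (1 - t) • x + t • A x) (fun x => ?_) (by simp)
    (fun t ht => (h t ht).injOn) (K.isLoop.mono fun a b _ t ht s hs => ?_)
  · simpa using this
  · apply Continuous.continuousOn; fun_prop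
  · rw [show A (AffineMap.lineMap a b s) = AffineMap.lineMap (A a) (A b) s from
      AffineMap.apply_lineMap A.toAffineMap a b s]
    simp only [AffineMap.lineMap_apply_module]
    module

/-- The map `x ↦ x + ℓ x • w`. -/
noncomputable def shear (ℓ : Space →ᵃ[ℝ] ℝ) (w : Space) (h : -1 < ℓ.linear w) :
    Space ≃ᵃ[ℝ] Space where
  toFun x := x + ℓ x • w
  -- The map multiplies `ℓ` by `1 + ℓ.linear w`, which is positive by hypothesis.
  invFun x := x - (ℓ x / (1 + ℓ.linear w)) • w
  left_inv x := by
    have h1 : (1 : ℝ) + ℓ.linear w ≠ 0 := by linarith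
    have : ℓ (x + ℓ x • w) = ℓ x + ℓ x * ℓ.linear w := by
      have := ℓ.map_vadd x (ℓ x • w)
      simp only [vadd_eq_add, map_smul, smul_eq_mul] at this
      rw [add_comm x, this, add_comm]
    change (x + ℓ x • w) - (ℓ (x + ℓ x • w) / (1 + ℓ.linear w)) • w = x
    rw [this, show (ℓ x + ℓ x * ℓ.linear w) / (1 + ℓ.linear w) = ℓ x by field_simp]
    simp
  right_inv x := by
    have h1 : (1 : ℝ) + ℓ.linear w ≠ 0 := by linarith
    have : ℓ (x - (ℓ x / (1 + ℓ.linear w)) • w) = ℓ x - (ℓ x / (1 + ℓ.linear w)) * ℓ.linear w := by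
      have := ℓ.map_vadd x (-(ℓ x / (1 + ℓ.linear w)) • w)
      simp only [vadd_eq_add, map_smul, smul_eq_mul] at this
      rw [sub_eq_neg_add, ← neg_smul, this]; ring
    change (x - (ℓ x / (1 + ℓ.linear w)) • w) + ℓ (x - (ℓ x / (1 + ℓ.linear w)) • w) • w = x
    rw [this, show ℓ x - (ℓ x / (1 + ℓ.linear w)) * ℓ.linear w = ℓ x / (1 + ℓ.linear w) by
      field_simp; ring]
    simp
  linear := LinearEquiv.ofLinearMap (LinearMap.id + ℓ.linear.smulRight w)
      (LinearMap.id - (1 / (1 + ℓ.linear w)) • ℓ.linear.smulRight w) (by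
        ext i
        have h1 : (1 : ℝ) + ℓ.linear w ≠ 0 := by linarith
        simp
        field_simp
        ring) (by
        ext i
        have h1 : (1 : ℝ) + ℓ.linear w ≠ 0 := by linarith
        simp
        field_simp
        ring)
  map_vadd' x v := by
    have := ℓ.map_vadd x v
    simp only [vadd_eq_add] at this
    simp [this, add_smul]
    abel

theorem shear_apply (ℓ : Space →ᵃ[ℝ] ℝ) (w : Space) (h : -1 < ℓ.linear w) (x : Space) :
    shear ℓ w h x = x + ℓ x • w := rfl

theorem apply_add_smul (ℓ : Space →ᵃ[ℝ] ℝ) (x w : Space) (r : ℝ) :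
    ℓ (x + r • w) = ℓ x + r * ℓ.linear w := by
  have := ℓ.map_vadd x (r • w)
  simp only [vadd_eq_add, map_smul, smul_eq_mul] at this
  rw [add_comm x, this, add_comm]

/-- At time `t` the homotopy multiplies differences of `ℓ` by `1 + t * ℓ.linear w > 0`. Points with
the same image therefore have the same value of `ℓ`, hence are equal. -/
theorem goodAff_shear (ℓ : Space →ᵃ[ℝ] ℝ) (w : Space) (h : -1 < ℓ.linear w) :
    GoodAff (shear ℓ w h) := by
  refine goodAff_of_path fun t ht x y he => ?_
  simp only [shear_apply] at he
  have he' : x + (t * ℓ x) • w = y + (t * ℓ y) • w := by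
    rw [← sub_eq_zero] at he ⊢; rw [← he]; module
  have h2 := congrArg ℓ he'
  rw [apply_add_smul, apply_add_smul] at h2
  have h3 : (ℓ x - ℓ y) * (1 + t * ℓ.linear w) = 0 := by linarith
  have h4 : 0 < 1 + t * ℓ.linear w := by
    rcases eq_or_lt_of_le ht.1 with h0 | h0
    · rw [← h0]; norm_num
    · have := mul_pos h0 (show 0 < 1 + ℓ.linear w by linarith)
      linarith [ht.2]
  have h5 : ℓ x = ℓ y := by
    rcases mul_eq_zero.1 h3 with h | h
    · linarith
    · exact absurd h h4.ne'
  rw [h5] at he'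
  exact add_right_cancel he'

theorem goodAff_homothety (c : Space) {r : ℝ} (hr : 0 < r) :
    GoodAff (AffineEquiv.homothetyUnitsMulHom c (Units.mk0 r hr.ne')) := by
  refine goodAff_of_path fun t ht x y he => ?_
  simp only [AffineEquiv.coe_homothetyUnitsMulHom_apply, Units.val_mk0, AffineMap.homothety_apply,
    vsub_eq_sub, vadd_eq_add] at he
  have h1 : (1 - t + t * r) • (x - y) = 0 := by
    rw [← sub_eq_zero] at he; rw [← he]; module
  have h2 : 0 < 1 - t + t * r := by
    rcases eq_or_lt_of_le ht.1 with h | h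
    · rw [← h]; norm_num
    · have := mul_pos h hr; linarith [ht.2]
  exact sub_eq_zero.1 ((smul_eq_zero.1 h1).resolve_left h2.ne')

theorem goodAff_const (v : Space) : GoodAff (AffineEquiv.constVAdd ℝ Space v) := by
  refine goodAff_of_path fun t ht x y he => ?_
  simp only [AffineEquiv.constVAdd_apply, vadd_eq_add] at he
  rw [← sub_eq_zero] at he ⊢
  rw [← he]; module

/-- A map of space carrying every knot to an equivalent one. -/
structure Amb (h : Space → Space) : Prop where
  injective : Function.Injective h
  becomes : ∀ K : Knot, K.Becomes (h '' K.carrier)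

theorem Amb.comp {g h : Space → Space} (hg : Amb g) (hh : Amb h) : Amb (g ∘ h) :=
  ⟨hg.injective.comp hh.injective, fun K => (hh.becomes K).trans fun K' hK' => by
    rw [image_comp, ← hK']; exact hg.becomes K'⟩

/-- `h` agrees near `x` with an affine map preserving knot types. -/
def LocAff (h : Space → Space) (x : Space) : Prop :=
  ∃ A : Space ≃ᵃ[ℝ] Space, GoodAff A ∧ ∀ᶠ y in 𝓝 x, h y = A y

section Push

variable {ι : Type} [Fintype ι] [Nonempty ι] (ℓ : ι → Space →ᵃ[ℝ] ℝ) (w : Space)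

/-- A piecewise affine bump. -/
noncomputable def bump (x : Space) : ℝ := max 0 (Finset.univ.inf' Finset.univ_nonempty fun i => ℓ i x)

theorem bump_nonneg (x : Space) : 0 ≤ bump ℓ x := le_max_left _ _

theorem bump_eq_zero {x : Space} (i : ι) (h : ℓ i x ≤ 0) : bump ℓ x = 0 :=
  max_eq_left ((Finset.inf'_le _ (Finset.mem_univ i)).trans h)

theorem bump_eq {x : Space} (i : ι) (h : 0 ≤ ℓ i x) (hi : ∀ j, ℓ i x ≤ ℓ j x) : bump ℓ x = ℓ i x := by
  have : (Finset.univ.inf' Finset.univ_nonempty fun i => ℓ i x) = ℓ i x :=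
    le_antisymm (Finset.inf'_le _ (Finset.mem_univ i)) (Finset.le_inf' _ _ fun j _ => hi j)
  rw [bump, this, max_eq_right h]

theorem exists_min (x : Space) : ∃ i, ∀ j, ℓ i x ≤ ℓ j x := by
  obtain ⟨i, -, hi⟩ := Finset.exists_min_image Finset.univ (fun i => ℓ i x) Finset.univ_nonempty
  exact ⟨i, fun j => hi j (Finset.mem_univ j)⟩

theorem bump_eq_or (x : Space) :
    (bump ℓ x = 0 ∧ ∃ i, ℓ i x ≤ 0) ∨ ∃ i, 0 < ℓ i x ∧ bump ℓ x = ℓ i x ∧ ∀ j, ℓ i x ≤ ℓ j x := by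
  obtain ⟨i, hi⟩ := exists_min ℓ x
  rcases le_or_gt (ℓ i x) 0 with h | h
  · exact Or.inl ⟨bump_eq_zero ℓ i h, i, h⟩
  · exact Or.inr ⟨i, h, bump_eq ℓ i h.le hi, hi⟩

theorem continuous_bump : Continuous (bump ℓ) := by
  unfold bump
  refine continuous_const.max ?_
  refine Continuous.finset_inf'_apply _ fun i _ => ?_
  exact (ℓ i).continuous_of_finiteDimensional

variable {w} in
-- Moving by `r • w` lowers each `ℓ i` by less than `r`, hence also the positive part of their
-- minimum. This makes pushes injective.
theorem bump_add_lt (hw : ∀ i, -1 < (ℓ i).linear w) (x : Space) {r : ℝ} (hr : 0 < r) :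
    bump ℓ x - r < bump ℓ (x + r • w) := by
  have h1 : ∀ i, ℓ i x - r < ℓ i (x + r • w) := fun i => by
    rw [apply_add_smul]; nlinarith [hw i]
  rcases bump_eq_or ℓ x with ⟨h, -⟩ | ⟨i, hi, h, hj⟩
  · rw [h]; linarith [bump_nonneg ℓ (x + r • w)]
  · rcases bump_eq_or ℓ (x + r • w) with ⟨h', j, hj'⟩ | ⟨j, -, h', -⟩
    · rw [h, h']; linarith [h1 j, hj j]
    · rw [h, h']; linarith [h1 j, hj j]

/-- As no difference `ℓ i - ℓ j` changes sign, an index minimizing `ℓ i a + ℓ i b` realizes the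
minimum at both ends, and so along the whole edge. Since `ℓ i` does not change sign either, the
positive part is affine there. -/
theorem bump_lineMap {a b : Space} (h1 : ∀ i, 0 ≤ ℓ i a * ℓ i b)
    (h2 : ∀ i j, 0 ≤ (ℓ i - ℓ j) a * (ℓ i - ℓ j) b) {s : ℝ} (hs : s ∈ Icc (0 : ℝ) 1) :
    bump ℓ (AffineMap.lineMap a b s) = (1 - s) * bump ℓ a + s * bump ℓ b := by
  obtain ⟨i, -, hi⟩ := Finset.exists_min_image Finset.univ (fun i => ℓ i a + ℓ i b)
    Finset.univ_nonempty
  have hle : ∀ j, ℓ i a ≤ ℓ j a ∧ ℓ i b ≤ ℓ j b := by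
    intro j
    have h3 := hi j (Finset.mem_univ j)
    have h4 := nonneg_or_nonpos (h2 i j)
    simp only [show ∀ x, (ℓ i - ℓ j) x = ℓ i x - ℓ j x from fun _ => rfl] at h4
    rcases h4 with h4 | h4
    · constructor <;> linarith [h4.1, h4.2]
    · constructor <;> linarith [h4.1, h4.2]
  have hs' : 0 ≤ 1 - s := by linarith [hs.2]
  have hle' : ∀ j, ℓ i (AffineMap.lineMap a b s) ≤ ℓ j (AffineMap.lineMap a b s) := by
    intro j
    rw [apply_lineMap', apply_lineMap']
    exact add_le_add (mul_le_mul_of_nonneg_left (hle j).1 hs') (mul_le_mul_of_nonneg_left (hle j).2 hs.1)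
  rcases nonneg_or_nonpos (h1 i) with h | h
  · rw [bump_eq ℓ i h.1 fun j => (hle j).1, bump_eq ℓ i h.2 fun j => (hle j).2, bump_eq ℓ i _ hle',
      apply_lineMap']
    rw [apply_lineMap']
    exact add_nonneg (mul_nonneg hs' h.1) (mul_nonneg hs.1 h.2)
  · rw [bump_eq_zero ℓ i h.1, bump_eq_zero ℓ i h.2, bump_eq_zero ℓ i]
    · simp
    · rw [apply_lineMap']
      have e1 := mul_nonneg hs' (neg_nonneg.2 h.1)
      have e2 := mul_nonneg hs.1 (neg_nonneg.2 h.2)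
      linarith

/-- Pushing in the direction `w`. -/
noncomputable def push (x : Space) : Space := x + bump ℓ x • w

theorem continuous_push : Continuous (push ℓ w) :=
  continuous_id.add ((continuous_bump ℓ).smul continuous_const)

variable {w} in
-- Points with the same image differ by a multiple of `w`. The bump would have to drop along `w` by
-- at least the distance travelled, against `bump_add_lt`.
theorem push_inj (hw : ∀ i, -1 < (ℓ i).linear w) {t : ℝ} (ht : t ∈ Icc (0 : ℝ) 1) :
    Function.Injective fun x => x + (t * bump ℓ x) • w := by
  have key : ∀ x y : Space, bump ℓ y < bump ℓ x → x + (t * bump ℓ x) • w ≠ y + (t * bump ℓ y) • w := by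
    intro x y hlt he
    have hy : y = x + (t * (bump ℓ x - bump ℓ y)) • w := by
      rw [← sub_eq_zero] at he ⊢
      rw [← neg_eq_zero, ← he]; module
    rcases eq_or_lt_of_le ht.1 with h0 | h0
    · rw [← h0] at hy
      simp only [zero_mul, zero_smul, add_zero] at hy
      rw [hy] at hlt; exact lt_irrefl _ hlt
    · have := bump_add_lt ℓ hw x (mul_pos h0 (sub_pos.2 hlt))
      rw [← hy] at this
      nlinarith [ht.2]
  intro x y he
  rcases lt_trichotomy (bump ℓ x) (bump ℓ y) with h | h | h
  · exact absurd he.symm (key y x h)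
  · simp only [h] at he; exact add_right_cancel he
  · exact absurd he (key x y h)

variable {w} in
-- Scaling the bump by `t` gives an isotopy, affine wherever no `ℓ i` and no difference `ℓ i - ℓ j`
-- changes sign.
theorem amb_push (hw : ∀ i, -1 < (ℓ i).linear w) : Amb (push ℓ w) := by
  classical
  have e : push ℓ w = fun x => x + (1 * bump ℓ x) • w := by funext x; simp [push]
  rw [e]
  refine ⟨push_inj ℓ hw (by simp), fun K => ?_⟩
  refine K.becomes_of_piecewise (fun t x => x + (t * bump ℓ x) • w)
    ((Finset.univ.toList.map ℓ) ++ (Finset.univ.toList.map fun ij : ι × ι => ℓ ij.1 - ℓ ij.2))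
    (fun x => by apply Continuous.continuousOn; fun_prop) (by simp)
    (fun t ht => (push_inj ℓ hw ht).injOn) ?_
  · intro a b _ hl t ht s hs
    have hb := bump_lineMap ℓ (a := a) (b := b) (fun i => hl _ (by simp))
      (fun i j => hl _ (List.mem_append.2 (Or.inr (List.mem_map.2 ⟨(i, j), by simp, rfl⟩)))) hs
    change AffineMap.lineMap a b s + (t * bump ℓ (AffineMap.lineMap a b s)) • w = _
    rw [hb]
    simp only [AffineMap.lineMap_apply_module]
    module

variable {w} in
theorem locAff_push_of_eq (hw : ∀ i, -1 < (ℓ i).linear w) {x : Space} (i : ι) (hx : 0 < ℓ i x)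
    (hj : ∀ j, j ≠ i → ℓ i x < ℓ j x) : LocAff (push ℓ w) x := by
  refine ⟨shear (ℓ i) w (hw i), goodAff_shear _ _ _, ?_⟩
  have hcont : ∀ i, Continuous (ℓ i) := fun i => (ℓ i).continuous_of_finiteDimensional
  have h1 : ∀ᶠ y in 𝓝 x, 0 < ℓ i y := (hcont i).continuousAt.eventually (lt_mem_nhds hx)
  have h2 : ∀ᶠ y in 𝓝 x, ∀ j, j ≠ i → ℓ i y < ℓ j y := by
    rw [eventually_all]
    intro j
    by_cases hji : j = i
    · exact Eventually.of_forall fun y h => absurd hji h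
    · filter_upwards [(hcont i).continuousAt.eventually_lt (hcont j).continuousAt (hj j hji)] with y hy _ using hy
  filter_upwards [h1, h2] with y hy1 hy2
  rw [push, shear_apply, bump_eq ℓ i hy1.le]
  intro j
  by_cases hji : j = i
  · rw [hji]
  · exact (hy2 j hji).le

theorem locAff_push_of_neg {x : Space} (i : ι) (hx : ℓ i x < 0) : LocAff (push ℓ w) x := by
  refine ⟨_, GoodAff.refl, ?_⟩
  have hcont : Continuous (ℓ i) := (ℓ i).continuous_of_finiteDimensional
  filter_upwards [hcont.continuousAt.eventually (gt_mem_nhds hx)] with y hy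
  simp [push, bump_eq_zero ℓ i hy.le]

variable {w} in
/-- Pushes are undone by pushes. -/
theorem exists_push_inverse (hw : ∀ i, -1 < (ℓ i).linear w) :
    ∃ g, Amb g ∧ Continuous g ∧ ∀ x, g (push ℓ w x) = x := by
  -- Where the bump equals `ℓ i`, the push multiplies `ℓ i` by `1 + (ℓ i).linear w`. The rescaled
  -- function takes the old value at the new point.
  set ℓ' : ι → Space →ᵃ[ℝ] ℝ := fun i => (1 / (1 + (ℓ i).linear w)) • ℓ i with hℓ'
  have hpos : ∀ i, 0 < 1 + (ℓ i).linear w := fun i => by linarith [hw i]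
  have hw' : ∀ i, -1 < (ℓ' i).linear (-w) := by
    intro i
    have h1 := hpos i
    have : (ℓ' i).linear (-w) = 1 / (1 + (ℓ i).linear w) - 1 := by
      simp only [hℓ', AffineMap.smul_linear, LinearMap.smul_apply, map_neg, smul_eq_mul]
      field_simp; ring
    rw [this]
    have : 0 < 1 / (1 + (ℓ i).linear w) := by positivity
    linarith
  refine ⟨push ℓ' (-w), amb_push ℓ' hw', continuous_push _ _, fun x => ?_⟩
  have hval : ∀ i y, ℓ' i y = ℓ i y / (1 + (ℓ i).linear w) := by
    intro i y
    change (1 / (1 + (ℓ i).linear w)) * ℓ i y = _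
    ring
  suffices bump ℓ' (push ℓ w x) = bump ℓ x by
    rw [push, this, push]; simp
  rcases bump_eq_or ℓ x with ⟨h, i, hi⟩ | ⟨i, hi, h, hj⟩
  · rw [push, h, zero_smul, add_zero]
    apply bump_eq_zero ℓ' i
    rw [hval]; exact div_nonpos_of_nonpos_of_nonneg hi (hpos i).le
  · have e : ∀ j, ℓ j (push ℓ w x) = ℓ j x + ℓ i x * (ℓ j).linear w := fun j => by
      rw [push, h, apply_add_smul]
    have ei : ℓ' i (push ℓ w x) = ℓ i x := by
      rw [hval, e]; have := (hpos i).ne'; field_simp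
    rw [bump_eq ℓ' i (by rw [ei]; exact hi.le), ei, h]
    intro j
    rw [ei, hval, e, le_div_iff₀ (hpos j)]
    linarith [hj j]

end Push

theorem LocAff.inverse {h g : Space → Space} {x : Space} (hx : LocAff h x) (hg : Amb g)
    (hgc : Continuous g) (hgh : ∀ x, g (h x) = x) : LocAff g (h x) := by
  obtain ⟨A, hA, he⟩ := hx
  refine ⟨A.symm, hA.symm, ?_⟩
  have hc : Tendsto g (𝓝 (h x)) (𝓝 x) := by
    have := hgc.tendsto (h x); rwa [hgh] at this
  filter_upwards [hc.eventually he] with y hy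
  have : h (g y) = y := hg.injective (hgh _)
  rw [this] at hy
  exact (A.symm_apply_eq.2 hy).symm

end KnotMosaic

namespace KnotMosaic

open Set Filter Topology

/-! ### Elementary deformations are realized by pushes -/

/-- Affine coordinates adapted to a triangle. -/
structure TriCoord (a b c : Space) where
  s : Space →ᵃ[ℝ] ℝ
  y : Space →ᵃ[ℝ] ℝ
  z : Space →ᵃ[ℝ] ℝ
  sa : s a = -1
  sb : s b = 1
  ya : y a = 0
  yb : y b = 0
  za : z a = 0
  zb : z b = 0
  sw : s.linear (c - midpoint ℝ a b) = 0
  yw : y.linear (c - midpoint ℝ a b) = 1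
  zw : z.linear (c - midpoint ℝ a b) = 0
  mem : ∀ x, z x = 0 → 0 ≤ y x → y x ≤ 1 + s x → y x ≤ 1 - s x → x ∈ convexHull ℝ {a, b, c}

theorem midpoint_eq' (a b : Space) : midpoint ℝ a b = (1 / 2 : ℝ) • a + (1 / 2 : ℝ) • b := by
  rw [midpoint_eq_smul_add, smul_add]; norm_num

/-- The origin is the midpoint of `[a, b]`. The basis consists of half the side, the median vector
towards `c`, and a vector transverse to the plane of the triangle. -/
theorem exists_triCoord {a b c : Space} (hi : AffineIndependent ℝ ![a, b, c]) :
    Nonempty (TriCoord a b c) := by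
  set m := midpoint ℝ a b with hm
  have hlin : LinearIndependent ℝ ![b - a, c - a] := by
    have := (affineIndependent_iff_linearIndependent_vsub ℝ _ (0 : Fin 3)).1 hi
    have := this.comp (fun i : Fin 2 => (⟨i.succ, Fin.succ_ne_zero i⟩ : {x : Fin 3 // x ≠ 0})) (by
      intro i j hij; simpa using hij)
    have e : ((fun i : {x : Fin 3 // x ≠ 0} => (![a, b, c] i -ᵥ ![a, b, c] 0 : Space)) ∘
        fun i : Fin 2 => ⟨i.succ, Fin.succ_ne_zero i⟩) = ![b - a, c - a] := by
      ext i; fin_cases i <;> rfl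
    rwa [e] at this
  rw [LinearIndependent.pair_iff] at hlin
  obtain ⟨φ, φ0, φ1, φ2⟩ := exists_dual_const a b c
  obtain ⟨e3, he3⟩ := DFunLike.ne_iff.1 φ0
  simp only [LinearMap.zero_apply] at he3
  set e1 : Space := (1 / 2 : ℝ) • (b - a) with he1
  set e2 : Space := c - m with he2
  have φe1 : φ e1 = 0 := by rw [he1, map_smul, map_sub, φ1, sub_self, smul_zero]
  have φe2 : φ e2 = 0 := by
    rw [he2, hm, midpoint_eq', map_sub, map_add, map_smul, map_smul, φ1, φ2, smul_eq_mul]; ring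
  have hli : LinearIndependent ℝ ![e1, e2, e3] := by
    rw [Fintype.linearIndependent_iff]
    intro g hg
    simp only [Fin.sum_univ_three, Matrix.cons_val_zero, Matrix.cons_val_one, Matrix.cons_val] at hg
    have h2 := congrArg φ hg
    simp only [map_add, map_smul, φe1, φe2, mul_zero, zero_add, map_zero, smul_eq_mul] at h2
    have g2 : g 2 = 0 := (mul_eq_zero.1 h2).resolve_right he3
    have h3 := hlin (g 0 / 2 - g 1 / 2) (g 1) (by
      rw [g2, zero_smul, add_zero] at hg
      rw [← hg, he1, he2, hm, midpoint_eq']; module)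
    intro i
    fin_cases i
    · show g 0 = 0
      linarith [h3.1, h3.2]
    · exact h3.2
    · exact g2
  set B := basisOfLinearIndependentOfCardEqFinrank hli (by simp) with hB
  have B0 : B 0 = e1 := by simp [hB]
  have B1 : B 1 = e2 := by simp [hB]
  have B2 : B 2 = e3 := by simp [hB]
  have hco : ∀ i j, B.coord i (B j) = if i = j then 1 else 0 := by
    intro i j
    rw [Module.Basis.coord_apply, Module.Basis.repr_self, Finsupp.single_apply]
    simp [eq_comm]
  set f : Fin 3 → (Space →ᵃ[ℝ] ℝ) := fun i =>
    (B.coord i).toAffineMap - AffineMap.const ℝ Space (B.coord i m) with hf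
  have fa : ∀ i x, f i x = B.coord i (x - m) := fun i x => (map_sub (B.coord i) x m).symm
  have fl : ∀ i v, (f i).linear v = B.coord i v := by
    intro i v; simp [hf]
  have ea : a - m = (-1 : ℝ) • B 0 := by rw [B0, he1, hm, midpoint_eq']; module
  have eb : b - m = (1 : ℝ) • B 0 := by rw [B0, he1, hm, midpoint_eq']; module
  refine ⟨⟨f 0, f 1, f 2, ?_, ?_, ?_, ?_, ?_, ?_, ?_, ?_, ?_, ?_⟩⟩
  · rw [fa, ea, map_smul, hco]; simp
  · rw [fa, eb, map_smul, hco]; simp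
  · rw [fa, ea, map_smul, hco]; simp
  · rw [fa, eb, map_smul, hco]; simp
  · rw [fa, ea, map_smul, hco]; simp
  · rw [fa, eb, map_smul, hco]; simp
  · rw [fl, ← hm, ← he2, ← B1, hco]; simp
  · rw [fl, ← hm, ← he2, ← B1, hco]; simp
  · rw [fl, ← hm, ← he2, ← B1, hco]; simp
  · intro x hz hy h1 h2
    have hx := B.sum_repr (x - m)
    simp only [Fin.sum_univ_three, ← Module.Basis.coord_apply, ← fa, hz, zero_smul, add_zero, B0, B1] at hx
    refine mem_convexHull₃.2 ⟨(1 - f 0 x - f 1 x) / 2, (1 + f 0 x - f 1 x) / 2, f 1 x, by linarith,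
      by linarith, hy, by ring, ?_⟩
    have : x = m + (f 0 x • e1 + f 1 x • e2) := by rw [hx]; abel
    conv_lhs => rw [this]
    rw [he1, he2, hm, midpoint_eq']
    module

namespace TriCoord

variable {a b c : Space} (T : TriCoord a b c)

/-- The sign attached to a Boolean. -/
def sgn (σ : Bool) : ℝ := if σ then 1 else -1

/-- The entries are the weights of `1 ± s`, `y` and `z`. The first triple gives the tent over the
side; the others are walls which make the bump vanish off a thin neighbourhood of the triangle: two
steep ones in `z`, one below `y = 0`, one just above the two other sides. On the side itself these
four equal `(1 + ε) (1 ± s)`, so the tent is the minimum. The weight of `y` is `-(1 - ε)` rather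
than `-1` because the push must be injective. -/
noncomputable def coeff (ε : ℝ) : Fin 5 → ℝ × ℝ × ℝ :=
  ![(1, 0, 0), (1 + ε, 0, -(1 / ε)), (1 + ε, 0, 1 / ε), (1 + ε, 1 / ε, 0), (1 + ε, -(1 - ε), 0)]

/-- The affine functions bounding the bump of a triangle. -/
noncomputable def ell (ε : ℝ) (i : Bool × Fin 5) : Space →ᵃ[ℝ] ℝ :=
  (coeff ε i.2).1 • (AffineMap.const ℝ Space 1 + sgn i.1 • T.s) + (coeff ε i.2).2.1 • T.y +
    (coeff ε i.2).2.2 • T.z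

theorem ell_apply (ε : ℝ) (i : Bool × Fin 5) (x : Space) :
    T.ell ε i x = (coeff ε i.2).1 * (1 + sgn i.1 * T.s x) + (coeff ε i.2).2.1 * T.y x +
      (coeff ε i.2).2.2 * T.z x := rfl

theorem ell_linear {ε : ℝ} (hε : 0 < ε) (i : Bool × Fin 5) :
    -1 < (T.ell ε i).linear (c - midpoint ℝ a b) := by
  have : (T.ell ε i).linear (c - midpoint ℝ a b) = (coeff ε i.2).2.1 := by
    simp [ell, T.sw, T.yw, T.zw]
  rw [this]
  obtain ⟨σ, k⟩ := i
  fin_cases k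
  · simp [coeff]
  · simp [coeff]
  · simp [coeff]
  · simp only [coeff]; simp; have : 0 < ε⁻¹ := by positivity
    linarith
  · simp [coeff]; linarith

/-- The displacement of the points of the side. -/
noncomputable def tent (x : Space) : ℝ := min (1 + T.s x) (1 - T.s x)

theorem side {x : Space} (hx : x ∈ segment ℝ a b) :
    T.y x = 0 ∧ T.z x = 0 ∧ -1 ≤ T.s x ∧ T.s x ≤ 1 := by
  obtain ⟨r, hr, rfl⟩ := mem_segment'.1 hx
  simp only [apply_combo, T.ya, T.yb, T.za, T.zb, T.sa, T.sb]
  refine ⟨by ring, by ring, ?_, ?_⟩ <;> nlinarith [hr.1, hr.2]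

theorem ell_side {ε : ℝ} {x : Space} (hx : x ∈ segment ℝ a b) (i : Bool × Fin 5) :
    T.ell ε i x = (if i.2 = 0 then 1 else 1 + ε) * (1 + sgn i.1 * T.s x) := by
  obtain ⟨h1, h2, -, -⟩ := T.side hx
  rw [ell_apply, h1, h2]
  obtain ⟨σ, k⟩ := i
  fin_cases k <;> simp [coeff]

theorem bump_side {ε : ℝ} (hε : 0 < ε) {x : Space} (hx : x ∈ segment ℝ a b) :
    bump (T.ell ε) x = T.tent x := by
  obtain ⟨-, -, h3, h4⟩ := T.side hx
  have key : ∀ σ : Bool, 0 ≤ 1 + sgn σ * T.s x := by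
    intro σ; cases σ <;> simp [sgn] <;> linarith
  have key2 : ∀ σ : Bool, T.tent x ≤ 1 + sgn σ * T.s x := by
    intro σ; cases σ
    · simp only [sgn, tent]; norm_num; linarith [min_le_right (1 + T.s x) (1 - T.s x)]
    · simp [sgn, tent]
  have hle : ∀ i, T.tent x ≤ T.ell ε i x := by
    intro i
    rw [T.ell_side hx]
    have := key i.1
    have := key2 i.1
    split_ifs
    · linarith
    · nlinarith
  rcases le_total (1 + T.s x) (1 - T.s x) with h | h
  · have e : T.tent x = T.ell ε (true, 0) x := by
      rw [T.ell_side hx]; simp [sgn, tent, h]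
    rw [bump_eq (T.ell ε) (true, 0), e]
    · rw [T.ell_side hx]; simp [sgn]; linarith
    · intro j; rw [← e]; exact hle j
  · have e : T.tent x = T.ell ε (false, 0) x := by
      rw [T.ell_side hx]; simp [sgn, tent, h]; ring
    rw [bump_eq (T.ell ε) (false, 0), e]
    · rw [T.ell_side hx]; simp [sgn]; linarith
    · intro j; rw [← e]; exact hle j

/-- The excluded points are the corners of the tent. Elsewhere on the side exactly one of the
functions is minimal and it is positive, the factor `1 + ε` ruling out ties with the walls. -/
theorem locAff_side {ε : ℝ} (hε : 0 < ε) {x : Space} (hx : x ∈ segment ℝ a b) (ha : x ≠ a)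
    (hb : x ≠ b) (hm : x ≠ midpoint ℝ a b) :
    LocAff (push (T.ell ε) (c - midpoint ℝ a b)) x := by
  obtain ⟨-, -, h3, h4⟩ := T.side hx
  obtain ⟨r, hr, hxr⟩ := mem_segment'.1 hx
  have hs : T.s x = 2 * r - 1 := by rw [hxr, apply_combo, T.sa, T.sb]; ring
  have hr0 : r ≠ 0 := by rintro rfl; exact ha (by simpa using hxr)
  have hr1 : r ≠ 1 := by rintro rfl; exact hb (by simpa using hxr)
  have hr2 : r ≠ 1 / 2 := by
    rintro rfl; apply hm; rw [hxr, midpoint_eq']; norm_num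
  have hr0' : 0 < r := lt_of_le_of_ne hr.1 (Ne.symm hr0)
  have hr1' : r < 1 := lt_of_le_of_ne hr.2 hr1
  rcases lt_or_gt_of_ne hr2 with h | h
  · refine locAff_push_of_eq _ (T.ell_linear hε) (true, 0) ?_ ?_
    · rw [T.ell_side hx, hs]; simp [sgn]; linarith
    · rintro ⟨σ, k⟩ hne
      rw [T.ell_side hx, T.ell_side hx, hs]
      cases σ
      · by_cases hk : k = 0
        · simp [sgn, hk]; linarith
        · simp [sgn, hk]; nlinarith
      · have hk : k ≠ 0 := by rintro rfl; exact hne rfl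
        simp [sgn, hk]; nlinarith
  · refine locAff_push_of_eq _ (T.ell_linear hε) (false, 0) ?_ ?_
    · rw [T.ell_side hx, hs]; simp [sgn]; linarith
    · rintro ⟨σ, k⟩ hne
      rw [T.ell_side hx, T.ell_side hx, hs]
      cases σ
      · have hk : k ≠ 0 := by rintro rfl; exact hne rfl
        simp [sgn, hk]; nlinarith
      · by_cases hk : k = 0
        · simp [sgn, hk]; linarith
        · simp [sgn, hk]; nlinarith

/-- The tent is affine on each half of the side, with value 0 at `a` and `b` and value 1 at the
midpoint, which is therefore pushed to `c`. -/
theorem image_side {ε : ℝ} (hε : 0 < ε) :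
    push (T.ell ε) (c - midpoint ℝ a b) '' segment ℝ a b = segment ℝ a c ∪ segment ℝ c b := by
  set m := midpoint ℝ a b with hm
  have hval : ∀ x ∈ segment ℝ a b, push (T.ell ε) (c - m) x = x + T.tent x • (c - m) := by
    intro x hx; rw [push, T.bump_side hε hx]
  have hmm : m ∈ segment ℝ a b := midpoint_mem_segment _ _
  have hsm : T.s m = 0 := by rw [hm, midpoint_eq', show (1 / 2 : ℝ) • a = (1 - 1 / 2 : ℝ) • a by norm_num, apply_combo, T.sa, T.sb]; norm_num
  have e1 : ∀ r ∈ Icc (0 : ℝ) 1, push (T.ell ε) (c - m) ((1 - r) • a + r • m) = (1 - r) • a + r • c := by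
    intro r hr
    rw [hval _ (segment_subset_left hmm (mem_segment'.2 ⟨r, hr, rfl⟩)), tent, apply_combo, hsm, T.sa,
      min_eq_left (by linarith [hr.2])]
    module
  have e2 : ∀ r ∈ Icc (0 : ℝ) 1, push (T.ell ε) (c - m) ((1 - r) • m + r • b) = (1 - r) • c + r • b := by
    intro r hr
    rw [hval _ (segment_subset_right hmm (mem_segment'.2 ⟨r, hr, rfl⟩)), tent, apply_combo, hsm, T.sb,
      min_eq_right (by linarith [hr.1])]
    module
  rw [segment_eq_union hmm, image_union]
  congr 1
  · ext x; constructor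
    · rintro ⟨_, hy, rfl⟩
      obtain ⟨r, hr, rfl⟩ := mem_segment'.1 hy
      exact mem_segment'.2 ⟨r, hr, e1 r hr⟩
    · intro hx
      obtain ⟨r, hr, rfl⟩ := mem_segment'.1 hx
      exact ⟨_, mem_segment'.2 ⟨r, hr, rfl⟩, e1 r hr⟩
  · ext x; constructor
    · rintro ⟨_, hy, rfl⟩
      obtain ⟨r, hr, rfl⟩ := mem_segment'.1 hy
      exact mem_segment'.2 ⟨r, hr, e2 r hr⟩
    · intro hx
      obtain ⟨r, hr, rfl⟩ := mem_segment'.1 hx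
      exact ⟨_, mem_segment'.2 ⟨r, hr, rfl⟩, e2 r hr⟩

/-- Away from the triangle the bump vanishes when it is thin enough. -/
theorem eventually_neg {x : Space} (hx : x ∉ convexHull ℝ {a, b, c}) :
    ∀ᶠ p : ℝ × Space in 𝓝 (0, x), 0 < p.1 → ∃ i, T.ell p.1 i p.2 < 0 := by
  have hs : Continuous T.s := T.s.continuous_of_finiteDimensional
  have hy : Continuous T.y := T.y.continuous_of_finiteDimensional
  have hz : Continuous T.z := T.z.continuous_of_finiteDimensional
  have lim : ∀ f : ℝ × Space → ℝ, Continuous f → f (0, x) < 0 → ∀ᶠ p in 𝓝 ((0 : ℝ), x), f p < 0 :=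
    fun f hf h => hf.continuousAt.eventually (gt_mem_nhds h)
  -- A point off the triangle violates one of the inequalities in `T.mem`, and each violation makes
  -- one bounding function negative for small `ε`. Multiplying the functions with `1 / ε` by `ε`
  -- makes them continuous at `ε = 0`.
  by_cases h1 : 0 ≤ 1 + T.s x
  swap
  · filter_upwards [lim (fun p => 1 + T.s p.2) (by fun_prop) (not_le.1 h1)] with p hp _
    exact ⟨(true, 0), by rw [ell_apply]; simpa [coeff, sgn] using hp⟩
  by_cases h2 : 0 ≤ 1 - T.s x
  swap
  · filter_upwards [lim (fun p => 1 - T.s p.2) (by fun_prop) (not_le.1 h2)] with p hp _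
    exact ⟨(false, 0), by rw [ell_apply]; simp [coeff, sgn]; linarith⟩
  rcases lt_trichotomy (T.z x) 0 with h3 | h3 | h3
  · filter_upwards [lim (fun p => p.1 * ((1 + p.1) * (1 + T.s p.2)) + T.z p.2) (by fun_prop)
      (by simpa using h3)] with p hp hp0
    refine ⟨(true, 2), ?_⟩
    have : T.ell p.1 (true, 2) p.2 = (p.1 * ((1 + p.1) * (1 + T.s p.2)) + T.z p.2) / p.1 := by
      rw [ell_apply]; simp [coeff, sgn]; field_simp
    rw [this]; exact div_neg_of_neg_of_pos hp hp0
  · rcases lt_or_ge (T.y x) 0 with h4 | h4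
    · filter_upwards [lim (fun p => p.1 * ((1 + p.1) * (1 + T.s p.2)) + T.y p.2) (by fun_prop)
        (by simpa using h4)] with p hp hp0
      refine ⟨(true, 3), ?_⟩
      have : T.ell p.1 (true, 3) p.2 = (p.1 * ((1 + p.1) * (1 + T.s p.2)) + T.y p.2) / p.1 := by
        rw [ell_apply]; simp [coeff, sgn]; field_simp
      rw [this]; exact div_neg_of_neg_of_pos hp hp0
    · by_cases h5 : T.y x ≤ 1 + T.s x
      · have h6 : 1 - T.s x - T.y x < 0 := by
          by_contra h6; exact hx (T.mem x h3 h4 h5 (by linarith))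
        filter_upwards [lim (fun p => (1 + p.1) * (1 - T.s p.2) - (1 - p.1) * T.y p.2) (by fun_prop)
          (by simpa using h6)] with p hp _
        refine ⟨(false, 4), ?_⟩
        rw [ell_apply]; simp [coeff, sgn]; linarith
      · filter_upwards [lim (fun p => (1 + p.1) * (1 + T.s p.2) - (1 - p.1) * T.y p.2) (by fun_prop)
          (by simp; linarith)] with p hp _
        refine ⟨(true, 4), ?_⟩
        rw [ell_apply]; simp [coeff, sgn]; linarith
  · filter_upwards [lim (fun p => p.1 * ((1 + p.1) * (1 + T.s p.2)) - T.z p.2) (by fun_prop)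
      (by simpa using h3)] with p hp hp0
    refine ⟨(true, 1), ?_⟩
    have : T.ell p.1 (true, 1) p.2 = (p.1 * ((1 + p.1) * (1 + T.s p.2)) - T.z p.2) / p.1 := by
      rw [ell_apply]; simp [coeff, sgn]; field_simp; ring
    rw [this]; exact div_neg_of_neg_of_pos hp hp0

/-- The bump vanishes on a segment leaving the triangle at an end point of the side. -/
theorem eventually_ray (σ : Bool) {p v : Space} (hs : 1 + sgn σ * T.s p = 0) (hy : T.y p = 0)
    (hz : T.z p = 0) (hv : segment ℝ p v ∩ convexHull ℝ {a, b, c} ⊆ {p}) (hpv : p ≠ v) :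
    ∀ᶠ ε in 𝓝[>] (0 : ℝ), ∀ x ∈ segment ℝ p v, bump (T.ell ε) x = 0 := by
  set s' := 1 + sgn σ * T.s v with hs'
  set y' := T.y v with hy'
  set z' := T.z v with hz'
  -- The functions with sign `σ` vanish at `p`, so along the segment they are multiples of their
  -- value at `v`. It is enough that one of these values be nonpositive.
  have hval : ∀ ε k r, T.ell ε (σ, k) ((1 - r) • p + r • v) =
      r * ((coeff ε k).1 * s' + (coeff ε k).2.1 * y' + (coeff ε k).2.2 * z') := by
    intro ε k r
    rw [apply_combo, ell_apply, ell_apply, hs, hy, hz]; ring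
  have hsuff : ∀ (ε : ℝ) (k : Fin 5), (coeff ε k).1 * s' + (coeff ε k).2.1 * y' + (coeff ε k).2.2 * z' ≤ 0 →
      ∀ x ∈ segment ℝ p v, bump (T.ell ε) x = 0 := by
    intro ε k h x hx
    obtain ⟨r, hr, rfl⟩ := mem_segment'.1 hx
    refine bump_eq_zero _ (σ, k) ?_
    rw [hval]; exact mul_nonpos_of_nonneg_of_nonpos hr.1 h
  have lim : ∀ f : ℝ → ℝ, Continuous f → f 0 < 0 → ∀ᶠ ε in 𝓝[>] (0 : ℝ), f ε < 0 ∧ 0 < ε :=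
    fun f hf h => ((hf.continuousAt.eventually (gt_mem_nhds h)).filter_mono nhdsWithin_le_nhds).and
      self_mem_nhdsWithin
  rcases lt_trichotomy z' 0 with h3 | h3 | h3
  · filter_upwards [lim (fun ε => ε * ((1 + ε) * s') + z') (by fun_prop) (by simpa using h3)] with ε hε
    refine hsuff ε 2 ?_
    have : (coeff ε 2).1 * s' + (coeff ε 2).2.1 * y' + (coeff ε 2).2.2 * z' =
        (ε * ((1 + ε) * s') + z') / ε := by
      have := hε.2.ne'
      simp [coeff]; field_simp
    rw [this]; exact (div_neg_of_neg_of_pos hε.1 hε.2).le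
  · rcases lt_or_ge y' 0 with h4 | h4
    · filter_upwards [lim (fun ε => ε * ((1 + ε) * s') + y') (by fun_prop) (by simpa using h4)] with ε hε
      refine hsuff ε 3 ?_
      have : (coeff ε 3).1 * s' + (coeff ε 3).2.1 * y' + (coeff ε 3).2.2 * z' =
          (ε * ((1 + ε) * s') + y') / ε := by
        have := hε.2.ne'
        simp [coeff]; field_simp
      rw [this]; exact (div_neg_of_neg_of_pos hε.1 hε.2).le
    · have h5 : s' < y' := by
        by_contra h5
        -- otherwise a point near `p` lies in the triangle
        have hs0 : 0 ≤ s' := h4.trans (not_lt.1 h5)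
        -- With this `r` one has `r * (s' + y') < 1`, so the point also satisfies the inequality for
        -- the other end of the side and lies in the triangle.
        set r : ℝ := 1 / (1 + s' + y') with hr
        have hden : 0 < 1 + s' + y' := by linarith
        have hr0 : 0 < r := by positivity
        have hr1 : r ≤ 1 := by rw [hr, div_le_one hden]; linarith
        have hmem : (1 - r) • p + r • v ∈ segment ℝ p v := mem_segment'.2 ⟨r, ⟨hr0.le, hr1⟩, rfl⟩
        have hsx : 1 + sgn σ * T.s ((1 - r) • p + r • v) = r * s' := by
          rw [apply_combo]
          linear_combination (1 - r) * hs + r * (rfl : s' = s')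
        have hyx : T.y ((1 - r) • p + r • v) = r * y' := by rw [apply_combo, hy]; ring
        have hzx : T.z ((1 - r) • p + r • v) = 0 := by
          rw [apply_combo, hz, ← hz', h3]; ring
        have hprod : r * (1 + s' + y') = 1 := by rw [hr]; field_simp
        have hle : r * y' ≤ r * s' := mul_le_mul_of_nonneg_left (not_lt.1 h5) hr0.le
        have hin : (1 - r) • p + r • v ∈ convexHull ℝ {a, b, c} := by
          refine T.mem _ hzx (by rw [hyx]; positivity) ?_ ?_
          · cases σ
            · simp only [sgn] at hsx; rw [hyx]
              norm_num at hsx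
              nlinarith
            · simp only [sgn] at hsx; rw [hyx]
              norm_num at hsx
              nlinarith
          · cases σ
            · simp only [sgn] at hsx; rw [hyx]
              norm_num at hsx
              nlinarith
            · simp only [sgn] at hsx; rw [hyx]
              norm_num at hsx
              nlinarith
        have := hv ⟨hmem, hin⟩
        rw [mem_singleton_iff] at this
        have h0 : r • (v - p) = 0 := by
          rw [← sub_eq_zero] at this; rw [← this]; module
        rcases smul_eq_zero.1 h0 with h | h
        · exact hr0.ne' h
        · exact hpv (sub_eq_zero.1 h).symm
      filter_upwards [lim (fun ε => (1 + ε) * s' - (1 - ε) * y') (by fun_prop) (by simp; linarith)]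
        with ε hε
      refine hsuff ε 4 ?_
      simp [coeff, h3]; linarith [hε.1]
  · filter_upwards [lim (fun ε => ε * ((1 + ε) * s') - z') (by fun_prop) (by simpa using h3)] with ε hε
    refine hsuff ε 1 ?_
    have : (coeff ε 1).1 * s' + (coeff ε 1).2.1 * y' + (coeff ε 1).2.2 * z' =
        (ε * ((1 + ε) * s') - z') / ε := by
      have := hε.2.ne'
      simp [coeff]; field_simp; ring
    rw [this]; exact (div_neg_of_neg_of_pos hε.1 hε.2).le

end TriCoord

/-- `K` is carried to `K'` by a map preserving knot types, which can be chosen affine near any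
given point outside a finite set. -/
def CanMove (K K' : Knot) : Prop :=
  ∃ F : Set Space, F.Finite ∧ ∀ x ∈ K.carrier, x ∉ F →
    ∃ h, Amb h ∧ h '' K.carrier = K'.carrier ∧ LocAff h x

/-- A push with a thin bump around the triangle moves the side `[a, b]` onto the other two sides and
fixes the complementary arc `U`. How thin it must be may depend on the point at which the map is to
be affine, but the three corners of the tent do not. The reverse move uses the inverse push. -/
theorem canMove_of_deltaMove {K K' : Knot} (hd : Knot.DeltaMove K K') :
    CanMove K K' ∧ CanMove K' K := by
  obtain ⟨a, b, c, hi, hK, hK'⟩ := hd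
  obtain ⟨T⟩ := exists_triCoord hi
  set w := c - midpoint ℝ a b with hw
  obtain ⟨hab, hac, hbc⟩ := ne_of_affineIndependent hi
  have hsub : segment ℝ a b ⊆ K.carrier := hK ▸ inter_subset_left
  obtain ⟨U, hU, hKU, hUi⟩ := K.isLoop.exists_complement (Arc.single hab trivial) hsub
  have hUh : U ∩ convexHull ℝ {a, b, c} ⊆ {a, b} := by
    rintro x ⟨hx, hx'⟩
    refine hUi ⟨?_, hx⟩
    rw [← hK]; exact ⟨hKU ▸ Or.inr hx, hx'⟩
  have hnot : ¬ segment ℝ a b ⊆ U := by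
    intro h
    rcases hUi ⟨midpoint_mem_segment a b, h (midpoint_mem_segment a b)⟩ with h | h
    · exact hab ((midpoint_eq_left_iff ℝ).1 h)
    · exact hab ((midpoint_eq_right_iff ℝ).1 h)
  obtain ⟨v, U₁, hav, hU1, hU1c, haU1⟩ := hU.exists_start
  obtain ⟨v', U₂, hbv, hU2, hU2c, hbU2⟩ := hU.symm'.exists_start
  have hvh : segment ℝ a v ∩ convexHull ℝ {a, b, c} ⊆ {a} := by
    rintro x ⟨hx, hx'⟩
    rcases hUh ⟨hU1 ▸ Or.inl hx, hx'⟩ with h | h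
    · exact h
    · rw [mem_singleton_iff] at h; subst h
      exact absurd ((segment_subset_left hx).trans (hU1 ▸ subset_union_left)) hnot
  have hvh' : segment ℝ b v' ∩ convexHull ℝ {a, b, c} ⊆ {b} := by
    rintro x ⟨hx, hx'⟩
    rcases hUh ⟨hU2 ▸ Or.inl hx, hx'⟩ with h | h
    · subst h
      refine absurd ((segment_subset_left hx).trans ?_) (segment_symm ℝ x b ▸ hnot)
      rw [hU2]; exact subset_union_left
    · exact h
  have ev1 := T.eventually_ray true (p := a) (v := v) (by simp [TriCoord.sgn, T.sa]) T.ya T.za hvh hav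
  have ev2 := T.eventually_ray false (p := b) (v := v') (by simp [TriCoord.sgn, T.sb]) T.yb T.zb hvh' hbv
  -- Each point of `U` is on one of the two edges at the ends, controlled by `eventually_ray`, or in
  -- this compact set, which avoids the triangle.
  have hcomp : IsCompact (U₁ ∩ U₂ ∩ U) := hU.isCompact.inter_left (hU1c.inter hU2c)
  have hnothull : ∀ x ∈ U, x ≠ a → x ≠ b → x ∉ convexHull ℝ {a, b, c} := by
    intro x hx hxa hxb hx'
    rcases hUh ⟨hx, hx'⟩ with h | h
    · exact hxa h
    · exact hxb h
  have ev3 : ∀ᶠ ε in 𝓝 (0 : ℝ), ∀ x ∈ U₁ ∩ U₂ ∩ U, 0 < ε → ∃ i, T.ell ε i x < 0 := by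
    refine hcomp.eventually_forall_of_forall_eventually fun x hx => ?_
    exact T.eventually_neg (hnothull x hx.2 (fun h => haU1 (h ▸ hx.1.1)) (fun h => hbU2 (h ▸ hx.1.2)))
  -- the choice of the size of the bump
  have main : ∀ x ∈ K.carrier, x ≠ a → x ≠ b → x ≠ midpoint ℝ a b → ∃ ε : ℝ, 0 < ε ∧
      (∀ x ∈ U, bump (T.ell ε) x = 0) ∧ LocAff (push (T.ell ε) w) x := by
    intro x hx hxa hxb hxm
    have ev4 : ∀ᶠ ε in 𝓝 (0 : ℝ), 0 < ε → x ∈ U → ∃ i, T.ell ε i x < 0 := by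
      by_cases hxU : x ∈ U
      · have hc : Tendsto (fun ε : ℝ => (ε, x)) (𝓝 0) (𝓝 (0, x)) := by
          refine Continuous.tendsto' ?_ _ _ rfl
          fun_prop
        filter_upwards [hc.eventually (T.eventually_neg (hnothull x hxU hxa hxb))] with ε h h0 _
        exact h h0
      · exact Eventually.of_forall fun _ _ h => absurd h hxU
    have hpos : ∀ᶠ ε in 𝓝[>] (0 : ℝ), 0 < ε := self_mem_nhdsWithin
    obtain ⟨ε, h1, h2, h3, h4, h0⟩ := (ev1.and (ev2.and
      ((ev3.filter_mono nhdsWithin_le_nhds).and ((ev4.filter_mono nhdsWithin_le_nhds).and hpos)))).exists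
    refine ⟨ε, h0, fun y hy => ?_, ?_⟩
    · rcases hU1.le hy with h | hy1
      · exact h1 y h
      rcases hU2.le hy with h | hy2
      · exact h2 y h
      obtain ⟨i, hi⟩ := h3 y ⟨⟨hy1, hy2⟩, hy⟩ h0
      exact bump_eq_zero _ i hi.le
    · rcases hKU.le hx with h | h
      · exact T.locAff_side h0 h hxa hxb hxm
      · obtain ⟨i, hi⟩ := h4 h0 h
        exact locAff_push_of_neg _ _ i hi
  have himg : ∀ ε : ℝ, 0 < ε → (∀ x ∈ U, bump (T.ell ε) x = 0) →
      push (T.ell ε) w '' K.carrier = K'.carrier := by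
    intro ε h0 hε
    have hUfix : push (T.ell ε) w '' U = U := by
      have : ∀ x ∈ U, push (T.ell ε) w x = x := fun x hx => by simp [push, hε x hx]
      rw [image_congr this, image_id']
    rw [hKU, image_union, hUfix, T.image_side h0, hK', hKU]
    ext x; constructor
    · rintro (h | h)
      · exact Or.inr h
      · by_cases hx : x ∈ segment ℝ a b
        · right
          rcases hUi ⟨hx, h⟩ with h | h
          · left; rw [h]; exact left_mem_segment ℝ _ _
          · rw [mem_singleton_iff] at h
            right; rw [h]; exact right_mem_segment ℝ _ _
        · exact Or.inl ⟨Or.inr h, hx⟩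
    · rintro (⟨h | h, hx⟩ | h)
      · exact absurd h hx
      · exact Or.inr h
      · exact Or.inl h
  constructor
  · refine ⟨{a, b, midpoint ℝ a b}, by simp, fun x hx hxF => ?_⟩
    simp only [mem_insert_iff, mem_singleton_iff, not_or] at hxF
    obtain ⟨ε, h0, hε, hl⟩ := main x hx hxF.1 hxF.2.1 hxF.2.2
    exact ⟨_, amb_push _ (T.ell_linear h0), himg ε h0 hε, hl⟩
  · -- the restriction of the push to `K` does not depend on the size of the bump
    obtain ⟨τ, hτ1, hτ2⟩ : ∃ τ : Space → Space, (∀ x ∈ segment ℝ a b, τ x = x + T.tent x • w) ∧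
        ∀ x ∉ segment ℝ a b, τ x = x := by
      classical
      exact ⟨fun x => if x ∈ segment ℝ a b then x + T.tent x • w else x,
        fun x hx => if_pos hx, fun x hx => if_neg hx⟩
    have hτe : ∀ ε : ℝ, 0 < ε → (∀ x ∈ U, bump (T.ell ε) x = 0) → ∀ x ∈ K.carrier,
        push (T.ell ε) w x = τ x := by
      intro ε h0 hε x hx
      by_cases hxs : x ∈ segment ℝ a b
      · rw [hτ1 x hxs, push, T.bump_side h0 hxs]
      · rw [hτ2 x hxs, push, hε x ((hKU.le hx).resolve_left hxs), zero_smul, add_zero]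
    -- The exceptional points of `K'` are the images of those of `K`. They have to be fixed before
    -- `ε` is chosen, which is why `τ` is introduced.
    refine ⟨τ '' {a, b, midpoint ℝ a b}, (Set.toFinite _).image τ, fun x hx hxF => ?_⟩
    -- some push maps onto `K'`
    obtain ⟨x₁, hx1, hx1F⟩ : ∃ y ∈ K.carrier, y ∉ ({a, b, midpoint ℝ a b} : Set Space) := by
      obtain ⟨y, hy, hya, hyb⟩ := hU.exists_interior
      refine ⟨y, hKU ▸ Or.inr hy, ?_⟩
      simp only [mem_insert_iff, mem_singleton_iff, not_or]
      refine ⟨hya, hyb, fun h => ?_⟩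
      rcases hUi ⟨h ▸ midpoint_mem_segment a b, hy⟩ with h | h
      · exact hya h
      · exact hyb h
    simp only [mem_insert_iff, mem_singleton_iff, not_or] at hx1F
    obtain ⟨ε₁, h01, hε1, -⟩ := main x₁ hx1 hx1F.1 hx1F.2.1 hx1F.2.2
    rw [← himg ε₁ h01 hε1] at hx
    obtain ⟨y, hy, rfl⟩ := hx
    rw [hτe ε₁ h01 hε1 y hy] at hxF ⊢
    have hyF : y ∉ ({a, b, midpoint ℝ a b} : Set Space) := fun h => hxF ⟨y, h, rfl⟩
    simp only [mem_insert_iff, mem_singleton_iff, not_or] at hyF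
    obtain ⟨ε, h0, hε, hl⟩ := main y hy hyF.1 hyF.2.1 hyF.2.2
    obtain ⟨g, hg, hgc, hgi⟩ := exists_push_inverse (T.ell ε) (T.ell_linear h0)
    refine ⟨g, hg, ?_, ?_⟩
    · rw [← himg ε h0 hε, image_image]
      simp only [hw, hgi, image_id']
    · rw [← hτe ε h0 hε y hy]
      exact hl.inverse hg hgc hgi

/-- Equivalent knots are related by a map preserving knot types, which is affine near some interior
point of any given segment of the first one. -/
theorem exists_amb_of_equivalent {K K' : Knot} (h : Knot.Equivalent K K') {u v : Space} (huv : u ≠ v)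
    (hs : segment ℝ u v ⊆ K.carrier) :
    ∃ x ∈ openSegment ℝ u v, ∃ g, Amb g ∧ g '' K.carrier = K'.carrier ∧ LocAff g x := by
  have step : ∀ {K K' : Knot}, CanMove K K' → ∀ {u v : Space}, u ≠ v → segment ℝ u v ⊆ K.carrier →
      ∃ x ∈ openSegment ℝ u v, ∃ g, Amb g ∧ g '' K.carrier = K'.carrier ∧ LocAff g x := by
    rintro K K' ⟨F, hF, hFm⟩ u v huv hs
    have hinf : (openSegment ℝ u v).Infinite := by
      rw [openSegment_eq_image_lineMap]
      exact (Ioo_infinite zero_lt_one).image (AffineMap.lineMap_injective ℝ huv).injOn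
    obtain ⟨x, hx, hxF⟩ := (hinf.sdiff hF).nonempty
    exact ⟨x, hx, hFm x (hs (openSegment_subset_segment ℝ _ _ hx)) hxF⟩
  -- Both directions are carried along, since `EqvGen` contains a symmetry step.
  have key : ∀ K K', Knot.Equivalent K K' →
      (∀ {u v : Space}, u ≠ v → segment ℝ u v ⊆ K.carrier →
      ∃ x ∈ openSegment ℝ u v, ∃ g, Amb g ∧ g '' K.carrier = K'.carrier ∧ LocAff g x) ∧
      (∀ {u v : Space}, u ≠ v → segment ℝ u v ⊆ K'.carrier →
      ∃ x ∈ openSegment ℝ u v, ∃ g, Amb g ∧ g '' K'.carrier = K.carrier ∧ LocAff g x) := by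
    -- Near `x` the first map is affine, so it sends a short segment to a segment of `K₂`. The
    -- second statement applies there, and the point it provides is pulled back. This is why the
    -- point may only be prescribed up to a segment.
    have comp : ∀ {K₁ K₂ K₃ : Knot}, (∀ {u v : Space}, u ≠ v → segment ℝ u v ⊆ K₁.carrier →
        ∃ x ∈ openSegment ℝ u v, ∃ g, Amb g ∧ g '' K₁.carrier = K₂.carrier ∧ LocAff g x) →
        (∀ {u v : Space}, u ≠ v → segment ℝ u v ⊆ K₂.carrier →
        ∃ x ∈ openSegment ℝ u v, ∃ g, Amb g ∧ g '' K₂.carrier = K₃.carrier ∧ LocAff g x) →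
        (∀ {u v : Space}, u ≠ v → segment ℝ u v ⊆ K₁.carrier →
        ∃ x ∈ openSegment ℝ u v, ∃ g, Amb g ∧ g '' K₁.carrier = K₃.carrier ∧ LocAff g x) := by
      intro K₁ K₂ K₃ h1 h2 u v huv hs
      obtain ⟨x, hx, g, hg, hgi, A, hA, hAe⟩ := h1 huv hs
      obtain ⟨ρ, hρ, hball⟩ := Metric.eventually_nhds_iff_ball.1 hAe
      -- a smaller segment around `x`
      obtain ⟨δ, hδ, hδ1, hu', hv'⟩ : ∃ δ : ℝ, 0 < δ ∧ δ < 1 ∧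
          AffineMap.lineMap x u δ ∈ Metric.ball x ρ ∧ AffineMap.lineMap x v δ ∈ Metric.ball x ρ := by
        have hc : ∀ u : Space, Tendsto (fun s : ℝ => (AffineMap.lineMap x u s : Space)) (𝓝[>] 0) (𝓝 x) := by
          intro u
          have : Continuous (fun s : ℝ => (AffineMap.lineMap x u s : Space)) :=
            AffineMap.lineMap_continuous
          have := this.tendsto 0
          simp only [AffineMap.lineMap_apply_zero] at this
          exact this.mono_left nhdsWithin_le_nhds
        obtain ⟨δ, h1, h2, h3⟩ := ((hc u).eventually (Metric.ball_mem_nhds x hρ)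
          |>.and (((hc v).eventually (Metric.ball_mem_nhds x hρ)).and
          (Ioo_mem_nhdsGT (zero_lt_one' ℝ)))).exists
        exact ⟨δ, h3.1, h3.2, h1, h2⟩
      set u' : Space := AffineMap.lineMap x u δ
      set v' : Space := AffineMap.lineMap x v δ
      have hu's : u' ∈ openSegment ℝ u v := by
        obtain ⟨p, q, hp, hq, hpq, rfl⟩ := hx
        refine ⟨(1 - δ) * p + δ, (1 - δ) * q, by nlinarith, by nlinarith, by linear_combination (1 - δ) * hpq, ?_⟩
        simp only [u', AffineMap.lineMap_apply_module]
        module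
      have hv's : v' ∈ openSegment ℝ u v := by
        obtain ⟨p, q, hp, hq, hpq, rfl⟩ := hx
        refine ⟨(1 - δ) * p, (1 - δ) * q + δ, by nlinarith, by nlinarith, by linear_combination (1 - δ) * hpq, ?_⟩
        simp only [v', AffineMap.lineMap_apply_module]
        module
      have hu'v' : u' ≠ v' := by
        intro h
        have : δ • (u - v) = 0 := by
          have h' : (AffineMap.lineMap x u δ : Space) = AffineMap.lineMap x v δ := h
          rw [AffineMap.lineMap_apply_module, AffineMap.lineMap_apply_module, ← sub_eq_zero] at h'
          rw [← h']; module
        rcases smul_eq_zero.1 this with h | h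
        · exact hδ.ne' h
        · exact huv (sub_eq_zero.1 h)
      have hsso : segment ℝ u' v' ⊆ openSegment ℝ u v := (convex_openSegment u v).segment_subset hu's hv's
      have hss := hsso.trans (openSegment_subset_segment ℝ u v)
      have hsball : segment ℝ u' v' ⊆ Metric.ball x ρ := (convex_ball x ρ).segment_subset hu' hv'
      have himgs : A '' segment ℝ u' v' = segment ℝ (A u') (A v') :=
        image_segment ℝ A.toAffineMap u' v'
      have himgo : A '' openSegment ℝ u' v' = openSegment ℝ (A u') (A v') :=
        image_openSegment ℝ A.toAffineMap u' v'
      obtain ⟨x₂, hx2, g₂, hg2, hgi2, A₂, hA2, hAe2⟩ := h2 (u := A u') (v := A v')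
        (A.injective.ne hu'v') (by
          rw [← himgs, ← hgi]
          rintro _ ⟨y, hy, rfl⟩
          exact ⟨y, hs (hss hy), hball y (hsball hy)⟩)
      rw [← himgo] at hx2
      obtain ⟨y, hy, rfl⟩ := hx2
      refine ⟨y, hsso (openSegment_subset_segment ℝ _ _ hy), g₂ ∘ g, hg2.comp hg,
        by rw [image_comp, hgi, hgi2], A.trans A₂, hA.trans hA2, ?_⟩
      · have hyb := hsball (openSegment_subset_segment ℝ _ _ hy)
        filter_upwards [Metric.isOpen_ball.mem_nhds hyb,
          (A.toAffineMap.continuous_of_finiteDimensional.tendsto y).eventually hAe2] with z hz1 hz2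
        show g₂ (g z) = A₂ (A z)
        rw [hball z hz1]; exact hz2
    intro K K' h
    induction h with
    | rel K K' h => exact ⟨step (canMove_of_deltaMove h).1, step (canMove_of_deltaMove h).2⟩
    | refl K =>
      have : CanMove K K := ⟨∅, by simp, fun x _ _ => ⟨id, ⟨Function.injective_id, fun K => K.becomes_self (by simp)⟩,
        by simp, _, GoodAff.refl, by simp⟩⟩
      exact ⟨step this, step this⟩
    | symm K K' _ ih => exact ⟨ih.2, ih.1⟩
    | trans K₁ K₂ K₃ _ _ ih1 ih2 => exact ⟨comp ih1.1 ih2.1, comp ih2.2 ih1.2⟩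
  exact (key K K' h).1 huv hs

end KnotMosaic

namespace KnotMosaic

open Set Filter Topology

/-! ### Shrinking one side of a knot -/

theorem affineIndependent_swap {a b c : Space} (h : AffineIndependent ℝ ![a, b, c]) :
    AffineIndependent ℝ ![a, c, b] := by
  have := (affineIndependent_equiv (Equiv.swap (1 : Fin 3) 2)).2 h
  convert this using 1
  ext i; fin_cases i <;> rfl

theorem affineIndependent_cyclic {a b c : Space} (h : AffineIndependent ℝ ![a, b, c]) :
    AffineIndependent ℝ ![b, c, a] := by
  have := (affineIndependent_equiv (finRotate 3)).2 h
  convert this using 1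
  ext i; fin_cases i <;> rfl

theorem lt_combo {x y k r : ℝ} (hr : r ∈ Icc (0 : ℝ) 1) (hx : k < x) (hy : k < y) :
    k < (1 - r) * x + r * y := by
  rcases eq_or_lt_of_le hr.1 with h | h
  · rw [← h]; linarith
  · nlinarith [mul_pos h (sub_pos.2 hy), mul_nonneg (sub_nonneg.2 hr.2) (sub_pos.2 hx).le]

theorem combo_lt {x y k r : ℝ} (hr : r ∈ Icc (0 : ℝ) 1) (hx : x < k) (hy : y < k) :
    (1 - r) * x + r * y < k := by
  linarith [lt_combo hr (neg_lt_neg hx) (neg_lt_neg hy)]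

theorem le_combo {x y k r : ℝ} (hr : r ∈ Icc (0 : ℝ) 1) (hx : k ≤ x) (hy : k ≤ y) :
    k ≤ (1 - r) * x + r * y := by
  nlinarith [mul_nonneg hr.1 (sub_nonneg.2 hy), mul_nonneg (sub_nonneg.2 hr.2) (sub_nonneg.2 hx)]

theorem combo_le {x y k r : ℝ} (hr : r ∈ Icc (0 : ℝ) 1) (hx : x ≤ k) (hy : y ≤ k) :
    (1 - r) * x + r * y ≤ k := by
  linarith [le_combo hr (neg_le_neg hx) (neg_le_neg hy)]

theorem exists_affine_smul (f : Space →ₗ[ℝ] ℝ) (c η : ℝ) (z : Space) :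
    ∃ F : Space →ᵃ[ℝ] Space, ∀ x, F x = ((f x - c) / η) • z := by
  refine ⟨((LinearMap.toSpanSingleton ℝ Space z).toAffineMap).comp
    (η⁻¹ • (f.toAffineMap - AffineMap.const ℝ Space c)), fun x => ?_⟩
  simp [LinearMap.toSpanSingleton_apply, div_eq_inv_mul]

theorem lineMap_add_smul {E : Space → Space} (F : Space →ᵃ[ℝ] Space) {u v : Space} {r : ℝ} (k : ℝ)
    (h1 : E u = F u) (h2 : E v = F v) (h3 : E (AffineMap.lineMap u v r) = F (AffineMap.lineMap u v r)) :
    AffineMap.lineMap u v r + k • E (AffineMap.lineMap u v r) =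
      AffineMap.lineMap (u + k • E u) (v + k • E v) r := by
  rw [h1, h2, h3, AffineMap.apply_lineMap]
  simp only [AffineMap.lineMap_apply_module]; module

theorem exists_dual_pos {u v : Space} (h : u ≠ v) : ∃ g : Space →ₗ[ℝ] ℝ, g v < g u := by
  obtain ⟨i, hi⟩ := Function.ne_iff.1 h
  rcases lt_or_gt_of_ne hi with hi | hi
  · exact ⟨-LinearMap.proj i, by simpa using hi⟩
  · exact ⟨LinearMap.proj i, by simpa using hi⟩

/-- Near its end points, an arc leaving a plane consists of two segments. -/
theorem Arc'.exists_collar {B : Set Space} {a b : Space} (hB : Arc' B a b) (f g : Space →ₗ[ℝ] ℝ) {c : ℝ}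
    (ha : f a = c) (hb : f b = c) (hf : ∀ x ∈ B, x = a ∨ x = b ∨ c < f x) (hg : g b < g a) :
    ∃ (a₁ b₁ : Space) (η : ℝ), 0 < η ∧ f a₁ = c + η ∧ f b₁ = c + η ∧ segment ℝ a a₁ ⊆ B ∧
      segment ℝ b b₁ ⊆ B ∧ g b < g a₁ ∧ g b₁ < g a ∧ g b₁ < (g a + g b) / 2 ∧
      (g a + g b) / 2 < g a₁ ∧ ∀ x ∈ B, f x ≤ c + η → x ∈ segment ℝ a a₁ ∨ x ∈ segment ℝ b b₁ := by
  have hab := hB.ne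
  have start : ∀ {a b : Space}, Arc' B a b → f a = c → f b = c → (∀ x ∈ B, x = a ∨ x = b ∨ c < f x) →
      ∃ v S', c < f v ∧ B = segment ℝ a v ∪ S' ∧ IsClosed S' ∧ a ∉ S' := by
    intro a b hB ha hb hf
    obtain ⟨v, S', hav, rfl, hS, haS⟩ := hB.exists_start
    refine ⟨v, S', ?_, rfl, hS, haS⟩
    have hm : midpoint ℝ a v ∈ segment ℝ a v := midpoint_mem_segment a v
    have hfm : f (midpoint ℝ a v) = (c + f v) / 2 := by
      rw [midpoint_eq', map_add, map_smul, map_smul, ha]; simp; ring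
    rcases hf _ (Or.inl (right_mem_segment ℝ a v)) with h | h | h
    · exact absurd h hav.symm
    · rcases hf _ (Or.inl hm) with h' | h' | h'
      · rw [midpoint_eq_left_iff] at h'; exact absurd h' hav
      · rw [h, midpoint_eq_right_iff] at h'; exact absurd (h'.trans h.symm) hav
      · rw [hfm, h, hb] at h'; linarith
    · exact h
  obtain ⟨v, S, hv, hBS, hS, haS⟩ := start hB ha hb hf
  obtain ⟨v', S', hv', hBS', hS', hbS'⟩ := start hB.symm' hb ha (fun x hx => by
    rcases hf x hx with h | h | h <;> tauto)
  have hcomp : IsCompact (S ∩ S' ∩ B) := hB.isCompact.inter_left (hS.inter hS')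
  -- Away from its two end edges the arc is compact and strictly above the plane, so it stays a
  -- definite height above it.
  obtain ⟨δ, hδ, hδS⟩ : ∃ δ > 0, ∀ x ∈ S ∩ S' ∩ B, c + δ < f x := by
    have hcont : ContinuousOn f (S ∩ S' ∩ B) := (LinearMap.continuous_of_finiteDimensional f).continuousOn
    rcases (S ∩ S' ∩ B).eq_empty_or_nonempty with h | h
    · exact ⟨1, one_pos, by simp [h]⟩
    · obtain ⟨y, hy, hym⟩ := hcomp.exists_isMinOn h hcont
      have : c < f y := by
        rcases hf y hy.2 with h | h | h
        · exact absurd hy.1.1 (h ▸ haS)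
        · exact absurd hy.1.2 (h ▸ hbS')
        · exact h
      exact ⟨(f y - c) / 2, by linarith, fun x hx => by have := hym hx; simp only [mem_ofPred_eq] at this; linarith⟩
  have hlim : ∀ u w : Space, ∀ k : ℝ, Tendsto (fun η : ℝ => g ((1 - η / k) • u + (η / k) • w)) (𝓝[>] 0) (𝓝 (g u)) := by
    intro u w k
    have hc : Continuous (fun η : ℝ => g ((1 - η / k) • u + (η / k) • w)) :=
      (LinearMap.continuous_of_finiteDimensional g).comp (by fun_prop)
    have := hc.tendsto 0
    simp only [zero_div, sub_zero, one_smul, zero_smul, add_zero] at this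
    exact this.mono_left nhdsWithin_le_nhds
  have hm : 0 < min δ (min (f v - c) (f v' - c)) := lt_min hδ (lt_min (by linarith) (by linarith))
  -- The height `η` is below `δ` and both end edges. It is also small enough for `g` to keep the two
  -- collar segments on opposite sides of the mean of `g a` and `g b`.
  obtain ⟨η, h1, h2, h3⟩ := (((hlim a v (f v - c)).eventually (lt_mem_nhds (show (g a + g b) / 2 < g a by linarith))).and
    (((hlim b v' (f v' - c)).eventually (gt_mem_nhds (show g b < (g a + g b) / 2 by linarith))).and
    (Ioo_mem_nhdsGT hm))).exists
  have hη := h3.1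
  have hη1 : η < δ := h3.2.trans_le (min_le_left _ _)
  have hη2 : η < f v - c := h3.2.trans_le ((min_le_right _ _).trans (min_le_left _ _))
  have hη3 : η < f v' - c := h3.2.trans_le ((min_le_right _ _).trans (min_le_right _ _))
  have point : ∀ {a v : Space}, f a = c → η < f v - c →
      (1 - η / (f v - c)) • a + (η / (f v - c)) • v ∈ segment ℝ a v ∧
      f ((1 - η / (f v - c)) • a + (η / (f v - c)) • v) = c + η ∧
      ∀ x ∈ segment ℝ a v, f x ≤ c + η → x ∈ segment ℝ a ((1 - η / (f v - c)) • a + (η / (f v - c)) • v) := by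
    intro a v ha h
    have hk : 0 < f v - c := hη.trans h
    refine ⟨mem_segment'.2 ⟨_, ⟨by positivity, (div_le_one hk).2 h.le⟩, rfl⟩, ?_, ?_⟩
    · rw [map_add, map_smul, map_smul, ha]; simp only [smul_eq_mul]; field_simp; ring
    · intro x hx hxf
      obtain ⟨s, hs, rfl⟩ := mem_segment'.1 hx
      rw [map_add, map_smul, map_smul, ha, smul_eq_mul, smul_eq_mul] at hxf
      refine mem_segment'.2 ⟨s * (f v - c) / η, ⟨by have := hs.1; positivity, ?_⟩, ?_⟩
      · rw [div_le_one hη]; linarith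
      · match_scalars
        · field_simp; ring
        · field_simp
  obtain ⟨p1, p2, p3⟩ := point ha hη2
  obtain ⟨q1, q2, q3⟩ := point hb hη3
  refine ⟨_, _, η, hη, p2, q2, (segment_subset_left p1).trans (hBS ▸ subset_union_left),
    (segment_subset_left q1).trans (hBS' ▸ subset_union_left), by linarith, by linarith, h2, h1, ?_⟩
  intro x hx hxf
  rcases hBS.le hx with h | h
  · exact Or.inl (p3 x h hxf)
  rcases hBS'.le hx with h' | h'
  · exact Or.inr (q3 x h' hxf)
  have := hδS x ⟨⟨h, h'⟩, hx⟩
  linarith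

theorem combo₃_pos {α β γ x y z : ℝ} (hα : 0 ≤ α) (hβ : 0 ≤ β) (hγ : 0 ≤ γ) (h : α + β + γ = 1)
    (hx : 0 < x) (hy : 0 < y) (hz : 0 < z) : 0 < α * x + β * y + γ * z := by
  have h1 := mul_nonneg hα hx.le
  have h2 := mul_nonneg hβ hy.le
  have h3 := mul_nonneg hγ hz.le
  rcases hα.eq_or_lt with h4 | h4
  · rcases hβ.eq_or_lt with h5 | h5
    · have : γ = 1 := by linarith
      rw [this]; linarith
    · linarith [mul_pos h5 hy]
  · linarith [mul_pos h4 hx]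

/-- Replacing two disjoint segments crossing a slab by paths with a first edge in its boundary. -/
theorem Knot.becomes_add_feet {K : Knot} {T C : Set Space} {a b a' b' a₂ b₂ : Space}
    (f g : Space →ₗ[ℝ] ℝ) {c d : ℝ} (hK : K.carrier = (T ∪ C ∪ segment ℝ b b₂) ∪ segment ℝ a a₂)
    (hcd : c < d) (ha : f a = c) (hb : f b = c) (ha' : f a' = c) (hb' : f b' = c)
    (ha₂ : f a₂ = d) (hb₂ : f b₂ = d) (hT : ∀ x ∈ T, f x ≤ c)
    (hTc : ∀ x ∈ T, f x = c → x = a ∨ x = b) (hC : ∀ x ∈ C, d ≤ f x)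
    (h1 : g b < g a) (h2 : g b < g a') (h3 : g b' < g a) (h4 : g b' < g a') (h5 : g b₂ < g a₂)
    (haa : a ≠ a') (hbb : b ≠ b') :
    K.Becomes (T ∪ (segment ℝ a a' ∪ (segment ℝ a' a₂ ∪ C ∪ segment ℝ b' b₂) ∪ segment ℝ b b')) := by
  -- The height `f` of a point of the triangle determines the weight of its top vertex, so `T` and
  -- `C` can only be met at the bottom and at the top. At equal heights `g` separates the strand at
  -- `a` from the strand at `b`.
  have level : ∀ {a a' a₂ : Space} {α β γ : ℝ}, f a = c → f a' = c → f a₂ = d → α + β + γ = 1 →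
      f (α • a + β • a₂ + γ • a') = c + β * (d - c) := by
    intro a a' a₂ α β γ ha ha' ha₂ h
    simp only [map_add, map_smul, smul_eq_mul, ha, ha', ha₂]
    linear_combination c * h
  have level' : ∀ {a a₂ : Space} {r : ℝ}, f a = c → f a₂ = d →
      f ((1 - r) • a + r • a₂) = c + r * (d - c) := by
    intro a a₂ r ha ha₂
    simp only [map_add, map_smul, smul_eq_mul, ha, ha₂]; ring
  have hdc : 0 < d - c := sub_pos.2 hcd
  have low : ∀ {β : ℝ}, 0 ≤ β → c + β * (d - c) ≤ c → β = 0 := by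
    intro β hβ h
    nlinarith
  have high : ∀ {a a' a₂ : Space} {α β γ : ℝ}, 0 ≤ α → 0 ≤ γ → α + β + γ = 1 →
      d ≤ c + β * (d - c) → α • a + β • a₂ + γ • a' = a₂ := by
    intro a a' a₂ α β γ h1 h2 h h'
    have : 1 ≤ β := by nlinarith
    have e1 : α = 0 := by linarith
    have e2 : γ = 0 := by linarith
    have e3 : β = 1 := by linarith
    rw [e1, e2, e3]; module
  have same : ∀ {β r : ℝ}, c + β * (d - c) = c + r * (d - c) → r = β := by
    intro β r h
    have : (r - β) * (d - c) = 0 := by linarith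
    rcases mul_eq_zero.1 this with h | h <;> linarith
  have indep : ∀ {a a' a₂ : Space}, a ≠ a' → f a = c → f a' = c → f a₂ = d →
      AffineIndependent ℝ ![a, a₂, a'] := by
    intro a a' a₂ h ha ha' ha₂
    exact affineIndependent_swap (affineIndependent_of_dual h f (ha.trans ha'.symm) (by
      rw [ha, ha₂]; exact hcd.ne'))
  refine (Knot.becomes_add_vertex hK (indep haa ha ha' ha₂) ?_).trans fun K' hK' => ?_
  · rintro x ⟨hx, hxh⟩
    obtain ⟨α, β, γ, hα, hβ, hγ, hs, rfl⟩ := mem_convexHull₃.1 hxh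
    rcases hx with (hx | hx) | hx
    · have hβ0 := low hβ (level ha ha' ha₂ hs ▸ hT _ hx)
      rcases hTc _ hx (by rw [level ha ha' ha₂ hs, hβ0]; ring) with h | h
      · exact Or.inl h
      · have := congrArg g h
        simp only [map_add, map_smul, smul_eq_mul] at this
        subst hβ0
        have h := combo₃_pos hα le_rfl hγ hs (sub_pos.2 h1) (sub_pos.2 h1) (sub_pos.2 h2)
        refine absurd ?_ h.ne'
        linear_combination this - g b * hs
    · exact Or.inr (high hα hγ hs (level ha ha' ha₂ hs ▸ hC _ hx))
    · obtain ⟨r, hr, hx⟩ := mem_segment'.1 hx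
      have hf := congrArg f hx
      rw [level ha ha' ha₂ hs, level' hb hb₂] at hf
      obtain rfl := same hf
      have := congrArg g hx
      simp only [map_add, map_smul, smul_eq_mul] at this
      have h := combo₃_pos hα hβ hγ hs (sub_pos.2 h1) (sub_pos.2 h5) (sub_pos.2 h2)
      refine absurd ?_ h.ne'
      linear_combination this - g b * hs
  · have hK'' : K'.carrier = (T ∪ C ∪ (segment ℝ a a' ∪ segment ℝ a' a₂)) ∪ segment ℝ b b₂ := by
      rw [hK']; ac_rfl
    have e : T ∪ (segment ℝ a a' ∪ (segment ℝ a' a₂ ∪ C ∪ segment ℝ b' b₂) ∪ segment ℝ b b') =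
        (T ∪ C ∪ (segment ℝ a a' ∪ segment ℝ a' a₂)) ∪ (segment ℝ b b' ∪ segment ℝ b' b₂) := by
      ac_rfl
    rw [e]
    refine Knot.becomes_add_vertex hK'' (indep hbb hb hb' hb₂) ?_
    rintro x ⟨hx, hxh⟩
    obtain ⟨α, β, γ, hα, hβ, hγ, hs, rfl⟩ := mem_convexHull₃.1 hxh
    rcases hx with (hx | hx) | hx | hx
    · have hβ0 := low hβ (level hb hb' hb₂ hs ▸ hT _ hx)
      rcases hTc _ hx (by rw [level hb hb' hb₂ hs, hβ0]; ring) with h | h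
      · have := congrArg g h
        simp only [map_add, map_smul, smul_eq_mul] at this
        subst hβ0
        have h := combo₃_pos hα le_rfl hγ hs (sub_pos.2 h1) (sub_pos.2 h1) (sub_pos.2 h3)
        refine absurd ?_ h.ne'
        linear_combination g a * hs - this
      · exact Or.inl h
    · exact Or.inr (high hα hγ hs (level hb hb' hb₂ hs ▸ hC _ hx))
    · obtain ⟨r, hr, hx⟩ := mem_segment'.1 hx
      have hf := congrArg f hx
      have e2 : f ((1 - r) • a + r • a') = c := by
        simp only [map_add, map_smul, smul_eq_mul, ha, ha']; ring
      rw [level hb hb' hb₂ hs, e2] at hf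
      have hβ0 := low hβ hf.le
      have hg := congrArg g hx
      simp only [map_add, map_smul, smul_eq_mul] at hg
      subst hβ0
      have l1 := lt_combo hr h1 h2
      have l2 := lt_combo hr h3 h4
      have h := combo₃_pos hα le_rfl hγ hs (sub_pos.2 l1) (sub_pos.2 l1) (sub_pos.2 l2)
      refine absurd ?_ h.ne'
      linear_combination ((1 - r) * g a + r * g a') * hs - hg
    · obtain ⟨r, hr, hx⟩ := mem_segment'.1 hx
      have hf := congrArg f hx
      rw [level hb hb' hb₂ hs, level' ha' ha₂] at hf
      obtain rfl := same hf
      have := congrArg g hx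
      simp only [map_add, map_smul, smul_eq_mul] at this
      have h := combo₃_pos hα hβ hγ hs (sub_pos.2 h2) (sub_pos.2 h5) (sub_pos.2 h4)
      refine absurd ?_ h.ne'
      linear_combination g a' * hs - this

set_option maxHeartbeats 1000000 in
/-- The part of a knot on one side of a plane can be shrunk towards a point of the plane. -/
theorem Knot.becomes_shrink {L : Knot} {T B : Set Space} {a b o : Space} {f : Space →ₗ[ℝ] ℝ} {c s : ℝ}
    (hL : L.carrier = T ∪ B) (hT : ∀ x ∈ T, f x ≤ c) (hTc : ∀ x ∈ T, f x = c → x = a ∨ x = b)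
    (hB : Arc' B a b) (ha : f a = c) (hb : f b = c) (hBf : ∀ x ∈ B, x = a ∨ x = b ∨ c < f x)
    (ho : o ∈ openSegment ℝ a b) (hs0 : 0 < s) (hs1 : s < 1) :
    L.Becomes (T ∪ (segment ℝ a (AffineMap.homothety o s a) ∪ AffineMap.homothety o s '' B ∪
      segment ℝ b (AffineMap.homothety o s b))) := by
  obtain ⟨g, hg⟩ := exists_dual_pos hB.ne
  obtain ⟨a₁, b₁, η, hη, hfa, hfb, haB, hbB, hg1, hg2, hg3, hg4, hcol⟩ := hB.exists_collar f g ha hb hBf hg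
  set A : Space →ᵃ[ℝ] Space := AffineMap.homothety o s with hA
  have hAx : ∀ x, A x = x + (s - 1) • (x - o) := by
    intro x; rw [hA, AffineMap.homothety_apply]
    simp only [vsub_eq_sub, vadd_eq_add]; module
  obtain ⟨p, q, hp, hq, hpq, hpo⟩ := ho
  have hfo : f o = c := by
    rw [← hpo, map_add, map_smul, map_smul, ha, hb, ← add_smul, hpq, one_smul]
  have hgo : g o = p * g a + q * g b := by rw [← hpo]; simp
  have hfA : ∀ x, f (A x) = c + s * (f x - c) := by
    intro x; rw [hAx, map_add, map_smul, map_sub, hfo, smul_eq_mul]; ring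
  have hgA : ∀ x, g (A x) = (1 - s) * g o + s * g x := by
    intro x; rw [hAx, map_add, map_smul, map_sub, smul_eq_mul]; ring
  set m := (g a + g b) / 2 with hm
  have hLc : ∀ x ∈ L.carrier, f x = c → x = a ∨ x = b := by
    intro x hx hfx
    rcases hL.le hx with h | h
    · exact hTc x h hfx
    · rcases hBf x h with h | h | h
      · exact Or.inl h
      · exact Or.inr h
      · linarith
  have hBc : ∀ x ∈ B, c ≤ f x := by
    intro x hx
    rcases hBf x hx with rfl | rfl | h <;> linarith
  have seg : ∀ {a a₁ x : Space}, f a = c → f a₁ = c + η → x ∈ segment ℝ a a₁ →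
      x = (1 - (f x - c) / η) • a + ((f x - c) / η) • a₁ ∧ 0 ≤ (f x - c) / η ∧ (f x - c) / η ≤ 1 := by
    intro a a₁ x ha ha1 hx
    obtain ⟨r, hr, rfl⟩ := mem_segment'.1 hx
    have : (f ((1 - r) • a + r • a₁) - c) / η = r := by
      rw [map_add, map_smul, map_smul, ha, ha1]; simp only [smul_eq_mul]; field_simp; ring
    rw [this]; exact ⟨rfl, hr.1, hr.2⟩
  -- points of the slab
  have slab : ∀ x ∈ L.carrier, c ≤ f x → f x ≤ c + η →
      (x ∈ segment ℝ a a₁ ∧ m < g x) ∨ (x ∈ segment ℝ b b₁ ∧ g x < m) := by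
    intro x hx h1 h2
    have : x ∈ segment ℝ a a₁ ∨ x ∈ segment ℝ b b₁ := by
      rcases hL.le hx with h | h
      · rcases hTc x h (le_antisymm (hT x h) h1) with rfl | rfl
        · exact Or.inl (left_mem_segment ℝ _ _)
        · exact Or.inr (left_mem_segment ℝ _ _)
      · exact hcol x h h2
    have hma : m < g a := by rw [hm]; linarith
    have hmb : g b < m := by rw [hm]; linarith
    refine this.imp (fun h => ⟨h, ?_⟩) (fun h => ⟨h, ?_⟩)
    · obtain ⟨r, hr, rfl⟩ := mem_segment'.1 h
      simp only [map_add, map_smul, smul_eq_mul]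
      exact lt_combo hr hma hg4
    · obtain ⟨r, hr, rfl⟩ := mem_segment'.1 h
      simp only [map_add, map_smul, smul_eq_mul]
      exact combo_lt hr hmb hg3
  classical
  -- The isotopy is `x + t (s - 1) E x`. It fixes the part below the plane, is a homothety with
  -- centre `o` above height `c + η`, and interpolates linearly along each of the two collar
  -- segments, which `g` tells apart.
  obtain ⟨E, hE⟩ : ∃ E : Space → Space, ∀ x, E x = if f x ≤ c then 0 else if c + η ≤ f x then x - o else
    if m ≤ g x then ((f x - c) / η) • (a₁ - o) else ((f x - c) / η) • (b₁ - o) := ⟨_, fun x => rfl⟩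
  have E1 : ∀ x, f x ≤ c → E x = 0 := fun x h => by rw [hE, if_pos h]
  have E2 : ∀ x, c + η ≤ f x → E x = x - o := fun x h => by
    rw [hE, if_neg (by linarith), if_pos h]
  have E3 : ∀ x ∈ L.carrier, c ≤ f x → f x ≤ c + η → m ≤ g x →
      x ∈ segment ℝ a a₁ ∧ E x = ((f x - c) / η) • (a₁ - o) := by
    intro x hx h1 h2 h3
    have hxs := ((slab x hx h1 h2).resolve_right fun h => by linarith [h.2]).1
    refine ⟨hxs, ?_⟩
    rcases eq_or_lt_of_le h1 with h | h
    · rw [E1 x h.ge, ← h]; simp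
    rcases eq_or_lt_of_le h2 with h' | h'
    · have := (seg ha hfa hxs).1
      rw [h', add_sub_cancel_left, div_self hη.ne'] at this
      rw [E2 x h'.ge, h', add_sub_cancel_left, div_self hη.ne', this]; module
    · rw [hE, if_neg (by linarith), if_neg (by linarith), if_pos h3]
  have E4 : ∀ x ∈ L.carrier, c ≤ f x → f x ≤ c + η → g x ≤ m →
      x ∈ segment ℝ b b₁ ∧ E x = ((f x - c) / η) • (b₁ - o) := by
    intro x hx h1 h2 h3
    have hxs := (slab x hx h1 h2).resolve_left fun h => by linarith [h.2]
    refine ⟨hxs.1, ?_⟩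
    rcases eq_or_lt_of_le h1 with h | h
    · rw [E1 x h.ge, ← h]; simp
    rcases eq_or_lt_of_le h2 with h' | h'
    · have := (seg hb hfb hxs.1).1
      rw [h', add_sub_cancel_left, div_self hη.ne'] at this
      rw [E2 x h'.ge, h', add_sub_cancel_left, div_self hη.ne', this]; module
    · rw [hE, if_neg (by linarith), if_neg (by linarith), if_neg (by linarith [hxs.2])]
  -- heights
  have Ef : ∀ x ∈ L.carrier, c ≤ f x → f (E x) = f x - c := by
    intro x hx h1
    rcases le_total (c + η) (f x) with h | h
    · rw [E2 x h, map_sub, hfo]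
    · rcases le_total m (g x) with h' | h'
      · rw [(E3 x hx h1 h h').2, map_smul, map_sub, hfa, hfo, smul_eq_mul]; field_simp; ring
      · rw [(E4 x hx h1 h h').2, map_smul, map_sub, hfb, hfo, smul_eq_mul]; field_simp; ring
  have step : L.Becomes ((fun t x => x + (t * (s - 1)) • E x) 1 '' L.carrier) := by
    refine L.becomes_of_piecewise (fun t x => x + (t * (s - 1)) • E x)
      [f.toAffineMap - AffineMap.const ℝ Space c, f.toAffineMap - AffineMap.const ℝ Space (c + η),
        g.toAffineMap - AffineMap.const ℝ Space m] (fun x => by fun_prop) (by simp) ?_ ?_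
    · intro t ht x hx y hy hxy
      simp only at hxy
      obtain ⟨τ, hτ⟩ : ∃ τ, τ = t * (s - 1) := ⟨_, rfl⟩
      rw [← hτ] at hxy
      have hτ1 : 0 < 1 + τ := by rw [hτ]; nlinarith [ht.1, ht.2]
      have hfxy := congrArg f hxy
      simp only [map_add, map_smul, smul_eq_mul] at hfxy
      rcases le_or_gt (f x) c with hx1 | hx1
      · rcases le_or_gt (f y) c with hy1 | hy1
        · simpa [E1 x hx1, E1 y hy1] using hxy
        · rw [E1 x hx1, Ef y hy hy1.le, map_zero] at hfxy
          nlinarith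
      rcases le_or_gt (f y) c with hy1 | hy1
      · rw [E1 y hy1, Ef x hx hx1.le, map_zero] at hfxy
        nlinarith
      rw [Ef x hx hx1.le, Ef y hy hy1.le] at hfxy
      have hfe : f x = f y := by
        have : (1 + τ) * (f x - f y) = 0 := by linarith
        rcases mul_eq_zero.1 this with h | h <;> linarith
      rcases le_total (c + η) (f x) with h | h
      · rw [E2 x h, E2 y (hfe ▸ h)] at hxy
        have : (1 + τ) • (x - y) = 0 := by
          rw [← sub_eq_zero] at hxy; rw [← hxy]; module
        rcases smul_eq_zero.1 this with h | h
        · linarith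
        · exact sub_eq_zero.1 h
      · have hx0 := slab x hx hx1.le h
        have hy0 := slab y hy hy1.le (hfe ▸ h)
        -- Points of the two collar segments at the same height stay apart: the difference of `g` on
        -- their images is a convex combination of the positive numbers `g a - g b` and `(1 + τ) (g
        -- a₁ - g b₁)`.
        have cross : ∀ x ∈ L.carrier, ∀ y ∈ L.carrier, c < f x → f x ≤ c + η → f x = f y →
            x + τ • E x = y + τ • E y → m < g x → g y < m → False := by
          intro x hx y hy hx1 h hfe hxy hgx hgy
          obtain ⟨hxs, hxE⟩ := E3 x hx hx1.le h hgx.le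
          obtain ⟨hys, hyE⟩ := E4 y hy (by linarith) (by linarith) hgy.le
          obtain ⟨hx', hr0, hr1⟩ := seg ha hfa hxs
          obtain ⟨hy', -, -⟩ := seg hb hfb hys
          rw [hxE, hyE] at hxy
          rw [← hfe] at hy' hxy
          set r := (f x - c) / η
          have := congrArg g hxy
          rw [hx', hy'] at this
          simp only [map_add, map_smul, map_sub, smul_eq_mul] at this
          have h3 : 0 < (1 + τ) * (g a₁ - g b₁) := mul_pos hτ1 (by linarith)
          have := lt_combo ⟨hr0, hr1⟩ (sub_pos.2 hg) h3
          linarith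
        rcases hx0 with hx0 | hx0
        · rcases hy0 with hy0 | hy0
          · rw [(seg ha hfa hx0.1).1, (seg ha hfa hy0.1).1, hfe]
          · exact (cross x hx y hy hx1 h hfe hxy hx0.2 hy0.2).elim
        · rcases hy0 with hy0 | hy0
          · exact (cross y hy x hx hy1 (hfe ▸ h) hfe.symm hxy.symm hy0.2 hx0.2).elim
          · rw [(seg hb hfb hx0.1).1, (seg hb hfb hy0.1).1, hfe]
    · intro u v huv hl t ht r hr
      simp only [List.mem_cons, List.not_mem_nil, or_false, forall_eq_or_imp, forall_eq,
        AffineMap.coe_sub, Pi.sub_apply, LinearMap.coe_toAffineMap, AffineMap.const_apply] at hl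
      obtain ⟨l1, l2, l3⟩ := hl
      have hu := huv (left_mem_segment ℝ _ _)
      have hv := huv (right_mem_segment ℝ _ _)
      have hw : AffineMap.lineMap u v r ∈ L.carrier := huv (mem_segment_iff_lineMap.2 ⟨r, hr, rfl⟩)
      have fw : f (AffineMap.lineMap u v r) = (1 - r) * f u + r * f v := by
        rw [AffineMap.lineMap_apply_module]; simp
      have gw : g (AffineMap.lineMap u v r) = (1 - r) * g u + r * g v := by
        rw [AffineMap.lineMap_apply_module]; simp
      rcases nonneg_or_nonpos l1 with h1 | h1
      swap
      · refine lineMap_add_smul (AffineMap.const ℝ Space 0) _ (E1 _ ?_) (E1 _ ?_) (E1 _ ?_)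
        · linarith
        · linarith
        · rw [fw]; exact combo_le hr (by linarith) (by linarith)
      rcases nonneg_or_nonpos l2 with h2 | h2
      · refine lineMap_add_smul (AffineMap.id ℝ Space - AffineMap.const ℝ Space o) _ (E2 _ ?_) (E2 _ ?_) (E2 _ ?_)
        · linarith
        · linarith
        · rw [fw]; exact le_combo hr (by linarith) (by linarith)
      have fw1 : c ≤ f (AffineMap.lineMap u v r) := by rw [fw]; exact le_combo hr (by linarith) (by linarith)
      have fw2 : f (AffineMap.lineMap u v r) ≤ c + η := by rw [fw]; exact combo_le hr (by linarith) (by linarith)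
      rcases nonneg_or_nonpos l3 with h3 | h3
      · obtain ⟨F, hF⟩ := exists_affine_smul f c η (a₁ - o)
        refine lineMap_add_smul F _ ?_ ?_ ?_
        · rw [hF]; exact (E3 u hu (by linarith) (by linarith) (by linarith)).2
        · rw [hF]; exact (E3 v hv (by linarith) (by linarith) (by linarith)).2
        · rw [hF]; exact (E3 _ hw fw1 fw2 (by rw [gw]; exact le_combo hr (by linarith) (by linarith))).2
      · obtain ⟨F, hF⟩ := exists_affine_smul f c η (b₁ - o)
        refine lineMap_add_smul F _ ?_ ?_ ?_
        · rw [hF]; exact (E4 u hu (by linarith) (by linarith) (by linarith)).2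
        · rw [hF]; exact (E4 v hv (by linarith) (by linarith) (by linarith)).2
        · rw [hF]; exact (E4 _ hw fw1 fw2 (by rw [gw]; exact combo_le hr (by linarith) (by linarith))).2
  have Gseg : ∀ {a a₁ : Space}, (∀ x ∈ segment ℝ a a₁, E x = ((f x - c) / η) • (a₁ - o)) →
      f a = c → f a₁ = c + η →
      (fun x => x + (s - 1) • E x) '' segment ℝ a a₁ = segment ℝ a (A a₁) := by
    intro a a₁ hE ha ha₁
    have key : ∀ r ∈ Icc (0 : ℝ) 1, (1 - r) • a + r • a₁ + (s - 1) • E ((1 - r) • a + r • a₁) =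
        (1 - r) • a + r • A a₁ := by
      intro r hr
      rw [hE _ (mem_segment'.2 ⟨r, hr, rfl⟩)]
      have : (f ((1 - r) • a + r • a₁) - c) / η = r := by
        rw [map_add, map_smul, map_smul, ha, ha₁]; simp only [smul_eq_mul]; field_simp; ring
      rw [this, hAx]; module
    ext y; constructor
    · rintro ⟨x, hx, rfl⟩
      obtain ⟨r, hr, rfl⟩ := mem_segment'.1 hx
      exact mem_segment'.2 ⟨r, hr, key r hr⟩
    · intro hy
      obtain ⟨r, hr, rfl⟩ := mem_segment'.1 hy
      exact ⟨_, mem_segment'.2 ⟨r, hr, rfl⟩, key r hr⟩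
  have hBL : B ⊆ L.carrier := hL ▸ subset_union_right
  have hma : m < g a := by rw [hm]; linarith
  have hmb : g b < m := by rw [hm]; linarith
  have inslab : ∀ {a a₁ x : Space}, f a = c → f a₁ = c + η → x ∈ segment ℝ a a₁ →
      c ≤ f x ∧ f x ≤ c + η := by
    intro a a₁ x ha ha₁ hx
    obtain ⟨r, hr, rfl⟩ := mem_segment'.1 hx
    simp only [map_add, map_smul, smul_eq_mul, ha, ha₁]
    exact ⟨le_combo hr le_rfl (by linarith), combo_le hr (by linarith) le_rfl⟩
  set C := {x ∈ B | c + η ≤ f x} with hCdef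
  have hBe : B = segment ℝ a a₁ ∪ C ∪ segment ℝ b b₁ := by
    refine Subset.antisymm (fun x hx => ?_) (union_subset (union_subset haB fun x hx => hx.1) hbB)
    rcases le_total (f x) (c + η) with h | h
    · rcases hcol x hx h with h | h
      · exact Or.inl (Or.inl h)
      · exact Or.inr h
    · exact Or.inl (Or.inr ⟨hx, h⟩)
  have himg : (fun x => x + (s - 1) • E x) '' L.carrier =
      (T ∪ A '' C ∪ segment ℝ b (A b₁)) ∪ segment ℝ a (A a₁) := by
    have e1 : (fun x => x + (s - 1) • E x) '' T = T := by
      rw [image_congr (g := id) fun x hx => by simp [E1 x (hT x hx)], image_id]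
    have e2 : (fun x => x + (s - 1) • E x) '' C = A '' C :=
      image_congr fun x hx => by rw [E2 x hx.2, hAx]
    have e3 := Gseg (a := a) (a₁ := a₁) (fun x hx => (E3 x (hBL (haB hx)) (inslab ha hfa hx).1
      (inslab ha hfa hx).2 (by
        obtain ⟨r, hr, rfl⟩ := mem_segment'.1 hx
        simp only [map_add, map_smul, smul_eq_mul]
        exact (lt_combo hr hma hg4).le)).2) ha hfa
    have e4 := Gseg (a := b) (a₁ := b₁) (fun x hx => (E4 x (hBL (hbB hx)) (inslab hb hfb hx).1
      (inslab hb hfb hx).2 (by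
        obtain ⟨r, hr, rfl⟩ := mem_segment'.1 hx
        simp only [map_add, map_smul, smul_eq_mul]
        exact (combo_lt hr hmb hg3).le)).2) hb hfb
    rw [hL, hBe, image_union, image_union, image_union, e1, e2, e3, e4]
    ac_rfl
  simp only [one_mul] at step
  refine step.trans fun K' hK' => ?_
  have himgseg : ∀ u v, A '' segment ℝ u v = segment ℝ (A u) (A v) := image_segment ℝ A
  rw [hBe, image_union, image_union, himgseg, himgseg]
  have hq' : q = 1 - p := by linarith
  have hgo1 : g b < g o := by rw [hgo, hq']; nlinarith [mul_pos hp (sub_pos.2 hg)]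
  have hgo2 : g o < g a := by rw [hgo, hq']; nlinarith [mul_pos hq (sub_pos.2 hg)]
  have hAne : ∀ {a : Space}, a ≠ o → a ≠ A a := by
    intro a h h'
    rw [hAx] at h'
    have : (s - 1) • (a - o) = 0 := by rw [← sub_eq_zero] at h'; rw [← neg_eq_zero, ← h']; module
    rcases smul_eq_zero.1 this with h1 | h1
    · linarith
    · exact h (sub_eq_zero.1 h1)
  have hs1' : 0 < 1 - s := by linarith
  -- The isotopy has left straight edges from `a` to `A a₁` and from `b` to `A b₁`. Rerouting them
  -- through `A a` and `A b` completes the homothetic copy of `B`.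
  refine Knot.becomes_add_feet f g (c := c) (d := c + s * η) (hK'.trans himg) (by nlinarith) ha hb ?_ ?_ ?_ ?_
    hT hTc ?_ hg ?_ ?_ ?_ ?_ (hAne ?_) (hAne ?_)
  · rw [hfA, ha]; ring
  · rw [hfA, hb]; ring
  · rw [hfA, hfa]; ring
  · rw [hfA, hfb]; ring
  · rintro _ ⟨x, hx, rfl⟩
    rw [hfA]; nlinarith [hx.2]
  · rw [hgA]; nlinarith
  · rw [hgA]; nlinarith
  · rw [hgA, hgA]; nlinarith
  · rw [hgA, hgA]; nlinarith
  · rintro rfl; linarith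
  · rintro rfl; linarith

end KnotMosaic

namespace KnotMosaic

open Set Filter Topology

/-! ### A knot with a trivial part on one side of a plane -/

theorem GoodAff.amb {A : Space ≃ᵃ[ℝ] Space} (hA : GoodAff A) : Amb A := ⟨A.injective, hA⟩

theorem segment_lineMap (u v : Space) {α β : ℝ} (h : α ≤ β) :
    segment ℝ (AffineMap.lineMap u v α : Space) (AffineMap.lineMap u v β) =
      (AffineMap.lineMap u v : ℝ →ᵃ[ℝ] Space) '' Icc α β := by
  rw [← segment_eq_Icc h, image_segment]

theorem openSegment_lineMap (u v : Space) {α β : ℝ} (h : α < β) :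
    openSegment ℝ (AffineMap.lineMap u v α : Space) (AffineMap.lineMap u v β) =
      (AffineMap.lineMap u v : ℝ →ᵃ[ℝ] Space) '' Ioo α β := by
  rw [← openSegment_eq_Ioo h, image_openSegment]

theorem segment_eq_lineMap_image (u v : Space) :
    segment ℝ u v = (AffineMap.lineMap u v : ℝ →ᵃ[ℝ] Space) '' Icc 0 1 :=
  segment_eq_image_lineMap ℝ u v

theorem segment_sdiff_openSegment {u v : Space} (huv : u ≠ v) {α β : ℝ} (h0 : 0 ≤ α) (h : α < β)
    (h1 : β ≤ 1) :
    segment ℝ u v \ openSegment ℝ (AffineMap.lineMap u v α : Space) (AffineMap.lineMap u v β) =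
      segment ℝ u (AffineMap.lineMap u v α) ∪ segment ℝ (AffineMap.lineMap u v β) v := by
  have e1 : segment ℝ u (AffineMap.lineMap u v α) =
      (AffineMap.lineMap u v : ℝ →ᵃ[ℝ] Space) '' Icc 0 α := by
    rw [← segment_lineMap u v h0, AffineMap.lineMap_apply_zero]
  have e2 : segment ℝ (AffineMap.lineMap u v β) v =
      (AffineMap.lineMap u v : ℝ →ᵃ[ℝ] Space) '' Icc β 1 := by
    rw [← segment_lineMap u v h1, AffineMap.lineMap_apply_one]
  rw [e1, e2, openSegment_lineMap u v h, segment_eq_lineMap_image,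
    ← image_sdiff (AffineMap.lineMap_injective ℝ huv), ← image_union]
  congr 1
  ext t
  simp only [Set.mem_sdiff, mem_Icc, mem_Ioo, mem_union]
  grind

/-- The carrier of a trivial knot can be straightened to a triangle by a map which is the identity
near some interior point of a given edge. -/
theorem Knot.IsTrivial.exists_amb {L : Knot} (hL : L.IsTrivial) {a b : Space} (hab : a ≠ b)
    (hs : segment ℝ a b ⊆ L.carrier) :
    ∃ (Z : Space → Space) (u v w o : Space) (κ : ℝ), Amb Z ∧ AffineIndependent ℝ ![u, v, w] ∧
      Z '' L.carrier = segment ℝ u v ∪ (segment ℝ v w ∪ segment ℝ w u) ∧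
      o ∈ openSegment ℝ a b ∧ o ∈ openSegment ℝ u v ∧ 0 < κ ∧ v - u = κ • (b - a) ∧
      ∀ᶠ y in 𝓝 o, Z y = y := by
  obtain ⟨T, hT, u, v, w, hind, hTc⟩ := hL
  obtain ⟨x, hx, h, hh, himg, A, hA, hev⟩ := exists_amb_of_equivalent hT hab hs
  obtain ⟨ρ, hρ, hball⟩ := Metric.eventually_nhds_iff_ball.1 hev
  -- two points near `x` with images on the same side
  obtain ⟨p, q, u, v, w, hpq, hp, hq, hpb, hqb, hind, hTc, hpu, hqu⟩ : ∃ p q u v w : Space, p ≠ q ∧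
      p ∈ openSegment ℝ a b ∧ q ∈ openSegment ℝ a b ∧ p ∈ Metric.ball x ρ ∧ q ∈ Metric.ball x ρ ∧
      AffineIndependent ℝ ![u, v, w] ∧
      T.carrier = segment ℝ u v ∪ (segment ℝ v w ∪ segment ℝ w u) ∧ A p ∈ segment ℝ u v ∧
      A q ∈ segment ℝ u v := by
    rw [openSegment_eq_image_lineMap] at hx
    obtain ⟨r, hr, rfl⟩ := hx
    -- Infinitely many points near `x` are sent into three sides of a triangle, so two of them go to
    -- the same side.
    set S : Set ℝ := Ioo 0 1 ∩ (AffineMap.lineMap a b : ℝ →ᵃ[ℝ] Space) ⁻¹' Metric.ball (AffineMap.lineMap a b r) ρ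
    have hS : S.Infinite := by
      refine infinite_of_mem_nhds r (inter_mem (Ioo_mem_nhds hr.1 hr.2) ?_)
      exact (AffineMap.lineMap_continuous (R := ℝ)).continuousAt.preimage_mem_nhds
        (Metric.ball_mem_nhds _ hρ)
    have hcov : S ⊆ {r | A (AffineMap.lineMap a b r) ∈ segment ℝ u v} ∩ S ∪
        ({r | A (AffineMap.lineMap a b r) ∈ segment ℝ v w} ∩ S ∪
        {r | A (AffineMap.lineMap a b r) ∈ segment ℝ w u} ∩ S) := by
      intro r' hr'
      have h1 : AffineMap.lineMap a b r' ∈ L.carrier :=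
        hs (mem_segment_iff_lineMap.2 ⟨r', Ioo_subset_Icc_self hr'.1, rfl⟩)
      have h2 : A (AffineMap.lineMap a b r') ∈ T.carrier := by
        rw [← hball _ hr'.2, ← himg]; exact mem_image_of_mem _ h1
      rw [hTc] at h2
      rcases h2 with (h | h) | h
      · exact Or.inl ⟨h, hr'⟩
      · exact Or.inr (Or.inl ⟨h, hr'⟩)
      · exact Or.inr (Or.inr ⟨h, hr'⟩)
    have key : ∀ u v w : Space, AffineIndependent ℝ ![u, v, w] →
        T.carrier = segment ℝ u v ∪ (segment ℝ v w ∪ segment ℝ w u) →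
        ({r | A (AffineMap.lineMap a b r) ∈ segment ℝ u v} ∩ S).Infinite → ∃ p q u v w : Space, p ≠ q ∧
      p ∈ openSegment ℝ a b ∧ q ∈ openSegment ℝ a b ∧ p ∈ Metric.ball (AffineMap.lineMap a b r) ρ ∧
      q ∈ Metric.ball (AffineMap.lineMap a b r) ρ ∧ AffineIndependent ℝ ![u, v, w] ∧
      T.carrier = segment ℝ u v ∪ (segment ℝ v w ∪ segment ℝ w u) ∧ A p ∈ segment ℝ u v ∧
      A q ∈ segment ℝ u v := by
      intro u v w hi hTc hinf
      obtain ⟨r₁, h1, r₂, h2, hne⟩ := hinf.nontrivial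
      refine ⟨AffineMap.lineMap a b r₁, AffineMap.lineMap a b r₂, u, v, w,
        (AffineMap.lineMap_injective ℝ hab).ne hne, ?_, ?_, h1.2.2, h2.2.2, hi, hTc, h1.1, h2.1⟩
      · rw [openSegment_eq_image_lineMap]; exact ⟨_, h1.2.1, rfl⟩
      · rw [openSegment_eq_image_lineMap]; exact ⟨_, h2.2.1, rfl⟩
    rcases infinite_union.1 (hS.mono hcov) with h | h
    · exact key u v w hind (by rw [hTc]; ac_rfl) h
    rcases infinite_union.1 h with h | h
    · exact key v w u (affineIndependent_cyclic hind) (by rw [hTc]; ac_rfl) h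
    · exact key w u v (affineIndependent_cyclic (affineIndependent_cyclic hind)) (by rw [hTc]; ac_rfl) h
  set o := midpoint ℝ p q with ho
  have hob : o ∈ Metric.ball x ρ :=
    (convex_ball x ρ).segment_subset hpb hqb (midpoint_mem_segment p q)
  -- Near `o` the map `h` is the affine map `A`. Composing with the inverse of `A` makes it the
  -- identity there and still gives a triangle.
  have hZ : ∀ᶠ y in 𝓝 o, (A.symm ∘ h) y = y := by
    filter_upwards [Metric.isOpen_ball.mem_nhds hob] with y hy
    simp [hball y hy]
  have hoab : o ∈ openSegment ℝ a b :=
    (convex_openSegment a b).segment_subset hp hq (midpoint_mem_segment p q)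
  have hseg : ∀ a b, A.symm '' segment ℝ a b = segment ℝ (A.symm a) (A.symm b) :=
    image_segment ℝ A.symm.toAffineMap
  have himg' : (A.symm ∘ h) '' L.carrier = segment ℝ (A.symm u) (A.symm v) ∪
      (segment ℝ (A.symm v) (A.symm w) ∪ segment ℝ (A.symm w) (A.symm u)) := by
    rw [image_comp, himg, hTc, image_union, image_union, hseg, hseg, hseg]
  have hind' : AffineIndependent ℝ ![A.symm u, A.symm v, A.symm w] := by
    have := hind.map' A.symm.toAffineMap A.symm.injective
    convert this using 1
    ext i; fin_cases i <;> rfl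
  have hpu' : p ∈ segment ℝ (A.symm u) (A.symm v) := by
    rw [← hseg]; exact ⟨_, hpu, by simp⟩
  have hqu' : q ∈ segment ℝ (A.symm u) (A.symm v) := by
    rw [← hseg]; exact ⟨_, hqu, by simp⟩
  generalize A.symm u = u' at *
  generalize A.symm v = v' at *
  generalize A.symm w = w' at *
  have hAmb : Amb (A.symm ∘ h) := hA.symm.amb.comp hh
  have huv := (ne_of_affineIndependent hind').1
  obtain ⟨s₁, hs1, hp'⟩ := mem_segment'.1 hpu'
  obtain ⟨s₂, hs2, hq'⟩ := mem_segment'.1 hqu'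
  obtain ⟨r₁, -, hp''⟩ := mem_segment'.1 (openSegment_subset_segment ℝ _ _ hp)
  obtain ⟨r₂, -, hq''⟩ := mem_segment'.1 (openSegment_subset_segment ℝ _ _ hq)
  have hs12 : s₁ - s₂ ≠ 0 := fun h => hpq (by rw [hp', hq', sub_eq_zero.1 h])
  have hr12 : r₁ - r₂ ≠ 0 := fun h => hpq (by rw [hp'', hq'', sub_eq_zero.1 h])
  have hpar : (s₁ - s₂) • (v' - u') = (r₁ - r₂) • (b - a) := by
    have h1 : p - q = (s₁ - s₂) • (v' - u') := by rw [hp', hq']; module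
    have h2 : p - q = (r₁ - r₂) • (b - a) := by rw [hp'', hq'']; module
    rw [← h1, h2]
  have hpar' : v' - u' = ((r₁ - r₂) / (s₁ - s₂)) • (b - a) := by
    rw [div_eq_inv_mul, mul_smul, ← hpar, smul_smul, inv_mul_cancel₀ hs12, one_smul]
  have houv : o ∈ openSegment ℝ u' v' := by
    have e : o = (1 - (s₁ + s₂) / 2) • u' + ((s₁ + s₂) / 2) • v' := by
      rw [ho, midpoint_eq', hp', hq']; module
    have h1 : s₁ ≠ s₂ := fun h => hs12 (sub_eq_zero.2 h)
    have h2 : 0 < s₁ + s₂ := by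
      rcases lt_or_gt_of_ne h1 with h | h <;> linarith [hs1.1, hs2.1]
    have h3 : s₁ + s₂ < 2 := by
      rcases lt_or_gt_of_ne h1 with h | h <;> linarith [hs1.2, hs2.2]
    exact ⟨_, _, by linarith, by linarith, by ring, e.symm⟩
  -- If the side runs against `b - a`, its end points are exchanged so that the ratio `κ` becomes
  -- positive.
  rcases lt_or_gt_of_ne (div_ne_zero hr12 hs12) with hneg | hpos
  · refine ⟨_, v', u', w', o, -((r₁ - r₂) / (s₁ - s₂)), hAmb,
      affineIndependent_cyclic (affineIndependent_swap (affineIndependent_cyclic (affineIndependent_cyclic hind'))),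
      ?_, hoab, by rwa [openSegment_symm], by linarith, ?_, hZ⟩
    · rw [himg', segment_symm ℝ v' u', segment_symm ℝ u' w', segment_symm ℝ w' v']; ac_rfl
    · rw [neg_smul, ← hpar']; abel
  · exact ⟨_, u', v', w', o, _, hAmb, hind', himg', hoab, houv, hpos, hpar', hZ⟩

/-- The vertex `r` is strictly below the level of `p` and `q`, so a point at that level or above
gives it weight zero. -/
theorem mem_segment_of_dual {p q r x : Space} (f : Space →ₗ[ℝ] ℝ) {c : ℝ}
    (hx : x ∈ convexHull ℝ {p, q, r}) (hp : f p = c) (hq : f q = c) (hr : f r < c) (hxc : c ≤ f x) :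
    x ∈ segment ℝ p q := by
  obtain ⟨α, β, γ, hα, hβ, hγ, hs, rfl⟩ := mem_convexHull₃.1 hx
  simp only [map_add, map_smul, smul_eq_mul, hp, hq] at hxc
  have h : γ * (c - f r) ≤ 0 := by linarith [congrArg (c * ·) hs, mul_comm c α, mul_comm c β, mul_comm c γ, mul_add c (α + β) γ, mul_add c α β, mul_sub γ c (f r)]
  have h0 : γ = 0 := by nlinarith [sub_pos.2 hr]
  subst h0
  exact ⟨α, β, hα, hβ, by linarith, by simp⟩

/-- By height, both representations of `x` give `r` the same weight. If this weight is not 1,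
cancelling `r` and rescaling puts `u` on `[p, q]`. -/
theorem eq_apex_of_dual {p q r u x : Space} (f : Space →ₗ[ℝ] ℝ) {c : ℝ}
    (hx : x ∈ convexHull ℝ {p, q, r}) (hp : f p = c) (hq : f q = c) (hr : f r < c)
    (hu : f u = c) (hxu : x ∈ segment ℝ r u) (hupq : u ∉ segment ℝ p q) : x = r := by
  obtain ⟨α, β, γ, hα, hβ, hγ, hs, rfl⟩ := mem_convexHull₃.1 hx
  obtain ⟨s, hs', he⟩ := mem_segment'.1 hxu
  have hf := congrArg f he
  simp only [map_add, map_smul, smul_eq_mul, hp, hq, hu] at hf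
  have hγs : γ = 1 - s := by
    have : (γ - (1 - s)) * (f r - c) = 0 := by linear_combination hf - c * hs
    rcases mul_eq_zero.1 this with h | h <;> linarith
  rcases hs'.1.eq_or_lt with h | h
  · rw [he, ← h]; module
  · refine absurd ⟨α / s, β / s, by positivity, by positivity, ?_, ?_⟩ hupq
    · field_simp; linarith
    · have e : s • u = α • p + β • q := by
        rw [hγs] at he
        have : s • u = ((1 - s) • r + s • u) - (1 - s) • r := by abel
        rw [this, ← he]; abel
      rw [div_eq_inv_mul, div_eq_inv_mul, mul_smul, mul_smul, ← smul_add, ← e, smul_smul,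
        inv_mul_cancel₀ h.ne', one_smul]

theorem eventually_homothety_image {C : Set Space} (hC : IsCompact C) {o : Space} {U : Set Space}
    (hU : U ∈ 𝓝 o) : ∀ᶠ s in 𝓝[>] (0 : ℝ), AffineMap.homothety o s '' C ⊆ U := by
  obtain ⟨R, hR0, hR⟩ := hC.isBounded.subset_ball_lt 0 o
  obtain ⟨ε, hε, hεU⟩ := Metric.mem_nhds_iff.1 hU
  filter_upwards [Ioo_mem_nhdsGT (div_pos hε hR0)] with s hs
  rintro _ ⟨x, hx, rfl⟩
  refine hεU ?_
  have h1 := hR hx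
  rw [Metric.mem_ball] at h1 ⊢
  rw [dist_homothety_center, Real.norm_of_nonneg hs.1.le]
  have := (lt_div_iff₀ hR0).1 hs.2
  rw [dist_comm] at h1
  nlinarith [hs.1]

/-- Removing the corners of a triangle which lie below a plane. -/
theorem Knot.becomes_retract {K : Knot} {C : Set Space} {u v w z a b : Space} (f k : Space →ₗ[ℝ] ℝ)
    {c : ℝ} (hK : K.carrier = C ∪ (segment ℝ u a ∪ segment ℝ b v ∪ (segment ℝ v w ∪ segment ℝ w u)))
    (hind : AffineIndependent ℝ ![u, v, w]) (hfu : f u = c) (hfv : f v = c) (hz : f z < c)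
    (huv : k u = k v) (hvw : k v = k w) (hkz : k z < k u)
    (hC1 : Disjoint C (convexHull ℝ {w, u, z})) (hC2 : Disjoint C (convexHull ℝ {v, w, z}))
    (hC : ∀ x ∈ C, x = a ∨ x = b ∨ c < f x) {α β : ℝ} (hα : 0 < α) (hαβ : α < β) (hβ : β < 1)
    (ha : a = AffineMap.lineMap u v α) (hb : b = AffineMap.lineMap u v β) :
    K.Becomes (C ∪ segment ℝ a b) := by
  -- The functional `k` is constant on the plane of the triangle `u v w`, and `f` has the value `c`
  -- on the line through `u, a, b, v`. Since `z` is strictly below in both senses, the two moves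
  -- involving `w` are controlled by `k` and the later ones by `f`.
  obtain ⟨huv', huw, hvw'⟩ := ne_of_affineIndependent hind
  have hP : Function.Injective (AffineMap.lineMap u v : ℝ →ᵃ[ℝ] Space) := AffineMap.lineMap_injective ℝ huv'
  have hfa : f a = c := by
    rw [ha, AffineMap.lineMap_apply_module, map_add, map_smul, map_smul, hfu, hfv, ← add_smul]; simp
  have hfb : f b = c := by
    rw [hb, AffineMap.lineMap_apply_module, map_add, map_smul, map_smul, hfu, hfv, ← add_smul]; simp
  have eua : segment ℝ u a = (AffineMap.lineMap u v : ℝ →ᵃ[ℝ] Space) '' Icc 0 α := by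
    rw [← segment_lineMap u v hα.le, AffineMap.lineMap_apply_zero, ha]
  have ebv : segment ℝ b v = (AffineMap.lineMap u v : ℝ →ᵃ[ℝ] Space) '' Icc β 1 := by
    rw [← segment_lineMap u v hβ.le, AffineMap.lineMap_apply_one, hb]
  have euv := segment_eq_lineMap_image u v
  have hsua : segment ℝ u a ⊆ segment ℝ u v := by
    rw [eua, euv]; exact image_mono (Icc_subset_Icc le_rfl (by linarith))
  have hsbv : segment ℝ b v ⊆ segment ℝ u v := by
    rw [ebv, euv]; exact image_mono (Icc_subset_Icc (by linarith) le_rfl)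
  have hdisj : Disjoint (segment ℝ u a) (segment ℝ b v) := by
    rw [eua, ebv, disjoint_image_iff hP, Set.disjoint_left]
    intro t h1 h2; linarith [h1.2, h2.1]
  have hfseg : ∀ {p q x : Space}, f p = c → f q = c → x ∈ segment ℝ p q → f x = c := by
    intro p q x hp hq hx
    obtain ⟨r, hr, rfl⟩ := mem_segment'.1 hx
    rw [map_add, map_smul, map_smul, hp, hq, ← add_smul]; simp
  have hkseg : ∀ {p q x : Space}, k p = k u → k q = k u → x ∈ segment ℝ p q → k x = k u := by
    intro p q x hp hq hx
    obtain ⟨r, hr, rfl⟩ := mem_segment'.1 hx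
    rw [map_add, map_smul, map_smul, hp, hq, ← add_smul]; simp
  have hua : u ≠ a := by
    rintro h
    have := hP (a₁ := 0) (a₂ := α) (by rw [AffineMap.lineMap_apply_zero, ← ha, ← h])
    linarith
  have hbv : b ≠ v := by
    rintro h
    have := hP (a₁ := β) (a₂ := 1) (by rw [AffineMap.lineMap_apply_one, ← hb, ← h])
    linarith
  have hab : a ≠ b := by
    rintro h
    have := hP (a₁ := α) (a₂ := β) (by rw [← ha, ← hb, h])
    linarith
  have hcyc := affineIndependent_cyclic hind
  have hcyc' := affineIndependent_cyclic hcyc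
  have i1 := segment_inter_of_affineIndependent hind
  have i2 := segment_inter_of_affineIndependent hcyc
  have i3 := segment_inter_of_affineIndependent hcyc'
  -- add `z` on the side `[w, u]`
  refine (Knot.becomes_add_vertex (R := C ∪ (segment ℝ u a ∪ segment ℝ b v ∪ segment ℝ v w)) (a := w)
    (b := u) (c := z) (by rw [hK]; ac_rfl)
    (affineIndependent_of_dual huw.symm k (by rw [huv, hvw]) (by rw [← hvw, ← huv]; exact hkz.ne))
    ?_).trans fun K₁ hK₁ => ?_
  · rintro x ⟨hx, hxh⟩
    have flat : k x = k u → x ∈ segment ℝ w u := fun h =>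
      mem_segment_of_dual k hxh (c := k u) (by rw [huv, hvw]) rfl hkz h.ge
    rcases hx with hx | (hx | hx) | hx
    · exact absurd hxh (Set.disjoint_left.1 hC1 hx)
    · exact Or.inr (i3 ⟨flat (hkseg rfl huv.symm (hsua hx)), hsua hx⟩)
    · exact Or.inr (i3 ⟨flat (hkseg rfl huv.symm (hsbv hx)), hsbv hx⟩)
    · exact Or.inl (i2 ⟨hx, flat (hkseg huv.symm (by rw [huv, hvw]) hx)⟩)
  -- remove `w`
  refine (Knot.becomes_remove_vertex (R := C ∪ (segment ℝ u a ∪ segment ℝ b v ∪ segment ℝ z u)) (a := v)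
    (b := z) (c := w) (by rw [hK₁]; ac_rfl)
    (affineIndependent_swap (affineIndependent_of_dual hvw' k hvw (by rw [← huv]; exact hkz.ne)))
    ?_).trans fun K₂ hK₂ => ?_
  · rintro x ⟨hx, hxh⟩
    rw [triangle_swap'] at hxh
    have flat : k x = k u → x ∈ segment ℝ v w := fun h =>
      mem_segment_of_dual k hxh (c := k u) huv.symm (by rw [huv, hvw]) hkz h.ge
    rcases hx with hx | (hx | hx) | hx
    · exact absurd hxh (Set.disjoint_left.1 hC2 hx)
    · exact Or.inl (i1 ⟨hsua hx, flat (hkseg rfl huv.symm (hsua hx))⟩)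
    · exact Or.inl (i1 ⟨hsbv hx, flat (hkseg rfl huv.symm (hsbv hx))⟩)
    · exact Or.inr (eq_apex_of_dual k hxh (c := k u) huv.symm (by rw [huv, hvw]) hkz rfl hx
        fun h => huv' (i1 ⟨left_mem_segment ℝ _ _, h⟩))
  -- remove `v`
  refine (Knot.becomes_remove_vertex (R := C ∪ (segment ℝ u a ∪ segment ℝ z u)) (a := b)
    (b := z) (c := v) (by rw [hK₂]; ac_rfl)
    (affineIndependent_swap (affineIndependent_of_dual hbv f (hfb.trans hfv.symm)
      (by rw [hfb]; exact hz.ne))) ?_).trans fun K₃ hK₃ => ?_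
  · rintro x ⟨hx, hxh⟩
    rw [triangle_swap'] at hxh
    have flat : c ≤ f x → x ∈ segment ℝ b v := fun h => mem_segment_of_dual f hxh hfb hfv hz h
    rcases hx with hx | hx | hx
    · rcases hC x hx with rfl | rfl | h
      · exact absurd (flat hfa.ge) (Set.disjoint_left.1 hdisj (right_mem_segment ℝ _ _))
      · exact Or.inl rfl
      · exact absurd (hfseg hfb hfv (flat h.le)) h.ne'
    · exact absurd (flat (hfseg hfu hfa hx).ge) (Set.disjoint_left.1 hdisj hx)
    · exact Or.inr (eq_apex_of_dual f hxh hfb hfv hz hfu hx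
        (Set.disjoint_left.1 hdisj (left_mem_segment ℝ _ _)))
  -- remove `u`
  refine (Knot.becomes_remove_vertex (R := C ∪ segment ℝ b z) (a := a)
    (b := z) (c := u) (by rw [hK₃, segment_symm ℝ a u, segment_symm ℝ u z]; ac_rfl)
    (affineIndependent_swap (affineIndependent_of_dual hua.symm f (hfa.trans hfu.symm)
      (by rw [hfa]; exact hz.ne))) ?_).trans fun K₄ hK₄ => ?_
  · rintro x ⟨hx, hxh⟩
    rw [triangle_swap'] at hxh
    have flat : c ≤ f x → x ∈ segment ℝ u a := fun h => by
      rw [segment_symm]; exact mem_segment_of_dual f hxh hfa hfu hz h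
    rcases hx with hx | hx
    · rcases hC x hx with rfl | rfl | h
      · exact Or.inl rfl
      · exact absurd (left_mem_segment ℝ _ _) (Set.disjoint_left.1 hdisj (flat hfb.ge))
      · exact absurd (hfseg hfu hfa (flat h.le)) h.ne'
    · rw [segment_symm] at hx
      refine Or.inr (eq_apex_of_dual f hxh hfa hfu hz hfb hx fun h => ?_)
      rw [segment_symm] at h
      exact Set.disjoint_left.1 hdisj h (left_mem_segment ℝ _ _)
  -- remove `z`
  refine Knot.becomes_remove_vertex (c := z) (by rw [hK₄, segment_symm ℝ b z]; ac_rfl)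
    (affineIndependent_of_dual hab f (hfa.trans hfb.symm) (by rw [hfa]; exact hz.ne)) ?_
  rintro x ⟨hx, hxh⟩
  rcases hC x hx with rfl | rfl | h
  · exact Or.inl rfl
  · exact Or.inr rfl
  · exact absurd (hfseg hfa hfb (mem_segment_of_dual f hxh hfa hfb hz h.le)) h.ne'

/-- If closing up the part of a knot below a plane gives a trivial knot, then closing up the part
above the plane gives an equivalent knot. -/
theorem Knot.becomes_of_trivial_side {L L₁ : Knot} {T B : Set Space} {a b : Space}
    {f : Space →ₗ[ℝ] ℝ} {c : ℝ} (hL : L.carrier = T ∪ B) (hT : ∀ x ∈ T, f x ≤ c)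
    (hTc : ∀ x ∈ T, f x = c → x = a ∨ x = b) (hB : Arc' B a b) (ha : f a = c) (hb : f b = c)
    (hBf : ∀ x ∈ B, x = a ∨ x = b ∨ c < f x) (hL₁ : L₁.carrier = T ∪ segment ℝ a b)
    (h₁ : L₁.IsTrivial) : L.Becomes (B ∪ segment ℝ a b) := by
  -- `Z` straightens `T ∪ [a, b]` to a triangle and is the identity near `o`. If `B` is first shrunk
  -- into that neighbourhood, `Z` sends the whole knot to a triangle with a small copy of `B` in the
  -- side `[u, v]`. The rest of the triangle is then retracted by way of `z`, and the small copy is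
  -- enlarged again.
  have hab := hB.ne
  obtain ⟨Z, u, v, w, o, κ, hZ, hind, himg, hoab, houv, hκ, hκv, hev⟩ :=
    h₁.exists_amb hab (hL₁ ▸ subset_union_right)
  have huv' := (ne_of_affineIndependent hind).1
  -- a point below the plane, off the plane of the triangle
  obtain ⟨z, k, huv, hvw, hkz, hz⟩ : ∃ (z : Space) (k : Space →ₗ[ℝ] ℝ), k u = k v ∧ k v = k w ∧
      k z < k u ∧ f z < c := by
    obtain ⟨k, hk0, hk1, hk2⟩ := exists_dual_const u v w
    obtain ⟨x, hx, hxa, hxb⟩ := hB.exists_interior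
    have hfx : c < f x := by
      rcases hBf x hx with h | h | h
      · exact absurd h hxa
      · exact absurd h hxb
      · exact h
    -- This is the reflection in `a` of a point above the plane. A nearby point is still below the
    -- plane and can be taken off the plane of the triangle.
    have hU : {y | f y < c} ∈ 𝓝 ((2 : ℝ) • a - x) := by
      refine (isOpen_lt (LinearMap.continuous_of_finiteDimensional f) continuous_const).mem_nhds ?_
      show f ((2 : ℝ) • a - x) < c
      rw [map_sub, map_smul, ha, smul_eq_mul]; linarith
    obtain ⟨r, hr, hkr, -⟩ := exists_smul_avoid hk0 hk0 _ (k u) (k u) hU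
    rcases lt_or_gt_of_ne hkr with h | h
    · exact ⟨r, k, hk1, hk2, h, hr⟩
    · exact ⟨r, -k, by simp [hk1], by simp [hk2], by simpa using h, hr⟩
  obtain ⟨p, hp, hpo⟩ : ∃ p ∈ Ioo (0 : ℝ) 1, o = AffineMap.lineMap a b p := by
    rw [openSegment_eq_image_lineMap] at hoab
    obtain ⟨p, hp, rfl⟩ := hoab; exact ⟨p, hp, rfl⟩
  obtain ⟨r, hr, hro⟩ : ∃ r ∈ Ioo (0 : ℝ) 1, o = AffineMap.lineMap u v r := by
    rw [openSegment_eq_image_lineMap] at houv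
    obtain ⟨p, hp, rfl⟩ := houv; exact ⟨p, hp, rfl⟩
  have hko : k o = k u := by
    rw [hro, AffineMap.lineMap_apply_module, map_add, map_smul, map_smul, ← huv, ← add_smul]; simp
  have hou : o ≠ u := by
    intro h
    have := AffineMap.lineMap_injective ℝ huv' (a₁ := r) (a₂ := 0) (by
      rw [AffineMap.lineMap_apply_zero, ← hro, h])
    linarith [hr.1]
  have hov : o ≠ v := by
    intro h
    have := AffineMap.lineMap_injective ℝ huv' (a₁ := r) (a₂ := 1) (by
      rw [AffineMap.lineMap_apply_one, ← hro, h])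
    linarith [hr.2]
  have hosuv := openSegment_subset_segment ℝ _ _ houv
  have hcyc := affineIndependent_cyclic hind
  have ho1 : o ∉ convexHull ℝ {w, u, z} := fun h => hou (segment_inter_of_affineIndependent
    (affineIndependent_cyclic hcyc) ⟨mem_segment_of_dual k h (c := k u) (by rw [huv, hvw]) rfl hkz hko.ge, hosuv⟩)
  have ho2 : o ∉ convexHull ℝ {v, w, z} := fun h => hov (segment_inter_of_affineIndependent
    hind ⟨hosuv, mem_segment_of_dual k h (c := k u) huv.symm (by rw [huv, hvw]) hkz hko.ge⟩)
  have hclosed : ∀ p q r : Space, IsClosed (convexHull ℝ {p, q, r}) := fun p q r =>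
    (Set.toFinite _).isClosed_convexHull (𝕜 := ℝ)
  have hnhds : {y | Z y = y} ∩ ((convexHull ℝ {w, u, z})ᶜ ∩ (convexHull ℝ {v, w, z})ᶜ) ∈ 𝓝 o :=
    inter_mem hev (inter_mem ((hclosed _ _ _).isOpen_compl.mem_nhds ho1)
      ((hclosed _ _ _).isOpen_compl.mem_nhds ho2))
  -- the scale of the part above the plane
  have hm : 0 < min 1 (min (κ * r / p) (κ * (1 - r) / (1 - p))) := by
    have h1 := hp.1; have h2 := sub_pos.2 hp.2; have h3 := hr.1; have h4 := sub_pos.2 hr.2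
    exact lt_min one_pos (lt_min (by positivity) (by positivity))
  obtain ⟨s, hsB, hs⟩ := ((eventually_homothety_image (hB.isCompact.union (isCompact_segment a b))
    hnhds).and (Ioo_mem_nhdsGT hm)).exists
  have hs0 := hs.1
  have hs1 : s < 1 := hs.2.trans_le (min_le_left _ _)
  have hs2 : s * p < κ * r := (lt_div_iff₀ hp.1).1
    (hs.2.trans_le ((min_le_right _ _).trans (min_le_left _ _)))
  have hs3 : s * (1 - p) < κ * (1 - r) := (lt_div_iff₀ (sub_pos.2 hp.2)).1
    (hs.2.trans_le ((min_le_right _ _).trans (min_le_right _ _)))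
  have hX := Knot.becomes_shrink hL hT hTc hB ha hb hBf hoab hs0 hs1
  set A : Space →ᵃ[ℝ] Space := AffineMap.homothety o s with hA
  have hAx : ∀ x, A x = o + s • (x - o) := by
    intro x; rw [hA, AffineMap.homothety_apply]
    simp only [vsub_eq_sub, vadd_eq_add]; module
  have hAa : A a = AffineMap.lineMap a b (p - s * p) := by
    rw [hAx, hpo]; simp only [AffineMap.lineMap_apply_module]; module
  have hAb : A b = AffineMap.lineMap a b (p + s * (1 - p)) := by
    rw [hAx, hpo]; simp only [AffineMap.lineMap_apply_module]; module
  have hba : b - a = κ⁻¹ • (v - u) := by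
    rw [hκv, smul_smul, inv_mul_cancel₀ hκ.ne', one_smul]
  have hline : ∀ t : ℝ, (AffineMap.lineMap a b (p + t) : Space) = AffineMap.lineMap u v (r + κ⁻¹ * t) := by
    intro t
    have e1 : (AffineMap.lineMap a b (p + t) : Space) = o + t • (b - a) := by
      rw [hpo]; simp only [AffineMap.lineMap_apply_module]; module
    have e2 : (AffineMap.lineMap u v (r + κ⁻¹ * t) : Space) = o + t • κ⁻¹ • (v - u) := by
      rw [hro]; simp only [AffineMap.lineMap_apply_module]; module
    rw [e1, e2, hba]
  have hAa' : A a = AffineMap.lineMap u v (r + κ⁻¹ * (-(s * p))) := by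
    rw [hAa, ← hline]; rfl
  have hAb' : A b = AffineMap.lineMap u v (r + κ⁻¹ * (s * (1 - p))) := by
    rw [hAb, ← hline]
  have hp1 := hp.1
  have hp2 := sub_pos.2 hp.2
  have hκi : 0 < κ⁻¹ := inv_pos.2 hκ
  -- The bounds on `s` put `A a` and `A b` strictly between `u` and `v`. The parameters on `[a, b]`
  -- and `[u, v]` are related by the factor `κ⁻¹`, and `o` has parameter `p` on the first and `r` on
  -- the second.
  have b1 : 0 < r + κ⁻¹ * (-(s * p)) := by
    have : κ⁻¹ * (s * p) < κ⁻¹ * (κ * r) := mul_lt_mul_of_pos_left hs2 hκi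
    rw [inv_mul_cancel_left₀ hκ.ne'] at this
    linarith
  have b2 : r + κ⁻¹ * (s * (1 - p)) < 1 := by
    have : κ⁻¹ * (s * (1 - p)) < κ⁻¹ * (κ * (1 - r)) := mul_lt_mul_of_pos_left hs3 hκi
    rw [inv_mul_cancel_left₀ hκ.ne'] at this
    linarith
  have b3 : r + κ⁻¹ * (-(s * p)) < r + κ⁻¹ * (s * (1 - p)) := by
    have : 0 < κ⁻¹ * (s * p + s * (1 - p)) := by positivity
    linarith
  have b4 : 0 < p - s * p := by nlinarith
  have b5 : p + s * (1 - p) < 1 := by nlinarith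
  have b6 : p - s * p < p + s * (1 - p) := by linarith [hs0]
  have hseg : ∀ x y, A '' segment ℝ x y = segment ℝ (A x) (A y) := image_segment ℝ A
  have hoseg : openSegment ℝ (A a) (A b) ⊆ A '' (B ∪ segment ℝ a b) := by
    rw [image_union, hseg]
    exact (openSegment_subset_segment ℝ _ _).trans subset_union_right
  have hZfix : ∀ y ∈ A '' (B ∪ segment ℝ a b), Z y = y := fun y hy => (hsB hy).1
  have hrest : T ∪ (segment ℝ a (A a) ∪ segment ℝ b (A b)) = L₁.carrier \ openSegment ℝ (A a) (A b) := by
    rw [hL₁, union_sdiff_distrib, hAa, hAb, segment_sdiff_openSegment hab b4.le b6 b5.le,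
      segment_symm ℝ b]
    congr 1
    refine (sdiff_eq_left.2 (Set.disjoint_left.2 fun x hx hx' => ?_)).symm
    rw [openSegment_lineMap _ _ b6] at hx'
    obtain ⟨t, ht, rfl⟩ := hx'
    have hinj := AffineMap.lineMap_injective ℝ hab
    rcases hTc _ hx (by
      rw [AffineMap.lineMap_apply_module, map_add, map_smul, map_smul, ha, hb, ← add_smul]; simp) with h | h
    · have := hinj (a₁ := t) (a₂ := 0) (by rw [AffineMap.lineMap_apply_zero, h])
      linarith [ht.1]
    · have := hinj (a₁ := t) (a₂ := 1) (by rw [AffineMap.lineMap_apply_one, h])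
      linarith [ht.2]
  -- Outside the small copy of `B` the shrunk knot is `L₁` without the open segment from `A a` to `A
  -- b`. `Z` fixes this open segment and the copy, and sends `L₁` to the triangle.
  have hZX : Z '' (T ∪ (segment ℝ a (A a) ∪ A '' B ∪ segment ℝ b (A b))) =
      A '' B ∪ (segment ℝ u (A a) ∪ segment ℝ (A b) v ∪ (segment ℝ v w ∪ segment ℝ w u)) := by
    have e : T ∪ (segment ℝ a (A a) ∪ A '' B ∪ segment ℝ b (A b)) =
        A '' B ∪ (T ∪ (segment ℝ a (A a) ∪ segment ℝ b (A b))) := by ac_rfl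
    have e1 : Z '' openSegment ℝ (A a) (A b) = openSegment ℝ (A a) (A b) := by
      rw [image_congr (g := id) fun y hy => hZfix y (hoseg hy), image_id]
    have e2 : Z '' (A '' B) = A '' B := by
      rw [image_congr (g := id) fun y hy => hZfix y (image_mono subset_union_left hy), image_id]
    rw [e, image_union, e2, hrest, image_sdiff hZ.injective, e1, himg, union_sdiff_distrib, hAa', hAb',
      segment_sdiff_openSegment huv' b1.le b3 b2.le]
    congr 2
    refine sdiff_eq_left.2 (Set.disjoint_left.2 fun x hx hx' => ?_)
    rw [openSegment_lineMap _ _ b3] at hx'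
    obtain ⟨t, ht, rfl⟩ := hx'
    have hmem : AffineMap.lineMap u v t ∈ segment ℝ u v :=
      mem_segment_iff_lineMap.2 ⟨t, ⟨by linarith [ht.1], by linarith [ht.2]⟩, rfl⟩
    have hinj := AffineMap.lineMap_injective ℝ huv'
    rcases hx with hx | hx
    · have h : AffineMap.lineMap u v t = v := segment_inter_of_affineIndependent hind ⟨hmem, hx⟩
      have := hinj (a₁ := t) (a₂ := 1) (by rw [AffineMap.lineMap_apply_one, h])
      linarith [ht.2]
    · have h : AffineMap.lineMap u v t = u := segment_inter_of_affineIndependent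
        (affineIndependent_cyclic hcyc) ⟨hx, hmem⟩
      have := hinj (a₁ := t) (a₂ := 0) (by rw [AffineMap.lineMap_apply_zero, h])
      linarith [ht.1]
  have hfo : f o = c := by
    rw [hpo, AffineMap.lineMap_apply_module, map_add, map_smul, map_smul, ha, hb, ← add_smul]; simp
  have hfuv : f (v - u) = 0 := by rw [hκv, map_smul, map_sub, ha, hb]; simp
  have hou' : o = u + r • (v - u) := by
    rw [hro]; simp only [AffineMap.lineMap_apply_module]; module
  have hfu : f u = c := by
    have := congrArg f hou'
    rw [map_add, map_smul, hfuv, hfo] at this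
    simpa using this.symm
  have hfv : f v = c := by
    rw [map_sub, hfu] at hfuv; linarith
  refine (hX.trans fun K hK => hK ▸ hZ.becomes K).trans fun K hK => ?_
  rw [hZX] at hK
  refine (Knot.becomes_retract f k hK hind hfu hfv hz huv hvw hkz ?_ ?_ ?_ b1 b3 b2 hAa' hAb').trans
    fun K' hK' => ?_
  · exact Set.disjoint_left.2 fun x hx => (hsB (image_mono subset_union_left hx)).2.1
  · exact Set.disjoint_left.2 fun x hx => (hsB (image_mono subset_union_left hx)).2.2
  · rintro _ ⟨x, hx, rfl⟩
    rcases hBf x hx with rfl | rfl | h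
    · exact Or.inl rfl
    · exact Or.inr (Or.inl rfl)
    · right; right
      rw [hAx, map_add, map_smul, map_sub, hfo, smul_eq_mul]
      nlinarith
  -- The inverse homothety enlarges the small copy of `B ∪ [a, b]` to its original size.
  · have := (goodAff_homothety o hs0).symm K'
    convert this using 1
    have e : ∀ x, AffineEquiv.homothetyUnitsMulHom o (Units.mk0 s hs0.ne') x = A x := fun x => rfl
    rw [hK', ← hseg, ← image_union]
    ext x
    simp only [mem_image]
    constructor
    · intro hx
      exact ⟨_, ⟨x, hx, rfl⟩, by rw [← e, AffineEquiv.symm_apply_apply]⟩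
    · rintro ⟨_, ⟨y, hy, rfl⟩, rfl⟩
      rw [← e, AffineEquiv.symm_apply_apply]; exact hy

end KnotMosaic

namespace KnotMosaic

open Set Filter Topology

/-! ### Prime knots and planes meeting them in two points -/

/-- The points `a, b` cut the knot into two arcs whose interiors are connected and avoid the plane,
so each lies strictly on one side. They lie on different sides because both sides are occupied. -/
theorem Knot.arcs_of_plane {L : Knot} {f : Space →ₗ[ℝ] ℝ} {c : ℝ} {a b : Space} (hab : a ≠ b)
    (h : L.carrier ∩ {x | f x = c} = {a, b}) (h1 : ∃ x ∈ L.carrier, f x < c)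
    (h2 : ∃ x ∈ L.carrier, c < f x) :
    Arc' (L.carrier ∩ {x | f x ≤ c}) a b ∧ Arc' (L.carrier ∩ {x | c ≤ f x}) a b := by
  have haL : a ∈ L.carrier ∩ {x | f x = c} := h ▸ Or.inl rfl
  have hbL : b ∈ L.carrier ∩ {x | f x = c} := h ▸ Or.inr rfl
  have hfc : ∀ x ∈ L.carrier, f x = c → x = a ∨ x = b := fun x hx hc => h.le ⟨hx, hc⟩
  obtain ⟨S₁, S₂, hS1, hS2, hL, hi⟩ := L.isLoop.exists_arcs haL.1 hbL.1 hab
  have hcont : Continuous f := LinearMap.continuous_of_finiteDimensional f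
  have side : ∀ {S : Set Space}, Arc' S a b → S ⊆ L.carrier →
      (∀ x ∈ S, x ≠ a → x ≠ b → f x < c) ∨ (∀ x ∈ S, x ≠ a → x ≠ b → c < f x) := by
    intro S hS hSL
    have := hS.isPreconnected_interior.subset_or_subset
      (isOpen_lt hcont continuous_const) (isOpen_lt continuous_const hcont)
      (Set.disjoint_left.2 fun x (hx : f x < c) (hx' : c < f x) => lt_asymm hx hx') (by
        intro x hx
        rcases lt_trichotomy (f x) c with h | h | h
        · exact Or.inl h
        · exact absurd (hfc x (hSL hx.1) h) hx.2
        · exact Or.inr h)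
    refine this.imp ?_ ?_ <;>
    · intro h' x hx hxa hxb
      exact h' ⟨hx, by simp [hxa, hxb]⟩
  have key : ∀ {S₁ S₂ : Set Space}, Arc' S₁ a b → Arc' S₂ a b → L.carrier = S₁ ∪ S₂ →
      (∀ x ∈ S₁, x ≠ a → x ≠ b → f x < c) → (∀ x ∈ S₂, x ≠ a → x ≠ b → c < f x) →
      Arc' (L.carrier ∩ {x | f x ≤ c}) a b ∧ Arc' (L.carrier ∩ {x | c ≤ f x}) a b := by
    intro S₁ S₂ hS1 hS2 hL h1 h2
    have e1 : L.carrier ∩ {x | f x ≤ c} = S₁ := by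
      ext x; constructor
      · rintro ⟨hx, hxc : f x ≤ c⟩
        rcases hL.le hx with hx | hx
        · exact hx
        · by_cases hxa : x = a
          · rw [hxa]; exact hS1.left_mem
          by_cases hxb : x = b
          · rw [hxb]; exact hS1.right_mem
          exact absurd (h2 x hx hxa hxb) hxc.not_gt
      · intro hx
        refine ⟨hL ▸ Or.inl hx, show f x ≤ c from ?_⟩
        by_cases hxa : x = a
        · rw [hxa]; exact haL.2.le
        by_cases hxb : x = b
        · rw [hxb]; exact hbL.2.le
        exact (h1 x hx hxa hxb).le
    have e2 : L.carrier ∩ {x | c ≤ f x} = S₂ := by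
      ext x; constructor
      · rintro ⟨hx, hxc : c ≤ f x⟩
        rcases hL.le hx with hx | hx
        · by_cases hxa : x = a
          · rw [hxa]; exact hS2.left_mem
          by_cases hxb : x = b
          · rw [hxb]; exact hS2.right_mem
          exact absurd (h1 x hx hxa hxb) hxc.not_gt
        · exact hx
      · intro hx
        refine ⟨hL ▸ Or.inr hx, show c ≤ f x from ?_⟩
        by_cases hxa : x = a
        · rw [hxa]; exact haL.2.ge
        by_cases hxb : x = b
        · rw [hxb]; exact hbL.2.ge
        exact (h2 x hx hxa hxb).le
    rw [e1, e2]; exact ⟨hS1, hS2⟩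
  have s1 := side hS1 (hL ▸ subset_union_left)
  have s2 := side hS2 (hL ▸ subset_union_right)
  have hne : ∀ {x}, f x ≠ c → x ≠ a ∧ x ≠ b := by
    intro x hx
    refine ⟨?_, ?_⟩
    · rintro rfl; exact hx haL.2
    · rintro rfl; exact hx hbL.2
  rcases s1 with s1 | s1
  · rcases s2 with s2 | s2
    · obtain ⟨x, hx, hxc⟩ := h2
      obtain ⟨hxa, hxb⟩ := hne hxc.ne'
      rcases hL.le hx with h | h
      · exact absurd (s1 x h hxa hxb) hxc.not_gt
      · exact absurd (s2 x h hxa hxb) hxc.not_gt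
    · exact key hS1 hS2 hL s1 s2
  · rcases s2 with s2 | s2
    · exact key hS2 hS1 (hL.trans (union_comm _ _)) s2 s1
    · obtain ⟨x, hx, hxc⟩ := h1
      obtain ⟨hxa, hxb⟩ := hne hxc.ne
      rcases hL.le hx with h | h
      · exact absurd (s1 x h hxa hxb) hxc.not_gt
      · exact absurd (s2 x h hxa hxb) hxc.not_gt

/-- If a plane meets a prime knot in two points, then closing up one of its two parts gives an
equivalent knot. -/
theorem Knot.IsPrime.becomes_of_plane {K L : Knot} (hK : K.IsPrime) (hLK : Knot.Equivalent L K)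
    {f : Space →ₗ[ℝ] ℝ} {c : ℝ} {a b : Space} (hab : a ≠ b)
    (h : L.carrier ∩ {x | f x = c} = {a, b}) (h1 : ∃ x ∈ L.carrier, f x < c)
    (h2 : ∃ x ∈ L.carrier, c < f x) :
    L.Becomes ((L.carrier ∩ {x | f x ≤ c}) ∪ segment ℝ a b) ∨
      L.Becomes ((L.carrier ∩ {x | c ≤ f x}) ∪ segment ℝ a b) := by
  obtain ⟨hT, hB⟩ := L.arcs_of_plane hab h h1 h2
  have hfa : f a = c := (show a ∈ L.carrier ∩ {x | f x = c} from h ▸ Or.inl rfl).2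
  have hfb : f b = c := (show b ∈ L.carrier ∩ {x | f x = c} from h ▸ Or.inr rfl).2
  have hfc : ∀ x ∈ L.carrier, f x = c → x = a ∨ x = b := fun x hx hc => h.le ⟨hx, hc⟩
  have close : ∀ {S : Set Space}, Arc' S a b → S ⊆ L.carrier →
      IsSimpleClosedPolygon (S ∪ segment ℝ a b) := by
    intro S hS hSL
    rw [segment_symm]
    refine (IsLoop.of_arcs hS (Arc.single hab.symm trivial) ?_).isSimpleClosedPolygon
    rintro x ⟨hx, hx'⟩
    refine hfc x (hSL hx) ?_
    obtain ⟨r, hr, rfl⟩ := mem_segment'.1 hx'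
    rw [map_add, map_smul, map_smul, hfa, hfb, ← add_smul]; simp
  have hcov : L.carrier = (L.carrier ∩ {x | f x ≤ c}) ∪ (L.carrier ∩ {x | c ≤ f x}) := by
    rw [← inter_union_distrib_left]
    exact (inter_eq_left.2 fun x _ => le_total (f x) c).symm
  set L₁ : Knot := ⟨_, close hT inter_subset_left⟩
  set L₂ : Knot := ⟨_, close hB inter_subset_left⟩
  rcases hK.2 L₁ L₂ ⟨L, L₁, L₂, hLK.symm, .refl _, .refl _, f, c, a, b, hab, h, rfl, rfl⟩ with h' | h'
  · right
    refine Knot.becomes_of_trivial_side hcov (fun x hx => hx.2) (fun x hx => hfc x hx.1) hB hfa hfb ?_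
      (L₁ := L₁) rfl h'
    intro x hx
    rcases (show c ≤ f x from hx.2).eq_or_lt with h | h
    · rcases hfc x hx.1 h.symm with h | h <;> simp [h]
    · exact Or.inr (Or.inr h)
  · left
    refine Knot.becomes_of_trivial_side (f := -f) (c := -c) (hcov.trans (union_comm _ _))
      (fun x hx => neg_le_neg hx.2) (fun x hx hx' => hfc x hx.1 (neg_injective hx')) hT
      (by simp [hfa]) (by simp [hfb]) ?_ (L₁ := L₂) rfl h'
    intro x hx
    rcases (show f x ≤ c from hx.2).eq_or_lt with h | h
    · rcases hfc x hx.1 h with h | h <;> simp [h]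
    · exact Or.inr (Or.inr (neg_lt_neg h))

end KnotMosaic

namespace KnotMosaic

open Set Filter Topology

/-! ### Replacing arcs in the bottom plane of a knot -/

/-- By induction the arc after its first edge `[a, b]` is replaced by the path through `w`, and then
the vertex `b` between `a` and `w` is removed. All triangles lie below the plane `ζ = 0` except for
their top edge, so the rest of the knot does not obstruct. -/
theorem Knot.becomes_cone {S : Set Space} {a b w : Space} (h : Arc' S a b) (ζ : Space →ₗ[ℝ] ℝ)
    (hS : ∀ x ∈ S, ζ x = 0) (hw : ζ w < 0) :
    ∀ {K : Knot} {R : Set Space}, K.carrier = R ∪ S → (∀ x ∈ R, 0 ≤ ζ x) → R ∩ S ⊆ {a, b} →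
      K.Becomes (R ∪ (segment ℝ a w ∪ segment ℝ w b)) := by
  induction h with
  | @single a b hab _ =>
    intro K R hK hR hi
    have ha := hS a (left_mem_segment ℝ _ _)
    have hb := hS b (right_mem_segment ℝ _ _)
    exact Knot.becomes_add_vertex hK (affineIndependent_of_dual hab ζ (ha.trans hb.symm) (by rw [ha]; exact hw.ne))
      fun x hx => hi ⟨hx.1, mem_segment_of_dual ζ hx.2 ha hb hw (hR x hx.1)⟩
  | @cons a b c S hab _ hS' hi' ih =>
    intro K R hK hR hi
    have ha := hS a (Or.inl (left_mem_segment ℝ _ _))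
    have hb := hS b (Or.inl (right_mem_segment ℝ _ _))
    have hc := hS c (Or.inr hS'.right_mem)
    have haS : a ∉ S := fun h => hab (hi' ⟨left_mem_segment ℝ _ _, h⟩)
    have hcs : c ∉ segment ℝ a b := fun h => hS'.ne (hi' ⟨h, hS'.right_mem⟩).symm
    refine (ih (fun x hx => hS x (Or.inr hx)) (K := K) (R := R ∪ segment ℝ a b) (by rw [hK]; ac_rfl)
      ?_ ?_).trans fun K' hK' => ?_
    · rintro x (hx | hx)
      · exact hR x hx
      · exact (hS x (Or.inl hx)).ge
    · rintro x ⟨hx | hx, hxS⟩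
      · rcases hi ⟨hx, Or.inr hxS⟩ with rfl | h
        · exact absurd hxS haS
        · exact Or.inr h
      · exact Or.inl (hi' ⟨hx, hxS⟩)
    · have := Knot.becomes_remove_vertex (K := K') (R := R ∪ segment ℝ w c) (a := a) (b := w) (c := b)
        (by rw [hK']; ac_rfl)
        (affineIndependent_swap (affineIndependent_of_dual hab ζ (ha.trans hb.symm) (by rw [ha]; exact hw.ne))) ?_
      · convert this using 1; ac_rfl
      · rintro x ⟨hx, hxh⟩
        rw [triangle_swap'] at hxh
        rcases hx with hx | hx
        · have hxs := mem_segment_of_dual ζ hxh ha hb hw (hR x hx)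
          rcases hi ⟨hx, Or.inl hxs⟩ with h | h
          · exact Or.inl h
          · exact absurd ((show x = c from h) ▸ hxs) hcs
        · exact Or.inr (eq_apex_of_dual ζ hxh ha hb hw hc hx hcs)

/-- An arc in a plane bounding a half-space which contains the knot can be replaced by any other
arc in this plane with the same end points. -/
theorem Knot.becomes_flat {K : Knot} {R S S' : Set Space} {a b : Space} (ζ : Space →ₗ[ℝ] ℝ)
    (h : Arc' S a b) (h' : Arc' S' a b) (hS : ∀ x ∈ S, ζ x = 0) (hS' : ∀ x ∈ S', ζ x = 0)
    (hK : K.carrier = R ∪ S) (hR : ∀ x ∈ R, 0 ≤ ζ x) (hi : R ∩ S ⊆ {a, b}) (hi' : R ∩ S' ⊆ {a, b})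
    (hζ : ζ ≠ 0) : K.Becomes (R ∪ S') := by
  obtain ⟨z, hz⟩ : ∃ z, ζ z ≠ 0 := by
    by_contra! h0; exact hζ (LinearMap.ext h0)
  obtain ⟨w, hw⟩ : ∃ w, ζ w < 0 := by
    rcases lt_or_gt_of_ne hz with h | h
    · exact ⟨z, h⟩
    · exact ⟨-z, by simpa using h⟩
  -- The old and the new arc are deformed to the same two segments through `w`.
  obtain ⟨K₁, hK₁, e₁⟩ := Knot.becomes_cone h ζ hS hw hK hR hi
  set K' : Knot := ⟨_, ((hK ▸ K.isLoop).replace h h' hi hi').isSimpleClosedPolygon⟩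
  obtain ⟨K₂, hK₂, e₂⟩ := Knot.becomes_cone h' ζ hS' hw (K := K') rfl hR hi'
  rw [Knot.ext' (hK₁.trans hK₂.symm)] at e₁
  exact ⟨K', rfl, e₁.trans e₂.symm⟩

/-- A sufficient condition for adding an edge to an arc. -/
theorem Arc'.cons_of_dual {S : Set Space} {a b c : Space} (g : Space →ₗ[ℝ] ℝ) (hab : a ≠ b)
    (hS : Arc' S b c) (ha : g a ≤ g b) (h : ∀ x ∈ S, x = b ∨ g b < g x) :
    Arc' (segment ℝ a b ∪ S) a c := by
  refine Arc.cons hab trivial hS ?_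
  rintro x ⟨hx, hxS⟩
  rcases h x hxS with h | h
  · exact h
  · obtain ⟨r, hr, rfl⟩ := mem_segment'.1 hx
    rw [map_add, map_smul, map_smul, smul_eq_mul, smul_eq_mul] at h
    exact absurd (combo_le hr ha le_rfl) h.not_ge

/-! ### The curves on a tile in coordinates -/

theorem space_ext {p q : Space} (h0 : p 0 = q 0) (h1 : p 1 = q 1) (h2 : p 2 = q 2) : p = q := by
  ext i; fin_cases i
  · exact h0
  · exact h1
  · exact h2

theorem mem_segment_coord {p a b : Space} : p ∈ segment ℝ a b ↔ ∃ s ∈ Icc (0 : ℝ) 1,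
    p 0 = (1 - s) * a 0 + s * b 0 ∧ p 1 = (1 - s) * a 1 + s * b 1 ∧ p 2 = (1 - s) * a 2 + s * b 2 := by
  rw [mem_segment']
  refine exists_congr fun s => and_congr_right fun _ => ⟨?_, fun h => space_ext h.1 h.2.1 h.2.2⟩
  rintro rfl
  simp

namespace Tile

theorem mem_leftBottom {p : Space} : p ∈ strand Side.left Side.bottom ↔
    p 2 = 0 ∧ p 0 + p 1 = -1 ∧ -1 ≤ p 0 ∧ p 0 ≤ 0 := by
  simp only [strand, mem_segment_coord, Side.midpoint, mem_Icc, Matrix.cons_val]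
  exact ⟨by rintro ⟨s, h, h0, h1, h2⟩; exact ⟨by linarith, by linarith, by linarith, by linarith⟩,
    fun h => ⟨1 + p 0, ⟨by linarith, by linarith⟩, by linarith, by linarith, by linarith⟩⟩

theorem mem_rightBottom {p : Space} : p ∈ strand Side.right Side.bottom ↔
    p 2 = 0 ∧ p 0 - p 1 = 1 ∧ 0 ≤ p 0 ∧ p 0 ≤ 1 := by
  simp only [strand, mem_segment_coord, Side.midpoint, mem_Icc, Matrix.cons_val]
  exact ⟨by rintro ⟨s, h, h0, h1, h2⟩; exact ⟨by linarith, by linarith, by linarith, by linarith⟩,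
    fun h => ⟨1 - p 0, ⟨by linarith, by linarith⟩, by linarith, by linarith, by linarith⟩⟩

theorem mem_rightTop {p : Space} : p ∈ strand Side.right Side.top ↔
    p 2 = 0 ∧ p 0 + p 1 = 1 ∧ 0 ≤ p 0 ∧ p 0 ≤ 1 := by
  simp only [strand, mem_segment_coord, Side.midpoint, mem_Icc, Matrix.cons_val]
  exact ⟨by rintro ⟨s, h, h0, h1, h2⟩; exact ⟨by linarith, by linarith, by linarith, by linarith⟩,
    fun h => ⟨1 - p 0, ⟨by linarith, by linarith⟩, by linarith, by linarith, by linarith⟩⟩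

theorem mem_leftTop {p : Space} : p ∈ strand Side.left Side.top ↔
    p 2 = 0 ∧ p 1 - p 0 = 1 ∧ -1 ≤ p 0 ∧ p 0 ≤ 0 := by
  simp only [strand, mem_segment_coord, Side.midpoint, mem_Icc, Matrix.cons_val]
  exact ⟨by rintro ⟨s, h, h0, h1, h2⟩; exact ⟨by linarith, by linarith, by linarith, by linarith⟩,
    fun h => ⟨1 + p 0, ⟨by linarith, by linarith⟩, by linarith, by linarith, by linarith⟩⟩

theorem mem_horizontal {p : Space} : p ∈ strand Side.left Side.right ↔
    p 2 = 0 ∧ p 1 = 0 ∧ -1 ≤ p 0 ∧ p 0 ≤ 1 := by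
  simp only [strand, mem_segment_coord, Side.midpoint, mem_Icc, Matrix.cons_val]
  exact ⟨by rintro ⟨s, h, h0, h1, h2⟩; exact ⟨by linarith, by linarith, by linarith, by linarith⟩,
    fun h => ⟨(1 + p 0) / 2, ⟨by linarith, by linarith⟩, by linarith, by linarith, by linarith⟩⟩

theorem mem_vertical {p : Space} : p ∈ strand Side.top Side.bottom ↔
    p 2 = 0 ∧ p 0 = 0 ∧ -1 ≤ p 1 ∧ p 1 ≤ 1 := by
  simp only [strand, mem_segment_coord, Side.midpoint, mem_Icc, Matrix.cons_val]
  exact ⟨by rintro ⟨s, h, h0, h1, h2⟩; exact ⟨by linarith, by linarith, by linarith, by linarith⟩,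
    fun h => ⟨(1 - p 1) / 2, ⟨by linarith, by linarith⟩, by linarith, by linarith, by linarith⟩⟩

theorem mem_horizontalOver {p : Space} : p ∈ overStrand Side.left Side.right ↔
    p 1 = 0 ∧ ((-1 ≤ p 0 ∧ p 0 ≤ 0 ∧ p 2 = 1 + p 0) ∨ (0 ≤ p 0 ∧ p 0 ≤ 1 ∧ p 2 = 1 - p 0)) := by
  simp only [overStrand, mem_union, mem_segment_coord, Side.midpoint, mem_Icc, Matrix.cons_val]
  constructor
  · rintro (⟨s, h, h0, h1, h2⟩ | ⟨s, h, h0, h1, h2⟩)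
    · exact ⟨by linarith, Or.inl ⟨by linarith, by linarith, by linarith⟩⟩
    · exact ⟨by linarith, Or.inr ⟨by linarith, by linarith, by linarith⟩⟩
  · rintro ⟨h, h' | h'⟩
    · exact Or.inl ⟨1 + p 0, ⟨by linarith, by linarith⟩, by linarith, by linarith, by linarith⟩
    · exact Or.inr ⟨p 0, ⟨by linarith, by linarith⟩, by linarith, by linarith, by linarith⟩

theorem mem_verticalOver {p : Space} : p ∈ overStrand Side.top Side.bottom ↔
    p 0 = 0 ∧ ((-1 ≤ p 1 ∧ p 1 ≤ 0 ∧ p 2 = 1 + p 1) ∨ (0 ≤ p 1 ∧ p 1 ≤ 1 ∧ p 2 = 1 - p 1)) := by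
  simp only [overStrand, mem_union, mem_segment_coord, Side.midpoint, mem_Icc, Matrix.cons_val]
  constructor
  · rintro (⟨s, h, h0, h1, h2⟩ | ⟨s, h, h0, h1, h2⟩)
    · exact ⟨by linarith, Or.inr ⟨by linarith, by linarith, by linarith⟩⟩
    · exact ⟨by linarith, Or.inl ⟨by linarith, by linarith, by linarith⟩⟩
  · rintro ⟨h, h' | h'⟩
    · exact Or.inr ⟨-p 1, ⟨by linarith, by linarith⟩, by linarith, by linarith, by linarith⟩
    · exact Or.inl ⟨1 - p 1, ⟨by linarith, by linarith⟩, by linarith, by linarith, by linarith⟩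

/-- The tile rotated counterclockwise by a right angle. -/
def rot : Tile → Tile
  | blank => blank
  | leftBottom => rightBottom
  | rightBottom => rightTop
  | rightTop => leftTop
  | leftTop => leftBottom
  | horizontal => vertical
  | vertical => horizontal
  | leftBottomRightTop => leftTopRightBottom
  | leftTopRightBottom => leftBottomRightTop
  | horizontalOver => verticalOver
  | verticalOver => horizontalOver

theorem mem_drawing_rot (T : Tile) (p : Space) : p ∈ T.rot.drawing ↔ ![p 1, -p 0, p 2] ∈ T.drawing := by
  cases T <;> simp only [rot, drawing, mem_union, mem_leftBottom, mem_rightBottom, mem_rightTop,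
    mem_leftTop, mem_horizontal, mem_vertical, mem_horizontalOver, mem_verticalOver, Matrix.cons_val,
    mem_empty_iff_false] <;> grind

theorem bounds {T : Tile} {p : Space} (h : p ∈ T.drawing) :
    -1 ≤ p 0 ∧ p 0 ≤ 1 ∧ -1 ≤ p 1 ∧ p 1 ≤ 1 ∧ 0 ≤ p 2 := by
  cases T <;> simp only [drawing, mem_union, mem_leftBottom, mem_rightBottom, mem_rightTop,
    mem_leftTop, mem_horizontal, mem_vertical, mem_horizontalOver, mem_verticalOver,
    mem_empty_iff_false] at h <;> grind

theorem of_top {T : Tile} {p : Space} (h : p ∈ T.drawing) (h1 : p 1 = 1) :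
    Side.top ∈ T.connections ∧ p 0 = 0 ∧ p 2 = 0 := by
  cases T <;> simp only [drawing, mem_union, mem_leftBottom, mem_rightBottom, mem_rightTop,
    mem_leftTop, mem_horizontal, mem_vertical, mem_horizontalOver, mem_verticalOver,
    mem_empty_iff_false] at h <;>
    first
    | (exfalso; grind)
    | exact ⟨by decide, by grind, by grind⟩

theorem of_bottom {T : Tile} {p : Space} (h : p ∈ T.drawing) (h1 : p 1 = -1) :
    Side.bottom ∈ T.connections ∧ p 0 = 0 ∧ p 2 = 0 := by
  cases T <;> simp only [drawing, mem_union, mem_leftBottom, mem_rightBottom, mem_rightTop,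
    mem_leftTop, mem_horizontal, mem_vertical, mem_horizontalOver, mem_verticalOver,
    mem_empty_iff_false] at h <;>
    first
    | (exfalso; grind)
    | exact ⟨by decide, by grind, by grind⟩

theorem midpoint_mem {T : Tile} {s : Side} (h : s ∈ T.connections) : s.midpoint ∈ T.drawing := by
  cases T <;> cases s <;> first
    | exact absurd h (by decide)
    | (simp only [drawing, mem_union, mem_leftBottom, mem_rightBottom, mem_rightTop,
        mem_leftTop, mem_horizontal, mem_vertical, mem_horizontalOver, mem_verticalOver, Side.midpoint,
        Matrix.cons_val]; norm_num)

/-- This provides a point of the curve strictly below the upper edge of the row of any non-blank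
tile. -/
theorem exists_not_top {T : Tile} (h : T ≠ blank) : ∃ s ∈ T.connections, s ≠ Side.top := by
  cases T <;> first | exact absurd rfl h | decide

theorem exists_not_bottom {T : Tile} (h : T ≠ blank) : ∃ s ∈ T.connections, s ≠ Side.bottom := by
  cases T <;> first | exact absurd rfl h | decide

end Tile

end KnotMosaic

namespace KnotMosaic

open Set Filter Topology

/-! ### Mosaics on the integer grid -/

/-- A suitably connected array of tiles on the integer grid, all but finitely many of them blank.
The tile `tile x y` is centred at `(2 x, 2 y, 0)`. -/
structure Pattern where
  tile : ℤ → ℤ → Tile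
  right_iff : ∀ x y, Side.right ∈ (tile x y).connections ↔ Side.left ∈ (tile (x + 1) y).connections
  top_iff : ∀ x y, Side.top ∈ (tile x y).connections ↔ Side.bottom ∈ (tile x (y + 1)).connections
  finite : {c : ℤ × ℤ | tile c.1 c.2 ≠ Tile.blank}.Finite

/-- The centre of the tile in column `x` and row `y`. -/
def centre (x y : ℤ) : Space := ![2 * (x : ℝ), 2 * (y : ℝ), 0]

@[simp] theorem centre_zero (x y : ℤ) : centre x y 0 = 2 * (x : ℝ) := rfl
@[simp] theorem centre_one (x y : ℤ) : centre x y 1 = 2 * (y : ℝ) := rfl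
@[simp] theorem centre_two (x y : ℤ) : centre x y 2 = 0 := rfl

namespace Pattern

variable (F : Pattern)

/-- The cells carrying a non-blank tile. -/
def support : Set (ℤ × ℤ) := {c | F.tile c.1 c.2 ≠ Tile.blank}

/-- The number of non-blank tiles. -/
noncomputable def size : ℕ := F.support.ncard

/-- The curve drawn by a pattern. -/
def drawing : Set Space := {p | ∃ x y, p - centre x y ∈ (F.tile x y).drawing}

/-- The curve drawn by the pattern is a knot of the type of `K`. -/
def Rep (K : Knot) : Prop := ∃ L : Knot, L.carrier = F.drawing ∧ Knot.Equivalent L K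

variable {F}

theorem Rep.of_becomes {F' : Pattern} {K L : Knot} (hL : Knot.Equivalent L K)
    (h : L.Becomes F'.drawing) : F'.Rep K := by
  obtain ⟨L', hL', e⟩ := h
  exact ⟨L', hL', e.symm.trans hL⟩

theorem tile_of_mem {x y : ℤ} {p : Space} (h : p ∈ (F.tile x y).drawing) :
    F.tile x y ≠ Tile.blank := by
  intro h'; rw [h'] at h; exact h

theorem blank_of_connections {T : Tile} {s : Side} (h : s ∈ T.connections) : T ≠ Tile.blank := by
  rintro rfl; simp [Tile.connections] at h

theorem nonneg_two {p : Space} (h : p ∈ F.drawing) : 0 ≤ p 2 := by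
  obtain ⟨x, y, h⟩ := h
  simpa using (Tile.bounds h).2.2.2.2

/-- Translation of a pattern. -/
def shift (F : Pattern) (a b : ℤ) : Pattern where
  tile x y := F.tile (x + a) (y + b)
  right_iff x y := by
    rw [F.right_iff, show x + a + 1 = x + 1 + a by ring]
  top_iff x y := by
    rw [F.top_iff, show y + b + 1 = y + 1 + b by ring]
  finite := F.finite.preimage (f := fun c : ℤ × ℤ => (c.1 + a, c.2 + b))
    (Function.Injective.injOn fun c d h => by
      simp only [Prod.mk.injEq, add_left_inj] at h; exact Prod.ext h.1 h.2)

theorem support_shift (a b : ℤ) : (F.shift a b).support =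
    (fun c : ℤ × ℤ => (c.1 + a, c.2 + b)) ⁻¹' F.support := rfl

theorem size_shift (a b : ℤ) : (F.shift a b).size = F.size := by
  rw [size, size, support_shift, ncard_preimage_of_injective_subset_range]
  · intro c d h
    simp only [Prod.mk.injEq, add_left_inj] at h; exact Prod.ext h.1 h.2
  · exact fun c _ => ⟨(c.1 - a, c.2 - b), by simp⟩

theorem Rep.shift {K : Knot} (h : F.Rep K) (a b : ℤ) : (F.shift a b).Rep K := by
  obtain ⟨L, hL, e⟩ := h
  refine Rep.of_becomes e ?_
  have := goodAff_const (-centre a b) L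
  convert this using 1
  rw [hL]
  ext p
  simp only [mem_image, AffineEquiv.constVAdd_apply, vadd_eq_add]
  have key : ∀ x y : ℤ, p - centre x y = (p + centre a b) - centre (x + a) (y + b) := by
    intro x y
    apply space_ext <;> simp <;> ring
  constructor
  · rintro ⟨x, y, h⟩
    exact ⟨p + centre a b, ⟨x + a, y + b, by rw [← key]; exact h⟩, by simp⟩
  · rintro ⟨q, ⟨x, y, h⟩, rfl⟩
    refine ⟨x - a, y - b, ?_⟩
    show _ ∈ (F.tile (x - a + a) (y - b + b)).drawing
    rw [sub_add_cancel, sub_add_cancel]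
    convert h using 1
    apply space_ext <;> simp <;> ring

theorem Rep.eq_blank {K : Knot} (h : F.Rep K) : F.support.Nonempty := by
  obtain ⟨L, hL, -⟩ := h
  obtain ⟨x, y, S, hS, -, -, e⟩ := L.isLoop
  have hx : x ∈ F.drawing := hL ▸ e ▸ Or.inl hS.left_mem
  obtain ⟨i, j, hx⟩ := hx
  exact ⟨(i, j), tile_of_mem hx⟩

/-- Rotation of a pattern by a right angle, the cell `(x, y)` going to `(n - y, x)`. -/
def rot (F : Pattern) (n : ℤ) : Pattern where
  tile x y := (F.tile y (n - x)).rot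
  right_iff x y := by
    have h1 : ∀ T : Tile, Side.right ∈ T.rot.connections ↔ Side.bottom ∈ T.connections := by
      intro T; cases T <;> decide
    have h2 : ∀ T : Tile, Side.left ∈ T.rot.connections ↔ Side.top ∈ T.connections := by
      intro T; cases T <;> decide
    rw [h1, h2, F.top_iff, show n - (x + 1) + 1 = n - x by ring]
  top_iff x y := by
    have h1 : ∀ T : Tile, Side.top ∈ T.rot.connections ↔ Side.right ∈ T.connections := by
      intro T; cases T <;> decide
    have h2 : ∀ T : Tile, Side.bottom ∈ T.rot.connections ↔ Side.left ∈ T.connections := by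
      intro T; cases T <;> decide
    rw [h1, h2, F.right_iff]
  finite := by
    refine (F.finite.preimage (f := fun c : ℤ × ℤ => (c.2, n - c.1))
      (Function.Injective.injOn fun c d h => ?_)).subset fun c hc => ?_
    · simp only [Prod.mk.injEq, sub_right_inj] at h; exact Prod.ext h.2 h.1
    · intro h
      simp only [mem_ofPred_eq] at hc
      rw [h] at hc
      exact hc rfl

theorem _root_.KnotMosaic.Tile.rot_eq_blank {T : Tile} : T.rot = Tile.blank ↔ T = Tile.blank := by
  cases T <;> decide

theorem tile_rot (n x y : ℤ) : (F.rot n).tile x y = (F.tile y (n - x)).rot := rfl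

theorem tile_rot_eq_blank (n x y : ℤ) :
    (F.rot n).tile x y = Tile.blank ↔ F.tile y (n - x) = Tile.blank := Tile.rot_eq_blank

theorem support_rot (n : ℤ) : (F.rot n).support = (fun c : ℤ × ℤ => (c.2, n - c.1)) ⁻¹' F.support := by
  ext c
  exact (tile_rot_eq_blank n c.1 c.2).not

theorem size_rot (n : ℤ) : (F.rot n).size = F.size := by
  rw [size, size, support_rot, ncard_preimage_of_injective_subset_range]
  · intro c d h
    simp only [Prod.mk.injEq, sub_right_inj] at h; exact Prod.ext h.2 h.1
  · exact fun c _ => ⟨(n - c.2, c.1), by simp⟩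

/-- Rotation by a right angle about the vertical axis. -/
def quarterLinear : Space ≃ₗ[ℝ] Space where
  toFun p := ![-p 1, p 0, p 2]
  map_add' p q := by
    refine space_ext ?_ ?_ ?_ <;> simp only [Matrix.cons_val, Pi.add_apply]
    ring
  map_smul' r p := by
    refine space_ext ?_ ?_ ?_ <;> simp
  invFun p := ![p 1, -p 0, p 2]
  left_inv p := by
    refine space_ext ?_ ?_ ?_ <;> simp
  right_inv p := by
    refine space_ext ?_ ?_ ?_ <;> simp

/-- Rotation by a right angle about the vertical axis, followed by a translation. -/
noncomputable def quarter (n : ℤ) : Space ≃ᵃ[ℝ] Space :=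
  quarterLinear.toAffineEquiv.trans (AffineEquiv.constVAdd ℝ Space (centre n 0))

theorem quarter_apply (n : ℤ) (p : Space) : quarter n p = ![2 * n - p 1, p 0, p 2] := by
  have h : quarter n p = centre n 0 + ![-p 1, p 0, p 2] := rfl
  rw [h]
  refine space_ext ?_ ?_ ?_ <;> simp
  ring

/-- The straight homotopy from the identity to the quarter turn acts on horizontal differences with
determinant `(1 - t)² + t² > 0`. -/
theorem goodAff_quarter (n : ℤ) : GoodAff (quarter n) := by
  refine goodAff_of_path fun t ht p q h => ?_
  have h0 := congrFun h 0
  have h1 := congrFun h 1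
  have h2 := congrFun h 2
  simp [quarter_apply] at h0 h1 h2
  have e0 : (1 - t) * (p 0 - q 0) = t * (p 1 - q 1) := by linarith
  have e1 : (1 - t) * (p 1 - q 1) = -t * (p 0 - q 0) := by linarith
  have hpos : 0 < (1 - t) ^ 2 + t ^ 2 := by nlinarith [sq_nonneg (1 - 2 * t)]
  have f0 : ((1 - t) ^ 2 + t ^ 2) * (p 0 - q 0) = 0 := by linear_combination (1 - t) * e0 + t * e1
  have f1 : ((1 - t) ^ 2 + t ^ 2) * (p 1 - q 1) = 0 := by linear_combination (1 - t) * e1 - t * e0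
  refine space_ext ?_ ?_ ?_
  · exact sub_eq_zero.1 ((mul_eq_zero.1 f0).resolve_left hpos.ne')
  · exact sub_eq_zero.1 ((mul_eq_zero.1 f1).resolve_left hpos.ne')
  · linarith

theorem drawing_rot (n : ℤ) : (F.rot n).drawing = quarter n '' F.drawing := by
  ext p
  constructor
  · rintro ⟨x, y, h⟩
    rw [tile_rot, Tile.mem_drawing_rot] at h
    refine ⟨![p 1, 2 * n - p 0, p 2], ⟨y, n - x, ?_⟩, ?_⟩
    · convert h using 1
      apply space_ext <;> simp; ring
    · rw [quarter_apply]; apply space_ext <;> simp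
  · rintro ⟨q, ⟨x, y, h⟩, rfl⟩
    refine ⟨n - y, x, ?_⟩
    rw [tile_rot, Tile.mem_drawing_rot, sub_sub_cancel]
    convert h using 1
    rw [quarter_apply]
    apply space_ext <;> simp; ring

theorem Rep.rot {K : Knot} (h : F.Rep K) (n : ℤ) : (F.rot n).Rep K := by
  obtain ⟨L, hL, e⟩ := h
  refine Rep.of_becomes e ?_
  rw [drawing_rot, ← hL]
  exact goodAff_quarter n L

end Pattern

/-! ### Mosaics and patterns -/

/-- The pattern of a mosaic. -/
def Mosaic.toPattern {n : ℕ} (M : Mosaic n) : Pattern where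
  -- Rows of a mosaic are numbered downwards, so row `i` is placed at `y = -i`.
  tile x y := if h : (0 ≤ x ∧ x < n) ∧ (0 ≤ -y ∧ -y < n) then
    M.tile ⟨(-y).toNat, by omega⟩ ⟨x.toNat, by omega⟩ else Tile.blank
  right_iff x y := by
    constructor
    · intro h
      split_ifs at h with hc
      · obtain ⟨i', j', ⟨h1, h2⟩, h3⟩ := M.suitablyConnected _ _ _ h
        have hj := j'.2
        simp only [Fin.ext_iff] at h1 h2
        rw [dif_pos (by omega)]
        convert h3 using 4 <;> first | rfl | omega
      · simp [Tile.connections] at h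
    · intro h
      split_ifs at h with hc
      · obtain ⟨i', j', ⟨h1, h2⟩, h3⟩ := M.suitablyConnected _ _ _ h
        have hj := j'.2
        simp only [Fin.ext_iff] at h1 h2
        rw [dif_pos (by omega)]
        convert h3 using 4 <;> first | rfl | omega
      · simp [Tile.connections] at h
  top_iff x y := by
    constructor
    · intro h
      split_ifs at h with hc
      · obtain ⟨i', j', ⟨h1, h2⟩, h3⟩ := M.suitablyConnected _ _ _ h
        have hj := i'.2
        simp only [Fin.ext_iff] at h1 h2
        rw [dif_pos (by omega)]
        convert h3 using 4 <;> first | rfl | omega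
      · simp [Tile.connections] at h
    · intro h
      split_ifs at h with hc
      · obtain ⟨i', j', ⟨h1, h2⟩, h3⟩ := M.suitablyConnected _ _ _ h
        have hj := i'.2
        simp only [Fin.ext_iff] at h1 h2
        rw [dif_pos (by omega)]
        convert h3 using 4 <;> first | rfl | omega
      · simp [Tile.connections] at h
  finite := by
    refine ((finite_Icc (0 : ℤ) n).prod (finite_Icc (-n : ℤ) 0)).subset fun c hc => ?_
    by_contra h
    refine hc (dif_neg fun h' => h ?_)
    simp only [mem_prod, mem_Icc]
    omega

theorem Mosaic.tile_toPattern {n : ℕ} (M : Mosaic n) (i j : Fin n) :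
    M.toPattern.tile j (-(i : ℤ)) = M.tile i j := by
  show (if h : _ then _ else _) = _
  rw [dif_pos (by omega)]
  congr 1
  ext; simp

theorem Mosaic.exists_of_tile_toPattern {n : ℕ} (M : Mosaic n) {x y : ℤ}
    (h : M.toPattern.tile x y ≠ Tile.blank) : ∃ i j : Fin n, x = j ∧ y = -(i : ℤ) := by
  by_cases hc : (0 ≤ x ∧ x < n) ∧ (0 ≤ -y ∧ -y < n)
  · exact ⟨⟨(-y).toNat, by omega⟩, ⟨x.toNat, by omega⟩, by simp; omega, by simp; omega⟩
  · exact absurd (dif_neg hc) h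

theorem Mosaic.drawing_toPattern {n : ℕ} (M : Mosaic n) : M.toPattern.drawing = M.drawing := by
  ext p
  simp only [Mosaic.drawing, mem_iUnion, mem_image]
  have hc : ∀ i j : Fin n, (![2 * ((j : ℕ) : ℝ), -(2 * ((i : ℕ) : ℝ)), 0] : Space) =
      centre j (-(i : ℤ)) := by
    intro i j; apply space_ext <;> simp
  constructor
  · rintro ⟨x, y, h⟩
    obtain ⟨i, j, rfl, rfl⟩ := M.exists_of_tile_toPattern (Pattern.tile_of_mem h)
    rw [M.tile_toPattern] at h
    exact ⟨i, j, _, h, by rw [hc]; abel⟩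
  · rintro ⟨i, j, q, hq, rfl⟩
    refine ⟨j, -(i : ℤ), ?_⟩
    rw [M.tile_toPattern, hc, add_sub_cancel_left]
    exact hq

theorem Mosaic.size_toPattern {n : ℕ} (M : Mosaic n) : M.toPattern.size = M.tileNumber := by
  rw [Pattern.size, Mosaic.tileNumber, ← ncard_coe_finset]
  have hinj : Function.Injective (fun c : Fin n × Fin n => (((c.2 : ℕ) : ℤ), -((c.1 : ℕ) : ℤ))) := by
    intro c d h
    simp only [Prod.mk.injEq, neg_inj, Nat.cast_inj] at h
    exact Prod.ext (Fin.ext h.2) (Fin.ext h.1)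
  rw [← ncard_image_of_injective _ hinj]
  congr 1
  ext ⟨x, y⟩
  simp only [mem_image, Finset.coe_filter, Finset.mem_univ, true_and, mem_ofPred_eq, Prod.mk.injEq]
  constructor
  · intro h
    obtain ⟨i, j, rfl, rfl⟩ := M.exists_of_tile_toPattern h
    refine ⟨(i, j), ?_, rfl, rfl⟩
    rw [← M.tile_toPattern]; exact h
  · rintro ⟨⟨i, j⟩, h, rfl, rfl⟩
    show M.toPattern.tile j (-(i : ℤ)) ≠ _
    rw [M.tile_toPattern]; exact h

theorem Mosaic.rep_toPattern {n : ℕ} (M : Mosaic n) (K : Knot) :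
    M.toPattern.Rep K ↔ M.Represents K := by
  rw [Pattern.Rep, Mosaic.Represents, M.drawing_toPattern]

/-- A pattern in an `n × n` square comes from an `n`-mosaic. -/
theorem Pattern.exists_mosaic {F : Pattern} {n : ℕ}
    (h : ∀ x y, F.tile x y ≠ Tile.blank → (0 ≤ x ∧ x < n) ∧ (0 ≤ -y ∧ -y < n)) :
    ∃ M : Mosaic n, M.toPattern = F := by
  have hs : ∀ {x y : ℤ} {s : Side}, s ∈ (F.tile x y).connections → (0 ≤ x ∧ x < n) ∧ (0 ≤ -y ∧ -y < n) :=
    fun hs => h _ _ (Pattern.blank_of_connections hs)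
  refine ⟨⟨fun i j => F.tile j (-(i : ℤ)), ?_⟩, ?_⟩
  · rintro ⟨i, hi⟩ ⟨j, hj⟩ s hs'
    simp only at hs'
    cases s
    · have e := (F.right_iff (j - 1) (-(i : ℤ))).2 (by simpa using hs')
      have := hs e
      refine ⟨⟨i, hi⟩, ⟨j - 1, by omega⟩, ⟨rfl, by simp only; omega⟩, ?_⟩
      convert e using 3 <;> first | rfl | (simp only; omega)
    · have e := (F.right_iff _ _).1 hs'
      have := hs e
      exact ⟨⟨i, hi⟩, ⟨j + 1, by omega⟩, ⟨rfl, rfl⟩, e⟩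
    · have e := (F.top_iff _ _).1 hs'
      have := hs e
      refine ⟨⟨i - 1, by omega⟩, ⟨j, hj⟩, ⟨by simp only; omega, rfl⟩, ?_⟩
      convert e using 3 <;> first | rfl | (simp only; omega)
    · have e := (F.top_iff j (-(i : ℤ) - 1)).2 (by simpa using hs')
      have := hs e
      refine ⟨⟨i + 1, by omega⟩, ⟨j, hj⟩, ⟨rfl, rfl⟩, ?_⟩
      convert e using 3 <;> first | rfl | (simp only; omega)
  · have : ∀ {F G : Pattern}, F.tile = G.tile → F = G := by
      rintro ⟨⟩ ⟨⟩ h; cases h; rfl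
    apply this
    funext x y
    show (if h : _ then _ else _) = _
    split_ifs with hc
    · show F.tile _ _ = _
      congr 1 <;> simp only <;> omega
    · by_contra h'
      exact hc (h x y (Ne.symm h'))

end KnotMosaic

namespace KnotMosaic

open Set Filter Topology

namespace Pattern

variable {F : Pattern} {K : Knot}

/-! ### Crossings of horizontal lines -/

/-- The columns in which the curve passes from row `y` to row `y + 1`. -/
def cross (F : Pattern) (y : ℤ) : Set ℤ := {x | Side.top ∈ (F.tile x y).connections}

/-- The point at which the curve passes from row `y` to row `y + 1` in column `x`. -/
def gate (x y : ℤ) : Space := ![2 * (x : ℝ), 2 * (y : ℝ) + 1, 0]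

@[simp] theorem gate_zero (x y : ℤ) : gate x y 0 = 2 * (x : ℝ) := rfl
@[simp] theorem gate_one (x y : ℤ) : gate x y 1 = 2 * (y : ℝ) + 1 := rfl
@[simp] theorem gate_two (x y : ℤ) : gate x y 2 = 0 := rfl

theorem gate_injective (y : ℤ) : Function.Injective fun x => gate x y := fun x x' h => by
  have := congrFun h 0
  simpa using this

theorem exists_bound (F : Pattern) : ∃ N : ℤ, ∀ x y, F.tile x y ≠ Tile.blank →
    (-N < x ∧ x < N) ∧ (-N < y ∧ y < N) := by
  obtain ⟨a, ha⟩ := (F.finite.image Prod.fst).bddAbove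
  obtain ⟨b, hb⟩ := (F.finite.image Prod.fst).bddBelow
  obtain ⟨c, hc⟩ := (F.finite.image Prod.snd).bddAbove
  obtain ⟨d, hd⟩ := (F.finite.image Prod.snd).bddBelow
  refine ⟨max (max a c) (max (-b) (-d)) + 1, fun x y h => ?_⟩
  have h1 := ha ⟨(x, y), h, rfl⟩
  have h2 := hb ⟨(x, y), h, rfl⟩
  have h3 := hc ⟨(x, y), h, rfl⟩
  have h4 := hd ⟨(x, y), h, rfl⟩
  simp only at h1 h2 h3 h4
  omega

theorem row_of_mem {x y : ℤ} {p : Space} (h : p - centre x y ∈ (F.tile x y).drawing) :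
    2 * (x : ℝ) - 1 ≤ p 0 ∧ p 0 ≤ 2 * x + 1 ∧ 2 * (y : ℝ) - 1 ≤ p 1 ∧ p 1 ≤ 2 * y + 1 := by
  have := Tile.bounds h
  simp only [Pi.sub_apply, centre_zero, centre_one] at this
  exact ⟨by linarith, by linarith, by linarith, by linarith⟩

theorem gate_mem_of_top {x y : ℤ} (h : x ∈ F.cross y) : gate x y - centre x y ∈ (F.tile x y).drawing := by
  convert Tile.midpoint_mem h using 1
  apply space_ext <;> simp [Side.midpoint]

/-- Only tiles of the two adjacent rows reach this line, and a tile meets its own boundary only at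
its connection points. -/
theorem mem_line {y : ℤ} {p : Space} (hp : p ∈ F.drawing) (h : p 1 = 2 * (y : ℝ) + 1) :
    ∃ x ∈ F.cross y, p = gate x y := by
  obtain ⟨x, y', hp⟩ := hp
  obtain ⟨-, -, h1, h2⟩ := row_of_mem hp
  have h1' : y' ≤ y + 1 := by
    have : (y' : ℝ) ≤ y + 1 := by linarith
    exact_mod_cast this
  have h2' : y ≤ y' := by
    have : (y : ℝ) ≤ y' := by linarith
    exact_mod_cast this
  have h' : y' = y ∨ y' = y + 1 := by omega
  rcases h' with rfl | rfl
  · obtain ⟨ht, h0, h2⟩ := Tile.of_top hp (by simp [h])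
    simp only [Pi.sub_apply, centre_zero, centre_two] at h0 h2
    exact ⟨x, ht, space_ext (by simp; linarith) (by simp [h]) (by simp; linarith)⟩
  · obtain ⟨ht, h0, h2⟩ := Tile.of_bottom hp (by simp [h]; ring)
    simp only [Pi.sub_apply, centre_zero, centre_two] at h0 h2
    exact ⟨x, (F.top_iff x y).2 ht, space_ext (by simp; linarith) (by simp [h]) (by simp; linarith)⟩

theorem exists_below {x y y' : ℤ} (h : F.tile x y' ≠ Tile.blank) (hy : y' ≤ y) :
    ∃ p ∈ F.drawing, p 1 < 2 * (y : ℝ) + 1 := by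
  obtain ⟨s, hs, hst⟩ := Tile.exists_not_top h
  refine ⟨s.midpoint + centre x y', ⟨x, y', ?_⟩, ?_⟩
  · rw [add_sub_cancel_right]; exact Tile.midpoint_mem hs
  · have : (y' : ℝ) ≤ y := by exact_mod_cast hy
    have h1 : s.midpoint 1 ≤ 0 := by
      cases s <;> simp [Side.midpoint] at hst ⊢
    simp only [Pi.add_apply, centre_one]; linarith

theorem exists_above {x y y' : ℤ} (h : F.tile x y' ≠ Tile.blank) (hy : y < y') :
    ∃ p ∈ F.drawing, 2 * (y : ℝ) + 1 < p 1 := by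
  obtain ⟨s, hs, hst⟩ := Tile.exists_not_bottom h
  refine ⟨s.midpoint + centre x y', ⟨x, y', ?_⟩, ?_⟩
  · rw [add_sub_cancel_right]; exact Tile.midpoint_mem hs
  · have : (y : ℝ) + 1 ≤ y' := by exact_mod_cast hy
    have h1 : 0 ≤ s.midpoint 1 := by
      cases s <;> simp [Side.midpoint] at hst ⊢
    simp only [Pi.add_apply, centre_one]; linarith

theorem Rep.isPreconnected (h : F.Rep K) : IsPreconnected F.drawing := by
  obtain ⟨L, hL, -⟩ := h
  exact hL ▸ L.isLoop.isPreconnected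

/-- The curve is connected and has points on both sides of the line, so the second coordinate takes
the intermediate value. -/
theorem Rep.cross_nonempty (h : F.Rep K) {x y y₁ x' y₂ : ℤ} (h1 : F.tile x y₁ ≠ Tile.blank)
    (hy1 : y₁ ≤ y) (h2 : F.tile x' y₂ ≠ Tile.blank) (hy2 : y < y₂) : (F.cross y).Nonempty := by
  obtain ⟨p, hp, hp1⟩ := exists_below h1 hy1
  obtain ⟨q, hq, hq1⟩ := exists_above h2 hy2
  obtain ⟨z, hz, hz1⟩ := h.isPreconnected.intermediate_value hp hq (f := fun z => z 1)
    (continuous_apply 1).continuousOn ⟨hp1.le, hq1.le⟩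
  obtain ⟨x, hx, -⟩ := mem_line hz hz1
  exact ⟨x, hx⟩

theorem cross_finite (F : Pattern) (y : ℤ) : (F.cross y).Finite :=
  (F.finite.image Prod.fst).subset fun x hx => ⟨(x, y), blank_of_connections hx, rfl⟩

/-- The curve crosses every horizontal line an even number of times. -/
theorem even_cross (F : Pattern) (y : ℤ) : Even (F.cross y).ncard := by
  classical
  obtain ⟨N, hN⟩ := F.exists_bound
  have hfin : ∀ (s : Side) (y : ℤ), {x | s ∈ (F.tile x y).connections}.Finite := fun s y =>
    (F.finite.image Prod.fst).subset fun x hx => ⟨(x, y), blank_of_connections hx, rfl⟩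
  have hcard : ∀ (s : Side) (y : ℤ), {x | s ∈ (F.tile x y).connections}.ncard =
      ∑ x ∈ Finset.Icc (-N) N, if s ∈ (F.tile x y).connections then 1 else 0 := by
    intro s y
    rw [← Finset.card_filter, ← ncard_coe_finset]
    congr 1
    ext x
    simp only [mem_ofPred_eq, Finset.coe_filter, Finset.mem_Icc]
    refine ⟨fun h => ⟨?_, h⟩, fun h => h.2⟩
    have := (hN x y (blank_of_connections h)).1
    exact ⟨this.1.le, this.2.le⟩
  have hlr : ∀ y, {x | Side.left ∈ (F.tile x y).connections}.ncard =
      {x | Side.right ∈ (F.tile x y).connections}.ncard := by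
    intro y
    have : {x | Side.right ∈ (F.tile x y).connections} =
        (fun x => x + 1) ⁻¹' {x | Side.left ∈ (F.tile x y).connections} := by
      ext x; exact F.right_iff x y
    rw [this, ncard_preimage_of_injective_subset_range (add_left_injective (1 : ℤ))]
    exact fun x _ => ⟨x - 1, by simp⟩
  have htb : ∀ y, {x | Side.bottom ∈ (F.tile x y).connections}.ncard = (F.cross (y - 1)).ncard := by
    intro y
    congr 1
    ext x
    have := F.top_iff x (y - 1)
    rw [sub_add_cancel] at this
    exact this.symm
  -- Each tile has an even number of connection points, and in a row there are as many left ones as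
  -- right ones. So successive crossing numbers have the same parity, starting from zero below the
  -- pattern.
  have step : ∀ y, Even ((F.cross y).ncard + (F.cross (y - 1)).ncard) := by
    intro y
    have h1 : Even ({x | Side.top ∈ (F.tile x y).connections}.ncard +
        {x | Side.bottom ∈ (F.tile x y).connections}.ncard +
        ({x | Side.left ∈ (F.tile x y).connections}.ncard +
        {x | Side.right ∈ (F.tile x y).connections}.ncard)) := by
      rw [hcard, hcard, hcard, hcard, ← Finset.sum_add_distrib, ← Finset.sum_add_distrib,
        ← Finset.sum_add_distrib]
      refine Finset.even_sum _ fun x _ => ?_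
      generalize F.tile x y = T
      cases T <;> decide
    rw [hlr, htb] at h1
    exact (Nat.even_add.1 h1).2 ⟨_, rfl⟩
  have key : ∀ y, -N - 1 ≤ y → Even (F.cross y).ncard := by
    intro y hy
    induction y, hy using Int.leInduction with
    | base =>
      have : F.cross (-N - 1) = ∅ := by
        ext x
        simp only [mem_empty_iff_false, iff_false]
        intro h
        have := (hN x _ (blank_of_connections h)).2
        omega
      simp [this]
    | succ y hy ih =>
      have := step (y + 1)
      rw [add_sub_cancel_right] at this
      exact (Nat.even_add.1 this).2 ih
  by_cases hy : -N - 1 ≤ y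
  · exact key y hy
  · have : F.cross y = ∅ := by
      ext x
      simp only [mem_empty_iff_false, iff_false]
      intro h
      have := (hN x _ (blank_of_connections h)).2
      omega
    simp [this]

/-! ### Minimal patterns -/

/-- The occupied rows. -/
def rows (F : Pattern) : Set ℤ := {y | ∃ x, F.tile x y ≠ Tile.blank}

/-- The occupied columns. -/
def cols (F : Pattern) : Set ℤ := {x | ∃ y, F.tile x y ≠ Tile.blank}

theorem rows_eq (F : Pattern) : F.rows = Prod.snd '' F.support := by
  ext y; exact ⟨fun ⟨x, h⟩ => ⟨(x, y), h, rfl⟩, by rintro ⟨⟨x, y⟩, h, rfl⟩; exact ⟨x, h⟩⟩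

theorem cols_eq (F : Pattern) : F.cols = Prod.fst '' F.support := by
  ext y; exact ⟨fun ⟨x, h⟩ => ⟨(y, x), h, rfl⟩, by rintro ⟨⟨x, y⟩, h, rfl⟩; exact ⟨y, h⟩⟩

theorem rows_finite (F : Pattern) : F.rows.Finite := F.rows_eq ▸ F.finite.image _
theorem cols_finite (F : Pattern) : F.cols.Finite := F.cols_eq ▸ F.finite.image _

/-- The number of occupied rows and columns. -/
noncomputable def extent (F : Pattern) : ℕ := F.rows.ncard + F.cols.ncard

/-- A pattern of a knot with the least number of tiles and, among these, the least extent. -/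
structure Minimal (F : Pattern) (K : Knot) : Prop where
  rep : F.Rep K
  size_le : ∀ G : Pattern, G.Rep K → F.size ≤ G.size
  extent_le : ∀ G : Pattern, G.Rep K → G.size ≤ F.size → F.extent ≤ G.extent

theorem Rep.exists_minimal (h : F.Rep K) : ∃ G : Pattern, G.Minimal K ∧ G.size ≤ F.size := by
  have wf : WellFounded (fun G G' : Pattern => Prod.Lex (· < ·) (· < ·) (G.size, G.extent) (G'.size, G'.extent)) :=
    InvImage.wf _ (WellFounded.prod_lex Nat.lt_wfRel.wf Nat.lt_wfRel.wf)
  obtain ⟨G, hG, hmin⟩ := wf.has_min {G : Pattern | G.Rep K} ⟨F, h⟩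
  have hsize : ∀ G' : Pattern, G'.Rep K → G.size ≤ G'.size := fun G' h' => by
    by_contra! hlt
    exact hmin G' h' (Prod.Lex.left _ _ hlt)
  refine ⟨G, ⟨hG, hsize, fun G' h' hs => ?_⟩, hsize F h⟩
  by_contra! hlt
  refine hmin G' h' ?_
  rw [le_antisymm hs (hsize G' h')]
  exact Prod.Lex.right _ hlt

theorem rows_rot (n : ℤ) : (F.rot n).rows = F.cols := by
  ext y
  simp only [rows, cols, mem_ofPred_eq, ne_eq, tile_rot_eq_blank]
  exact ⟨fun ⟨x, h⟩ => ⟨_, h⟩, fun ⟨x, h⟩ => ⟨n - x, by rwa [sub_sub_cancel]⟩⟩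

theorem cols_rot (n : ℤ) : (F.rot n).cols = (fun x => n - x) ⁻¹' F.rows := by
  ext y
  simp only [rows, cols, mem_ofPred_eq, ne_eq, tile_rot_eq_blank, mem_preimage]

theorem extent_rot (n : ℤ) : (F.rot n).extent = F.extent := by
  rw [extent, extent, rows_rot, cols_rot,
    ncard_preimage_of_injective_subset_range (f := fun x => n - x) (sub_right_injective), add_comm]
  exact fun x _ => ⟨n - x, by simp⟩

theorem Minimal.rot (h : F.Minimal K) (n : ℤ) : (F.rot n).Minimal K :=
  ⟨h.rep.rot n, fun G hG => by rw [size_rot]; exact h.size_le G hG,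
    fun G hG hs => by rw [extent_rot]; rw [size_rot] at hs; exact h.extent_le G hG hs⟩

end Pattern

end KnotMosaic

namespace KnotMosaic

open Set Filter Topology

theorem proj_ne_zero (i : Fin 3) : (LinearMap.proj i : Space →ₗ[ℝ] ℝ) ≠ 0 := by
  intro h
  have := LinearMap.congr_fun h (fun _ => 1)
  simp at this

namespace Pattern

variable {F : Pattern} {K : Knot}

/-! ### Closing up the lower part of a pattern by a row of arcs -/

/-- The part of the pattern in the rows up to `y`, closed up by a strand in row `y + 1` from column
`p` to column `q`. -/
def cap (F : Pattern) {y p q : ℤ} (hpq : p < q) (hc : F.cross y = {p, q}) : Pattern where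
  tile x y' := if y' ≤ y then F.tile x y' else if y' = y + 1 then
    (if x = p then Tile.rightBottom else if x = q then Tile.leftBottom else
      if p < x ∧ x < q then Tile.horizontal else Tile.blank) else Tile.blank
  right_iff x y' := by
    by_cases h : y' ≤ y
    · simp only [if_pos h]; exact F.right_iff x y'
    · simp only [if_neg h]
      split_ifs <;> first | omega | decide
  top_iff x y' := by
    by_cases h : y' + 1 ≤ y
    · rw [if_pos (by omega), if_pos h]; exact F.top_iff x y'
    · rw [if_neg h]
      by_cases h' : y' ≤ y
      · obtain rfl : y' = y := by omega
        rw [if_pos le_rfl, if_pos rfl]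
        have : Side.top ∈ (F.tile x y').connections ↔ x = p ∨ x = q := by
          show x ∈ F.cross y' ↔ _
          rw [hc]; rfl
        rw [this]
        split_ifs with h1 h2 h3
        · exact iff_of_true (Or.inl h1) (by decide)
        · exact iff_of_true (Or.inr h2) (by decide)
        · exact iff_of_false (by tauto) (by decide)
        · exact iff_of_false (by tauto) (by decide)
      · rw [if_neg h']
        split_ifs <;> first | omega | decide
  finite := by
    refine (F.finite.union ((finite_Icc p q).prod (finite_singleton (y + 1)))).subset ?_
    rintro ⟨x, y'⟩ h
    simp only [mem_ofPred_eq] at h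
    split_ifs at h with h1 h2 h3 h4 h5
    · exact Or.inl h
    · exact Or.inr ⟨⟨h3.ge, by simp only; omega⟩, h2⟩
    · exact Or.inr ⟨⟨by simp only; omega, h4.le⟩, h2⟩
    · exact Or.inr ⟨⟨h5.1.le, h5.2.le⟩, h2⟩
    all_goals exact absurd rfl h

theorem cap_support {y p q : ℤ} (hpq : p < q) (hc : F.cross y = {p, q}) :
    (F.cap hpq hc).support = {c ∈ F.support | c.2 ≤ y} ∪ Icc p q ×ˢ {y + 1} := by
  ext ⟨x, y'⟩
  simp only [support, cap, mem_ofPred_eq, mem_union, mem_prod, mem_Icc, mem_singleton_iff]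
  split_ifs with h1 h2 h3 h4 h5
  · simp [h1]; omega
  · simp; omega
  · simp; omega
  · simp; omega
  · simp; omega
  · simp [h1, h2]

/-- The strand of `cap` in the new row. -/
def capArc (y p q : ℤ) : Set Space :=
  segment ℝ (gate p y) ![2 * p + 1, 2 * y + 2, 0] ∪
    (segment ℝ ![2 * p + 1, 2 * y + 2, 0] ![2 * q - 1, 2 * y + 2, 0] ∪
      segment ℝ ![2 * q - 1, 2 * y + 2, 0] (gate q y))

theorem mem_capArc {y p q : ℤ} (hpq : p < q) {z : Space} : z ∈ capArc y p q ↔ z 2 = 0 ∧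
    ((z 1 - z 0 = 2 * y + 1 - 2 * p ∧ 2 * (p : ℝ) ≤ z 0 ∧ z 0 ≤ 2 * p + 1) ∨
      (z 1 = 2 * y + 2 ∧ 2 * (p : ℝ) + 1 ≤ z 0 ∧ z 0 ≤ 2 * q - 1) ∨
      (z 0 + z 1 = 2 * y + 1 + 2 * q ∧ 2 * (q : ℝ) - 1 ≤ z 0 ∧ z 0 ≤ 2 * q)) := by
  have hpq' : (p : ℝ) + 1 ≤ q := by exact_mod_cast hpq
  simp only [capArc, mem_union, mem_segment_coord, Matrix.cons_val, gate_zero, gate_one, gate_two, mem_Icc]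
  constructor
  · rintro (⟨s, hs, h0, h1, h2⟩ | ⟨s, hs, h0, h1, h2⟩ | ⟨s, hs, h0, h1, h2⟩)
    · exact ⟨by linarith, Or.inl ⟨by linarith, by linarith, by linarith⟩⟩
    · refine ⟨by linarith, Or.inr (Or.inl ⟨by linarith, ?_, ?_⟩)⟩ <;> nlinarith
    · exact ⟨by linarith, Or.inr (Or.inr ⟨by linarith, by linarith, by linarith⟩)⟩
  · rintro ⟨h2, ⟨h, h3, h4⟩ | ⟨h, h3, h4⟩ | ⟨h, h3, h4⟩⟩
    · exact Or.inl ⟨z 0 - 2 * p, ⟨by linarith, by linarith⟩, by linarith, by linarith, by linarith⟩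
    · right; left
      -- For neighbouring columns the middle segment degenerates to a point.
      rcases hpq'.eq_or_lt with he | he
      · exact ⟨0, ⟨le_rfl, zero_le_one⟩, by linarith, by linarith, by linarith⟩
      · have hd : 0 < 2 * (q : ℝ) - 2 * p - 2 := by linarith
        refine ⟨(z 0 - 2 * p - 1) / (2 * q - 2 * p - 2), ⟨div_nonneg (by linarith) hd.le,
          (div_le_one hd).2 (by linarith)⟩, ?_, by linarith, by linarith⟩
        linear_combination -div_mul_cancel₀ (z 0 - 2 * p - 1) hd.ne'
    · exact Or.inr (Or.inr ⟨z 0 - 2 * q + 1, ⟨by linarith, by linarith⟩, by linarith, by linarith, by linarith⟩)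

theorem arc_capArc {y p q : ℤ} (hpq : p < q) : Arc' (capArc y p q) (gate p y) (gate q y) := by
  have hpq' : (p : ℝ) + 1 ≤ q := by exact_mod_cast hpq
  have h3 : Arc' (segment ℝ ![2 * (q : ℝ) - 1, 2 * y + 2, 0] (gate q y)) ![2 * (q : ℝ) - 1, 2 * y + 2, 0] (gate q y) := by
    refine Arc.single (fun h => ?_) trivial
    have := congrFun h 0
    simp at this
  have h3' : ∀ x ∈ segment ℝ ![2 * (q : ℝ) - 1, 2 * y + 2, 0] (gate q y),
      x = ![2 * (q : ℝ) - 1, 2 * y + 2, 0] ∨ 2 * (q : ℝ) - 1 < x 0 := by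
    intro x hx
    obtain ⟨s, hs, h0, h1, h2⟩ := mem_segment_coord.1 hx
    simp only [Matrix.cons_val, gate_zero, gate_one, gate_two] at h0 h1 h2
    rcases hs.1.eq_or_lt with h | h
    · left; rw [← h] at h0 h1 h2
      exact space_ext (by simp [h0]) (by simp [h1]) (by simp [h2])
    · right; linarith
  rcases hpq'.eq_or_lt with he | he
  · have e : (![2 * (p : ℝ) + 1, 2 * y + 2, 0] : Space) = ![2 * (q : ℝ) - 1, 2 * y + 2, 0] := by
      congr 1; linarith
    have e' : {![2 * (q : ℝ) - 1, 2 * y + 2, 0]} ∪ segment ℝ ![2 * (q : ℝ) - 1, 2 * y + 2, 0] (gate q y) =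
        segment ℝ ![2 * (q : ℝ) - 1, 2 * y + 2, 0] (gate q y) :=
      union_eq_self_of_subset_left (singleton_subset_iff.2 (left_mem_segment ℝ _ _))
    rw [capArc, e, segment_same, e']
    refine Arc'.cons_of_dual (LinearMap.proj 0) (fun h => ?_) h3 ?_ h3'
    · have := congrFun h 0
      simp at this; linarith
    · simp; linarith
  · have h2 : Arc' (segment ℝ ![2 * (p : ℝ) + 1, 2 * y + 2, 0] ![2 * (q : ℝ) - 1, 2 * y + 2, 0] ∪
        segment ℝ ![2 * (q : ℝ) - 1, 2 * y + 2, 0] (gate q y)) ![2 * (p : ℝ) + 1, 2 * y + 2, 0] (gate q y) := by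
      refine Arc'.cons_of_dual (LinearMap.proj 0) (fun h => ?_) h3 ?_ h3'
      · have := congrFun h 0
        simp at this; linarith
      · simp; linarith
    refine Arc'.cons_of_dual (LinearMap.proj 0) (fun h => ?_) h2 ?_ ?_
    · have := congrFun h 0
      simp at this
    · simp
    · rintro x (hx | hx)
      · obtain ⟨s, hs, h0, h1, h2⟩ := mem_segment_coord.1 hx
        simp only [Matrix.cons_val] at h0 h1 h2
        rcases hs.1.eq_or_lt with h | h
        · left; rw [← h] at h0 h1 h2
          exact space_ext (by simp [h0]) (by simp [h1]) (by simp [h2])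
        · right
          simp only [LinearMap.proj_apply, Matrix.cons_val]
          nlinarith
      · right
        simp only [LinearMap.proj_apply, Matrix.cons_val]
        rcases h3' x hx with rfl | h
        · simp only [Matrix.cons_val]; linarith
        · linarith

theorem drawing_cap {y p q : ℤ} (hpq : p < q) (hc : F.cross y = {p, q}) :
    (F.cap hpq hc).drawing = (F.drawing ∩ {z | z 1 ≤ 2 * y + 1}) ∪ capArc y p q := by
  have hpq' : (p : ℝ) + 1 ≤ q := by exact_mod_cast hpq
  ext z
  rw [mem_union, mem_capArc hpq]
  constructor
  · rintro ⟨x, y', h⟩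
    by_cases h1 : y' ≤ y
    · simp only [cap, if_pos h1] at h
      refine Or.inl ⟨⟨x, y', h⟩, ?_⟩
      have h1' : (y' : ℝ) ≤ y := by exact_mod_cast h1
      have := (row_of_mem h).2.2.2
      show z 1 ≤ _
      linarith
    · right
      simp only [cap, if_neg h1] at h
      split_ifs at h with h2 h3 h4 h5
      · subst h2 h3
        simp only [Tile.drawing, Tile.mem_rightBottom, Pi.sub_apply, centre_zero, centre_one, centre_two] at h
        push_cast at h
        exact ⟨by linarith, Or.inl ⟨by linarith, by linarith, by linarith⟩⟩
      · subst h2 h4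
        simp only [Tile.drawing, Tile.mem_leftBottom, Pi.sub_apply, centre_zero, centre_one, centre_two] at h
        push_cast at h
        exact ⟨by linarith, Or.inr (Or.inr ⟨by linarith, by linarith, by linarith⟩)⟩
      · subst h2
        simp only [Tile.drawing, Tile.mem_horizontal, Pi.sub_apply, centre_zero, centre_one, centre_two] at h
        push_cast at h
        have e1 : (p : ℝ) + 1 ≤ x := by exact_mod_cast h5.1
        have e2 : (x : ℝ) + 1 ≤ q := by exact_mod_cast h5.2
        exact ⟨by linarith, Or.inr (Or.inl ⟨by linarith, by linarith, by linarith⟩)⟩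
      · exact h.elim
      · exact h.elim
  · rintro (⟨⟨x, y', h⟩, hz⟩ | ⟨h2, h⟩)
    · have hz' : z 1 ≤ 2 * y + 1 := hz
      by_cases h1 : y' ≤ y
      · exact ⟨x, y', by simpa only [cap, if_pos h1] using h⟩
      · have h1' : (y : ℝ) + 1 ≤ y' := by exact_mod_cast not_le.1 h1
        have := (row_of_mem h).2.2.1
        obtain ⟨x', hx', rfl⟩ := mem_line (y := y) ⟨x, y', h⟩ (by linarith)
        exact ⟨x', y, by simpa only [cap, if_pos (le_refl y)] using gate_mem_of_top hx'⟩
    · rcases h with ⟨h, h3, h4⟩ | ⟨h, h3, h4⟩ | ⟨h, h3, h4⟩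
      · refine ⟨p, y + 1, ?_⟩
        simp only [cap, if_neg (show ¬ (y + 1 ≤ y) by omega), if_true]
        simp only [Tile.drawing, Tile.mem_rightBottom, Pi.sub_apply, centre_zero, centre_one, centre_two]
        push_cast
        exact ⟨by linarith, by linarith, by linarith, by linarith⟩
      · set x := ⌊(z 0 + 1) / 2⌋ with hx
        have f1 := Int.floor_le ((z 0 + 1) / 2)
        have f2 := Int.lt_floor_add_one ((z 0 + 1) / 2)
        rw [← hx] at f1 f2
        have g1 : p < x := by
          have : (p : ℝ) < x := by linarith
          exact_mod_cast this
        have g2 : x ≤ q := by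
          have : (x : ℝ) ≤ q := by linarith
          exact_mod_cast this
        refine ⟨x, y + 1, ?_⟩
        simp only [cap, if_neg (show ¬ (y + 1 ≤ y) by omega), if_true, if_neg g1.ne']
        by_cases g3 : x = q
        · rw [if_pos g3]
          rw [g3] at f1 f2 ⊢
          simp only [Tile.drawing, Tile.mem_leftBottom, Pi.sub_apply, centre_zero, centre_one, centre_two]
          push_cast
          exact ⟨by linarith, by linarith, by linarith, by linarith⟩
        · rw [if_neg g3, if_pos ⟨g1, lt_of_le_of_ne g2 g3⟩]
          simp only [Tile.drawing, Tile.mem_horizontal, Pi.sub_apply, centre_zero, centre_one, centre_two]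
          push_cast
          exact ⟨by linarith, by linarith, by linarith, by linarith⟩
      · refine ⟨q, y + 1, ?_⟩
        simp only [cap, if_neg (show ¬ (y + 1 ≤ y) by omega), if_true, if_neg hpq.ne']
        simp only [Tile.drawing, Tile.mem_leftBottom, Pi.sub_apply, centre_zero, centre_one, centre_two]
        push_cast
        exact ⟨by linarith, by linarith, by linarith, by linarith⟩

theorem inter_line {y p q : ℤ} (hc : F.cross y = {p, q}) :
    F.drawing ∩ {z | z 1 = 2 * (y : ℝ) + 1} = {gate p y, gate q y} := by
  ext z; constructor
  · rintro ⟨hz, h⟩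
    obtain ⟨x, hx, rfl⟩ := mem_line hz h
    rw [hc] at hx
    rcases hx with rfl | rfl
    · exact Or.inl rfl
    · exact Or.inr rfl
  · rintro (rfl | rfl)
    · exact ⟨⟨p, y, gate_mem_of_top (hc ▸ Or.inl rfl)⟩, rfl⟩
    · exact ⟨⟨q, y, gate_mem_of_top (hc ▸ Or.inr rfl)⟩, rfl⟩

/-- The straight segment between the two gates and the strand drawn by the new row both lie at
height zero, below which there is nothing. Hence `Knot.becomes_flat` exchanges them. -/
theorem rep_cap {y p q : ℤ} (hpq : p < q) (hc : F.cross y = {p, q}) {L : Knot}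
    (hL : L.carrier = (F.drawing ∩ {z | z 1 ≤ 2 * y + 1}) ∪ segment ℝ (gate p y) (gate q y))
    (e : Knot.Equivalent L K) : (F.cap hpq hc).Rep K := by
  refine Rep.of_becomes e ?_
  rw [drawing_cap]
  have hab : gate p y ≠ gate q y := fun h => hpq.ne (gate_injective y h)
  have hend : ∀ z ∈ F.drawing, z 1 = 2 * y + 1 → z ∈ ({gate p y, gate q y} : Set Space) := fun z hz h => by
    rw [← inter_line hc]; exact ⟨hz, h⟩
  refine Knot.becomes_flat (LinearMap.proj 2) (Arc.single hab trivial) (arc_capArc hpq) ?_ ?_ hL ?_ ?_ ?_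
    (proj_ne_zero 2)
  · intro x hx
    obtain ⟨s, hs, h0, h1, h2⟩ := mem_segment_coord.1 hx
    simpa using h2
  · exact fun x hx => ((mem_capArc hpq).1 hx).1
  · exact fun x hx => nonneg_two hx.1
  · rintro x ⟨hx, hx'⟩
    obtain ⟨s, hs, h0, h1, h2⟩ := mem_segment_coord.1 hx'
    exact hend x hx.1 (by rw [h1]; simp; ring)
  · rintro x ⟨⟨hx, hx1⟩, hx'⟩
    have hx1' : x 1 ≤ 2 * y + 1 := hx1
    refine hend x hx (le_antisymm hx1' ?_)
    rcases ((mem_capArc hpq).1 hx').2 with h | h | h <;> linarith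

/-- The columns between two crossings are occupied above the line if there are no other crossings. -/
theorem Rep.exists_above (h : F.Rep K) {y p q : ℤ} (hpq : p < q) (hc : F.cross y = {p, q}) {x : ℤ}
    (hx : x ∈ Icc p q) : ∃ y', y < y' ∧ F.tile x y' ≠ Tile.blank := by
  obtain ⟨L, hL, -⟩ := h
  have hab : gate p y ≠ gate q y := fun h => hpq.ne (gate_injective y h)
  have hp : p ∈ F.cross y := hc ▸ Or.inl rfl
  have up := Pattern.exists_above (blank_of_connections ((F.top_iff p y).1 hp)) (lt_add_one y)
  have low := Pattern.exists_below (blank_of_connections hp) le_rfl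
  -- The part above the line is an arc joining the two gates, so its abscissa takes the value `2 *
  -- x`. A point at that abscissa lies in column `x`.
  have harc := (L.arcs_of_plane (f := LinearMap.proj 1) hab (by rw [hL]; exact inter_line hc)
    (by rw [hL]; exact low) (by rw [hL]; exact up)).2
  have hx' : (p : ℝ) ≤ x ∧ (x : ℝ) ≤ q := ⟨by exact_mod_cast hx.1, by exact_mod_cast hx.2⟩
  obtain ⟨z, ⟨hz, hzy⟩, hz0⟩ := harc.isPreconnected.intermediate_value harc.left_mem harc.right_mem
    (f := fun z => z 0) (continuous_apply 0).continuousOn (show 2 * (x : ℝ) ∈ Icc _ _ by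
      simp only [gate_zero, mem_Icc]; constructor <;> linarith [hx'.1, hx'.2])
  simp only at hz0
  rw [hL] at hz
  have hzy' : 2 * (y : ℝ) + 1 ≤ z 1 := hzy
  obtain ⟨x', y', hz'⟩ := hz
  obtain ⟨h1, h2, h3, h4⟩ := row_of_mem hz'
  have hxx : x' = x := by
    have a1 : (x' : ℝ) < x + 1 := by linarith
    have a2 : (x : ℝ) < x' + 1 := by linarith
    have a1' : x' < x + 1 := by exact_mod_cast a1
    have a2' : x < x' + 1 := by exact_mod_cast a2
    omega
  subst hxx
  by_cases hy : y < y'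
  · exact ⟨y', hy, tile_of_mem hz'⟩
  · have hy' : (y' : ℝ) ≤ y := by exact_mod_cast not_lt.1 hy
    obtain ⟨x'', hx'', rfl⟩ := mem_line (y := y) ⟨x', y', hz'⟩ (by linarith)
    have : x'' = x' := by
      simp only [gate_zero] at hz0
      have : (x'' : ℝ) = x' := by linarith
      exact_mod_cast this
    subst this
    exact ⟨y + 1, lt_add_one y, blank_of_connections ((F.top_iff x'' y).1 hx'')⟩

/-- Capping does not increase the number of tiles: the new row fills the columns `p` to `q`, and
each of them contains a discarded tile above the line. The capped pattern uses no new row or column,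
so an occupied row above `y + 1` would be lost and the extent would drop. -/
theorem Minimal.row_le_of_cut (h : F.Minimal K) {y p q : ℤ} (hpq : p < q) (hc : F.cross y = {p, q})
    {L : Knot}
    (hL : L.carrier = (F.drawing ∩ {z | z 1 ≤ 2 * y + 1}) ∪ segment ℝ (gate p y) (gate q y))
    (e : Knot.Equivalent L K) : ∀ y' ∈ F.rows, y' ≤ y + 1 := by
  have hG := rep_cap hpq hc hL e
  have hfin : F.support.Finite := F.finite
  set G := F.cap hpq hc
  have hsupp : G.support = _ := cap_support hpq hc
  have hsize : G.size ≤ F.size := by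
    have h1 : G.size ≤ {c ∈ F.support | c.2 ≤ y}.ncard + (Icc p q).ncard := by
      rw [size, hsupp]
      refine (ncard_union_le _ _).trans (Nat.add_le_add_left ?_ _)
      rw [ncard_prod, ncard_singleton, mul_one]
    have h2 : F.size = {c ∈ F.support | c.2 ≤ y}.ncard + {c ∈ F.support | ¬ c.2 ≤ y}.ncard := by
      rw [size, ← ncard_union_eq (Set.disjoint_left.2 fun c hc hc' => hc'.2 hc.2)
        (hfin.subset fun c hc => hc.1) (hfin.subset fun c hc => hc.1)]
      congr 1; ext c; simp only [mem_union, mem_ofPred_eq]; tauto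
    have h3 : (Icc p q).ncard ≤ {c ∈ F.support | ¬ c.2 ≤ y}.ncard := by
      have hf : {c ∈ F.support | ¬ c.2 ≤ y}.Finite := hfin.subset fun c hc => hc.1
      refine (ncard_le_ncard (fun x hx => ?_) (hf.image Prod.fst)).trans (ncard_image_le hf)
      obtain ⟨y', hy', hb⟩ := h.rep.exists_above hpq hc hx
      exact ⟨(x, y'), ⟨hb, not_le.2 hy'⟩, rfl⟩
    omega
  have hext := h.extent_le G hG hsize
  intro y' hy'
  by_contra! hlt
  have hcols : G.cols ⊆ F.cols := by
    rw [cols_eq, hsupp]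
    rintro _ ⟨⟨x, y''⟩, hc' | hc', rfl⟩
    · exact ⟨y'', hc'.1⟩
    · obtain ⟨y₃, -, hb⟩ := h.rep.exists_above hpq hc hc'.1
      exact ⟨y₃, hb⟩
  have hrows : G.rows ⊆ F.rows \ {y'} := by
    rw [rows_eq, hsupp]
    rintro _ ⟨⟨x, y''⟩, hc' | hc', rfl⟩
    · exact ⟨⟨x, hc'.1⟩, fun h => by
        have h1 : y'' = y' := h
        have h2 : y'' ≤ y := hc'.2
        omega⟩
    · have h1 : y'' = y + 1 := hc'.2
      have hp : p ∈ F.cross y := hc ▸ Or.inl rfl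
      refine ⟨⟨p, ?_⟩, fun h => by
        have h2 : y'' = y' := h
        omega⟩
      simp only [h1]
      exact blank_of_connections ((F.top_iff p y).1 hp)
  have c1 := ncard_le_ncard hcols F.cols_finite
  have c2 := ncard_le_ncard hrows (F.rows_finite.subset sdiff_subset)
  rw [ncard_sdiff_singleton_of_mem hy'] at c2
  have c3 : 0 < F.rows.ncard := (ncard_pos F.rows_finite).2 ⟨y', hy'⟩
  simp only [extent] at hext
  omega

/-- In a minimal pattern of a prime knot, a horizontal line with at least two occupied rows on
both sides is crossed at least four times. -/
theorem Minimal.four_le_cross (h : F.Minimal K) (hK : K.IsPrime) {y y₁ y₂ : ℤ} (h1 : y₁ ∈ F.rows)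
    (hy1 : y₁ < y) (h2 : y₂ ∈ F.rows) (hy2 : y + 1 < y₂) : 4 ≤ (F.cross y).ncard := by
  have hne := h.rep.cross_nonempty (y := y) h1.choose_spec hy1.le h2.choose_spec (by omega)
  have hpos := (ncard_pos (F.cross_finite y)).2 hne
  have heven := F.even_cross y
  by_contra! hlt
  have h2c : (F.cross y).ncard = 2 := by
    obtain ⟨k, hk⟩ := heven; omega
  obtain ⟨p, q, hpq, hc⟩ : ∃ p q, p < q ∧ F.cross y = {p, q} := by
    obtain ⟨p, q, hpq, hc⟩ := ncard_eq_two.1 h2c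
    rcases lt_or_gt_of_ne hpq with h | h
    · exact ⟨p, q, h, hc⟩
    · exact ⟨q, p, h, by rw [hc, pair_comm]⟩
  obtain ⟨L, hL, e⟩ := h.rep
  have hab : gate p y ≠ gate q y := fun h => hpq.ne (gate_injective y h)
  have hp : p ∈ F.cross y := hc ▸ Or.inl rfl
  have up := Pattern.exists_above (blank_of_connections ((F.top_iff p y).1 hp)) (lt_add_one y)
  have low := Pattern.exists_below (blank_of_connections hp) le_rfl
  -- If the lower part survives, capping contradicts the row `y₂`. If the upper part survives, a
  -- half turn, made of two quarter turns, reduces to the same situation with the row `y₁`.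
  rcases hK.becomes_of_plane e (f := LinearMap.proj 1) hab (by rw [hL]; exact inter_line hc)
    (by rw [hL]; exact low) (by rw [hL]; exact up) with ⟨L', hL', e'⟩ | ⟨L', hL', e'⟩
  · have := h.row_le_of_cut hpq hc (by rw [hL', hL]; rfl) (e'.symm.trans e) y₂ h2
    omega
  · have hG := (h.rot 0).rot 0
    have hGc : ((F.rot 0).rot 0).cross (-y - 1) = {-q, -p} := by
      ext x
      have : Side.top ∈ (((F.rot 0).rot 0).tile x (-y - 1)).connections ↔ -x ∈ F.cross y := by
        have hT : ∀ T : Tile, Side.top ∈ T.rot.rot.connections ↔ Side.bottom ∈ T.connections := by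
          intro T; cases T <;> decide
        rw [tile_rot, tile_rot, hT, cross, mem_ofPred_eq, F.top_iff, show 0 - x = -x by ring,
          show 0 - (-y - 1) = y + 1 by ring]
      show Side.top ∈ (((F.rot 0).rot 0).tile x (-y - 1)).connections ↔ _
      rw [this, hc]
      simp only [mem_insert_iff, mem_singleton_iff]
      omega
    obtain ⟨L₁, hL₁, e₁⟩ := ((goodAff_quarter 0).trans (goodAff_quarter 0)) L'
    have hq2 : ∀ z, ((quarter 0).trans (quarter 0)) z = ![-z 0, -z 1, z 2] := by
      intro z
      rw [AffineEquiv.trans_apply, quarter_apply, quarter_apply]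
      refine space_ext ?_ ?_ ?_ <;> simp
    have hgate : ∀ x, ((quarter 0).trans (quarter 0)) (gate x y) = gate (-x) (-y - 1) := by
      intro x; rw [hq2]
      refine space_ext ?_ ?_ ?_ <;> simp; ring
    have := hG.row_le_of_cut (neg_lt_neg hpq) hGc (L := L₁) ?_ (e₁.symm.trans (e'.symm.trans e)) (-y₁) ?_
    · omega
    · rw [hL₁, hL', hL, image_union, drawing_rot, drawing_rot, ← image_comp]
      have hseg := image_segment ℝ ((quarter 0).trans (quarter 0)).toAffineMap (gate q y) (gate p y)
      have e1 : ⇑((quarter 0).trans (quarter 0)) '' segment ℝ (gate p y) (gate q y) =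
          segment ℝ (gate (-q) (-y - 1)) (gate (-p) (-y - 1)) := by
        rw [segment_symm, ← hgate, ← hgate]; exact hseg
      rw [e1]
      congr 1
      ext z
      constructor
      · rintro ⟨w, ⟨hw, hw1⟩, rfl⟩
        refine ⟨⟨w, hw, rfl⟩, ?_⟩
        have hw1' : 2 * (y : ℝ) + 1 ≤ w 1 := hw1
        rw [hq2]
        show -w 1 ≤ _
        push_cast; linarith
      · rintro ⟨⟨w, hw, rfl⟩, hw1⟩
        refine ⟨w, ⟨hw, ?_⟩, rfl⟩
        have hw2 : ((quarter 0).trans (quarter 0)) w 1 ≤ 2 * ((-y - 1 : ℤ) : ℝ) + 1 := hw1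
        rw [hq2] at hw2
        simp only [Matrix.cons_val] at hw2
        push_cast at hw2
        show 2 * (y : ℝ) + 1 ≤ w 1
        linarith
    · rw [rows_rot, cols_rot]
      show 0 - -y₁ ∈ F.rows
      simpa using h1

end Pattern

end KnotMosaic

namespace KnotMosaic

open Set Filter Topology

/-! ### Removing a row of vertical strands -/

namespace Tile

/-- The horizontal and vertical displacement along the lower half of the strand starting at the
bottom of a tile. -/
def slope : Tile → ℝ × ℝ
  | leftBottom => (-1, 0)
  | rightBottom => (1, 0)
  | leftBottomRightTop => (-1, 0)
  | leftTopRightBottom => (1, 0)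
  | verticalOver => (0, 1)
  | _ => (0, 0)

theorem abs_slope_le (T : Tile) : |T.slope.1| ≤ 1 := by
  cases T <;> simp [slope]

theorem low_mem {T : Tile} (h : Side.bottom ∈ T.connections) {l : ℝ} (hl : l ∈ Icc (0 : ℝ) 1) {p : Space}
    (h0 : p 0 = T.slope.1 * l) (h1 : p 1 = l - 1) (h2 : p 2 = T.slope.2 * l) : p ∈ T.drawing := by
  obtain ⟨l0, l1⟩ := hl
  cases T <;> first
    | exact absurd h (by decide)
    | (simp only [slope] at h0 h2
       simp only [drawing, mem_union, mem_leftBottom, mem_rightBottom, mem_rightTop,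
        mem_leftTop, mem_horizontal, mem_vertical, mem_horizontalOver, mem_verticalOver]
       grind)

theorem of_low {T : Tile} {p : Space} (h : p ∈ T.drawing) (h1 : p 1 < 0) :
    Side.bottom ∈ T.connections ∧ p 0 = T.slope.1 * (p 1 + 1) ∧ p 2 = T.slope.2 * (p 1 + 1) := by
  cases T <;> simp only [drawing, mem_union, mem_leftBottom, mem_rightBottom, mem_rightTop,
    mem_leftTop, mem_horizontal, mem_vertical, mem_horizontalOver, mem_verticalOver,
    mem_empty_iff_false] at h <;>
    first
    | (exfalso; grind)
    | exact ⟨by decide, by simp only [slope]; grind, by simp only [slope]; grind⟩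

end Tile

namespace Pattern

variable {F : Pattern} {K : Knot}

/-- The pattern without row `y`, the higher rows being moved down. -/
def collapse (F : Pattern) (y : ℤ) (hv : ∀ x, F.tile x y = Tile.blank ∨ F.tile x y = Tile.vertical) :
    Pattern where
  tile x y' := if y' < y then F.tile x y' else F.tile x (y' + 1)
  right_iff x y' := by
    split_ifs
    · exact F.right_iff x y'
    · exact F.right_iff x (y' + 1)
  top_iff x y' := by
    split_ifs with h1 h2 h2
    · exact F.top_iff x y'
    · obtain rfl : y = y' + 1 := by omega
      rw [F.top_iff, ← F.top_iff x (y' + 1)]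
      rcases hv x with h | h <;> rw [h] <;> decide
    · omega
    · exact F.top_iff x (y' + 1)
  finite := by
    refine (F.finite.union (F.finite.image fun c => (c.1, c.2 - 1))).subset fun c hc => ?_
    simp only [mem_ofPred_eq] at hc
    split_ifs at hc
    · exact Or.inl hc
    · exact Or.inr ⟨(c.1, c.2 + 1), hc, by simp⟩

theorem size_collapse_lt {y : ℤ} (hv : ∀ x, F.tile x y = Tile.blank ∨ F.tile x y = Tile.vertical)
    (hy : y ∈ F.rows) : (F.collapse y hv).size < F.size := by
  obtain ⟨x₀, hx₀⟩ := hy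
  have hinj : Function.Injective fun c : ℤ × ℤ => (c.1, if c.2 < y then c.2 else c.2 + 1) := by
    rintro ⟨a, b⟩ ⟨a', b'⟩ h
    simp only [Prod.mk.injEq] at h
    obtain ⟨h1, h2⟩ := h
    refine Prod.ext h1 ?_
    simp only
    split_ifs at h2 <;> omega
  rw [size, size, ← ncard_image_of_injective _ hinj]
  refine ncard_lt_ncard ⟨?_, fun h => ?_⟩ F.finite
  · rintro _ ⟨⟨x, y'⟩, h, rfl⟩
    simp only [support, collapse, mem_ofPred_eq] at h ⊢
    split_ifs at h ⊢ <;> exact h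
  · obtain ⟨⟨x, y'⟩, -, h⟩ := h (show (x₀, y) ∈ F.support from hx₀)
    simp only [Prod.mk.injEq] at h
    have := h.2
    split_ifs at this <;> omega

/-- The slab of heights from `c = 2 y - 1` to `c + 5 / 2` contains row `y` and a quarter of row `y +
1`. Inside it the curve consists of strands over the height axis, vertical at first and then with
the slope prescribed by the tile above. The slab is compressed by the factor 5, each strand becoming
straight with the final slope, and all higher points move down by 2. Only a quarter of row `y + 1`
is used so that strands stay within distance `1 / 2` of the axes of their columns and cannot meet.
-/
theorem Rep.collapse (h : F.Rep K) {y : ℤ}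
    (hv : ∀ x, F.tile x y = Tile.blank ∨ F.tile x y = Tile.vertical) : (F.collapse y hv).Rep K := by
  obtain ⟨L, hL, e⟩ := h
  refine Rep.of_becomes e ?_
  obtain ⟨N, hN⟩ := F.exists_bound
  obtain ⟨c, hc⟩ : ∃ c : ℝ, c = 2 * y - 1 := ⟨_, rfl⟩
  -- the strands in row `y` and in the lower part of row `y + 1`
  obtain ⟨S, hS⟩ : ∃ S : ℤ → ℝ → ℝ → Space, ∀ j Y l, S j Y l =
      ![2 * j + (F.tile j (y + 1)).slope.1 * l, Y, (F.tile j (y + 1)).slope.2 * l] :=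
    ⟨_, fun _ _ _ => rfl⟩
  have hbot : ∀ {j}, Side.bottom ∈ (F.tile j (y + 1)).connections → F.tile j y = Tile.vertical := by
    intro j hj
    rcases hv j with h | h
    · have := (F.top_iff j y).2 hj
      rw [h] at this
      exact absurd this (by decide)
    · exact h
  have hslope : ∀ j : ℤ, ∀ {l : ℝ}, 0 ≤ l → l ≤ 1 / 2 →
      |(F.tile j (y + 1)).slope.1 * l| ≤ 1 / 2 := by
    intro j l l0 l1
    rw [abs_mul, abs_of_nonneg l0]
    have := Tile.abs_slope_le (F.tile j (y + 1))
    nlinarith [abs_nonneg (F.tile j (y + 1)).slope.1]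
  have hstrand : ∀ p ∈ F.drawing, c ≤ p 1 → p 1 ≤ c + 5 / 2 → ∃ j : ℤ, (-N < j ∧ j < N) ∧
      Side.bottom ∈ (F.tile j (y + 1)).connections ∧ p = S j (p 1) (max 0 (p 1 - c - 2)) := by
    rintro p hp h1 h2
    have hmid : ∀ j, p - centre j y ∈ (F.tile j y).drawing → ∃ j : ℤ, (-N < j ∧ j < N) ∧
      Side.bottom ∈ (F.tile j (y + 1)).connections ∧ p = S j (p 1) (max 0 (p 1 - c - 2)) := by
      intro j hp
      have hb := (row_of_mem hp).2.2.2
      rcases hv j with h | h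
      · exact absurd h (tile_of_mem hp)
      · refine ⟨j, (hN _ _ (tile_of_mem hp)).1, (F.top_iff j y).1 (by rw [h]; decide), ?_⟩
        rw [h] at hp
        simp only [Tile.drawing, Tile.mem_vertical, Pi.sub_apply, centre_zero, centre_one, centre_two] at hp
        rw [max_eq_left (by linarith), hS]
        exact space_ext (by simp; linarith) rfl (by simp; linarith)
    obtain ⟨j, y', hp⟩ := hp
    obtain ⟨-, -, h3, h4⟩ := row_of_mem hp
    have g1 : y' < y + 2 := by
      have : (y' : ℝ) < y + 2 := by linarith
      exact_mod_cast this
    have g2 : y - 1 ≤ y' := by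
      have : (y : ℝ) - 1 ≤ y' := by linarith
      exact_mod_cast this
    obtain rfl | rfl | rfl : y' = y - 1 ∨ y' = y ∨ y' = y + 1 := by omega
    · push_cast at h4
      obtain ⟨x, hx, rfl⟩ := mem_line (y := y - 1) ⟨j, y - 1, hp⟩ (by push_cast; linarith)
      have hx' := (F.top_iff _ _).1 hx
      rw [sub_add_cancel] at hx'
      refine hmid x ?_
      convert Tile.midpoint_mem hx' using 1
      apply space_ext <;> simp [Side.midpoint]; ring
    · exact hmid j hp
    · have hlow := Tile.of_low hp (by simp; linarith)
      refine ⟨j, (hN _ _ (tile_of_mem hp)).1, hlow.1, ?_⟩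
      have e0 := hlow.2.1
      have e2 := hlow.2.2
      push_cast at h3
      simp only [Pi.sub_apply, centre_zero, centre_one, centre_two] at e0 e2
      push_cast at e0 e2
      rw [max_eq_right (by linarith), hS]
      refine space_ext ?_ rfl ?_
      · simp only [Matrix.cons_val]; rw [hc]; linarith [e0]
      · simp only [Matrix.cons_val]; rw [hc]; linarith [e2]
  have hmem : ∀ {j : ℤ}, Side.bottom ∈ (F.tile j (y + 1)).connections → ∀ {Y : ℝ}, c ≤ Y → Y ≤ c + 5 / 2 →
      S j Y (max 0 (Y - c - 2)) ∈ F.drawing := by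
    intro j hj Y h1 h2
    rcases le_total Y (c + 2) with h | h
    · refine ⟨j, y, ?_⟩
      rw [hbot hj, max_eq_left (by linarith), hS]
      simp only [Tile.drawing, Tile.mem_vertical, Pi.sub_apply, centre_zero, centre_one, centre_two,
        Matrix.cons_val]
      exact ⟨by ring, by ring, by linarith, by linarith⟩
    · refine ⟨j, y + 1, Tile.low_mem hj (l := Y - c - 2) ⟨by linarith, by linarith⟩ ?_ ?_ ?_⟩
      · rw [max_eq_right (by linarith), hS]; simp
      · rw [hS]; simp; linarith
      · rw [max_eq_right (by linarith), hS]; simp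
  -- the deformation
  obtain ⟨G, hG⟩ : ∃ G : Space → Space, ∀ p, G p = if p 1 ≤ c then p else if c + 5 / 2 ≤ p 1 then
      p - ![0, 2, 0] else S ⌊(p 0 + 1) / 2⌋ (c + (p 1 - c) / 5) ((p 1 - c) / 5) := ⟨_, fun _ => rfl⟩
  have G1 : ∀ {p : Space}, p 1 ≤ c → G p = p := fun h => by rw [hG, if_pos h]
  have G3 : ∀ {p : Space}, c + 5 / 2 ≤ p 1 → G p = p - ![0, 2, 0] := fun h => by
    rw [hG, if_neg (by linarith), if_pos h]
  have G2 : ∀ {j : ℤ} {Y : ℝ}, c ≤ Y → Y ≤ c + 5 / 2 →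
      G (S j Y (max 0 (Y - c - 2))) = S j (c + (Y - c) / 5) ((Y - c) / 5) := by
    intro j Y h1 h2
    rcases h1.eq_or_lt with rfl | h1
    · rw [G1 (by simp [hS]), max_eq_left (by linarith)]; simp
    rcases h2.eq_or_lt with rfl | h2
    · rw [G3 (by simp [hS]), max_eq_right (by linarith), hS, hS]
      refine space_ext ?_ ?_ ?_ <;> simp only [Pi.sub_apply, Matrix.cons_val] <;> ring
    have e1 : S j Y (max 0 (Y - c - 2)) 1 = Y := by simp [hS]
    rw [hG, e1, if_neg (by linarith), if_neg (by linarith)]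
    congr 1
    rw [Int.floor_eq_iff, hS]
    simp only [Matrix.cons_val]
    have := abs_le.1 (hslope j (l := max 0 (Y - c - 2)) (le_max_left _ _) (max_le (by norm_num) (by linarith)))
    constructor <;> linarith
  have Gy : ∀ p q : Space, p 1 < q 1 → G p 1 < G q 1 := by
    intro p q hpq
    rw [hG, hG]
    split_ifs <;> (try simp only [Pi.sub_apply, hS, Matrix.cons_val]) <;> linarith
  have huniq : ∀ {j j' : ℤ} {Y l Y' l' : ℝ}, 0 ≤ l → l ≤ 1 / 2 → 0 ≤ l' → l' ≤ 1 / 2 →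
      S j Y l 0 = S j' Y' l' 0 → j = j' := by
    intro j j' Y l Y' l' a1 a2 a3 a4 h
    have b1 := abs_le.1 (hslope j a1 a2)
    have b2 := abs_le.1 (hslope j' a3 a4)
    simp only [hS, Matrix.cons_val] at h
    have c1 : (j : ℝ) < j' + 1 := by linarith
    have c2 : (j' : ℝ) < j + 1 := by linarith
    have c1' : j < j' + 1 := by exact_mod_cast c1
    have c2' : j' < j + 1 := by exact_mod_cast c2
    omega
  -- The breaking functions are the two levels bounding the slab and the walls `2 * j + 1` between
  -- columns. The walls force an edge inside the slab to belong to a single strand.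
  have key := L.becomes_of_piecewise (fun t x => (1 - t) • x + t • G x)
    ([(LinearMap.proj 1 : Space →ₗ[ℝ] ℝ).toAffineMap - AffineMap.const ℝ Space c,
      (LinearMap.proj 1 : Space →ₗ[ℝ] ℝ).toAffineMap - AffineMap.const ℝ Space (c + 5 / 2)] ++
      (Finset.Icc (-N) N).toList.map fun j : ℤ =>
        (LinearMap.proj 0 : Space →ₗ[ℝ] ℝ).toAffineMap - AffineMap.const ℝ Space (2 * j + 1 : ℝ))
    (fun x => by fun_prop) (by simp) ?_ ?_
  · convert key using 1
    rw [hL, show (fun x => (1 - 1 : ℝ) • x + (1 : ℝ) • G x) = G by funext x; simp]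
    have hcol : ∀ {p : Space} {x : ℤ} (y' : ℤ), p - centre x y' = p + ![0, 2, 0] - centre x (y' + 1) := by
      intro p x y'
      refine space_ext ?_ ?_ ?_ <;> simp only [Pi.sub_apply, Pi.add_apply, Matrix.cons_val, centre_zero,
        centre_one, centre_two] <;> push_cast <;> ring
    have hmem' : ∀ {j : ℤ}, Side.bottom ∈ (F.tile j (y + 1)).connections → ∀ {l : ℝ}, 0 ≤ l → l ≤ 1 / 2 →
        S j (c + l) l ∈ (F.collapse y hv).drawing := by
      intro j hj l l0 l1
      refine ⟨j, y, ?_⟩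
      simp only [Pattern.collapse, lt_irrefl, if_false]
      refine Tile.low_mem hj (l := l) ⟨l0, by linarith⟩ ?_ ?_ ?_
      · simp [hS]
      · simp [hS]; linarith
      · simp [hS]
    ext q
    constructor
    · rintro ⟨x, y', hq⟩
      simp only [Pattern.collapse] at hq
      split_ifs at hq with hy
      · refine ⟨q, ⟨x, y', hq⟩, G1 ?_⟩
        have := (row_of_mem hq).2.2.2
        have : (y' : ℝ) + 1 ≤ y := by exact_mod_cast hy
        linarith
      · have hy' : (y : ℝ) ≤ y' := by exact_mod_cast not_lt.1 hy
        have hq0 := (Tile.bounds hq).2.2.1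
        simp only [Pi.sub_apply, centre_one] at hq0
        by_cases hq1 : c + 1 / 2 ≤ q 1
        · refine ⟨q + ![0, 2, 0], ⟨x, y' + 1, by rwa [← hcol]⟩, ?_⟩
          rw [G3 (by simp; linarith), add_sub_cancel_right]
        · obtain rfl : y' = y := by
            have : (y' : ℝ) < y + 1 := by linarith
            have : y' < y + 1 := by exact_mod_cast this
            omega
          obtain ⟨hb, e0, e2⟩ := Tile.of_low hq (by simp; linarith)
          simp only [Pi.sub_apply, centre_zero, centre_one, centre_two] at e0 e2
          refine ⟨_, hmem hb (Y := c + 5 * (q 1 - c)) (by linarith) (by linarith), ?_⟩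
          rw [G2 (by linarith) (by linarith), hS]
          refine space_ext ?_ ?_ ?_
          · simp only [Matrix.cons_val]; rw [hc]; linear_combination -e0
          · simp only [Matrix.cons_val]; ring
          · simp only [Matrix.cons_val]; rw [hc]; linear_combination -e2
    · rintro ⟨p, hp, rfl⟩
      rcases le_total (p 1) c with h1 | h1
      · rw [G1 h1]
        obtain ⟨x, y', hp⟩ := hp
        have hb := (row_of_mem hp).2.2.1
        have : y' ≤ y := by
          have : (y' : ℝ) ≤ y := by linarith
          exact_mod_cast this
        rcases this.lt_or_eq with h | rfl
        · exact ⟨x, y', by simpa only [Pattern.collapse, if_pos h] using hp⟩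
        · obtain ⟨j, -, hj, e⟩ := hstrand p ⟨x, y', hp⟩ (by linarith) (by linarith)
          have h1' : p 1 = c := by linarith
          have := hmem' hj le_rfl (by norm_num)
          rw [e, h1', max_eq_left (by linarith)]
          simpa using this
      rcases le_total (p 1) (c + 5 / 2) with h2 | h2
      · obtain ⟨j, -, hj, e⟩ := hstrand p hp h1 h2
        rw [e, G2 h1 h2]
        exact hmem' hj (by linarith) (by linarith)
      · rw [G3 h2]
        obtain ⟨x, y', hp⟩ := hp
        have hb := (row_of_mem hp).2.2.2
        have : y < y' := by
          have : (y : ℝ) < y' := by linarith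
          exact_mod_cast this
        refine ⟨x, y' - 1, ?_⟩
        simp only [Pattern.collapse]
        rw [if_neg (by omega), sub_add_cancel, hcol, sub_add_cancel, sub_add_cancel]
        exact hp
  · intro t ht p hp q hq hpq
    rw [hL] at hp hq
    simp only at hpq
    have h1 := congrFun hpq 1
    simp only [Pi.add_apply, Pi.smul_apply, smul_eq_mul] at h1
    -- The order of heights is preserved at all times, so only points of equal height could collide.
    have hlt : ∀ p q : Space, p 1 < q 1 → (1 - t) * p 1 + t * G p 1 < (1 - t) * q 1 + t * G q 1 := by
      intro p q h
      have := Gy p q h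
      rcases ht.1.eq_or_lt with h0 | h0
      · rw [← h0]; linarith
      · nlinarith [ht.2]
    have h1 : p 1 = q 1 := by
      rcases lt_trichotomy (p 1) (q 1) with h | h | h
      · exact absurd (hlt p q h) (by rw [h1]; exact lt_irrefl _)
      · exact h
      · exact absurd (hlt q p h) (by rw [h1]; exact lt_irrefl _)
    rcases le_total (p 1) c with a1 | a1
    · rw [G1 a1, G1 (h1 ▸ a1)] at hpq
      simpa [← add_smul] using hpq
    rcases le_total (c + 5 / 2) (p 1) with a2 | a2
    · rw [G3 a2, G3 (h1 ▸ a2)] at hpq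
      have e : ∀ p : Space, (1 - t) • p + t • (p - ![0, 2, 0]) = p - t • ![0, 2, 0] := fun p => by module
      rw [e, e] at hpq
      exact sub_left_injective hpq
    obtain ⟨j, -, -, ep⟩ := hstrand p hp a1 a2
    obtain ⟨j', -, -, eq⟩ := hstrand q hq (h1 ▸ a1) (h1 ▸ a2)
    have hjj : j = j' := by
      rw [ep, eq, G2 a1 a2, G2 (h1 ▸ a1) (h1 ▸ a2)] at hpq
      have e : ∀ j Y l Y' l', (1 - t) • S j Y l + t • S j Y' l' = S j ((1 - t) * Y + t * Y') ((1 - t) * l + t * l') := by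
        intro j Y l Y' l'
        simp only [hS]
        refine space_ext ?_ ?_ ?_ <;> simp <;> ring
      rw [e, e, ← h1] at hpq
      have m1 : (0 : ℝ) ≤ max 0 (p 1 - c - 2) := le_max_left _ _
      have m2 : max 0 (p 1 - c - 2) ≤ 1 / 2 := max_le (by norm_num) (by linarith)
      have n1 : 0 ≤ (1 - t) * max 0 (p 1 - c - 2) + t * ((p 1 - c) / 5) := by
        have := ht.1; have := sub_nonneg.2 ht.2
        have : 0 ≤ (p 1 - c) / 5 := by linarith
        positivity
      have n2 : (1 - t) * max 0 (p 1 - c - 2) + t * ((p 1 - c) / 5) ≤ 1 / 2 :=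
        combo_le ht m2 (by linarith)
      exact huniq n1 n2 n1 n2 (congrFun hpq 0)
    rw [ep, eq, hjj, h1]
  · intro a b hab hl t ht s hs
    rw [hL] at hab
    have ha := hab (left_mem_segment ℝ a b)
    have hb := hab (right_mem_segment ℝ a b)
    have hw := hab (segment_eq_image_lineMap ℝ a b ▸ mem_image_of_mem _ hs)
    have lc : ∀ i, (AffineMap.lineMap a b s : Space) i = (1 - s) * a i + s * b i := by
      intro i; simp [AffineMap.lineMap_apply_module]
    suffices hG' : G (AffineMap.lineMap a b s) = AffineMap.lineMap (G a) (G b) s by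
      show (1 - t) • _ + t • G _ = AffineMap.lineMap ((1 - t) • a + t • G a) ((1 - t) • b + t • G b) s
      rw [hG']
      simp only [AffineMap.lineMap_apply_module]
      module
    have l1 := hl _ (List.mem_append_left _ (List.mem_cons_self ..))
    have l2 := hl _ (List.mem_append_left _ (List.mem_cons_of_mem _ (List.mem_cons_self ..)))
    simp only [AffineMap.coe_sub, Pi.sub_apply, LinearMap.coe_toAffineMap, LinearMap.proj_apply,
      AffineMap.const_apply] at l1 l2
    rcases nonneg_or_nonpos l1 with m1 | m1
    swap
    · rw [G1 (p := a) (by linarith), G1 (p := b) (by linarith), G1]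
      rw [lc]; exact combo_le hs (by linarith) (by linarith)
    rcases nonneg_or_nonpos l2 with m2 | m2
    · rw [G3 (p := a) (by linarith), G3 (p := b) (by linarith), G3]
      · simp only [AffineMap.lineMap_apply_module]; module
      · rw [lc]; exact le_combo hs (by linarith) (by linarith)
    have b1 : c ≤ (AffineMap.lineMap a b s : Space) 1 := by
      rw [lc]; exact le_combo hs (by linarith) (by linarith)
    have b2 : (AffineMap.lineMap a b s : Space) 1 ≤ c + 5 / 2 := by
      rw [lc]; exact combo_le hs (by linarith) (by linarith)
    have hrange : ∀ {p : Space}, p ∈ F.drawing → c ≤ p 1 → p 1 ≤ c + 5 / 2 → ∃ j : ℤ, (-N < j ∧ j < N) ∧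
        G p = S j (c + (p 1 - c) / 5) ((p 1 - c) / 5) ∧ |p 0 - 2 * j| ≤ 1 / 2 := by
      intro p hp c1 c2
      obtain ⟨j, hj, -, e⟩ := hstrand p hp c1 c2
      refine ⟨j, hj, ?_, ?_⟩
      · conv_lhs => rw [e]
        exact G2 c1 c2
      · have : p 0 - 2 * j = (F.tile j (y + 1)).slope.1 * max 0 (p 1 - c - 2) := by
          rw [e, hS]; simp
        rw [this]
        exact hslope j (le_max_left _ _) (max_le (by norm_num) (by linarith))
    obtain ⟨ja, hja, ea, ca⟩ := hrange ha (by linarith) (by linarith)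
    obtain ⟨jb, hjb, eb, cb⟩ := hrange hb (by linarith) (by linarith)
    obtain ⟨jw, hjw, ew, cw⟩ := hrange hw b1 b2
    have hsep : ∀ j : ℤ, -N < j ∧ j < N → 0 ≤ (a 0 - (2 * j + 1)) * (b 0 - (2 * j + 1)) := by
      intro j hj
      have := hl _ (List.mem_append_right _ (List.mem_map.2 ⟨j, Finset.mem_toList.2
        (Finset.mem_Icc.2 ⟨hj.1.le, hj.2.le⟩), rfl⟩))
      simpa using this
    rw [abs_le] at ca cb cw
    have hjab : ja = jb := by
      rcases lt_trichotomy ja jb with h | h | h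
      · have h' : (ja : ℝ) + 1 ≤ jb := by exact_mod_cast h
        nlinarith [hsep ja hja]
      · exact h
      · have h' : (jb : ℝ) + 1 ≤ ja := by exact_mod_cast h
        nlinarith [hsep jb hjb]
    subst hjab
    have hjw' : jw = ja := by
      have w0 := lc 0
      have w1 : (AffineMap.lineMap a b s : Space) 0 ≤ 2 * ja + 1 / 2 := by
        rw [w0]; exact combo_le hs (by linarith) (by linarith)
      have w2 : 2 * (ja : ℝ) - 1 / 2 ≤ (AffineMap.lineMap a b s : Space) 0 := by
        rw [w0]; exact le_combo hs (by linarith) (by linarith)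
      have c1 : (jw : ℝ) < ja + 1 := by linarith
      have c2 : (ja : ℝ) < jw + 1 := by linarith
      have c1' : jw < ja + 1 := by exact_mod_cast c1
      have c2' : ja < jw + 1 := by exact_mod_cast c2
      omega
    subst hjw'
    rw [ew, ea, eb, lc]
    simp only [hS, AffineMap.lineMap_apply_module]
    refine space_ext ?_ ?_ ?_ <;> simp <;> ring

theorem Minimal.exists_not_vertical (h : F.Minimal K) {y : ℤ} (hy : y ∈ F.rows) :
    ∃ x, F.tile x y ≠ Tile.blank ∧ F.tile x y ≠ Tile.vertical := by
  by_contra! hv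
  have hv' : ∀ x, F.tile x y = Tile.blank ∨ F.tile x y = Tile.vertical := fun x => by
    by_contra! h'; exact h'.2 (hv x h'.1)
  exact (size_collapse_lt hv' hy).not_ge (h.size_le _ (h.rep.collapse hv'))

end Pattern

end KnotMosaic

namespace KnotMosaic

open Set Filter Topology

namespace Pattern

variable {F : Pattern} {K : Knot}

/-! ### The number of tiles in terms of the number of rows -/

/-- The columns of the non-blank tiles in row `y`. -/
def occupied (F : Pattern) (y : ℤ) : Set ℤ := {x | F.tile x y ≠ Tile.blank}

theorem occupied_finite (F : Pattern) (y : ℤ) : (F.occupied y).Finite :=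
  (F.finite.image Prod.fst).subset fun x hx => ⟨(x, y), hx, rfl⟩

theorem cross_subset (y : ℤ) : F.cross y ⊆ F.occupied y := fun _ => blank_of_connections

theorem cross_pred_subset (y : ℤ) : F.cross (y - 1) ⊆ F.occupied y := fun x hx => by
  have := (F.top_iff _ _).1 hx
  rw [sub_add_cancel] at this
  exact blank_of_connections this

theorem sum_occupied_le (F : Pattern) (s : Finset ℤ) : ∑ y ∈ s, (F.occupied y).ncard ≤ F.size := by
  classical
  have hf : F.support.Finite := F.finite
  have h1 : ∀ y, (F.occupied y).ncard = {c ∈ hf.toFinset | c.2 = y}.card := by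
    intro y
    rw [← ncard_coe_finset, ← ncard_image_of_injective (F.occupied y) (Prod.mk_left_injective y)]
    congr 1
    ext ⟨x, y'⟩
    simp only [occupied, mem_image, mem_ofPred_eq, Prod.mk.injEq, Finset.coe_filter, Finite.mem_toFinset,
      support]
    constructor
    · rintro ⟨x, h, rfl, rfl⟩; exact ⟨h, rfl⟩
    · rintro ⟨h, rfl⟩; exact ⟨x, h, rfl, rfl⟩
  simp only [h1]
  rw [size, ncard_eq_toFinset_card _ hf]
  rw [← Finset.card_biUnion fun y _ y' _ hyy' => Finset.disjoint_left.2 fun c hc hc' =>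
    hyy' ((Finset.mem_filter.1 hc).2.symm.trans (Finset.mem_filter.1 hc').2)]
  exact Finset.card_le_card (Finset.biUnion_subset.2 fun y _ => Finset.filter_subset _ _)

/-- With at most four tiles, every tile of the row would be crossed both at the top and at the
bottom. A left connection then forces a right one, which would propagate for ever to the right. So
there are no horizontal connections and all tiles are vertical segments, which minimality excludes.
-/
theorem Minimal.five_le_occupied (h : F.Minimal K) {y : ℤ} (h1 : 4 ≤ (F.cross y).ncard)
    (h2 : 4 ≤ (F.cross (y - 1)).ncard) : 5 ≤ (F.occupied y).ncard := by
  by_contra! hlt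
  have e1 := eq_of_subset_of_ncard_le (F.cross_subset y) (by omega) (F.occupied_finite y)
  have e2 := eq_of_subset_of_ncard_le (F.cross_pred_subset y) (by omega) (F.occupied_finite y)
  have hT : ∀ x, F.tile x y = Tile.blank ∨ Side.top ∈ (F.tile x y).connections ∧
      Side.bottom ∈ (F.tile x y).connections := by
    intro x
    by_cases hx : x ∈ F.occupied y
    · refine Or.inr ⟨show x ∈ F.cross y from e1.symm ▸ hx, ?_⟩
      have := (F.top_iff _ _).1 (show x ∈ F.cross (y - 1) from e2.symm ▸ hx)
      rwa [sub_add_cancel] at this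
    · exact Or.inl (not_not.1 hx)
  obtain ⟨N, hN⟩ := F.exists_bound
  have hstep : ∀ x, Side.right ∈ (F.tile x y).connections → Side.right ∈ (F.tile (x + 1) y).connections := by
    intro x hx
    have hl := (F.right_iff x y).1 hx
    have := hT (x + 1)
    revert hl this
    generalize F.tile (x + 1) y = T
    cases T <;> decide
  have hright : ∀ x, Side.right ∉ (F.tile x y).connections := by
    intro x hx
    have : ∀ n : ℕ, Side.right ∈ (F.tile (x + n) y).connections := by
      intro n
      induction n with
      | zero => simpa using hx
      | succ n ih => rw [Nat.cast_succ, ← add_assoc]; exact hstep _ ih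
    have h1 := (hN _ _ (blank_of_connections (this (2 * N).toNat))).1
    have h2 := (hN _ _ (blank_of_connections hx)).1
    omega
  have hne : (F.occupied y).Nonempty := nonempty_of_ncard_ne_zero (by rw [← e1]; omega)
  obtain ⟨x, hx1, hx2⟩ := h.exists_not_vertical hne
  have h1 := hT x
  have h2 := hright x
  revert h1 h2 hx1 hx2
  generalize F.tile x y = T
  cases T <;> decide

/-- A connected curve cannot skip a row between its lowest and its highest row. -/
theorem Rep.exists_rows_eq (h : F.Rep K) : ∃ a b, a ≤ b ∧ F.rows = Icc a b := by
  obtain ⟨⟨x, y⟩, hc⟩ := h.eq_blank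
  have hne : F.rows.Nonempty := ⟨y, x, hc⟩
  obtain ⟨a, ha, ha'⟩ := F.rows_finite.exists_minimal hne
  obtain ⟨b, hb, hb'⟩ := F.rows_finite.exists_maximal hne
  have hlow : ∀ y ∈ F.rows, a ≤ y := fun y hy => by
    by_contra! hlt; exact hlt.not_ge (ha' hy hlt.le)
  have hupp : ∀ y ∈ F.rows, y ≤ b := fun y hy => by
    by_contra! hlt; exact hlt.not_ge (hb' hy hlt.le)
  refine ⟨a, b, hlow b hb, Subset.antisymm (fun y hy => ⟨hlow y hy, hupp y hy⟩) fun y hy => ?_⟩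
  rcases hy.2.eq_or_lt with rfl | hlt
  · exact hb
  · obtain ⟨x, hx⟩ := h.cross_nonempty ha.choose_spec hy.1 hb.choose_spec hlt
    exact ⟨x, blank_of_connections hx⟩

theorem Rep.two_le_cross (h : F.Rep K) {y a b : ℤ} (ha : a ∈ F.rows) (hay : a ≤ y) (hb : b ∈ F.rows)
    (hyb : y < b) : 2 ≤ (F.cross y).ncard := by
  have h1 := (ncard_pos (F.cross_finite y)).2
    (h.cross_nonempty ha.choose_spec hay hb.choose_spec hyb)
  obtain ⟨k, hk⟩ := F.even_cross y
  omega

theorem Rep.two_le_occupied (h : F.Rep K) {y a b : ℤ} (ha : a ∈ F.rows) (hay : a ≤ y) (hb : b ∈ F.rows)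
    (hyb : y ≤ b) (hab : a < b) : 2 ≤ (F.occupied y).ncard := by
  rcases hyb.lt_or_eq with hlt | rfl
  · exact (h.two_le_cross ha hay hb hlt).trans (ncard_le_ncard (F.cross_subset y) (F.occupied_finite y))
  · exact (h.two_le_cross ha (y := y - 1) (by omega) hb (by omega)).trans
      (ncard_le_ncard (F.cross_pred_subset y) (F.occupied_finite y))

theorem Rep.two_mul_rows_le (h : F.Rep K) (hr : 2 ≤ F.rows.ncard) : 2 * F.rows.ncard ≤ F.size := by
  obtain ⟨a, b, hab, e⟩ := h.exists_rows_eq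
  have hcard : F.rows.ncard = (Finset.Icc a b).card := by
    rw [e, ← Finset.coe_Icc, ncard_coe_finset]
  have ha : a ∈ F.rows := e ▸ ⟨le_rfl, hab⟩
  have hb : b ∈ F.rows := e ▸ ⟨hab, le_rfl⟩
  rw [hcard, Int.card_Icc] at hr
  refine le_trans ?_ (F.sum_occupied_le (Finset.Icc a b))
  rw [hcard, mul_comm, ← smul_eq_mul]
  refine Finset.card_nsmul_le_sum _ _ _ fun y hy => ?_
  rw [Finset.mem_Icc] at hy
  exact h.two_le_occupied ha hy.1 hb hy.2 (by omega)

/-- From bottom to top the rows have at least `2, 4, 5, ..., 5, 4, 2` tiles. -/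
theorem Minimal.five_mul_rows_le (h : F.Minimal K) (hK : K.IsPrime) (hr : 4 ≤ F.rows.ncard) :
    5 * F.rows.ncard ≤ F.size + 8 := by
  obtain ⟨a, b, hab, e⟩ := h.rep.exists_rows_eq
  have hcard : F.rows.ncard = (Finset.Icc a b).card := by
    rw [e, ← Finset.coe_Icc, ncard_coe_finset]
  have ha : a ∈ F.rows := e ▸ ⟨le_rfl, hab⟩
  have hb : b ∈ F.rows := e ▸ ⟨hab, le_rfl⟩
  rw [hcard, Int.card_Icc] at hr
  have hfour : ∀ y, a < y → y + 1 < b → 4 ≤ (F.cross y).ncard := fun y h1 h2 =>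
    h.four_le_cross hK ha h1 hb h2
  -- The outermost rows fall short of five by 3 and their neighbours by 1, a total of 8. For at
  -- least four rows these are four different rows.
  have hrow : ∀ y ∈ Finset.Icc a b, (5 - (if y = a then 3 else 0) - (if y = b then 3 else 0) -
      (if y = a + 1 then 1 else 0) - (if y = b - 1 then 1 else 0) : ℤ) ≤ ((F.occupied y).ncard : ℤ) := by
    intro y hy
    rw [Finset.mem_Icc] at hy
    have h2 := h.rep.two_le_occupied ha hy.1 hb hy.2 (by omega)
    have hc := ncard_le_ncard (F.cross_subset y) (F.occupied_finite y)
    have hc' := ncard_le_ncard (F.cross_pred_subset y) (F.occupied_finite y)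
    by_cases h3 : y = a ∨ y = b
    · split_ifs <;> omega
    by_cases h4 : y = a + 1
    · have := hfour y (by omega) (by omega)
      split_ifs <;> omega
    have h5 := hfour (y - 1) (by omega) (by omega)
    by_cases h6 : y = b - 1
    · split_ifs <;> omega
    have := h.five_le_occupied (hfour y (by omega) (by omega)) h5
    split_ifs <;> omega
  have hsum := Finset.sum_le_sum hrow
  rw [Finset.sum_sub_distrib, Finset.sum_sub_distrib, Finset.sum_sub_distrib, Finset.sum_sub_distrib,
    Finset.sum_ite_eq', Finset.sum_ite_eq', Finset.sum_ite_eq', Finset.sum_ite_eq',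
    if_pos (Finset.mem_Icc.2 ⟨le_rfl, hab⟩), if_pos (Finset.mem_Icc.2 ⟨hab, le_rfl⟩),
    if_pos (Finset.mem_Icc.2 ⟨by omega, by omega⟩), if_pos (Finset.mem_Icc.2 ⟨by omega, by omega⟩),
    Finset.sum_const, nsmul_eq_mul] at hsum
  have hle : (∑ y ∈ Finset.Icc a b, ((F.occupied y).ncard : ℤ)) ≤ F.size := by
    exact_mod_cast F.sum_occupied_le (Finset.Icc a b)
  rw [hcard]
  omega

end Pattern

end KnotMosaic

namespace KnotMosaic

open Set Filter Topology

/-! ### Planar segments -/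

/-- The point `(x, y, 0)`. -/
def pt (x y : ℝ) : Space := ![x, y, 0]

@[simp] theorem pt_zero (x y : ℝ) : pt x y 0 = x := rfl
@[simp] theorem pt_one (x y : ℝ) : pt x y 1 = y := rfl
@[simp] theorem pt_two (x y : ℝ) : pt x y 2 = 0 := rfl

/-- The segment from `(a, b, 0)` to `(c, d, 0)`. -/
def seg (a b c d : ℝ) : Set Space := segment ℝ (pt a b) (pt c d)

theorem seg_symm (a b c d : ℝ) : seg a b c d = seg c d a b := segment_symm ℝ _ _

theorem mem_seg {a b c d : ℝ} {p : Space} : p ∈ seg a b c d ↔ ∃ s ∈ Icc (0 : ℝ) 1,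
    p 0 = (1 - s) * a + s * c ∧ p 1 = (1 - s) * b + s * d ∧ p 2 = 0 := by
  simp [seg, mem_segment_coord]

theorem seg_split {a b c d e f : ℝ} (h : ∃ s ∈ Icc (0 : ℝ) 1, c = (1 - s) * a + s * e ∧
    d = (1 - s) * b + s * f) : seg a b e f = seg a b c d ∪ seg c d e f := by
  refine segment_eq_union ?_
  obtain ⟨s, hs, h0, h1⟩ := h
  exact mem_segment_coord.2 ⟨s, hs, by simpa using h0, by simpa using h1, by simp⟩

theorem affineIndependent_pt {a b c d e f : ℝ} (h : (c - a) * (f - b) ≠ (d - b) * (e - a)) :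
    AffineIndependent ℝ ![pt a b, pt c d, pt e f] := by
  refine affineIndependent_of_dual (fun h' => ?_)
    ((d - b) • (LinearMap.proj 0 : Space →ₗ[ℝ] ℝ) - (c - a) • (LinearMap.proj 1 : Space →ₗ[ℝ] ℝ)) ?_ ?_
  · have h0 := congrFun h' 0
    have h1 := congrFun h' 1
    simp only [pt_zero, pt_one] at h0 h1
    apply h; rw [h0, h1]; ring
  · simp; ring
  · intro h'
    simp only [LinearMap.sub_apply, LinearMap.smul_apply, LinearMap.proj_apply, pt_zero, pt_one,
      smul_eq_mul] at h'
    apply h; linarith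

/-- Removal of a vertex in terms of barycentric coordinates. -/
theorem Knot.becomes_remove_vertex_coord {K : Knot} {R : Set Space} {a b c : Space}
    (hK : K.carrier = R ∪ (segment ℝ a c ∪ segment ℝ c b)) (hi : AffineIndependent ℝ ![a, b, c])
    (hR : ∀ p ∈ R, ∀ α β γ : ℝ, 0 ≤ α → 0 ≤ β → 0 ≤ γ → α + β + γ = 1 →
      p 0 = α * a 0 + β * b 0 + γ * c 0 → p 1 = α * a 1 + β * b 1 + γ * c 1 →
      p 2 = α * a 2 + β * b 2 + γ * c 2 → α = 1 ∨ β = 1) : K.Becomes (R ∪ segment ℝ a b) := by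
  refine Knot.becomes_remove_vertex hK hi ?_
  rintro p ⟨hp, hp'⟩
  obtain ⟨α, β, γ, hα, hβ, hγ, hs, rfl⟩ := mem_convexHull₃.1 hp'
  rcases hR _ hp α β γ hα hβ hγ hs (by simp) (by simp) (by simp) with rfl | rfl
  · have h1 : β = 0 := by linarith
    have h2 : γ = 0 := by linarith
    simp [h1, h2]
  · have h1 : α = 0 := by linarith
    have h2 : γ = 0 := by linarith
    simp [h1, h2]

theorem Knot.becomes_remove_pt {K : Knot} {R : Set Space} {a b c d e f : ℝ}
    (hK : K.carrier = R ∪ (seg a b e f ∪ seg e f c d)) (hi : (c - a) * (f - b) ≠ (d - b) * (e - a))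
    (hR : ∀ p ∈ R, ∀ α β γ : ℝ, 0 ≤ α → 0 ≤ β → 0 ≤ γ → α + β + γ = 1 →
      p 0 = α * a + β * c + γ * e → p 1 = α * b + β * d + γ * f → p 2 = 0 → α = 1 ∨ β = 1) :
    K.Becomes (R ∪ seg a b c d) :=
  Knot.becomes_remove_vertex_coord hK (affineIndependent_pt hi) fun p hp α β γ h1 h2 h3 h4 h5 h6 h7 =>
    hR p hp α β γ h1 h2 h3 h4 h5 h6 (by simpa using h7)

/-- A knot containing a triangle is the triangle. -/
theorem Knot.isTrivial_of_triangle {K : Knot} {a b c : Space} (h : AffineIndependent ℝ ![a, b, c])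
    (hac : segment ℝ a c ⊆ K.carrier) (hb : segment ℝ a b ∪ segment ℝ b c ⊆ K.carrier)
    (harc : Arc' (segment ℝ a b ∪ segment ℝ b c) a c) (hne : b ∉ segment ℝ a c) : K.IsTrivial := by
  obtain ⟨U, hU, hK, hi⟩ := K.isLoop.exists_complement (Arc.single harc.ne trivial) hac
  have := Arc.eq_or_eq_of_subset_union (Arc.single (P := fun _ _ => True) harc.ne trivial) hU hi harc (hK ▸ hb)
  rcases this with e | e
  · exact absurd (e ▸ Or.inl (right_mem_segment ℝ a b)) hne
  · refine ⟨K, Knot.Equivalent.refl K, a, b, c, h, ?_⟩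
    rw [hK, ← e, union_comm, segment_symm ℝ a c]

/-! ### Cutting off a corner -/

/-- Removing the vertex `(1, 0)` next to the corner. -/
theorem Knot.becomes_cut_first {K : Knot} {R : Set Space} {a a' b b' : ℝ}
    (ha : a = 3 ∧ a' = 0 ∨ a = 2 ∧ a' = 1) (hb : b = 0 ∧ b' = 3 ∨ b = 1 ∧ b' = 2)
    (hK : K.carrier = R ∪ (seg a a' 1 0 ∪ seg 1 0 0 1 ∪ seg 0 1 b b'))
    (hR : ∀ p ∈ R, 3 ≤ p 0 + p 1 ∨ 3 ≤ p 0 ∨ 3 ≤ p 1) :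
    K.Becomes (R ∪ (seg a a' 0 1 ∪ seg 0 1 b b')) := by
  -- The corner cell is the square `[-1, 1]²`. The strand leaves the cell to its right at `(a, a')`,
  -- which is `(3, 0)` for a horizontal tile and `(2, 1)` for an arc. Likewise `(b, b')` is its exit
  -- from the cell above.
  have := Knot.becomes_remove_pt (K := K) (R := R ∪ seg 0 1 b b') (a := a) (b := a') (c := 0) (d := 1)
    (e := 1) (f := 0) (by rw [hK]; ac_rfl) ?_ ?_
  · convert this using 1; ac_rfl
  · rcases ha with ⟨rfl, rfl⟩ | ⟨rfl, rfl⟩ <;> norm_num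
  · rintro p (hp | hp) α β γ hα hβ hγ hs h0 h1 -
    · left
      rcases ha with ⟨rfl, rfl⟩ | ⟨rfl, rfl⟩ <;> rcases hR p hp with h | h | h <;> linarith
    · obtain ⟨s, ⟨hs0, hs1⟩, g0, g1, -⟩ := mem_seg.1 hp
      right
      rcases ha with ⟨rfl, rfl⟩ | ⟨rfl, rfl⟩ <;> rcases hb with ⟨rfl, rfl⟩ | ⟨rfl, rfl⟩ <;> linarith

/-- Cutting off the corner between `(1, 0)` and `(0, 1)`. -/
theorem Knot.becomes_cut {K : Knot} {R : Set Space} {a a' b b' : ℝ}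
    (ha : a = 3 ∧ a' = 0 ∨ a = 2 ∧ a' = 1) (hb : b = 0 ∧ b' = 3 ∨ b = 1 ∧ b' = 2)
    (hK : K.carrier = R ∪ (seg a a' 1 0 ∪ seg 1 0 0 1 ∪ seg 0 1 b b'))
    (hR : ∀ p ∈ R, 3 < p 0 + p 1 ∨ 3 ≤ p 0 ∨ 3 ≤ p 1 ∨ p = pt a a' ∨ p = pt b b') :
    K.Becomes (R ∪ seg a a' b b') := by
  refine (Knot.becomes_cut_first ha hb hK fun p hp => ?_).trans fun K' hK' => ?_
  · rcases hR p hp with h | h | h | rfl | rfl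
    · exact Or.inl h.le
    · exact Or.inr (Or.inl h)
    · exact Or.inr (Or.inr h)
    · left; rcases ha with ⟨rfl, rfl⟩ | ⟨rfl, rfl⟩ <;> norm_num
    · left; rcases hb with ⟨rfl, rfl⟩ | ⟨rfl, rfl⟩ <;> norm_num
  · refine Knot.becomes_remove_pt hK' ?_ ?_
    · rcases ha with ⟨rfl, rfl⟩ | ⟨rfl, rfl⟩ <;> rcases hb with ⟨rfl, rfl⟩ | ⟨rfl, rfl⟩ <;> norm_num
    · rintro p hp α β γ hα hβ hγ hs h0 h1 -
      rcases hR p hp with h | h | h | rfl | rfl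
      · exfalso
        rcases ha with ⟨rfl, rfl⟩ | ⟨rfl, rfl⟩ <;> rcases hb with ⟨rfl, rfl⟩ | ⟨rfl, rfl⟩ <;> linarith
      · left
        rcases ha with ⟨rfl, rfl⟩ | ⟨rfl, rfl⟩ <;> rcases hb with ⟨rfl, rfl⟩ | ⟨rfl, rfl⟩ <;> linarith
      · right
        rcases ha with ⟨rfl, rfl⟩ | ⟨rfl, rfl⟩ <;> rcases hb with ⟨rfl, rfl⟩ | ⟨rfl, rfl⟩ <;> linarith
      · left
        simp only [pt_zero, pt_one] at h0 h1
        rcases ha with ⟨rfl, rfl⟩ | ⟨rfl, rfl⟩ <;> rcases hb with ⟨rfl, rfl⟩ | ⟨rfl, rfl⟩ <;> linarith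
      · right
        simp only [pt_zero, pt_one] at h0 h1
        rcases ha with ⟨rfl, rfl⟩ | ⟨rfl, rfl⟩ <;> rcases hb with ⟨rfl, rfl⟩ | ⟨rfl, rfl⟩ <;> linarith

section Centre

variable {K : Knot} {R : Set Space}

/-- Straightening at `(1, 2)`. -/
theorem Knot.becomes_straight_left {e e' : ℝ} (he : e = 2 ∧ e' = 3 ∨ e = 3 ∧ e' = 2)
    (hK : K.carrier = R ∪ seg 1 2 e e' ∪ seg 3 0 1 2) (hR : ∀ p ∈ R, 3 ≤ p 0 ∨ 3 ≤ p 1) :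
    K.Becomes (R ∪ seg 3 0 2 1 ∪ seg 2 1 e e') := by
  refine Knot.becomes_remove_pt (R := R ∪ seg 3 0 2 1) (e := 1) (f := 2) ?_ ?_ ?_
  · rw [hK, seg_split (a := 3) (b := 0) (c := 2) (d := 1) (e := 1) (f := 2)
      ⟨1 / 2, by norm_num, by norm_num, by norm_num⟩]
    ac_rfl
  · rcases he with ⟨rfl, rfl⟩ | ⟨rfl, rfl⟩ <;> norm_num
  · rintro p (hp | hp) α β γ hα hβ hγ hs h0 h1 -
    · right
      rcases he with ⟨rfl, rfl⟩ | ⟨rfl, rfl⟩ <;> rcases hR p hp with h | h <;> linarith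
    · obtain ⟨s, ⟨hs0, hs1⟩, g0, g1, -⟩ := mem_seg.1 hp
      left
      rcases he with ⟨rfl, rfl⟩ | ⟨rfl, rfl⟩ <;> linarith

/-- Straightening at `(2, 1)`. -/
theorem Knot.becomes_straight_right {e e' : ℝ} (he : e = 2 ∧ e' = 3 ∨ e = 3 ∧ e' = 2)
    (hK : K.carrier = R ∪ seg 2 1 e e' ∪ seg 2 1 0 3) (hR : ∀ p ∈ R, 3 ≤ p 0 ∨ 3 ≤ p 1) :
    K.Becomes (R ∪ seg 1 2 0 3 ∪ seg 1 2 e e') := by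
  refine Knot.becomes_remove_pt (R := R ∪ seg 1 2 0 3) (e := 2) (f := 1) ?_ ?_ ?_
  · rw [hK, seg_split (a := 2) (b := 1) (c := 1) (d := 2) (e := 0) (f := 3)
      ⟨1 / 2, by norm_num, by norm_num, by norm_num⟩, seg_symm 2 1 1 2]
    ac_rfl
  · rcases he with ⟨rfl, rfl⟩ | ⟨rfl, rfl⟩ <;> norm_num
  · rintro p (hp | hp) α β γ hα hβ hγ hs h0 h1 -
    · right
      rcases he with ⟨rfl, rfl⟩ | ⟨rfl, rfl⟩ <;> rcases hR p hp with h | h <;> linarith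
    · obtain ⟨s, ⟨hs0, hs1⟩, g0, g1, -⟩ := mem_seg.1 hp
      left
      rcases he with ⟨rfl, rfl⟩ | ⟨rfl, rfl⟩ <;> linarith

/-- Removing a clasp with two arcs. -/
theorem Knot.becomes_arcs (hK : K.carrier = R ∪ (seg 1 2 2 3 ∪ seg 3 2 2 1) ∪ seg 2 1 1 2)
    (hR : ∀ p ∈ R, 3 ≤ p 0 ∨ 3 ≤ p 1) : K.Becomes (R ∪ seg 3 2 2 3) := by
  refine (Knot.becomes_remove_pt (R := R ∪ seg 3 2 2 1) (a := 2) (b := 1) (c := 2) (d := 3) (e := 1) (f := 2)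
    (by rw [hK]; ac_rfl) (by norm_num) ?_).trans fun K' hK' => ?_
  · rintro p (hp | hp) α β γ hα hβ hγ hs h0 h1 -
    · right; rcases hR p hp with h | h <;> linarith
    · obtain ⟨s, ⟨hs0, hs1⟩, g0, g1, -⟩ := mem_seg.1 hp
      left; linarith
  · refine Knot.becomes_remove_pt (e := 2) (f := 1) (hK'.trans (union_assoc _ _ _)) (by norm_num) ?_
    rintro p hp α β γ hα hβ hγ hs h0 h1 -
    rcases hR p hp with h | h
    · left; linarith
    · right; linarith

/-- Removing a crossing whose horizontal strand is above. -/
theorem Knot.becomes_horizontalOver (hK : K.carrier = R ∪ (segment ℝ (pt 1 2) ![2, 2, 1] ∪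
    segment ℝ ![2, 2, 1] (pt 3 2) ∪ seg 2 3 2 1) ∪ seg 2 1 1 2)
    (hR : ∀ p ∈ R, 3 ≤ p 0 ∨ 3 ≤ p 1) : K.Becomes (R ∪ seg 3 2 2 3) := by
  -- The crossing closes a curl around the corner. First the lower strand is shortened underneath
  -- the upper one, then the upper strand is lowered to height zero, and finally the remaining
  -- vertex `(1, 2)` is removed.
  refine (Knot.becomes_remove_pt (R := R ∪ (segment ℝ (pt 1 2) ![2, 2, 1] ∪ segment ℝ ![2, 2, 1] (pt 3 2)))
    (a := 2) (b := 3) (c := 1) (d := 2) (e := 2) (f := 1) (by rw [hK]; ac_rfl) (by norm_num) ?_).trans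
    fun K₁ hK₁ => (Knot.becomes_remove_vertex_coord (K := K₁) (R := R ∪ seg 2 3 1 2)
      (a := pt 1 2) (b := pt 3 2) (c := ![2, 2, 1]) (by rw [hK₁]; ac_rfl) ?_ ?_).trans
    fun K₂ hK₂ => ?_
  · rintro p (hp | hp | hp) α β γ hα hβ hγ hs h0 h1 h2
    · left; rcases hR p hp with h | h <;> linarith
    · obtain ⟨s, ⟨hs0, hs1⟩, g0, g1, g2⟩ := mem_segment_coord.1 hp
      simp only [pt_zero, pt_one, pt_two, Matrix.cons_val] at g0 g1 g2
      right; linarith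
    · obtain ⟨s, ⟨hs0, hs1⟩, g0, g1, g2⟩ := mem_segment_coord.1 hp
      simp only [pt_zero, pt_one, pt_two, Matrix.cons_val] at g0 g1 g2
      exfalso; linarith
  · refine affineIndependent_of_dual (fun h => ?_) (LinearMap.proj 2) (by simp) (by simp)
    have := congrFun h 0
    norm_num at this
  · rintro p (hp | hp) α β γ hα hβ hγ hs h0 h1 -
    · simp only [pt_zero, pt_one, Matrix.cons_val] at h0 h1
      right; rcases hR p hp with h | h <;> linarith
    · obtain ⟨s, ⟨hs0, hs1⟩, g0, g1, g2⟩ := mem_seg.1 hp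
      simp only [pt_zero, pt_one, Matrix.cons_val] at h0 h1
      left; linarith
  · rw [seg_symm]
    refine Knot.becomes_remove_pt (e := 1) (f := 2) (hK₂.trans (union_assoc _ _ _)) (by norm_num) ?_
    rintro p hp α β γ hα hβ hγ hs h0 h1 -
    rcases hR p hp with h | h
    · right; linarith
    · left; linarith

/-- Removing a crossing whose vertical strand is above. -/
theorem Knot.becomes_verticalOver (hK : K.carrier = R ∪ (segment ℝ (pt 2 3) ![2, 2, 1] ∪
    segment ℝ ![2, 2, 1] (pt 2 1) ∪ seg 1 2 3 2) ∪ seg 2 1 1 2)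
    (hR : ∀ p ∈ R, 3 ≤ p 0 ∨ 3 ≤ p 1) : K.Becomes (R ∪ seg 3 2 2 3) := by
  refine (Knot.becomes_remove_pt (R := R ∪ (segment ℝ (pt 2 3) ![2, 2, 1] ∪ segment ℝ ![2, 2, 1] (pt 2 1)))
    (a := 2) (b := 1) (c := 3) (d := 2) (e := 1) (f := 2) (by rw [hK]; ac_rfl) (by norm_num) ?_).trans
    fun K₁ hK₁ => (Knot.becomes_remove_vertex_coord (K := K₁) (R := R ∪ seg 2 1 3 2)
      (a := pt 2 3) (b := pt 2 1) (c := ![2, 2, 1]) (by rw [hK₁]; ac_rfl) ?_ ?_).trans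
    fun K₂ hK₂ => ?_
  · rintro p (hp | hp | hp) α β γ hα hβ hγ hs h0 h1 h2
    · right; rcases hR p hp with h | h <;> linarith
    · obtain ⟨s, ⟨hs0, hs1⟩, g0, g1, g2⟩ := mem_segment_coord.1 hp
      simp only [pt_zero, pt_one, pt_two, Matrix.cons_val] at g0 g1 g2
      exfalso; linarith
    · obtain ⟨s, ⟨hs0, hs1⟩, g0, g1, g2⟩ := mem_segment_coord.1 hp
      simp only [pt_zero, pt_one, pt_two, Matrix.cons_val] at g0 g1 g2
      left; linarith
  · refine affineIndependent_of_dual (fun h => ?_) (LinearMap.proj 2) (by simp) (by simp)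
    have := congrFun h 1
    norm_num at this
  · rintro p (hp | hp) α β γ hα hβ hγ hs h0 h1 -
    · simp only [pt_zero, pt_one, Matrix.cons_val] at h0 h1
      left; rcases hR p hp with h | h <;> linarith
    · obtain ⟨s, ⟨hs0, hs1⟩, g0, g1, g2⟩ := mem_seg.1 hp
      simp only [pt_zero, pt_one, Matrix.cons_val] at h0 h1
      right; linarith
  · refine Knot.becomes_remove_pt (e := 2) (f := 1) (K := K₂) ?_ (by norm_num) ?_
    · rw [hK₂, seg_symm 3 2 2 1, seg_symm 2 1 2 3]
      show _ ∪ seg 2 3 2 1 = _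
      ac_rfl
    rintro p hp α β γ hα hβ hγ hs h0 h1 -
    rcases hR p hp with h | h
    · left; linarith
    · right; linarith

/-- A closed curve through the four sides of the corner square. -/
theorem Knot.isTrivial_of_diamond (hK : K.carrier = R ∪ (seg 2 1 1 0 ∪ seg 1 0 0 1 ∪ seg 0 1 1 2))
    (hR : ∀ p ∈ R, 3 ≤ p 0 + p 1 ∨ 3 ≤ p 0 ∨ 3 ≤ p 1) (hd : seg 1 2 2 1 ⊆ R) : K.IsTrivial := by
  -- Without the vertex `(1, 0)` the knot contains the whole triangle `(0, 1)`, `(1, 2)`, `(2, 1)`,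
  -- and so equals it.
  obtain ⟨K', hK', e⟩ := Knot.becomes_cut_first (Or.inr ⟨rfl, rfl⟩) (Or.inr ⟨rfl, rfl⟩) hK hR
  have h : K'.IsTrivial := by
    refine Knot.isTrivial_of_triangle (a := pt 0 1) (b := pt 1 2) (c := pt 2 1)
      (affineIndependent_pt (by norm_num)) ?_ ?_ ?_ ?_
    · rw [hK', segment_symm]
      exact fun x hx => Or.inr (Or.inl hx)
    · rw [hK']
      rintro x (hx | hx)
      · exact Or.inr (Or.inr hx)
      · exact Or.inl (hd hx)
    · refine Arc'.cons_of_dual (LinearMap.proj 0) (fun h => ?_) (Arc.single (fun h => ?_) trivial) ?_ ?_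
      · have := congrFun h 0
        norm_num at this
      · have := congrFun h 0
        norm_num at this
      · simp
      · intro x hx
        obtain ⟨s, ⟨hs, -⟩, h0, h1, h2⟩ := mem_seg.1 hx
        rcases hs.eq_or_lt with rfl | hs
        · left; exact space_ext (by simp [h0]) (by simp [h1]) (by simp [h2])
        · right; simp; linarith
    · intro hx
      obtain ⟨s, hs, h0, h1, h2⟩ := mem_seg.1 hx
      simp at h0 h1
  obtain ⟨T, eT, hT⟩ := h
  exact ⟨T, e.trans eT, hT⟩

end Centre

end KnotMosaic

/-! ### The four cells at a corner of a pattern -/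

namespace KnotMosaic

open Set Filter Topology

/-- The curve drawn on the tile `T` in the cell `(x, y)`. -/
def cell (T : Tile) (x y : ℤ) : Set Space := {p | p - centre x y ∈ T.drawing}

theorem preimage_sub_segment (c a b : Space) :
    {p | p - c ∈ segment ℝ a b} = segment ℝ (a + c) (b + c) := by
  ext p
  rw [mem_ofPred_eq, ← mem_segment_translate ℝ c, add_sub_cancel, add_comm c, add_comm c]

theorem midpoint_left_add (x y : ℤ) : Side.left.midpoint + centre x y = pt (2 * x - 1) (2 * y) :=
  space_ext (by simp [Side.midpoint]; ring) (by simp [Side.midpoint]) (by simp [Side.midpoint])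

theorem midpoint_right_add (x y : ℤ) : Side.right.midpoint + centre x y = pt (2 * x + 1) (2 * y) :=
  space_ext (by simp [Side.midpoint]; ring) (by simp [Side.midpoint]) (by simp [Side.midpoint])

theorem midpoint_top_add (x y : ℤ) : Side.top.midpoint + centre x y = pt (2 * x) (2 * y + 1) :=
  space_ext (by simp [Side.midpoint]) (by simp [Side.midpoint]; ring) (by simp [Side.midpoint])

theorem midpoint_bottom_add (x y : ℤ) : Side.bottom.midpoint + centre x y = pt (2 * x) (2 * y - 1) :=
  space_ext (by simp [Side.midpoint]) (by simp [Side.midpoint]; ring) (by simp [Side.midpoint])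

theorem apex_add (x y : ℤ) : (![0, 0, 1] : Space) + centre x y = ![2 * (x : ℝ), 2 * (y : ℝ), 1] :=
  space_ext (by simp) (by simp) (by simp)

theorem cell_eq (T : Tile) (x y : ℤ) : cell T x y =
    match T with
    | Tile.blank => ∅
    | Tile.leftBottom => seg (2 * x - 1) (2 * y) (2 * x) (2 * y - 1)
    | Tile.rightBottom => seg (2 * x + 1) (2 * y) (2 * x) (2 * y - 1)
    | Tile.rightTop => seg (2 * x + 1) (2 * y) (2 * x) (2 * y + 1)
    | Tile.leftTop => seg (2 * x - 1) (2 * y) (2 * x) (2 * y + 1)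
    | Tile.horizontal => seg (2 * x - 1) (2 * y) (2 * x + 1) (2 * y)
    | Tile.vertical => seg (2 * x) (2 * y + 1) (2 * x) (2 * y - 1)
    | Tile.leftBottomRightTop => seg (2 * x - 1) (2 * y) (2 * x) (2 * y - 1) ∪
        seg (2 * x + 1) (2 * y) (2 * x) (2 * y + 1)
    | Tile.leftTopRightBottom => seg (2 * x - 1) (2 * y) (2 * x) (2 * y + 1) ∪
        seg (2 * x + 1) (2 * y) (2 * x) (2 * y - 1)
    | Tile.horizontalOver => segment ℝ (pt (2 * x - 1) (2 * y)) ![2 * (x : ℝ), 2 * (y : ℝ), 1] ∪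
        segment ℝ ![2 * (x : ℝ), 2 * (y : ℝ), 1] (pt (2 * x + 1) (2 * y)) ∪
        seg (2 * x) (2 * y + 1) (2 * x) (2 * y - 1)
    | Tile.verticalOver => segment ℝ (pt (2 * x) (2 * y + 1)) ![2 * (x : ℝ), 2 * (y : ℝ), 1] ∪
        segment ℝ ![2 * (x : ℝ), 2 * (y : ℝ), 1] (pt (2 * x) (2 * y - 1)) ∪
        seg (2 * x - 1) (2 * y) (2 * x + 1) (2 * y) := by
  have h : ∀ a b : Space, {p | p - centre x y ∈ segment ℝ a b} = _ := preimage_sub_segment (centre x y)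
  have hu : ∀ A B : Set Space, {p | p - centre x y ∈ A ∪ B} =
    {p | p - centre x y ∈ A} ∪ {p | p - centre x y ∈ B} := fun _ _ => rfl
  cases T <;> simp only [cell, Tile.drawing, Tile.strand, Tile.overStrand, hu, h, midpoint_left_add,
    midpoint_right_add, midpoint_top_add, midpoint_bottom_add, apex_add, seg]
  rfl

/-- In the cell `(1, 1)` the bound says that the curve stays on or above the line `x + y = 3`, along
which corners are cut off. The list tells how this line can be touched. -/
theorem Tile.sum_bound {T : Tile} {p : Space} (h : p ∈ T.drawing) :
    -1 ≤ p 0 + p 1 ∧ (T = leftBottom ∨ T = leftBottomRightTop ∨ -1 < p 0 + p 1 ∨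
      (Side.left ∈ T.connections ∧ p = Side.left.midpoint) ∨
      (Side.bottom ∈ T.connections ∧ p = Side.bottom.midpoint)) := by
  have hleft : p 0 = -1 → p 1 = 0 → p 2 = 0 → p = Side.left.midpoint := fun h0 h1 h2 =>
    space_ext (by simp [h0, Side.midpoint]) (by simp [h1, Side.midpoint]) (by simp [h2, Side.midpoint])
  have hbottom : p 0 = 0 → p 1 = -1 → p 2 = 0 → p = Side.bottom.midpoint := fun h0 h1 h2 =>
    space_ext (by simp [h0, Side.midpoint]) (by simp [h1, Side.midpoint]) (by simp [h2, Side.midpoint])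
  cases T <;> simp only [drawing, mem_union, mem_leftBottom, mem_rightBottom, mem_rightTop,
    mem_leftTop, mem_horizontal, mem_vertical, mem_horizontalOver, mem_verticalOver,
    mem_empty_iff_false] at h <;> simp [Tile.connections] <;> grind

namespace Pattern

variable {F : Pattern} {K : Knot}

/-- The part of the curve outside of the corner cells. -/
def outer (F : Pattern) : Set Space :=
  {p | ∃ x y, ¬ ((x = 0 ∨ x = 1) ∧ (y = 0 ∨ y = 1)) ∧ p - centre x y ∈ (F.tile x y).drawing}

/-- The tiles `A, B, C` can be replaced by `A', B', C'` in the cells `(1, 0)`, `(0, 1)`, `(1, 1)`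
when the cell `(0, 0)` is made blank. -/
abbrev Fits (A B C A' B' C' : Tile) : Prop :=
  (Side.left ∉ A'.connections ∧ Side.bottom ∉ A'.connections ∧
    (Side.right ∈ A'.connections ↔ Side.right ∈ A.connections) ∧
    (Side.top ∈ A'.connections ↔ Side.bottom ∈ C'.connections)) ∧
  (Side.left ∉ B'.connections ∧ Side.bottom ∉ B'.connections ∧
    (Side.top ∈ B'.connections ↔ Side.top ∈ B.connections) ∧
    (Side.right ∈ B'.connections ↔ Side.left ∈ C'.connections)) ∧
  (Side.right ∈ C'.connections ↔ Side.right ∈ C.connections) ∧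
  (Side.top ∈ C'.connections ↔ Side.top ∈ C.connections)

/-- The pattern with changed corner cells. -/
def recorner (F : Pattern) (hx : ∀ y, F.tile (-1) y = Tile.blank) (hy : ∀ x, F.tile x (-1) = Tile.blank)
    {A B C : Tile} (h : Fits (F.tile 1 0) (F.tile 0 1) (F.tile 1 1) A B C) : Pattern where
  tile x y := if x = 0 ∧ y = 0 then Tile.blank else if x = 1 ∧ y = 0 then A else
    if x = 0 ∧ y = 1 then B else if x = 1 ∧ y = 1 then C else F.tile x y
  right_iff x y := by
    obtain ⟨⟨a1, a2, a3, a4⟩, ⟨b1, b2, b3, b4⟩, c1, c2⟩ := h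
    have e1 := F.right_iff x y
    have hb : ∀ s, s ∉ Tile.blank.connections := fun s => by simp [Tile.connections]
    by_cases hxm : x = -1
    · subst hxm
      rw [hx] at e1
      split_ifs <;> first | omega | simp_all
    · split_ifs <;> first | omega | simp_all
  top_iff x y := by
    obtain ⟨⟨a1, a2, a3, a4⟩, ⟨b1, b2, b3, b4⟩, c1, c2⟩ := h
    have e1 := F.top_iff x y
    have hb : ∀ s, s ∉ Tile.blank.connections := fun s => by simp [Tile.connections]
    by_cases hym : y = -1
    · subst hym
      rw [hy] at e1
      split_ifs <;> first | omega | simp_all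
    · split_ifs <;> first | omega | simp_all
  finite := by
    refine (F.finite.union (((finite_Icc (0 : ℤ) 1).prod (finite_Icc (0 : ℤ) 1)))).subset fun c hc => ?_
    by_contra h'
    simp only [mem_union, mem_prod, mem_Icc, mem_ofPred_eq, not_or, not_not] at h' hc
    split_ifs at hc <;> first | omega | exact hc h'.1

theorem drawing_recorner (hx : ∀ y, F.tile (-1) y = Tile.blank) (hy : ∀ x, F.tile x (-1) = Tile.blank)
    {A B C : Tile} (h : Fits (F.tile 1 0) (F.tile 0 1) (F.tile 1 1) A B C) :
    (F.recorner hx hy h).drawing = F.outer ∪ cell C 1 1 ∪ cell A 1 0 ∪ cell B 0 1 := by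
  ext p
  constructor
  · rintro ⟨x, y, hp⟩
    simp only [recorner] at hp
    split_ifs at hp with h1 h2 h3 h4
    · exact hp.elim
    · obtain ⟨rfl, rfl⟩ := h2; exact Or.inl (Or.inr hp)
    · obtain ⟨rfl, rfl⟩ := h3; exact Or.inr hp
    · obtain ⟨rfl, rfl⟩ := h4; exact Or.inl (Or.inl (Or.inr hp))
    · exact Or.inl (Or.inl (Or.inl ⟨x, y, by omega, hp⟩))
  · rintro (((⟨x, y, h', hp⟩ | hp) | hp) | hp)
    · refine ⟨x, y, ?_⟩
      simp only [recorner]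
      rwa [if_neg (by omega), if_neg (by omega), if_neg (by omega), if_neg (by omega)]
    · exact ⟨1, 1, by simpa [recorner, cell] using hp⟩
    · exact ⟨1, 0, by simpa [recorner, cell] using hp⟩
    · exact ⟨0, 1, by simpa [recorner, cell] using hp⟩

theorem drawing_eq_outer (F : Pattern) : F.drawing = F.outer ∪ cell (F.tile 1 1) 1 1 ∪
    (cell (F.tile 1 0) 1 0 ∪ cell (F.tile 0 0) 0 0 ∪ cell (F.tile 0 1) 0 1) := by
  ext p
  constructor
  · rintro ⟨x, y, hp⟩
    by_cases h : (x = 0 ∨ x = 1) ∧ (y = 0 ∨ y = 1)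
    · obtain ⟨rfl | rfl, rfl | rfl⟩ := h
      · exact Or.inr (Or.inl (Or.inr hp))
      · exact Or.inr (Or.inr hp)
      · exact Or.inr (Or.inl (Or.inl hp))
      · exact Or.inl (Or.inr hp)
    · exact Or.inl (Or.inl ⟨x, y, h, hp⟩)
  · rintro ((⟨x, y, h, hp⟩ | hp) | (hp | hp) | hp)
    exacts [⟨x, y, hp⟩, ⟨1, 1, hp⟩, ⟨1, 0, hp⟩, ⟨0, 0, hp⟩, ⟨0, 1, hp⟩]

theorem mem_outer (hx : ∀ x y, x < 0 → F.tile x y = Tile.blank)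
    (hy : ∀ x y, y < 0 → F.tile x y = Tile.blank) {p : Space} (hp : p ∈ F.outer) : 3 ≤ p 0 ∨ 3 ≤ p 1 := by
  obtain ⟨x, y, h, hp⟩ := hp
  have hne := tile_of_mem hp
  obtain ⟨h1, -, h3, -⟩ := row_of_mem hp
  have hx0 : 0 ≤ x := by
    by_contra! h'; exact hne (hx x y h')
  have hy0 : 0 ≤ y := by
    by_contra! h'; exact hne (hy x y h')
  have : 2 ≤ x ∨ 2 ≤ y := by omega
  rcases this with h2 | h2
  · left
    have : (2 : ℝ) ≤ x := by exact_mod_cast h2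
    linarith
  · right
    have : (2 : ℝ) ≤ y := by exact_mod_cast h2
    linarith

theorem Rep.exists_recorner (hx : ∀ y, F.tile (-1) y = Tile.blank) (hy : ∀ x, F.tile x (-1) = Tile.blank)
    {L : Knot} (e : Knot.Equivalent L K) (A B C : Tile)
    (h : Fits (F.tile 1 0) (F.tile 0 1) (F.tile 1 1) A B C)
    (hL : L.Becomes (F.outer ∪ cell C 1 1 ∪ cell A 1 0 ∪ cell B 0 1)) :
    ∃ F' : Pattern, F'.Rep K ∧ F'.tile 0 0 = Tile.blank ∧
      ∀ x y, ¬ ((x = 0 ∨ x = 1) ∧ (y = 0 ∨ y = 1)) → F'.tile x y = F.tile x y := by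
  refine ⟨F.recorner hx hy h, Rep.of_becomes e (by rwa [drawing_recorner]), by simp [recorner], ?_⟩
  intro x y h'
  simp only [recorner]
  rw [if_neg (by omega), if_neg (by omega), if_neg (by omega), if_neg (by omega)]

end Pattern

end KnotMosaic

/-! ### Emptying a corner cell -/

namespace KnotMosaic

open Set Filter Topology

theorem cell_blank (x y : ℤ) : cell Tile.blank x y = ∅ := rfl

theorem cell_horizontal_one_zero : cell Tile.horizontal 1 0 = seg 3 0 1 0 := by
  rw [cell_eq]; norm_num; exact seg_symm _ _ _ _

theorem cell_leftTop_one_zero : cell Tile.leftTop 1 0 = seg 2 1 1 0 := by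
  rw [cell_eq]; norm_num; exact seg_symm _ _ _ _

theorem cell_rightTop_zero_zero : cell Tile.rightTop 0 0 = seg 1 0 0 1 := by
  rw [cell_eq]; norm_num

theorem cell_vertical_zero_one : cell Tile.vertical 0 1 = seg 0 1 0 3 := by
  rw [cell_eq]; norm_num; exact seg_symm _ _ _ _

theorem cell_rightBottom_zero_one : cell Tile.rightBottom 0 1 = seg 0 1 1 2 := by
  rw [cell_eq]; norm_num; exact seg_symm _ _ _ _

theorem cell_rightTop_one_zero : cell Tile.rightTop 1 0 = seg 3 0 2 1 := by
  rw [cell_eq]; norm_num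

theorem cell_rightTop_zero_one : cell Tile.rightTop 0 1 = seg 1 2 0 3 := by
  rw [cell_eq]; norm_num

theorem cell_leftBottom_one_one : cell Tile.leftBottom 1 1 = seg 1 2 2 1 := by
  rw [cell_eq]; norm_num

theorem cell_rightBottom_one_one : cell Tile.rightBottom 1 1 = seg 2 1 3 2 := by
  rw [cell_eq]; norm_num; exact seg_symm _ _ _ _

theorem cell_rightTop_one_one : cell Tile.rightTop 1 1 = seg 3 2 2 3 := by
  rw [cell_eq]; norm_num

theorem cell_leftTop_one_one : cell Tile.leftTop 1 1 = seg 1 2 2 3 := by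
  rw [cell_eq]; norm_num

theorem cell_horizontal_one_one : cell Tile.horizontal 1 1 = seg 1 2 3 2 := by
  rw [cell_eq]; norm_num

theorem cell_vertical_one_one : cell Tile.vertical 1 1 = seg 2 1 2 3 := by
  rw [cell_eq]; norm_num; exact seg_symm _ _ _ _

theorem cell_leftBottomRightTop_one_one :
    cell Tile.leftBottomRightTop 1 1 = seg 1 2 2 1 ∪ seg 3 2 2 3 := by
  rw [cell_eq]; norm_num

theorem cell_leftTopRightBottom_one_one :
    cell Tile.leftTopRightBottom 1 1 = seg 1 2 2 3 ∪ seg 3 2 2 1 := by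
  rw [cell_eq]; norm_num

theorem cell_horizontalOver_one_one : cell Tile.horizontalOver 1 1 =
    segment ℝ (pt 1 2) ![2, 2, 1] ∪ segment ℝ ![2, 2, 1] (pt 3 2) ∪ seg 2 3 2 1 := by
  rw [cell_eq]; norm_num

theorem cell_verticalOver_one_one : cell Tile.verticalOver 1 1 =
    segment ℝ (pt 2 3) ![2, 2, 1] ∪ segment ℝ ![2, 2, 1] (pt 2 1) ∪ seg 1 2 3 2 := by
  rw [cell_eq]; norm_num

namespace Pattern

variable {F : Pattern} {K : Knot}

/-- With nothing to the left and below, a non-blank corner tile is an arc from right to top, and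
each of its two neighbours has two possible forms. In the resulting four cases the corner is cut off
and the strands are straightened so that they fit tiles in the other three cells. The change stays
within this `2 × 2` block, so that it can be repeated at the other corners of a larger square. -/
theorem Rep.exists_corner_blank (h : F.Rep K) (hK : K.IsPrime)
    (hx : ∀ x y, x < 0 → F.tile x y = Tile.blank) (hy : ∀ x y, y < 0 → F.tile x y = Tile.blank) :
    ∃ F' : Pattern, F'.Rep K ∧ F'.tile 0 0 = Tile.blank ∧
      ∀ x y, ¬ ((x = 0 ∨ x = 1) ∧ (y = 0 ∨ y = 1)) → F'.tile x y = F.tile x y := by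
  by_cases h00 : F.tile 0 0 = Tile.blank
  · exact ⟨F, h, h00, fun _ _ _ => rfl⟩
  have hx' : ∀ y, F.tile (-1) y = Tile.blank := fun y => hx _ _ (by norm_num)
  have hy' : ∀ x, F.tile x (-1) = Tile.blank := fun x => hy _ _ (by norm_num)
  have hb : ∀ s, s ∉ Tile.blank.connections := fun s => by simp [Tile.connections]
  have l0 := F.right_iff (-1) 0
  have l1 := F.right_iff (-1) 1
  have b0 := F.top_iff 0 (-1)
  have b1 := F.top_iff 1 (-1)
  rw [hx'] at l0 l1
  rw [hy'] at b0 b1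
  have r0 := F.right_iff 0 0
  have t0 := F.top_iff 0 0
  have r1 := F.right_iff 0 1
  have t1 := F.top_iff 1 0
  simp only [hb, false_iff, neg_add_cancel, zero_add] at l0 l1 b0 b1 r0 t0 r1 t1
  have e00 : F.tile 0 0 = Tile.rightTop := by
    revert h00 l0 b0
    cases F.tile 0 0 <;> decide
  rw [e00] at r0 t0
  have e10 : F.tile 1 0 = Tile.horizontal ∨ F.tile 1 0 = Tile.leftTop := by
    revert r0 b1
    cases F.tile 1 0 <;> decide
  have e01 : F.tile 0 1 = Tile.vertical ∨ F.tile 0 1 = Tile.rightBottom := by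
    revert t0 l1
    cases F.tile 0 1 <;> decide
  have hout : ∀ p ∈ F.outer, 3 ≤ p 0 ∨ 3 ≤ p 1 := fun p hp => mem_outer hx hy hp
  obtain ⟨L, hL, e⟩ := h
  rw [F.drawing_eq_outer, e00, cell_rightTop_zero_zero] at hL
  have hnl : Side.left.midpoint + centre 1 1 = pt 1 2 := by
    rw [midpoint_left_add]; norm_num
  have hnb : Side.bottom.midpoint + centre 1 1 = pt 2 1 := by
    rw [midpoint_bottom_add]; norm_num
  have hsum : ∀ p ∈ F.outer ∪ cell (F.tile 1 1) 1 1, 3 ≤ p 0 + p 1 ∨ 3 ≤ p 0 ∨ 3 ≤ p 1 := by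
    rintro p (hp | hp)
    · exact Or.inr (hout p hp)
    · have := (Tile.sum_bound hp).1
      simp only [Pi.sub_apply, centre_zero, centre_one, Int.cast_one] at this
      left; linarith
  have hcut : F.tile 1 1 ≠ Tile.leftBottom → F.tile 1 1 ≠ Tile.leftBottomRightTop →
      ∀ p ∈ F.outer ∪ cell (F.tile 1 1) 1 1, 3 < p 0 + p 1 ∨ 3 ≤ p 0 ∨ 3 ≤ p 1 ∨
        (Side.bottom ∈ (F.tile 1 1).connections ∧ p = pt 2 1) ∨
        (Side.left ∈ (F.tile 1 1).connections ∧ p = pt 1 2) := by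
    rintro n1 n2 p (hp | hp)
    · exact Or.inr ((hout p hp).imp_right Or.inl)
    · rcases (Tile.sum_bound hp).2 with h | h | h | ⟨h, hp⟩ | ⟨h, hp⟩
      · exact absurd h n1
      · exact absurd h n2
      · simp only [Pi.sub_apply, centre_zero, centre_one, Int.cast_one] at h
        left; linarith
      · exact Or.inr (Or.inr (Or.inr (Or.inr ⟨h, by rw [← hnl, ← hp, sub_add_cancel]⟩)))
      · exact Or.inr (Or.inr (Or.inr (Or.inl ⟨h, by rw [← hnb, ← hp, sub_add_cancel]⟩)))
  rcases e10 with e10 | e10 <;> rcases e01 with e01 | e01 <;> rw [e10] at hL t1 <;> rw [e01] at hL r1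
  · -- both strands leave the corner square straight
    rw [cell_horizontal_one_zero, cell_vertical_zero_one] at hL
    have key := Knot.becomes_cut (Or.inl ⟨rfl, rfl⟩) (Or.inl ⟨rfl, rfl⟩) hL fun p hp => by
      have e11 : F.tile 1 1 = Tile.blank ∨ F.tile 1 1 = Tile.rightTop := by
        revert t1 r1
        cases F.tile 1 1 <;> decide
      rcases hcut (by rcases e11 with h | h <;> rw [h] <;> decide)
        (by rcases e11 with h | h <;> rw [h] <;> decide) p hp with h | h | h | h | h
      · exact Or.inl h
      · exact Or.inr (Or.inl h)
      · exact Or.inr (Or.inr (Or.inl h))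
      · exact absurd h.1 (by rcases e11 with h | h <;> rw [h] <;> decide)
      · exact absurd h.1 (by rcases e11 with h | h <;> rw [h] <;> decide)
    -- The chord from `(3, 0)` to `(0, 3)` passes through `(2, 1)` and `(1, 2)`, the midpoints of
    -- the lower and left sides of the cell `(1, 1)`. It is therefore drawn by three arc tiles.
    rw [seg_split (a := 3) (b := 0) (c := 2) (d := 1) (e := 0) (f := 3)
      ⟨1 / 3, by norm_num, by norm_num, by norm_num⟩,
      seg_split (a := 2) (b := 1) (c := 1) (d := 2) (e := 0) (f := 3)
      ⟨1 / 2, by norm_num, by norm_num, by norm_num⟩] at key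
    have e11 : F.tile 1 1 = Tile.blank ∨ F.tile 1 1 = Tile.rightTop := by
      revert t1 r1
      cases F.tile 1 1 <;> decide
    rcases e11 with e11 | e11
    · refine Rep.exists_recorner hx' hy' e Tile.rightTop Tile.rightTop Tile.leftBottom
        (by rw [e10, e01, e11]; decide) ?_
      rw [cell_leftBottom_one_one, cell_rightTop_one_zero, cell_rightTop_zero_one, seg_symm 1 2 2 1]
      rw [e11, cell_blank, union_empty] at key
      convert key using 1; ac_rfl
    · refine Rep.exists_recorner hx' hy' e Tile.rightTop Tile.rightTop Tile.leftBottomRightTop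
        (by rw [e10, e01, e11]; decide) ?_
      rw [cell_leftBottomRightTop_one_one, cell_rightTop_one_zero, cell_rightTop_zero_one, seg_symm 1 2 2 1]
      rw [e11, cell_rightTop_one_one] at key
      convert key using 1; ac_rfl
  · rw [cell_horizontal_one_zero, cell_rightBottom_zero_one] at hL
    have e11 : F.tile 1 1 = Tile.leftTop ∨ F.tile 1 1 = Tile.horizontal := by
      revert t1 r1
      cases F.tile 1 1 <;> decide
    have key := Knot.becomes_cut (Or.inl ⟨rfl, rfl⟩) (Or.inr ⟨rfl, rfl⟩) hL fun p hp => by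
      rcases hcut (by rcases e11 with h | h <;> rw [h] <;> decide)
        (by rcases e11 with h | h <;> rw [h] <;> decide) p hp with h | h | h | h | h
      · exact Or.inl h
      · exact Or.inr (Or.inl h)
      · exact Or.inr (Or.inr (Or.inl h))
      · exact absurd h.1 (by rcases e11 with h | h <;> rw [h] <;> decide)
      · exact Or.inr (Or.inr (Or.inr (Or.inr h.2)))
    rcases e11 with e11 | e11
    · refine Rep.exists_recorner hx' hy' e Tile.rightTop Tile.blank Tile.vertical
        (by rw [e10, e01, e11]; decide) (key.trans fun K' hK' => ?_)
      rw [e11, cell_leftTop_one_one] at hK'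
      have := Knot.becomes_straight_left (Or.inl ⟨rfl, rfl⟩) hK' hout
      rw [cell_vertical_one_one, cell_rightTop_one_zero, cell_blank, union_empty]
      convert this using 1; ac_rfl
    · refine Rep.exists_recorner hx' hy' e Tile.rightTop Tile.blank Tile.rightBottom
        (by rw [e10, e01, e11]; decide) (key.trans fun K' hK' => ?_)
      rw [e11, cell_horizontal_one_one] at hK'
      have := Knot.becomes_straight_left (Or.inr ⟨rfl, rfl⟩) hK' hout
      rw [cell_rightBottom_one_one, cell_rightTop_one_zero, cell_blank, union_empty]
      convert this using 1; ac_rfl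
  · rw [cell_leftTop_one_zero, cell_vertical_zero_one] at hL
    have e11 : F.tile 1 1 = Tile.vertical ∨ F.tile 1 1 = Tile.rightBottom := by
      revert t1 r1
      cases F.tile 1 1 <;> decide
    have key := Knot.becomes_cut (Or.inr ⟨rfl, rfl⟩) (Or.inl ⟨rfl, rfl⟩) hL fun p hp => by
      rcases hcut (by rcases e11 with h | h <;> rw [h] <;> decide)
        (by rcases e11 with h | h <;> rw [h] <;> decide) p hp with h | h | h | h | h
      · exact Or.inl h
      · exact Or.inr (Or.inl h)
      · exact Or.inr (Or.inr (Or.inl h))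
      · exact Or.inr (Or.inr (Or.inr (Or.inl h.2)))
      · exact absurd h.1 (by rcases e11 with h | h <;> rw [h] <;> decide)
    rcases e11 with e11 | e11
    · refine Rep.exists_recorner hx' hy' e Tile.blank Tile.rightTop Tile.leftTop
        (by rw [e10, e01, e11]; decide) (key.trans fun K' hK' => ?_)
      rw [e11, cell_vertical_one_one] at hK'
      have := Knot.becomes_straight_right (Or.inl ⟨rfl, rfl⟩) hK' hout
      rw [cell_leftTop_one_one, cell_rightTop_zero_one, cell_blank, union_empty]
      convert this using 1; ac_rfl
    · refine Rep.exists_recorner hx' hy' e Tile.blank Tile.rightTop Tile.horizontal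
        (by rw [e10, e01, e11]; decide) (key.trans fun K' hK' => ?_)
      rw [e11, cell_rightBottom_one_one] at hK'
      have := Knot.becomes_straight_right (Or.inr ⟨rfl, rfl⟩) hK' hout
      rw [cell_horizontal_one_one, cell_rightTop_zero_one, cell_blank, union_empty]
      convert this using 1; ac_rfl
  · rw [cell_leftTop_one_zero, cell_rightBottom_zero_one] at hL
    -- Such an arc in the cell `(1, 1)` would close the curve up to a square, a trivial knot. This
    -- is where nontriviality is used.
    have hdiamond : ¬ seg 1 2 2 1 ⊆ cell (F.tile 1 1) 1 1 := fun hd => by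
      obtain ⟨T, eT, hT⟩ := Knot.isTrivial_of_diamond hL hsum (hd.trans subset_union_right)
      exact hK.1 ⟨T, e.symm.trans eT, hT⟩
    have n1 : F.tile 1 1 ≠ Tile.leftBottom := fun h => hdiamond (by rw [h, cell_leftBottom_one_one])
    have n2 : F.tile 1 1 ≠ Tile.leftBottomRightTop := fun h =>
      hdiamond (by rw [h, cell_leftBottomRightTop_one_one]; exact subset_union_left)
    have key := Knot.becomes_cut (Or.inr ⟨rfl, rfl⟩) (Or.inr ⟨rfl, rfl⟩) hL fun p hp => by
      rcases hcut n1 n2 p hp with h | h | h | h | h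
      · exact Or.inl h
      · exact Or.inr (Or.inl h)
      · exact Or.inr (Or.inr (Or.inl h))
      · exact Or.inr (Or.inr (Or.inr (Or.inl h.2)))
      · exact Or.inr (Or.inr (Or.inr (Or.inr h.2)))
    have e11 : F.tile 1 1 = Tile.leftTopRightBottom ∨ F.tile 1 1 = Tile.horizontalOver ∨
        F.tile 1 1 = Tile.verticalOver := by
      revert t1 r1 n1 n2
      cases F.tile 1 1 <;> decide
    refine Rep.exists_recorner hx' hy' e Tile.blank Tile.blank Tile.rightTop
      (by rcases e11 with h | h | h <;> rw [e10, e01, h] <;> decide) (key.trans fun K' hK' => ?_)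
    rw [cell_rightTop_one_one, cell_blank, cell_blank, union_empty, union_empty]
    rcases e11 with e11 | e11 | e11 <;> rw [e11] at hK'
    · rw [cell_leftTopRightBottom_one_one] at hK'
      exact Knot.becomes_arcs hK' hout
    · rw [cell_horizontalOver_one_one] at hK'
      exact Knot.becomes_horizontalOver hK' hout
    · rw [cell_verticalOver_one_one] at hK'
      exact Knot.becomes_verticalOver hK' hout

end Pattern

end KnotMosaic

/-! ### The bound for five by five squares and the conclusion -/

namespace KnotMosaic

open Set Filter Topology

namespace Pattern

variable {F : Pattern} {K : Knot}

/-- A pattern in a `5 × 5` square can be changed to avoid the corners of the square. -/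
theorem Rep.exists_size_le (h : F.Rep K) (hK : K.IsPrime)
    (hF : ∀ x y, F.tile x y ≠ Tile.blank → (0 ≤ x ∧ x < 5) ∧ (0 ≤ y ∧ y < 5)) :
    ∃ G : Pattern, G.Rep K ∧ G.size ≤ 21 := by
  -- One step empties the corner `(0, 0)` and turns the square by a quarter, bringing the next
  -- corner there. The set `s` records corners emptied before; they lie outside the `2 × 2` block
  -- being changed, so they remain blank.
  have step : ∀ (F : Pattern) (s : Set (ℤ × ℤ)), F.Rep K →
      (∀ x y, F.tile x y ≠ Tile.blank → (0 ≤ x ∧ x < 5) ∧ (0 ≤ y ∧ y < 5)) →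
      (∀ c ∈ s, (3 ≤ c.1 ∨ 3 ≤ c.2) ∧ F.tile c.1 c.2 = Tile.blank) →
      ∃ G : Pattern, G.Rep K ∧
        (∀ x y, G.tile x y ≠ Tile.blank → (0 ≤ x ∧ x < 5) ∧ (0 ≤ y ∧ y < 5)) ∧
        G.tile 4 0 = Tile.blank ∧ ∀ c ∈ s, G.tile (4 - c.2) c.1 = Tile.blank := by
    intro F s h hF hs
    obtain ⟨F', hF', h0, hsame⟩ := h.exists_corner_blank hK
      (fun x y hx => by_contra fun h' => by have := hF x y h'; omega)
      (fun x y hy => by_contra fun h' => by have := hF x y h'; omega)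
    refine ⟨F'.rot 4, hF'.rot 4, fun x y hxy => ?_, ?_, fun c hc => ?_⟩
    · rw [Ne, tile_rot_eq_blank] at hxy
      by_cases hc : (y = 0 ∨ y = 1) ∧ (4 - x = 0 ∨ 4 - x = 1)
      · omega
      · rw [hsame _ _ hc] at hxy
        have := hF _ _ hxy
        omega
    · rw [tile_rot_eq_blank]; exact h0
    · obtain ⟨h1, h2⟩ := hs c hc
      rw [tile_rot_eq_blank, sub_sub_cancel, hsame _ _ (by omega), h2]
  obtain ⟨F₁, h₁, b₁, c₁, -⟩ := step F ∅ h hF (by simp)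
  obtain ⟨F₂, h₂, b₂, c₂, s₂⟩ := step F₁ {(4, 0)} h₁ b₁ (by simpa using c₁)
  obtain ⟨F₃, h₃, b₃, c₃, s₃⟩ := step F₂ {(4, 0), (4, 4)} h₂ b₂ (by
    simp only [mem_insert_iff, mem_singleton_iff, forall_eq_or_imp, forall_eq] at s₂ ⊢
    exact ⟨⟨by norm_num, c₂⟩, by norm_num, by simpa using s₂⟩)
  obtain ⟨F₄, h₄, b₄, c₄, s₄⟩ := step F₃ {(4, 0), (4, 4), (0, 4)} h₃ b₃ (by
    simp only [mem_insert_iff, mem_singleton_iff, forall_eq_or_imp, forall_eq] at s₃ ⊢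
    exact ⟨⟨by norm_num, c₃⟩, ⟨by norm_num, by simpa using s₃.1⟩, by norm_num, by simpa using s₃.2⟩)
  simp only [mem_insert_iff, mem_singleton_iff, forall_eq_or_imp, forall_eq] at s₄
  norm_num at s₄
  refine ⟨F₄, h₄, ?_⟩
  -- All four corners are blank now, leaving `25 - 4 = 21` cells.
  have hsub : F₄.support ⊆ (((Finset.Ico (0 : ℤ) 5 ×ˢ Finset.Ico (0 : ℤ) 5) \
      {(4, 0), (4, 4), (0, 4), (0, 0)} : Finset (ℤ × ℤ)) : Set (ℤ × ℤ)) := by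
    rintro ⟨x, y⟩ hc
    have hb := b₄ x y hc
    simp only [Finset.coe_sdiff, Finset.coe_product, Finset.coe_Ico, Set.mem_sdiff, mem_prod, mem_Ico]
    refine ⟨hb, fun h' => ?_⟩
    simp only [Finset.coe_insert, Finset.coe_singleton, mem_insert_iff, mem_singleton_iff,
      Prod.mk.injEq] at h'
    have hc' : F₄.tile x y ≠ Tile.blank := hc
    rcases h' with ⟨rfl, rfl⟩ | ⟨rfl, rfl⟩ | ⟨rfl, rfl⟩ | ⟨rfl, rfl⟩
    · exact hc' c₄
    · exact hc' s₄.1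
    · exact hc' s₄.2.1
    · exact hc' s₄.2.2
  refine (ncard_le_ncard hsub (Finset.finite_toSet _)).trans ?_
  rw [ncard_coe_finset]
  decide

/-- The occupied rows and columns form intervals of length at most `m`. Translating the leftmost
column and the top row to 0 puts the pattern into the square of an `m`-mosaic. -/
theorem Minimal.block (h : F.Minimal K) {m : ℕ} (hr : F.rows.ncard ≤ m) (hc : F.cols.ncard ≤ m) :
    ∃ M : Mosaic m, M.Represents K ∧ M.tileNumber = F.size := by
  obtain ⟨a, b, hab, e⟩ := h.rep.exists_rows_eq
  obtain ⟨a', b', hab', e'⟩ := (h.rep.rot 0).exists_rows_eq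
  rw [rows_rot] at e'
  rw [e, ← Finset.coe_Icc, ncard_coe_finset, Int.card_Icc] at hr
  rw [e', ← Finset.coe_Icc, ncard_coe_finset, Int.card_Icc] at hc
  obtain ⟨M, hM⟩ := Pattern.exists_mosaic (F := F.shift a' b) (n := m) fun x y hxy => by
    have h1 : y + b ∈ F.rows := ⟨_, hxy⟩
    have h2 : x + a' ∈ F.cols := ⟨_, hxy⟩
    rw [e, mem_Icc] at h1
    rw [e', mem_Icc] at h2
    omega
  refine ⟨M, (M.rep_toPattern K).1 (hM ▸ h.rep.shift a' b), ?_⟩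
  rw [← M.size_toPattern, hM, size_shift]

end Pattern

theorem Mosaic.tileNumber_le {n : ℕ} (M : Mosaic n) : M.tileNumber ≤ n * n := by
  refine (Finset.card_filter_le _ _).trans ?_
  simp

theorem Mosaic.exists_size_le {K : Knot} (M : Mosaic 5) (h : M.Represents K) (hK : K.IsPrime) :
    ∃ G : Pattern, G.Rep K ∧ G.size ≤ 21 := by
  refine (((M.rep_toPattern K).2 h).shift 0 (-4)).exists_size_le hK fun x y hxy => ?_
  obtain ⟨i, j, h1, h2⟩ := M.exists_of_tile_toPattern (x := x + 0) (y := y + -4) hxy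
  omega

/-- A pattern of a prime knot with the least number of tiles can be moved to a minimal mosaic if
its size is not too large. -/
theorem Knot.exists_mosaic_of_minimal {K : Knot} (hK : K.IsPrime) {m : ℕ} (M : Mosaic m)
    (hM : M.Represents K) (hm : m ≤ 6) {F : Pattern} (hF : F.Minimal K) (h6 : m = 6 → F.size ≤ 26) :
    ∃ M' : Mosaic m, M'.Represents K ∧ M'.tileNumber = F.size := by
  have hle : F.size ≤ m * m := by
    refine (hF.size_le _ ((M.rep_toPattern K).2 hM)).trans ?_
    rw [M.size_toPattern]; exact M.tileNumber_le
  have h5 : m = 5 → F.size ≤ 21 := by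
    rintro rfl
    obtain ⟨G, hG, hs⟩ := M.exists_size_le hM hK
    exact (hF.size_le G hG).trans hs
  have hpos : 0 < F.size := (ncard_pos F.finite).2 hF.rep.eq_blank
  -- If `r > m`, the tiles needed exceed those available: 27 against 26 for `m = 6`, 22 against 21
  -- for `m = 5`, 17 against 16, 12 against 9, 6 against 4, and 4 against 1 for `m = 4, 3, 2, 1`.
  -- For `m = 0` there would be no tile at all.
  have hbound : ∀ {r : ℕ}, (2 ≤ r → 2 * r ≤ F.size) → (4 ≤ r → 5 * r ≤ F.size + 8) → r ≤ m := by
    intro r h2 h4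
    by_contra! hlt
    interval_cases m
    all_goals omega
  refine hF.block (hbound hF.rep.two_mul_rows_le (hF.five_mul_rows_le hK)) (hbound ?_ ?_)
  · have := (hF.rep.rot 0).two_mul_rows_le
    rwa [Pattern.rows_rot, Pattern.size_rot] at this
  · have := (hF.rot 0).five_mul_rows_le hK
    rwa [Pattern.rows_rot, Pattern.size_rot] at this

end KnotMosaic

theorem mainTheorem7 (K : KnotMosaic.Knot) (hK : K.IsPrime)
    (hm : K.mosaicNumber ≤ 6) (ht : K.minimalMosaicTileNumber ≤ 27) :
    K.tileNumber = K.minimalMosaicTileNumber := by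
  have hle : K.tileNumber ≤ K.minimalMosaicTileNumber := by
    refine sInf_le_sInf ?_
    rintro _ ⟨n, M, -, hM, rfl⟩
    exact ⟨n, M, hM, rfl⟩
  refine le_antisymm hle ?_
  -- The infimum of the empty set is `⊤`, so `hm` guarantees that `K` has a mosaic and that both
  -- infima are attained.
  have hne : {m : ℕ∞ | ∃ (n : ℕ) (M : KnotMosaic.Mosaic n), M.Represents K ∧ m = (n : ℕ∞)}.Nonempty := by
    by_contra! h
    rw [KnotMosaic.Knot.mosaicNumber, h, sInf_empty] at hm
    exact absurd hm (by decide)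
  obtain ⟨m, M, hM, hmeq⟩ := csInf_mem hne
  have hmeq' : K.mosaicNumber = (m : ℕ∞) := hmeq
  rw [hmeq'] at hm
  have hne' : {t : ℕ∞ | ∃ (n : ℕ) (M : KnotMosaic.Mosaic n), M.Represents K ∧
      t = (M.tileNumber : ℕ∞)}.Nonempty := ⟨_, m, M, hM, rfl⟩
  obtain ⟨n, M₀, hM₀, ht₀⟩ := csInf_mem hne'
  have ht₀' : K.tileNumber = (M₀.tileNumber : ℕ∞) := ht₀
  obtain ⟨F, hF, hFs⟩ := KnotMosaic.Pattern.Rep.exists_minimal ((M₀.rep_toPattern K).2 hM₀)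
  rw [M₀.size_toPattern] at hFs
  by_contra! hlt
  -- The strict inequality assumed for contradiction turns the bound 27 into 26, which is what
  -- excludes a seventh row.
  have h27 : (M₀.tileNumber : ℕ∞) < 27 := ht₀' ▸ hlt.trans_le ht
  have h26 : M₀.tileNumber < 27 := by exact_mod_cast h27
  obtain ⟨M', hM', hs⟩ := KnotMosaic.Knot.exists_mosaic_of_minimal hK M hM (by exact_mod_cast hm) hF
    fun _ => by omega
  have h1 : K.minimalMosaicTileNumber ≤ (M'.tileNumber : ℕ∞) :=
    sInf_le ⟨m, M', hmeq'.symm, hM', rfl⟩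
  refine hlt.not_ge (h1.trans ?_)
  rw [ht₀', hs]
  exact_mod_cast hFs
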